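/- Let $k$ be an algebraically closed field of characteristic $0$. *Input data* $(\infty_{\mathcal X},\mathbf L_R,\mathbf L_\infty,r,d,\ell)$ consists of a proper Deligne--Mumford stack $\infty_{\mathcal X}$ over $k$ with projective coarse moduli space, two line bundles $\mathbf L_R$, $\mathbf L_\infty$ on $\infty_{\mathcal X}$, and positive integers $r,d,\ell$. Let $\mathbf{BC}^*_\omega=\mathbf{BG}_m$ with universal line bundle $\omega$. The input data determines a log stack $\infty^{1/\ell}$ over $\infty_{\mathcal X}\times\mathbf{BC}^*_\omega$ as follows. Let $\infty$ be the stack of $r$-th roots of $\mathbf L_R\boxtimes\omega$ over $\infty_{\mathcal X}\times\mathbf{BC}^*_\omega$, with universal root $\mathcal L$ (so $\mathcal L^{r}\cong\mathbf L_R\boxtimes\omega$), and put $\mathcal O(\infty)=\mathbf L_\infty\otimes\mathcal L^{-d}$. Then $\infty^{1/\ell}$ is the stack of $\ell$-th roots of $\mathcal O(\infty)$ over $\infty$, with universal root $\mathcal O(\infty^{1/\ell})$, and it carries the rank one Deligne--Faltings log structure given by the zero section of $\mathcal O(\infty^{1/\ell})$: the pullback of the divisorial log structure of $[\mathbb A^1/\mathbb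 G_m]$ (with respect to the origin) along $\mathcal O(\infty^{1/\ell}):\infty^{1/\ell}\to\mathbf{BG}_m\subset[\mathbb A^1/\mathbb G_m]$. For $\ell=1$ we write $\infty$ for $\infty^{1/1}$. **Proposition.** Let $(\infty_{\mathcal X},\mathbf L_R,\mathbf L_\infty,r,d,\ell)$ be input data. Let $\frac{d'}{r'}=\frac{d}{r\ell}$ in lowest terms with $d',r'>0$, and put $\widehat r=\operatorname{lcm}(r,r')$, $\widehat d=d'\widehat r/r'$. Then there are integers $a,b$ with $\frac1{\widehat r}=\frac ar+\frac{bd'}{r'}$. For any such $a,b$, let $\widehat{\infty_{\mathcal X}}$ be the fibre product of $$(\mathbf L_\infty^\vee,\mathcal O):\infty_{\mathcal X}\to(\mathbf{BG}_m)^2\quad\text{and}\quad(\mathbf{BG}_m)^2\to(\mathbf{BG}_m)^2,\ (L_1,L_2)\mapsto(L_1^{-d}\otimes L_2^{\ell},\,L_1^{a}\otimes L_2^{b}),$$ with its universal line bundles $L_1,L_2$, and put $\widehat{\mathbf L}_R=\mathbf L_R\otimes L_1^{-r}$, $\widehat{\mathbf L}_\infty=L_2^\vee$, $\widehat\ell=1$.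 Then: 1. $(\widehat{\infty_{\mathcal X}},\widehat{\mathbf L}_R,\widehat{\mathbf L}_\infty,\widehat r,\widehat d,\widehat\ell=1)$ is again input data, and $\widehat{\infty_{\mathcal X}}\to\infty_{\mathcal X}$ is étale; if $\infty_{\mathcal X}$ is smooth, so is $\widehat{\infty_{\mathcal X}}$. 2. Let $\widehat\infty$ be the target of the new input data, with universal $\widehat r$-th root $\widehat{\mathcal L}$ and $\mathcal O(\widehat\infty)=L_2^{\vee}\otimes\widehat{\mathcal L}^{-\widehat d}$. The Deligne--Faltings structures on $\widehat\infty$ and $\infty^{1/\ell}$ are log structures, and there is a canonical isomorphism of log stacks $\widehat\infty\to\infty^{1/\ell}$ over $\infty_{\mathcal X}\times\mathbf{BC}^*_\omega$. Here canonical means: it comes with isomorphisms between the pullback of $\mathcal L$ and $L_1\otimes\widehat{\mathcal L}^{\,\widehat r/r}$, and between the pullback of $\mathcal O(\infty^{1/\ell})$ and $\mathcal O(\widehat\infty)$, i.e. between the pullback of $\mathcal O(\infty^{1/\ell})^\vee$ and $L_2\otimes\widehat{\mathcal L}^{\,\widehat d}$; these are compatible with the universal isomorphisms $\mathcal L^{r}\cong\mathbf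 L_R\boxtimes\omega$, $\mathcal O(\infty^{1/\ell})^{\ell}\cong\mathbf L_\infty\otimes\mathcal L^{-d}$, $\widehat{\mathcal L}^{\,\widehat r}\cong\widehat{\mathbf L}_R\boxtimes\omega$ and $L_1^{-d}\otimes L_2^\ell\cong\mathbf L_\infty^\vee$; and the isomorphism of log structures is induced by $\mathcal O(\infty^{1/\ell})\cong\mathcal O(\widehat\infty)$. -/

import Mathlib

open CategoryTheory Opposite TensorProduct

universe u

namespace LogTarget

noncomputable section

/-! ## Invertible modules and their pullbacks -/

/-- An invertible module over a commutative ring `A`, i.e. a line bundle on `Spec A`. -/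
structure InvMod (A : Type u) [CommRing A] where
  carrier : Type u
  [grp : AddCommGroup carrier]
  [mod : Module A carrier]
  [inv : Module.Invertible A carrier]

namespace InvMod

instance (A : Type u) [CommRing A] : CoeSort (InvMod A) (Type u) := ⟨carrier⟩

attribute [instance] grp mod inv

variable {A B : Type u} [CommRing A] [CommRing B]

/-- Let `φ : A → B`, let `L` be invertible over `A` and `M` invertible over `B`. A `Map φ L M` is a
`φ`-semilinear map `L → M` which identifies `M` with the base change `B ⊗_A L`: the induced
`B`-linear map `B ⊗_A L → M` is surjective, hence bijective because both sides are invertible.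
So it is an isomorphism of line bundles between `M` and the pullback of `L` along
`Spec B → Spec A`. -/
structure Map (φ : A →+* B) (L : InvMod A) (M : InvMod B) where
  toFun : L →+ M
  map_smul : ∀ (a : A) (m : L), toFun (a • m) = φ a • toFun m
  span_range : Submodule.span B (Set.range toFun) = ⊤

instance (φ : A →+* B) (L : InvMod A) (M : InvMod B) : CoeFun (Map φ L M) (fun _ => L → M) :=
  ⟨fun f => f.toFun⟩

theorem swap_eq (L : InvMod A) (m m' : L) : m ⊗ₜ[A] m' = m' ⊗ₜ[A] m := by
  obtain ⟨c, hc⟩ := (Module.Invertible.toModuleEnd_bijective A (L ⊗[A] L)).2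
    (TensorProduct.comm A L L).toLinearMap
  have h : ∀ x y : L, y ⊗ₜ[A] x = c • (x ⊗ₜ[A] y) := fun x y => by
    simpa using (LinearMap.congr_fun hc (x ⊗ₜ y)).symm
  obtain ⟨S, hS⟩ := ((Module.Invertible.linearEquiv A L).symm 1).exists_finset
  have h1 : (1 : A) = ∑ i ∈ S, i.1 i.2 := by
    have := (LinearEquiv.symm_apply_eq _).mp hS
    simpa [Module.Invertible.linearEquiv] using this
  have hI : Ideal.span ((fun i : Module.Dual A L × L => i.1 i.2) '' S) = ⊤ := by
    rw [Ideal.eq_top_iff_one, h1]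
    exact Ideal.sum_mem _ fun i hi => Ideal.subset_span ⟨i, hi, rfl⟩
  have hI2 := Ideal.span_pow_eq_top _ hI 2
  have hc1 : (c - 1) = 0 := by
    have : ∀ a ∈ Ideal.span ((fun x => x ^ 2) '' ((fun i : Module.Dual A L × L => i.1 i.2) '' S)),
        (c - 1) * a = 0 := by
      intro a ha
      induction ha using Submodule.span_induction with
      | mem x hx =>
        obtain ⟨_, ⟨i, hi, rfl⟩, rfl⟩ := hx
        have := congrArg (LinearMap.mul' A A ∘ₗ TensorProduct.map i.1 i.1) (h i.2 i.2)
        simp at this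
        simp only [sub_mul, pow_two]
        rw [← this]; ring
      | zero => simp
      | add x y _ _ hx hy => rw [mul_add, hx, hy, add_zero]
      | smul a x _ hx => rw [smul_eq_mul, mul_left_comm, hx, mul_zero]
    rw [← mul_one (c - 1)]
    exact this 1 (by rw [hI2]; trivial)
  rw [h m' m, sub_eq_zero.mp hc1, one_smul]

theorem dual_comm (L : InvMod A) (χ : Module.Dual A L) (m m' : L) : χ m • m' = χ m' • m := by
  have := congrArg ((TensorProduct.lid A L).toLinearMap ∘ₗ TensorProduct.map χ LinearMap.id)
    (swap_eq L m m')
  simpa using this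

theorem Map.exists_dual {φ : A →+* B} {L : InvMod A} {M : InvMod B} (f : Map φ L M)
    (ψ : Module.Dual A L) : ∃ χ : Module.Dual B M, ∀ m, χ (f m) = φ (ψ m) := by
  let _ : Algebra A B := φ.toAlgebra
  let _ : Module A M := Module.compHom M φ
  have _ : IsScalarTower A B M := ⟨fun a b m => by
    change (φ a * b) • m = φ a • b • m
    rw [mul_smul]⟩
  let g : L →ₗ[A] M := { f.toFun with map_smul' := fun a m => f.map_smul a m }
  have hs : Function.Surjective (g.liftBaseChange B) := by
    rw [← LinearMap.range_eq_top, eq_top_iff, ← f.span_range, Submodule.span_le]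
    rintro _ ⟨l, rfl⟩
    exact ⟨1 ⊗ₜ l, by simp [g]⟩
  let e := LinearEquiv.ofBijective _ (Module.Invertible.bijective_of_surjective hs)
  refine ⟨(((Algebra.linearMap A B) ∘ₗ ψ).liftBaseChange B) ∘ₗ e.symm.toLinearMap, fun m => ?_⟩
  have : e.symm (f m) = 1 ⊗ₜ m := by
    rw [LinearEquiv.symm_apply_eq]
    simp [e, g]
  rw [LinearMap.comp_apply, LinearEquiv.coe_coe, this]
  simp
  rfl

theorem Map.dual_ext {φ : A →+* B} {L : InvMod A} {M : InvMod B} (f : Map φ L M)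
    {χ χ' : Module.Dual B M} (h : ∀ m, χ (f m) = χ' (f m)) : χ = χ' :=
  LinearMap.ext_on_range f.span_range h
theorem Map.ext {φ : A →+* B} {L : InvMod A} {M : InvMod B} {f g : Map φ L M}
    (h : ∀ m, f m = g m) : f = g := by
  obtain ⟨f, _, _⟩ := f
  obtain ⟨g, _, _⟩ := g
  obtain rfl : f = g := AddMonoidHom.ext h
  rfl

/-- The structure sheaf. -/
def unit (A : Type u) [CommRing A] : InvMod A := ⟨A⟩

/-- The tensor product of line bundles. -/
def tensor (L L' : InvMod A) : InvMod A := ⟨L ⊗[A] L'⟩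

/-- The dual line bundle. -/
def dual (L : InvMod A) : InvMod A := ⟨Module.Dual A L⟩

/-- Tensor powers `L^{⊗ n}`, `n ≥ 0`. -/
def npow (L : InvMod A) : ℕ → InvMod A
  | 0 => unit A
  | n + 1 => tensor L (npow L n)

/-- Integral tensor powers: `L^{⊗ n}` for `n ≥ 0`, and `(L^∨)^{⊗ (-n)}` for `n < 0`. -/
def zpow (L : InvMod A) : ℤ → InvMod A
  | Int.ofNat n => npow L n
  | Int.negSucc n => npow (dual L) (n + 1)

/-- The pure tensor `x ⊗ y` in `L ⊗ L'`. -/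
def tmul {L L' : InvMod A} (x : L) (y : L') : tensor L L' := x ⊗ₜ[A] y

/-- The value of a section of the dual on a section. -/
def pair {L : InvMod A} (χ : dual L) (x : L) : A := (show Module.Dual A L from χ) x

/-- The power `x^{⊗ n} ∈ L^{⊗ n}` of a section `x ∈ L`. -/
def pow {L : InvMod A} (x : L) : (n : ℕ) → npow L n
  | 0 => (1 : A)
  | n + 1 => tmul x (pow x n)

/-- Pullback on structure sheaves. -/
def Map.unit (φ : A →+* B) : Map φ (InvMod.unit A) (InvMod.unit B) where
  toFun := φ.toAddMonoidHom
  map_smul a m := φ.map_mul a m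
  span_range := by
    rw [eq_top_iff]
    intro (b : B) _
    have h : (1 : B) ∈ Set.range φ.toAddMonoidHom := ⟨1, φ.map_one⟩
    have := Submodule.smul_mem (Submodule.span B (Set.range φ.toAddMonoidHom)) b
      (Submodule.subset_span h)
    rwa [smul_eq_mul, mul_one] at this

/-- The semilinear map `x ⊗ y ↦ f x ⊗ g y`. -/
def Map.tensorHom {φ : A →+* B} {L L' : InvMod A} {M M' : InvMod B} (f : Map φ L M)
    (g : Map φ L' M') : L ⊗[A] L' →+ M ⊗[B] M' :=
  TensorProduct.liftAddHom
    (AddMonoidHom.mk' (fun m => AddMonoidHom.mk' (fun n => f m ⊗ₜ[B] g n)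
      (fun x y => by rw [map_add, TensorProduct.tmul_add]))
      (fun x y => AddMonoidHom.ext fun n => by
        change f (x + y) ⊗ₜ[B] g n = f x ⊗ₜ[B] g n + f y ⊗ₜ[B] g n
        rw [map_add, TensorProduct.add_tmul]))
    (fun a m n => by
      change f (a • m) ⊗ₜ[B] g n = f m ⊗ₜ[B] g (a • n)
      rw [f.map_smul, g.map_smul, TensorProduct.smul_tmul])

theorem Map.tensorHom_tmul {φ : A →+* B} {L L' : InvMod A} {M M' : InvMod B} (f : Map φ L M)
    (g : Map φ L' M') (x : L) (y : L') : f.tensorHom g (x ⊗ₜ[A] y) = f x ⊗ₜ[B] g y := rfl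

theorem Map.tensorHom_smul {φ : A →+* B} {L L' : InvMod A} {M M' : InvMod B} (f : Map φ L M)
    (g : Map φ L' M') (a : A) (m : L ⊗[A] L') :
    f.tensorHom g (a • m) = φ a • f.tensorHom g m := by
  induction m using TensorProduct.induction_on with
  | zero => rw [smul_zero, map_zero, smul_zero]
  | tmul x y =>
    rw [TensorProduct.smul_tmul', tensorHom_tmul, tensorHom_tmul, f.map_smul,
      TensorProduct.smul_tmul']
  | add x y hx hy => rw [smul_add, map_add, map_add, hx, hy, smul_add]

theorem Map.tensorHom_span {φ : A →+* B} {L L' : InvMod A} {M M' : InvMod B} (f : Map φ L M)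
    (g : Map φ L' M') : Submodule.span B (Set.range (f.tensorHom g)) = ⊤ := by
  rw [eq_top_iff]
  rintro x -
  induction x using TensorProduct.induction_on with
  | zero => exact Submodule.zero_mem _
  | add x y hx hy => exact Submodule.add_mem _ hx hy
  | tmul x y =>
    have hx : x ∈ Submodule.span B (Set.range f.toFun) := by rw [f.span_range]; trivial
    have hy : y ∈ Submodule.span B (Set.range g.toFun) := by rw [g.span_range]; trivial
    induction hx using Submodule.span_induction with
    | zero => rw [TensorProduct.zero_tmul]; exact Submodule.zero_mem _
    | add a b _ _ ha hb => rw [TensorProduct.add_tmul]; exact Submodule.add_mem _ ha hb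
    | smul c a _ ha => rw [← TensorProduct.smul_tmul']; exact Submodule.smul_mem _ c ha
    | mem a ha =>
      obtain ⟨l, rfl⟩ := ha
      induction hy using Submodule.span_induction with
      | zero => rw [TensorProduct.tmul_zero]; exact Submodule.zero_mem _
      | add a b _ _ ha hb => rw [TensorProduct.tmul_add]; exact Submodule.add_mem _ ha hb
      | smul c a _ ha => rw [TensorProduct.tmul_smul]; exact Submodule.smul_mem _ c ha
      | mem a ha =>
        obtain ⟨l', rfl⟩ := ha
        exact Submodule.subset_span ⟨l ⊗ₜ[A] l', rfl⟩

/-- Pullback on tensor products. -/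
def Map.tensor {φ : A →+* B} {L L' : InvMod A} {M M' : InvMod B} (f : Map φ L M)
    (g : Map φ L' M') : Map φ (L.tensor L') (M.tensor M') where
  toFun := f.tensorHom g
  map_smul := f.tensorHom_smul g
  span_range := f.tensorHom_span g

theorem Map.tensor_tmul {φ : A →+* B} {L L' : InvMod A} {M M' : InvMod B} (f : Map φ L M)
    (g : Map φ L' M') (x : L) (y : L') : f.tensor g (tmul x y) = tmul (f x) (g y) := rfl

theorem tensor_hom_ext {L L' : InvMod A} {M : Type u} [AddCommGroup M] {f g : L.tensor L' →+ M}
    (h : ∀ x y, f (tmul x y) = g (tmul x y)) : f = g := by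
  change L ⊗[A] L' →+ M at f g
  refine AddMonoidHom.ext fun (m : L ⊗[A] L') => ?_
  induction m using TensorProduct.induction_on with
  | zero => exact (map_zero f).trans (map_zero g).symm
  | tmul x y => exact h x y
  | add x y hx hy =>
    exact (map_add f x y).trans ((congrArg₂ (· + ·) hx hy).trans (map_add g x y).symm)

/-- Pullback on duals: the unique map with `(f^∨ ψ)(f m) = φ (ψ m)`. -/
def Map.dual {φ : A →+* B} {L : InvMod A} {M : InvMod B} (f : Map φ L M) :
    Map φ L.dual M.dual where
  toFun := AddMonoidHom.mk' (fun ψ => (f.exists_dual ψ).choose) (fun ψ ψ' =>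
    f.dual_ext fun m => by
      rw [(f.exists_dual (ψ + ψ')).choose_spec]
      refine (φ.map_add _ _).trans ?_
      rw [← (f.exists_dual ψ).choose_spec m, ← (f.exists_dual ψ').choose_spec m]
      rfl)
  map_smul a ψ := f.dual_ext fun m => by
    refine ((f.exists_dual (a • ψ)).choose_spec m).trans ((φ.map_mul _ _).trans ?_)
    rw [← (f.exists_dual ψ).choose_spec m]
    rfl
  span_range := by
    rw [eq_top_iff]
    rintro (χ : Module.Dual B M) -
    obtain ⟨S, hS⟩ := ((Module.Invertible.linearEquiv A L).symm 1).exists_finset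
    have h1 : (1 : A) = ∑ i ∈ S, i.1 i.2 := by
      have := (LinearEquiv.symm_apply_eq _).mp hS
      simpa [Module.Invertible.linearEquiv] using this
    have key : χ = ∑ i ∈ S, χ (f i.2) • (f.exists_dual i.1).choose := by
      ext m
      have h2 : ∀ i ∈ S, (χ (f i.2) • (f.exists_dual i.1).choose) m = φ (i.1 i.2) * χ m := by
        intro i _
        rw [← (f.exists_dual i.1).choose_spec i.2, LinearMap.smul_apply, smul_eq_mul,
          ← smul_eq_mul, ← smul_eq_mul, ← χ.map_smul, ← dual_comm, χ.map_smul, smul_eq_mul,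
          smul_eq_mul, mul_comm]
      rw [LinearMap.sum_apply, Finset.sum_congr rfl h2, ← Finset.sum_mul, ← map_sum, ← h1,
        map_one, one_mul]
    rw [key]
    exact Submodule.sum_mem _ fun i _ => Submodule.smul_mem _ _ (Submodule.subset_span ⟨i.1, rfl⟩)

theorem Map.dual_pair {φ : A →+* B} {L : InvMod A} {M : InvMod B} (f : Map φ L M) (ψ : L.dual)
    (m : L) : pair (f.dual ψ) (f m) = φ (pair ψ m) :=
  (f.exists_dual ψ).choose_spec m

/-- Pullback on tensor powers. -/
def Map.npow {φ : A →+* B} {L : InvMod A} {M : InvMod B} (f : Map φ L M) :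
    (n : ℕ) → Map φ (L.npow n) (M.npow n)
  | 0 => Map.unit φ
  | n + 1 => f.tensor (Map.npow f n)

/-- Pullback on integral tensor powers. -/
def Map.zpow {φ : A →+* B} {L : InvMod A} {M : InvMod B} (f : Map φ L M) :
    (n : ℤ) → Map φ (L.zpow n) (M.zpow n)
  | Int.ofNat n => f.npow n
  | Int.negSucc n => f.dual.npow (n + 1)

/-- The identity. -/
def Map.id {φ : A →+* A} (hφ : ∀ a, φ a = a) (L : InvMod A) : Map φ L L where
  toFun := AddMonoidHom.id L
  map_smul a m := by rw [hφ]; rfl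
  span_range := by
    rw [eq_top_iff]
    exact fun m _ => Submodule.subset_span ⟨m, rfl⟩

/-- Composition. -/
def Map.comp {C : Type u} [CommRing C] {φ : A →+* B} {ψ : B →+* C} {χ : A →+* C}
    (hχ : ∀ a, χ a = ψ (φ a)) {L : InvMod A} {M : InvMod B} {N : InvMod C}
    (f : Map φ L M) (g : Map ψ M N) : Map χ L N where
  toFun := g.toFun.comp f.toFun
  map_smul a m := by simp [f.map_smul, g.map_smul, hχ]
  span_range := by
    rw [eq_top_iff, ← g.span_range, Submodule.span_le]
    rintro _ ⟨m, rfl⟩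
    have hm : m ∈ Submodule.span B (Set.range f.toFun) := by rw [f.span_range]; trivial
    induction hm using Submodule.span_induction with
    | zero => rw [map_zero]; exact Submodule.zero_mem _
    | add a b _ _ ha hb => rw [map_add]; exact Submodule.add_mem _ ha hb
    | smul c a _ ha => rw [g.map_smul]; exact Submodule.smul_mem _ _ ha
    | mem a ha =>
      obtain ⟨l, rfl⟩ := ha
      exact Submodule.subset_span ⟨l, rfl⟩

section laws

/-- `f` is the identity map. -/
def Map.IsId {φ : A →+* A} {L : InvMod A} (f : Map φ L L) : Prop := ∀ m, f m = m

/-- `h` is the composite of `f` and `g`. -/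
def Map.IsComp {C : Type u} [CommRing C] {φ : A →+* B} {ψ : B →+* C} {χ : A →+* C}
    {L : InvMod A} {M : InvMod B} {N : InvMod C} (h : Map χ L N) (f : Map φ L M) (g : Map ψ M N) :
    Prop := ∀ m, h m = g (f m)

variable {C : Type u} [CommRing C] {φ₀ : A →+* A} {φ : A →+* B} {ψ : B →+* C} {χ : A →+* C}
variable {L L' : InvMod A} {M M' : InvMod B} {N N' : InvMod C}

theorem Map.IsId.tensor {f : Map φ₀ L L} {g : Map φ₀ L' L'} (hf : f.IsId) (hg : g.IsId) :
    (f.tensor g).IsId := fun m =>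
  DFunLike.congr_fun (tensor_hom_ext (f := (f.tensor g).toFun) (g := AddMonoidHom.id _)
    fun x y => by rw [tensor_tmul, hf, hg]; rfl) m

theorem Map.IsComp.tensor {h : Map χ L N} {f : Map φ L M} {g : Map ψ M N} {h' : Map χ L' N'}
    {f' : Map φ L' M'} {g' : Map ψ M' N'} (H : h.IsComp f g) (H' : h'.IsComp f' g') :
    (h.tensor h').IsComp (f.tensor f') (g.tensor g') := fun m =>
  DFunLike.congr_fun (tensor_hom_ext (f := (h.tensor h').toFun)
    (g := (g.tensor g').toFun.comp (f.tensor f').toFun)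
    fun x y => by
      rw [AddMonoidHom.comp_apply, tensor_tmul, tensor_tmul, tensor_tmul, H, H']) m

theorem Map.IsId.dual (hφ : ∀ a, φ₀ a = a) {f : Map φ₀ L L} (hf : f.IsId) : f.dual.IsId :=
  fun ψ => f.dual_ext fun m => (f.dual_pair ψ m).trans (by rw [hφ, hf]; rfl)

theorem Map.IsComp.dual (hχ : ∀ a, χ a = ψ (φ a)) {h : Map χ L N} {f : Map φ L M} {g : Map ψ M N}
    (H : h.IsComp f g) : h.dual.IsComp f.dual g.dual :=
  fun ξ => h.dual_ext fun m => (h.dual_pair ξ m).trans (by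
    rw [H m, hχ, ← f.dual_pair, ← g.dual_pair]; rfl)

theorem Map.IsId.npow (hφ : ∀ a, φ₀ a = a) {f : Map φ₀ L L} (hf : f.IsId) :
    ∀ n, (f.npow n).IsId
  | 0 => hφ
  | n + 1 => hf.tensor (hf.npow hφ n)

theorem Map.IsComp.npow (hχ : ∀ a, χ a = ψ (φ a)) {h : Map χ L N} {f : Map φ L M} {g : Map ψ M N}
    (H : h.IsComp f g) : ∀ n, (h.npow n).IsComp (f.npow n) (g.npow n)
  | 0 => hχ
  | n + 1 => H.tensor (H.npow hχ n)

theorem Map.IsId.zpow (hφ : ∀ a, φ₀ a = a) {f : Map φ₀ L L} (hf : f.IsId) :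
    ∀ n, (f.zpow n).IsId
  | Int.ofNat n => hf.npow hφ n
  | Int.negSucc n => (hf.dual hφ).npow hφ (n + 1)

theorem Map.IsComp.zpow (hχ : ∀ a, χ a = ψ (φ a)) {h : Map χ L N} {f : Map φ L M} {g : Map ψ M N}
    (H : h.IsComp f g) : ∀ n, (h.zpow n).IsComp (f.zpow n) (g.zpow n)
  | Int.ofNat n => H.npow hχ n
  | Int.negSucc n => (H.dual hχ).npow hχ (n + 1)

end laws

end InvMod

/-! ## Stacks over affine schemes -/

/-- The category of affine schemes over `k`: the object `op A` is `Spec A`. -/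
abbrev AffSch (k : Type u) [Field k] := (CommAlgCat.{u} k)ᵒᵖ

/-- A category `p : 𝒳 ⥤ AffSch k` over the category of affine `k`-schemes. -/
abbrev AffCat (k : Type u) [Field k] := BasedCategory.{u, u + 1} (AffSch k)

variable {k : Type u} [Field k]

/-- A finite jointly surjective family of étale morphisms of affine schemes. -/
def IsEtaleFamily {U : AffSch k} {n : ℕ} {V : Fin n → AffSch k} (v : ∀ i, V i ⟶ U) : Prop :=
  (∀ i, (v i).unop.hom.toRingHom.Etale) ∧
    ∀ p : PrimeSpectrum U.unop, ∃ i, ∃ q : PrimeSpectrum (V i).unop,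
      PrimeSpectrum.comap (v i).unop.hom.toRingHom q = p

/-- The covering sieves of the (big, affine) étale topology. -/
def IsEtaleSieve {U : AffSch k} (S : Sieve U) : Prop :=
  ∃ (n : ℕ) (V : Fin n → AffSch k) (v : ∀ i, V i ⟶ U), IsEtaleFamily v ∧ ∀ i, S (v i)

namespace AffCat

/-- If `x` is an object over `Spec A`, i.e. a morphism `Spec A → 𝒳`, then `X.O x = A`. -/
abbrev O (X : AffCat k) (x : X.obj) : CommAlgCat.{u} k := (X.p.obj x).unop

/-- The ring homomorphism `A → B` underlying a morphism of objects over `Spec B → Spec A`. -/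
abbrev pull (X : AffCat k) {x y : X.obj} (f : x ⟶ y) : X.O y →+* X.O x :=
  (X.p.map f).unop.hom.toRingHom

theorem pull_id (X : AffCat k) (x : X.obj) (a : X.O x) : X.pull (𝟙 x) a = a := by
  simp [pull]

theorem pull_comp (X : AffCat k) {x y z : X.obj} (f : x ⟶ y) (g : y ⟶ z) (a : X.O z) :
    X.pull (f ≫ g) a = X.pull f (X.pull g a) := by
  simp [pull]

/-- The category over `AffSch k` with underlying functor `G ⋙ p`. -/
@[reducible]
def comap (X : AffCat k) {C : Type (u + 1)} [Category.{u} C] (G : C ⥤ X.obj) : AffCat k where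
  obj := C
  category := inferInstance
  p := G ⋙ X.p

/-- `X` is fibred in groupoids over affine `k`-schemes. -/
structure IsFibredInGroupoids (X : AffCat k) : Prop where
  fibered : X.p.IsFibered
  cartesian : ∀ {x y : X.obj} (f : x ⟶ y), X.p.IsStronglyCartesian (X.p.map f) f

/-- `X` is a stack for the étale topology. For every covering sieve `S` of `U`, every descent datum
relative to `S` (a functor `D` from `S` to `𝒳` over `AffSch k`) is effective: it comes from an
object `x` over `U` with compatible maps `c V : D V ⟶ x`. Moreover morphisms out of `x` can be
glued uniquely from compatible families. -/
structure IsStack (X : AffCat k) : Prop extends IsFibredInGroupoids X where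
  descent : ∀ (U : AffSch k) (S : Sieve U), IsEtaleSieve S →
    ∀ (D : S.arrows.category ⥤ X.obj) (θ : D ⋙ X.p ≅ S.arrows.diagram),
    ∃ (x : X.obj) (e : X.p.obj x ≅ U) (c : ∀ V, D.obj V ⟶ x),
      (∀ V, X.p.map (c V) ≫ e.hom = θ.hom.app V ≫ V.obj.hom) ∧
      (∀ {V W} (g : V ⟶ W), D.map g ≫ c W = c V) ∧
      ∀ (y : X.obj) (w : X.p.obj x ⟶ X.p.obj y) (c' : ∀ V, D.obj V ⟶ y),
        (∀ {V W} (g : V ⟶ W), D.map g ≫ c' W = c' V) →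
        (∀ V, X.p.map (c' V) = X.p.map (c V) ≫ w) →
        ∃! h : x ⟶ y, X.p.map h = w ∧ ∀ V, c V ≫ h = c' V

/-- `z` with its two projections is the fibre product `Spec O(x) ×_𝒳 Spec O(y)`. For a category
fibred in groupoids, a morphism from `Spec B` to this 2-fibre product is an object `w` over `Spec B`
together with maps `w ⟶ x` and `w ⟶ y`, up to unique isomorphism. So the fibre product is
represented by an affine scheme if and only if `x` and `y` have a product `z` in `𝒳`, and then it is
`Spec O(z)`. -/
def IsFibreProduct (X : AffCat k) {x y z : X.obj} (f : z ⟶ x) (g : z ⟶ y) : Prop :=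
  Nonempty (Limits.IsLimit (Limits.BinaryFan.mk f g))

/-- The diagonal `𝒳 → 𝒳 × 𝒳` is representable by finite morphisms. -/
def HasFiniteDiagonal (X : AffCat k) : Prop :=
  ∀ x y : X.obj, ∃ (z : X.obj) (f : z ⟶ x) (g : z ⟶ y), X.IsFibreProduct f g ∧
    (Algebra.TensorProduct.productMap (X.p.map f).unop.hom (X.p.map g).unop.hom).toRingHom.Finite

/-- The morphism `x : Spec O(x) → 𝒳` is (affine and) étale. -/
def IsEtaleChart (X : AffCat k) (x : X.obj) : Prop :=
  ∀ y : X.obj, ∃ (z : X.obj) (f : z ⟶ x) (g : z ⟶ y), X.IsFibreProduct f g ∧ (X.pull g).Etale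

/-- The morphisms `x i : Spec O(x i) → 𝒳` are jointly surjective. -/
def IsJointlySurjective (X : AffCat k) {n : ℕ} (x : Fin n → X.obj) : Prop :=
  ∀ (y : X.obj) (p : PrimeSpectrum (X.O y)), ∃ (i : Fin n) (z : X.obj) (_ : z ⟶ x i) (g : z ⟶ y)
    (q : PrimeSpectrum (X.O z)), PrimeSpectrum.comap (X.pull g) q = p

/-- `𝒳 → Spec k` is universally closed: for every affine `T = Spec B`, the image in `T` of a closed
subset of `|𝒳 × T|` is closed. A closed subset of `|𝒳 × T|` is a family of closed subsets
`Z x φ ⊆ Spec O(x)`, one for each morphism `(x, φ) : Spec O(x) → 𝒳 × T`, compatible with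
pullback. -/
def IsUniversallyClosed (X : AffCat k) : Prop :=
  ∀ (B : CommAlgCat.{u} k) (Z : ∀ x : X.obj, (B →ₐ[k] X.O x) → Set (PrimeSpectrum (X.O x))),
    (∀ x φ, IsClosed (Z x φ)) →
    (∀ {x y : X.obj} (f : x ⟶ y) (φ : B →ₐ[k] X.O y),
      Z x ((X.p.map f).unop.hom.comp φ) = PrimeSpectrum.comap (X.pull f) ⁻¹' Z y φ) →
    IsClosed {b : PrimeSpectrum B | ∃ (x : X.obj) (φ : B →ₐ[k] X.O x), ∃ q ∈ Z x φ,
      PrimeSpectrum.comap φ.toRingHom q = b}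

/-- `𝒳` is a proper Deligne--Mumford stack over `k`: an étale stack which is separated (for a
Deligne--Mumford stack this means that the diagonal is finite), has an étale atlas by finitely many
affine schemes of finite type over `k`, and is universally closed over `k`. -/
structure IsProperDM (X : AffCat k) : Prop extends IsStack X where
  finite_diagonal : X.HasFiniteDiagonal
  atlas : ∃ (n : ℕ) (x : Fin n → X.obj), X.IsJointlySurjective x ∧
    ∀ i, X.IsEtaleChart (x i) ∧ Algebra.FiniteType k (X.O (x i))
  universallyClosed : X.IsUniversallyClosed

/-- A Deligne--Mumford stack is smooth over `k` if all its étale charts are. -/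
def IsSmooth (X : AffCat k) : Prop := ∀ x : X.obj, X.IsEtaleChart x → Algebra.Smooth k (X.O x)

/-- A morphism `G : 𝒴 → 𝒳` of Deligne--Mumford stacks with finite diagonal (it is automatically of
Deligne--Mumford type) is étale: for every étale chart `Spec A → 𝒴`, the composite
`Spec A → 𝒴 → 𝒳` is étale. -/
def IsEtaleMap (X : AffCat k) {C : Type (u + 1)} [Category.{u} C] (G : C ⥤ X.obj) : Prop :=
  ∀ y : C, (X.comap G).IsEtaleChart y → X.IsEtaleChart (G.obj y)

/-- A morphism from `𝒳` to a presheaf of sets `F` on affine `k`-schemes. -/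
structure MapTo (X : AffCat k) (F : (AffSch k)ᵒᵖ ⥤ Type u) where
  app : ∀ x : X.obj, F.obj (op (X.p.obj x))
  naturality : ∀ {x y : X.obj} (f : x ⟶ y), F.map (X.p.map f).op (app y) = app x

end AffCat

/-! ## Algebraic spaces, projective schemes and coarse moduli spaces -/

open AlgebraicGeometry in
/-- The affine scheme `Spec A`, as a scheme over `k`. -/
abbrev specOver (U : AffSch k) : Over (Spec (CommRingCat.of k)) :=
  (algSpec (CommRingCat.of k)).obj U

open AlgebraicGeometry in
/-- The functor of points of a `k`-scheme, on affine `k`-schemes. -/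
abbrev points (M : Over (Spec (CommRingCat.of k))) : (AffSch k)ᵒᵖ ⥤ Type u :=
  (algSpec (CommRingCat.of k)).op ⋙ yoneda.obj M

open AlgebraicGeometry in
/-- `F` is an algebraic space over `k`: an étale sheaf of sets with a jointly surjective family of
morphisms `a i : U i → F` from affine schemes which are representable by schemes and étale:
each `U i ×_F V`, with `V` affine, is a scheme `W` étale over `V`. -/
structure IsAlgebraicSpace (F : (AffSch k)ᵒᵖ ⥤ Type u) : Prop where
  sheaf : ∀ (U : AffSch k) (n : ℕ) (V : Fin n → AffSch k) (v : ∀ i, V i ⟶ U), IsEtaleFamily v →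
    ∀ s : ∀ i, F.obj (op (V i)),
      (∀ (i j : Fin n) (W : AffSch k) (g : W ⟶ V i) (h : W ⟶ V j), g ≫ v i = h ≫ v j →
        F.map g.op (s i) = F.map h.op (s j)) →
      ∃! t : F.obj (op U), ∀ i, F.map (v i).op t = s i
  atlas : ∃ (ι : Type u) (U : ι → AffSch k) (a : ∀ i, F.obj (op (U i))),
    (∀ (i : ι) (V : AffSch k) (b : F.obj (op V)),
      ∃ (W : Over (Spec (CommRingCat.of k))) (r : W ⟶ specOver (U i)) (s : W ⟶ specOver V),
        Etale s.left ∧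
        (∀ (T : AffSch k) (g : T ⟶ U i) (h : T ⟶ V), F.map g.op (a i) = F.map h.op b →
          ∃! w : specOver T ⟶ W, w ≫ r = (algSpec (CommRingCat.of k)).map g ∧
            w ≫ s = (algSpec (CommRingCat.of k)).map h) ∧
        (∀ (T : AffSch k) (g : T ⟶ U i) (h : T ⟶ V) (w : specOver T ⟶ W),
          w ≫ r = (algSpec (CommRingCat.of k)).map g →
          w ≫ s = (algSpec (CommRingCat.of k)).map h → F.map g.op (a i) = F.map h.op b)) ∧
    (∀ (V : AffSch k) (b : F.obj (op V)) (p : PrimeSpectrum V.unop),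
      ∃ (i : ι) (T : AffSch k) (g : T ⟶ U i) (h : T ⟶ V) (q : PrimeSpectrum T.unop),
        F.map g.op (a i) = F.map h.op b ∧ PrimeSpectrum.comap h.unop.hom.toRingHom q = p)

attribute [local instance] MvPolynomial.gradedAlgebra in
open AlgebraicGeometry in
/-- A `k`-scheme is projective: it is a closed subscheme of some `ℙ^n` over `k`. -/
def IsProjective (M : Over (Spec (CommRingCat.of k))) : Prop :=
  ∃ (n : ℕ) (i : M.left ⟶ Proj (MvPolynomial.homogeneousSubmodule (Fin (n + 1)) k)),
    IsClosedImmersion i ∧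
      i ≫ Proj.toSpecZero (MvPolynomial.homogeneousSubmodule (Fin (n + 1)) k) ≫
        Spec.map (CommRingCat.ofHom
          (algebraMap k (MvPolynomial.homogeneousSubmodule (Fin (n + 1)) k 0))) = M.hom

open AlgebraicGeometry in
/-- `π : 𝒳 → M` exhibits the scheme `M` as coarse moduli space of `𝒳`: it is initial among
morphisms from `𝒳` to algebraic spaces, and a bijection on isomorphism classes of `K`-points for
algebraically closed fields `K`. -/
structure IsCoarseModuli (X : AffCat k) (M : Over (Spec (CommRingCat.of k)))
    (π : X.MapTo (points M)) : Prop where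
  initial : ∀ F : (AffSch k)ᵒᵖ ⥤ Type u, IsAlgebraicSpace F → ∀ t : X.MapTo F,
    ∃! φ : points M ⟶ F, ∀ x, φ.app _ (π.app x) = t.app x
  surjective : ∀ (K : Type u) [Field K] [Algebra k K] [IsAlgClosed K]
    (m : (points M).obj (op (op (CommAlgCat.of k K)))),
    ∃ (x : X.obj) (e : op (CommAlgCat.of k K) ≅ X.p.obj x), (points M).map e.hom.op (π.app x) = m
  injective : ∀ (K : Type u) [Field K] [Algebra k K] [IsAlgClosed K] (x y : X.obj)
    (e : op (CommAlgCat.of k K) ≅ X.p.obj x) (e' : op (CommAlgCat.of k K) ≅ X.p.obj y),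
    (points M).map e.hom.op (π.app x) = (points M).map e'.hom.op (π.app y) →
    ∃ f : x ⟶ y, e.hom ≫ X.p.map f = e'.hom

/-- `𝒳` has a coarse moduli space which is a projective scheme over `k`. -/
def AffCat.HasProjectiveCoarse (X : AffCat k) : Prop :=
  ∃ (M : Over (AlgebraicGeometry.Spec (CommRingCat.of k))) (π : X.MapTo (points M)),
    IsCoarseModuli X M π ∧ IsProjective M

/-! ## Line bundles on stacks -/

/-- A line bundle on `𝒳`, i.e. a morphism `𝒳 → BG_m`: a line bundle on `Spec O(x)` for every
`x : Spec O(x) → 𝒳`, with compatible pullback isomorphisms. -/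
structure LineBundle (X : AffCat k) where
  obj : ∀ x : X.obj, InvMod (X.O x)
  map : ∀ {x y : X.obj} (f : x ⟶ y), InvMod.Map (X.pull f) (obj y) (obj x)
  map_id : ∀ x : X.obj, (map (𝟙 x)).IsId
  map_comp : ∀ {x y z : X.obj} (f : x ⟶ y) (g : y ⟶ z), (map (f ≫ g)).IsComp (map g) (map f)

namespace LineBundle

variable {X : AffCat k}

/-- The trivial line bundle. -/
def unit (X : AffCat k) : LineBundle X where
  obj x := InvMod.unit (X.O x)
  map f := InvMod.Map.unit (X.pull f)
  map_id x := X.pull_id x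
  map_comp f g := X.pull_comp f g

/-- Tensor product of line bundles. -/
def tensor (L L' : LineBundle X) : LineBundle X where
  obj x := (L.obj x).tensor (L'.obj x)
  map f := (L.map f).tensor (L'.map f)
  map_id x := (L.map_id x).tensor (L'.map_id x)
  map_comp f g := (L.map_comp f g).tensor (L'.map_comp f g)

/-- Dual line bundle. -/
def dual (L : LineBundle X) : LineBundle X where
  obj x := (L.obj x).dual
  map f := (L.map f).dual
  map_id x := (L.map_id x).dual (X.pull_id x)
  map_comp f g := (L.map_comp f g).dual (X.pull_comp f g)

/-- Tensor power with exponent in `ℕ`. -/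
def npow (L : LineBundle X) (n : ℕ) : LineBundle X where
  obj x := (L.obj x).npow n
  map f := (L.map f).npow n
  map_id x := (L.map_id x).npow (X.pull_id x) n
  map_comp f g := (L.map_comp f g).npow (X.pull_comp f g) n

/-- Tensor power with exponent in `ℤ`. -/
def zpow (L : LineBundle X) (n : ℤ) : LineBundle X where
  obj x := (L.obj x).zpow n
  map f := (L.map f).zpow n
  map_id x := (L.map_id x).zpow (X.pull_id x) n
  map_comp f g := (L.map_comp f g).zpow (X.pull_comp f g) n

/-- Pullback of a line bundle along a morphism `G : 𝒴 → 𝒳`. -/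
def comap {C : Type (u + 1)} [Category.{u} C] (G : C ⥤ X.obj) (L : LineBundle X) :
    LineBundle (X.comap G) where
  obj c := L.obj (G.obj c)
  map f := L.map (G.map f)
  map_id c m := by
    have := L.map_id (G.obj c) m
    rwa [← G.map_id] at this
  map_comp f g m := by
    have := L.map_comp (G.map f) (G.map g) m
    rwa [← G.map_comp] at this

end LineBundle

/-! ## The stacks `𝒳 × BG_m` and `Isom(N, N')` -/

/-- Objects of `𝒳 × BG_m`: an object of `𝒳` over `Spec A` and a line bundle on `Spec A`. -/
structure WithLine (X : AffCat k) where
  base : X.obj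
  line : InvMod (X.O base)

namespace WithLine

variable {X : AffCat k}

/-- Morphisms of `𝒳 × BG_m`. -/
structure Hom (a b : WithLine X) where
  base : a.base ⟶ b.base
  line : InvMod.Map (X.pull base) b.line a.line

theorem Hom.ext {a b : WithLine X} {f g : Hom a b} (h : f.base = g.base)
    (h' : ∀ m, f.line m = g.line m) : f = g := by
  obtain ⟨f, F⟩ := f
  obtain ⟨g, G⟩ := g
  obtain rfl : f = g := h
  obtain rfl : F = G := InvMod.Map.ext h'
  rfl

instance : Category.{u} (WithLine X) where
  Hom := Hom
  id a := ⟨𝟙 a.base, InvMod.Map.id (X.pull_id a.base) a.line⟩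
  comp f g := ⟨f.base ≫ g.base, InvMod.Map.comp (X.pull_comp f.base g.base) g.line f.line⟩
  id_comp f := Hom.ext (Category.id_comp f.base) fun _ => rfl
  comp_id f := Hom.ext (Category.comp_id f.base) fun _ => rfl
  assoc f g h := Hom.ext (Category.assoc f.base g.base h.base) fun _ => rfl

/-- The projection `𝒳 × BG_m → 𝒳`. -/
def forget (X : AffCat k) : WithLine X ⥤ X.obj where
  obj a := a.base
  map f := f.base

/-- The functor `𝒴 × BG_m → 𝒳 × BG_m` induced by `G : 𝒴 → 𝒳`. -/
def lift {C : Type (u + 1)} [Category.{u} C] (G : C ⥤ X.obj) :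
    WithLine (X.comap G) ⥤ WithLine X where
  obj a := ⟨G.obj a.base, a.line⟩
  map f := ⟨G.map f.base, f.line⟩
  map_id a := Hom.ext (G.map_id a.base) fun _ => rfl
  map_comp f g := Hom.ext (G.map_comp f.base g.base) fun _ => rfl

end WithLine

/-- The stack `𝒳 × BG_m`. -/
abbrev AffCat.withLine (X : AffCat k) : AffCat k := X.comap (WithLine.forget X)

/-- The universal line bundle on `𝒳 × BG_m`. -/
def tautLine (X : AffCat k) : LineBundle X.withLine where
  obj a := a.line
  map f := f.line
  map_id _ _ := rfl
  map_comp _ _ _ := rfl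

/-- Objects of `Isom(N, N')`: an object of `𝒳` with an isomorphism between the pullbacks of `N` and
`N'`. This is the fibre product of `(N, N') : 𝒳 → BG_m × BG_m` with the diagonal of `BG_m`. -/
structure WithIso {X : AffCat k} (N N' : LineBundle X) where
  base : X.obj
  iso : N.obj base ≃ₗ[X.O base] N'.obj base

namespace WithIso

variable {X : AffCat k} {N N' : LineBundle X}

/-- Morphisms of `Isom(N, N')`: the morphisms of `𝒳` compatible with the isomorphisms. -/
structure Hom (a b : WithIso N N') where
  base : a.base ⟶ b.base
  comm : ∀ m, a.iso (N.map base m) = N'.map base (b.iso m)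

theorem Hom.ext {a b : WithIso N N'} {f g : Hom a b} (h : f.base = g.base) : f = g := by
  obtain ⟨f, _⟩ := f
  obtain ⟨g, _⟩ := g
  obtain rfl : f = g := h
  rfl

instance : Category.{u} (WithIso N N') where
  Hom := Hom
  id a := ⟨𝟙 a.base, fun m => by rw [N.map_id, N'.map_id]⟩
  comp f g := ⟨f.base ≫ g.base, fun m => by
    rw [N.map_comp, N'.map_comp, f.comm, g.comm]⟩
  id_comp f := Hom.ext (Category.id_comp f.base)
  comp_id f := Hom.ext (Category.comp_id f.base)
  assoc f g h := Hom.ext (Category.assoc f.base g.base h.base)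

/-- The projection `Isom(N, N') → 𝒳`. -/
def forget (N N' : LineBundle X) : WithIso N N' ⥤ X.obj where
  obj a := a.base
  map f := f.base

end WithIso

/-- The stack `Isom(N, N')`. -/
abbrev AffCat.withIso (X : AffCat k) (N N' : LineBundle X) : AffCat k :=
  X.comap (WithIso.forget N N')

/-! ## Root stacks -/

/-- The objects of the stack of `n`-th roots of `N`, i.e. of the fibre product of `N : 𝒳 → BG_m`
with the `n`-th power map `BG_m → BG_m`: an object of `𝒳`, a line bundle `S`, and an isomorphism
`S^{⊗ n} ≅ N`. -/
abbrev RootObj (X : AffCat k) (n : ℕ) (N : LineBundle X) : Type (u + 1) :=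
  WithIso ((tautLine X).npow n) (N.comap (WithLine.forget X))

/-- The projection from the stack of `n`-th roots of `N` to `𝒳`. -/
def rootProj (X : AffCat k) (n : ℕ) (N : LineBundle X) : RootObj X n N ⥤ X.obj :=
  WithIso.forget _ _ ⋙ WithLine.forget X

/-- The stack of `n`-th roots of `N`. -/
abbrev rootStack (X : AffCat k) (n : ℕ) (N : LineBundle X) : AffCat k :=
  X.comap (rootProj X n N)

/-- The universal `n`-th root of `N`. -/
def univRoot (X : AffCat k) (n : ℕ) (N : LineBundle X) : LineBundle (rootStack X n N) :=
  (tautLine X).comap (WithIso.forget _ _)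

/-! ## Logarithmic structures -/

/-- A presheaf of commutative monoids `M` on `𝒳` with a morphism `α` to the multiplicative monoid
of the structure sheaf. -/
structure PreLog (X : AffCat k) where
  M : X.obj → Type u
  [monoid : ∀ x, CommMonoid (M x)]
  res : ∀ {x y : X.obj} (_ : x ⟶ y), M y →* M x
  res_id : ∀ (x : X.obj) (m : M x), res (𝟙 x) m = m
  res_comp : ∀ {x y z : X.obj} (f : x ⟶ y) (g : y ⟶ z) (m : M z),
    res (f ≫ g) m = res f (res g m)
  α : ∀ x : X.obj, M x →* X.O x
  α_res : ∀ {x y : X.obj} (f : x ⟶ y) (m : M y), α x (res f m) = X.pull f (α y m)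

attribute [instance] PreLog.monoid

/-- `(M, α)` is a log structure on `𝒳`: `M` is a sheaf for the étale topology, and `α` restricts to
an isomorphism from the preimage of the units of the structure sheaf to these units. -/
structure PreLog.IsLog {X : AffCat k} (l : PreLog X) : Prop where
  units : ∀ (x : X.obj) (a : X.O x), IsUnit a → ∃! m : l.M x, l.α x m = a
  sheaf : ∀ (x : X.obj) (n : ℕ) (y : Fin n → X.obj) (f : ∀ i, y i ⟶ x),
    IsEtaleFamily (fun i => X.p.map (f i)) → ∀ s : ∀ i, l.M (y i),
      (∀ (i j : Fin n) (z : X.obj) (g : z ⟶ y i) (h : z ⟶ y j), g ≫ f i = h ≫ f j →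
        l.res g (s i) = l.res h (s j)) →
      ∃! m : l.M x, ∀ i, l.res (f i) m = s i

section DeligneFaltings

variable {A B : Type u} [CommRing A] [CommRing B]

/-- Functoriality of the symmetric algebra for pullback maps. -/
def symMap {φ : A →+* B} {N : InvMod A} {N' : InvMod B} (f : InvMod.Map φ N N') :
    SymmetricAlgebra A N →+* SymmetricAlgebra B N' :=
  letI : Algebra A (SymmetricAlgebra B N') :=
    ((algebraMap B (SymmetricAlgebra B N')).comp φ).toAlgebra
  (SymmetricAlgebra.lift (R := A)
    ({ toFun := fun n => SymmetricAlgebra.ι B N' (f n)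
       map_add' := fun x y => by rw [map_add, map_add]
       map_smul' := fun a x => by
        rw [f.map_smul, map_smul, Algebra.smul_def, Algebra.smul_def]; rfl } :
      N →ₗ[A] SymmetricAlgebra B N')).toRingHom

theorem symMap_algebraMap {φ : A →+* B} {N : InvMod A} {N' : InvMod B} (f : InvMod.Map φ N N')
    (a : A) : symMap f (algebraMap A _ a) = algebraMap B _ (φ a) := by
  let _ : Algebra A (SymmetricAlgebra B N') :=
    ((algebraMap B (SymmetricAlgebra B N')).comp φ).toAlgebra
  exact AlgHom.commutes _ a

theorem symMap_ι {φ : A →+* B} {N : InvMod A} {N' : InvMod B} (f : InvMod.Map φ N N')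
    (n : N) : symMap f (SymmetricAlgebra.ι A N n) = SymmetricAlgebra.ι B N' (f n) := by
  let _ : Algebra A (SymmetricAlgebra B N') :=
    ((algebraMap B (SymmetricAlgebra B N')).comp φ).toAlgebra
  exact SymmetricAlgebra.lift_ι_apply _ n

theorem sym_hom_ext {N : InvMod A} {R : Type u} [CommRing R] {f g : SymmetricAlgebra A N →+* R}
    (h : ∀ a, f (algebraMap A _ a) = g (algebraMap A _ a))
    (h' : ∀ n, f (SymmetricAlgebra.ι A N n) = g (SymmetricAlgebra.ι A N n))
    (t : SymmetricAlgebra A N) : f t = g t := by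
  induction t using SymmetricAlgebra.induction with
  | algebraMap a => exact h a
  | ι n => exact h' n
  | mul a b ha hb => rw [map_mul, map_mul, ha, hb]
  | add a b ha hb => rw [map_add, map_add, ha, hb]

/-- An element `t` of `Sym_A(N)` is *log homogeneous* if Zariski locally on `Spec A` it has the form
`u g^n`, where `u` is a unit, `g` is a generator of `N` and `n ≥ 0`. Here this is written without
localizations: near the prime `p`, the elements `f` and `u` are invertible, `g` generates `N`, and
`t = (u / f) g^n`. -/
def IsLogHomogeneous {N : InvMod A} (t : SymmetricAlgebra A N) : Prop :=
  ∀ p : PrimeSpectrum A, ∃ f ∉ p.asIdeal, ∃ u ∉ p.asIdeal, ∃ (g : N) (n : ℕ),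
    (∀ x : N, ∃ a : A, f • x = a • g) ∧ f • t = u • SymmetricAlgebra.ι A N g ^ n

theorem exists_local_generator (N : InvMod A) (p : PrimeSpectrum A) :
    ∃ f ∉ p.asIdeal, ∃ g : N, ∀ x : N, ∃ a : A, f • x = a • g := by
  obtain ⟨S, hS⟩ := ((Module.Invertible.linearEquiv A N).symm 1).exists_finset
  have h1 : (1 : A) = ∑ i ∈ S, i.1 i.2 := by
    have := (LinearEquiv.symm_apply_eq _).mp hS
    simpa [Module.Invertible.linearEquiv] using this
  have : ∃ i ∈ S, i.1 i.2 ∉ p.asIdeal := by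
    by_contra! h
    exact p.2.one_notMem (h1 ▸ Ideal.sum_mem _ h)
  obtain ⟨i, _, hi⟩ := this
  exact ⟨i.1 i.2, hi, i.2, fun x => ⟨i.1 x, N.dual_comm i.1 i.2 x⟩⟩

theorem isLogHomogeneous_one {N : InvMod A} : IsLogHomogeneous (1 : SymmetricAlgebra A N) := by
  intro p
  obtain ⟨f, hf, g, hg⟩ := exists_local_generator N p
  exact ⟨f, hf, f, hf, g, 0, hg, by rw [pow_zero]⟩

theorem IsLogHomogeneous.mul {N : InvMod A} {s t : SymmetricAlgebra A N}
    (hs : IsLogHomogeneous s) (ht : IsLogHomogeneous t) : IsLogHomogeneous (s * t) := by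
  intro p
  obtain ⟨f, hf, u, hu, g, n, hg, hs⟩ := hs p
  obtain ⟨f', hf', u', hu', g', n', hg', ht⟩ := ht p
  obtain ⟨a, ha⟩ := hg g'
  obtain ⟨b, hb⟩ := hg' g
  have h1 : ∀ x : N, ((f * f' - a * b) * f) • x = 0 := by
    intro x
    obtain ⟨c, hc⟩ := hg x
    rw [mul_smul, hc, smul_comm, sub_smul, mul_smul, hb, smul_comm f, ha, ← mul_smul, mul_comm b,
      sub_self, smul_zero]
  have h2 : (f * f' - a * b) * f = 0 := by
    refine (Module.Invertible.toModuleEnd_bijective A N).1 (LinearMap.ext fun x => ?_)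
    rw [map_zero]
    exact h1 x
  have ha' : a ∉ p.asIdeal := by
    intro h
    have h3 : f * f' * f ∈ p.asIdeal := by
      have h4 : f * f' * f = a * (b * f) := by linear_combination h2
      rw [h4]
      exact Ideal.mul_mem_right _ _ h
    exact (p.2.mem_or_mem h3).elim (fun h => (p.2.mem_or_mem h).elim hf hf') hf
  have hpow : ∀ {y : A}, y ∉ p.asIdeal → ∀ m, y ^ m ∉ p.asIdeal :=
    fun hy m h => hy (p.2.mem_of_pow_mem m h)
  have hmul : ∀ {y z : A}, y ∉ p.asIdeal → z ∉ p.asIdeal → y * z ∉ p.asIdeal :=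
    fun hy hz h => (p.2.mem_or_mem h).elim hy hz
  refine ⟨f ^ n' * f' * f, hmul (hmul (hpow hf n') hf') hf, u * u' * a ^ n',
    hmul (hmul hu hu') (hpow ha' n'), g, n + n', fun x => ?_, ?_⟩
  · obtain ⟨c, hc⟩ := hg x
    exact ⟨f ^ n' * f' * c, by rw [mul_smul, hc, mul_smul (f ^ n' * f')]⟩
  · have h5 : (algebraMap A (SymmetricAlgebra A N) f * SymmetricAlgebra.ι A N g') ^ n' =
        (algebraMap A (SymmetricAlgebra A N) a * SymmetricAlgebra.ι A N g) ^ n' := by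
      rw [← Algebra.smul_def, ← Algebra.smul_def, ← map_smul, ← map_smul, ha]
    rw [mul_pow, mul_pow] at h5
    rw [Algebra.smul_def] at hs ht ⊢
    rw [Algebra.smul_def] at hs ht ⊢
    simp only [map_mul, map_pow]
    linear_combination (algebraMap A (SymmetricAlgebra A N) f ^ n' *
        algebraMap A (SymmetricAlgebra A N) f' * t) * hs +
      (algebraMap A (SymmetricAlgebra A N) f ^ n' * algebraMap A (SymmetricAlgebra A N) u *
        SymmetricAlgebra.ι A N g ^ n) * ht +
      (algebraMap A (SymmetricAlgebra A N) u * algebraMap A (SymmetricAlgebra A N) u' *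
        SymmetricAlgebra.ι A N g ^ n) * h5

theorem IsLogHomogeneous.map {φ : A →+* B} {N : InvMod A} {N' : InvMod B} (F : InvMod.Map φ N N')
    {t : SymmetricAlgebra A N} (ht : IsLogHomogeneous t) : IsLogHomogeneous (symMap F t) := by
  intro q
  obtain ⟨f, hf, u, hu, g, n, hg, ht⟩ := ht (PrimeSpectrum.comap φ q)
  refine ⟨φ f, hf, φ u, hu, F g, n, fun x => ?_, ?_⟩
  · have hx : x ∈ Submodule.span B (Set.range F.toFun) := by rw [F.span_range]; trivial
    induction hx using Submodule.span_induction with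
    | zero => exact ⟨0, by rw [smul_zero, zero_smul]⟩
    | add x y _ _ hx hy =>
      obtain ⟨a, ha⟩ := hx
      obtain ⟨b, hb⟩ := hy
      exact ⟨a + b, by rw [smul_add, ha, hb, add_smul]⟩
    | smul c x _ hx =>
      obtain ⟨a, ha⟩ := hx
      exact ⟨c * a, by rw [smul_comm, ha, mul_smul]⟩
    | mem x hx =>
      obtain ⟨y, rfl⟩ := hx
      obtain ⟨a, ha⟩ := hg y
      exact ⟨φ a, by rw [← F.map_smul, ha, F.map_smul]⟩
  · have := congrArg (symMap F) ht
    rw [Algebra.smul_def, Algebra.smul_def, map_mul, map_mul, map_pow, symMap_algebraMap,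
      symMap_algebraMap, symMap_ι] at this
    rw [Algebra.smul_def, Algebra.smul_def, this]

theorem symMap_zeroSection {φ : A →+* B} {N : InvMod A} {N' : InvMod B} (F : InvMod.Map φ N N')
    (t : SymmetricAlgebra A N) : SymmetricAlgebra.algebraMapInv (symMap F t) =
      φ (SymmetricAlgebra.algebraMapInv t) :=
  sym_hom_ext
    (f := (SymmetricAlgebra.algebraMapInv (R := B) (M := N')).toRingHom.comp (symMap F))
    (g := φ.comp (SymmetricAlgebra.algebraMapInv (R := A) (M := N)).toRingHom)
    (fun a => by
      change SymmetricAlgebra.algebraMapInv (symMap F (algebraMap A _ a)) =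
        φ (SymmetricAlgebra.algebraMapInv (algebraMap A _ a))
      rw [symMap_algebraMap, SymmetricAlgebra.algebraMap_leftInverse,
        SymmetricAlgebra.algebraMap_leftInverse])
    (fun n => by
      change SymmetricAlgebra.algebraMapInv (symMap F (SymmetricAlgebra.ι A N n)) =
        φ (SymmetricAlgebra.algebraMapInv (SymmetricAlgebra.ι A N n))
      rw [symMap_ι, SymmetricAlgebra.algebraMapInv_ι, SymmetricAlgebra.algebraMapInv_ι, map_zero])
    t

/-- The monoid of log homogeneous elements. -/
def logHomogeneous (N : InvMod A) : Submonoid (SymmetricAlgebra A N) where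
  carrier := {t | IsLogHomogeneous t}
  one_mem' := isLogHomogeneous_one
  mul_mem' := IsLogHomogeneous.mul

end DeligneFaltings

/-- The rank one Deligne--Faltings log structure given by the zero section of the line bundle `E`.
Its sections are (locally) the pairs of a natural number `n` and a generator of `(E^∨)^{⊗ n}`, i.e.
the log homogeneous elements of `Sym(E^∨)`. The map `α` is the evaluation of
`Sym(E^∨)` at the zero section of `E`: it is the identity on `n = 0` and zero on `n > 0`. -/
def zeroSectionLog {X : AffCat k} (E : LineBundle X) : PreLog X where
  M x := logHomogeneous (E.dual.obj x)
  res {x y} f := ((symMap (E.dual.map f)).toMonoidHom.comp (Submonoid.subtype _)).codRestrict _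
    fun t => t.2.map (E.dual.map f)
  res_id x m := Subtype.ext (sym_hom_ext (f := symMap (E.dual.map (𝟙 x))) (g := RingHom.id _)
    (fun a => by rw [symMap_algebraMap, X.pull_id]; rfl)
    (fun n => by rw [symMap_ι, E.dual.map_id]; rfl) m.1)
  res_comp {x y z} f g m := Subtype.ext (sym_hom_ext (f := symMap (E.dual.map (f ≫ g)))
    (g := (symMap (E.dual.map f)).comp (symMap (E.dual.map g)))
    (fun a => by
      rw [RingHom.comp_apply, symMap_algebraMap, symMap_algebraMap, symMap_algebraMap, X.pull_comp])
    (fun n => by rw [RingHom.comp_apply, symMap_ι, symMap_ι, symMap_ι, E.dual.map_comp]) m.1)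
  α x := (SymmetricAlgebra.algebraMapInv (R := X.O x)
    (M := E.dual.obj x)).toRingHom.toMonoidHom.comp (Submonoid.subtype _)
  α_res {x y} f m := symMap_zeroSection (E.dual.map f) m.1


/-! ## Log stacks over a base stack -/

/-- A stack with a log structure, together with a morphism `proj` to `B`. -/
structure LogStackOver (B : AffCat k) where
  C : Type (u + 1)
  [cat : Category.{u} C]
  proj : C ⥤ B.obj
  log : PreLog (B.comap proj)

namespace LogStackOver

attribute [instance] cat

/-- The log stack given by `S → 𝒴 → B`, with `S` over `𝒴`. -/
def push {B : AffCat k} {Y : Type (u + 1)} [Category.{u} Y] (G : Y ⥤ B.obj)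
    (S : LogStackOver (B.comap G)) : LogStackOver B where
  C := S.C
  proj := S.proj ⋙ G
  log := S.log

variable {B : AffCat k}

/-- An isomorphism of log stacks `S → T` over `B`: an equivalence of categories `functor`,
a 2-isomorphism `triangle` making the triangle over `B` commute, and an isomorphism `logEquiv` from the
pullback of the log structure of `T` to that of `S`. -/
structure Iso (S T : LogStackOver B) where
  functor : S.C ⥤ T.C
  isEquivalence : functor.IsEquivalence
  triangle : functor ⋙ T.proj ≅ S.proj
  logEquiv : ∀ x : S.C, T.log.M (functor.obj x) ≃* S.log.M x
  logEquiv_res : ∀ {x y : S.C} (f : x ⟶ y) (m : T.log.M (functor.obj y)),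
    logEquiv x (T.log.res (functor.map f) m) = S.log.res f (logEquiv y m)
  logEquiv_α : ∀ (x : S.C) (m : T.log.M (functor.obj x)),
    B.pull (triangle.hom.app x) (S.log.α x (logEquiv x m)) = T.log.α (functor.obj x) m

/-- An isomorphism between the pullback along `Φ : S → T` of a line bundle `E` on `T` and a
line bundle `E'` on `S`. -/
structure Iso.LineIso {S T : LogStackOver B} (Φ : S.Iso T) (E : LineBundle (B.comap T.proj))
    (E' : LineBundle (B.comap S.proj)) where
  equiv : ∀ x : S.C, E.obj (Φ.functor.obj x) ≃+ E'.obj x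
  equiv_smul : ∀ (x : S.C) (a : B.O (S.proj.obj x)) (e : E.obj (Φ.functor.obj x)),
    equiv x (B.pull (Φ.triangle.hom.app x) a • e) = a • equiv x e
  equiv_map : ∀ {x y : S.C} (f : x ⟶ y) (e : E.obj (Φ.functor.obj y)),
    equiv x (E.map (Φ.functor.map f) e) = E'.map f (equiv y e)

end LogStackOver

/-! ## The targets -/

/-- The image of `s^{⊗ n}` under the universal isomorphism `S^{⊗ n} ≅ N` on the stack of `n`-th
roots of `N`. -/
def rootPow {X : AffCat k} {n : ℕ} {N : LineBundle X} (y : RootObj X n N)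
    (s : (univRoot X n N).obj y) : N.obj ((rootProj X n N).obj y) :=
  y.iso (InvMod.pow s n)

/-- The input: a stack `X = ∞_𝒳`, line bundles `LR = 𝐋_R` and `Linf = 𝐋_∞`, and integers. -/
structure InputData (k : Type u) [Field k] where
  X : AffCat k
  LR : LineBundle X
  Linf : LineBundle X
  r : ℕ
  d : ℕ
  ℓ : ℕ

namespace InputData

variable (D : InputData k)

/-- The conditions on the input. -/
structure IsValid : Prop where
  properDM : D.X.IsProperDM
  projectiveCoarse : D.X.HasProjectiveCoarse
  r_pos : 0 < D.r
  d_pos : 0 < D.d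
  ℓ_pos : 0 < D.ℓ

/-- The stack `∞_𝒳 × BC^*_ω`. Its universal line bundle is `tautLine D.X = ω`. -/
abbrev base : AffCat k := D.X.withLine

/-- The line bundle `𝐋_R ⊠ ω` on `∞_𝒳 × BC^*_ω`. -/
def LRω : LineBundle D.base := (D.LR.comap (WithLine.forget D.X)).tensor (tautLine D.X)

/-- The stack `∞` of `r`-th roots of `𝐋_R ⊠ ω`. -/
abbrev infty : AffCat k := rootStack D.base D.r D.LRω

/-- The spin structure: the universal `r`-th root on `∞`. -/
abbrev spin : LineBundle D.infty := univRoot D.base D.r D.LRω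

/-- The line bundle `O(∞) = 𝐋_∞ ⊗ spin^{-d}` on `∞`. -/
def lineInfty : LineBundle D.infty :=
  ((D.Linf.comap (WithLine.forget D.X)).comap (rootProj D.base D.r D.LRω)).tensor
    (D.spin.dual.npow D.d)

/-- The stack `∞^{1/ℓ}`: the fibre product of `O(∞) : ∞ → BG_m` with the `ℓ`-th power map. -/
abbrev root : AffCat k := rootStack D.infty D.ℓ D.lineInfty

/-- The line bundle `O(∞^{1/ℓ})`: the universal `ℓ`-th root of `O(∞)`. -/
abbrev lineRoot : LineBundle D.root := univRoot D.infty D.ℓ D.lineInfty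

/-- The pullback of the spin structure to `∞^{1/ℓ}`. -/
abbrev spinRoot : LineBundle D.root := D.spin.comap (rootProj D.infty D.ℓ D.lineInfty)

/-- The projection `∞^{1/ℓ} → ∞_𝒳 × BC^*_ω`. -/
abbrev rootToBase : RootObj D.infty D.ℓ D.lineInfty ⥤ D.base.obj :=
  rootProj D.infty D.ℓ D.lineInfty ⋙ rootProj D.base D.r D.LRω

/-- The log stack `∞^{1/ℓ}` over `∞_𝒳 × BC^*_ω`; the log structure is given by the zero section of
`O(∞^{1/ℓ})`. -/
def target : LogStackOver D.base where
  C := RootObj D.infty D.ℓ D.lineInfty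
  proj := D.rootToBase
  log := zeroSectionLog D.lineRoot

/-! ### The modified input -/

/-- The fraction `d / (r ℓ)`; its reduced representation is `rat`. -/
def fraction : ℚ := (D.d : ℚ) / (D.r * D.ℓ)

/-- The denominator `r'`. -/
def rRed : ℕ := D.fraction.den

/-- The numerator `d'`. -/
def dRed : ℕ := D.fraction.num.toNat

/-- `r̂ = lcm(r, r')`. -/
def rHat : ℕ := Nat.lcm D.r D.rRed

/-- `d̂ = d' r̂ / r'`. -/
def dHat : ℕ := D.dRed * D.rHat / D.rRed

/-- The condition `1 / r̂ = a / r + b rat`. -/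
def IsBezout (a b : ℤ) : Prop := (1 : ℚ) / D.rHat = a / D.r + b * D.dRed / D.rRed

/-- The stack `∞_𝒳 × (BG_m)^2`. -/
abbrev X₂ : AffCat k := D.X.withLine.withLine

/-- The first universal line bundle on `∞_𝒳 × (BG_m)^2`. -/
def U₁ : LineBundle D.X₂ := (tautLine D.X).comap (WithLine.forget D.X.withLine)

/-- The second universal line bundle on `∞_𝒳 × (BG_m)^2`. -/
def U₂ : LineBundle D.X₂ := tautLine D.X.withLine

/-- The line bundle `U₁^{-d} ⊗ U₂^ℓ`. -/
def N₁ : LineBundle D.X₂ := (D.U₁.dual.npow D.d).tensor (D.U₂.npow D.ℓ)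

/-- The pullback of `𝐋_∞^∨` to `∞_𝒳 × (BG_m)^2`. -/
def LinfDual : LineBundle D.X₂ :=
  (D.Linf.dual.comap (WithLine.forget D.X)).comap (WithLine.forget D.X.withLine)

/-- The stack of `(x, U₁, U₂)` with an isomorphism `U₁^{-d} ⊗ U₂^ℓ ≅ 𝐋_∞^∨`. -/
abbrev X₃ : AffCat k := D.X₂.withIso D.N₁ D.LinfDual

variable (a b : ℤ)

/-- The line bundle `U₁^a ⊗ U₂^b`. -/
def N₂ : LineBundle D.X₃ :=
  ((D.U₁.zpow a).tensor (D.U₂.zpow b)).comap (WithIso.forget D.N₁ D.LinfDual)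

/-- The objects of the stack of `(x, U₁, U₂)` with isomorphisms `U₁^{-d} ⊗ U₂^ℓ ≅ 𝐋_∞^∨` and
`U₁^a ⊗ U₂^b ≅ O`. -/
abbrev HatObj : Type (u + 1) := WithIso (D.N₂ a b) (LineBundle.unit D.X₃)

/-- The projection to `∞_𝒳 × (BG_m)^2`. -/
def hatToX₂ : D.HatObj a b ⥤ D.X₂.obj :=
  WithIso.forget (D.N₂ a b) (LineBundle.unit D.X₃) ⋙ WithIso.forget D.N₁ D.LinfDual

/-- The projection to `∞_𝒳`. -/
def hatToX : D.HatObj a b ⥤ D.X.obj :=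
  D.hatToX₂ a b ⋙ WithLine.forget D.X.withLine ⋙ WithLine.forget D.X

/-- The modified stack: the fibre product of `(𝐋_∞^∨, O) : ∞_𝒳 → (BG_m)^2` with
`(U₁, U₂) ↦ (U₁^{-d} ⊗ U₂^ℓ, U₁^a ⊗ U₂^b)`. -/
abbrev XHat : AffCat k := D.X.comap (D.hatToX a b)

/-- The line bundle `L₁` on the modified stack. -/
def L₁ : LineBundle (D.XHat a b) := D.U₁.comap (D.hatToX₂ a b)

/-- The line bundle `L₂` on the modified stack. -/
def L₂ : LineBundle (D.XHat a b) := D.U₂.comap (D.hatToX₂ a b)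

/-- The modified input data. -/
def hat : InputData k where
  X := D.XHat a b
  LR := (D.LR.comap (D.hatToX a b)).tensor ((D.L₁ a b).dual.npow D.r)
  Linf := (D.L₂ a b).dual
  r := D.rHat
  d := D.dHat
  ℓ := 1

/-- The target of the modified input, as a log stack over `∞_𝒳 × BC^*_ω`. -/
def hatTarget : LogStackOver D.base :=
  LogStackOver.push (B := D.base) (WithLine.lift (D.hatToX a b)) (D.hat a b).target

end InputData

namespace InputData

variable (D : InputData k) (a b : ℤ)

/-- The pullback of `L₁` to the target of the modified input. -/
def L₁Target : LineBundle (D.hat a b).root :=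
  ((D.L₁ a b).comap (WithLine.forget (D.hat a b).X)).comap (D.hat a b).rootToBase

/-- The line bundle `L₁ ⊗ (spin^)^{r̂ / r}` on the target of the modified input. -/
def spinHat : LineBundle (D.hat a b).root :=
  (D.L₁Target a b).tensor ((D.hat a b).spinRoot.npow (D.rHat / D.r))

/-- An isomorphism of log stacks from the target `∞̂` of the modified input to `∞^{1/ℓ}`
over `∞_𝒳 × BC^*_ω`, which is compatible with all the universal data:
it identifies `spin` with `L₁ ⊗ (spin^)^{r̂ / r}` and `O(∞^{1/ℓ})` with `O(∞̂)`, it is compatible with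
the universal isomorphisms for these line bundles, and its effect on log structures is induced by
`O(∞^{1/ℓ}) ≅ O(∞̂)`. -/
structure CanonicalIso extends LogStackOver.Iso (D.hatTarget a b) D.target where
  spinIso : toIso.LineIso D.spinRoot (D.spinHat a b)
  lineIso : toIso.LineIso D.lineRoot (D.hat a b).lineRoot
  /-- The isomorphism of log structures is induced by `lineIso`: it sends a section `χ` of the dual
  of `O(∞^{1/ℓ})` to the corresponding section `χ'` of the dual of `O(∞̂)`. -/
  log_compat : ∀ (x : (D.hat a b).root.obj)
    (m : (zeroSectionLog D.lineRoot).M (toIso.functor.obj x))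
    (χ : D.lineRoot.dual.obj (toIso.functor.obj x))
    (χ' : (D.hat a b).lineRoot.dual.obj x),
    (∀ e, D.base.pull (toIso.triangle.hom.app x) (InvMod.pair χ' (lineIso.equiv x e)) =
      InvMod.pair χ e) →
    m.1 = SymmetricAlgebra.ι _ _ χ →
    Subtype.val (show (zeroSectionLog (D.hat a b).lineRoot).M x from toIso.logEquiv x m) =
      SymmetricAlgebra.ι _ _ χ'
  /-- Compatibility with the universal isomorphisms `spin^r ≅ 𝐋_R ⊗ ω` and
  `(spin^)^{r̂} ≅ 𝐋_R ⊗ L₁^{-r} ⊗ ω`. If the latter sends `s^{r̂}` to `(m ⊗ e₁^{-r}) ⊗ w`, then the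
  former sends `(e₁ ⊗ s^{r̂ / r})^r` to `m ⊗ w`. -/
  spin_compat : ∀ (x : (D.hat a b).root.obj)
    (e₁ : (D.L₁ a b).obj ((D.hat a b).rootToBase.obj x).base)
    (δ₁ : (D.L₁ a b).dual.obj ((D.hat a b).rootToBase.obj x).base)
    (s : (D.hat a b).spinRoot.obj x)
    (m : D.LR.obj ((D.hatToX a b).obj ((D.hat a b).rootToBase.obj x).base))
    (w : (tautLine (D.hat a b).X).obj ((D.hat a b).rootToBase.obj x))
    (σ : D.spinRoot.obj (toIso.functor.obj x)),
    InvMod.pair δ₁ e₁ = 1 →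
    rootPow ((rootProj (D.hat a b).infty (D.hat a b).ℓ (D.hat a b).lineInfty).obj x) s =
      InvMod.tmul (InvMod.tmul m (InvMod.pow δ₁ D.r)) w →
    spinIso.equiv x σ = InvMod.tmul e₁ (InvMod.pow s (D.rHat / D.r)) →
    rootPow ((rootProj D.infty D.ℓ D.lineInfty).obj (toIso.functor.obj x)) σ =
      D.LRω.map (toIso.triangle.hom.app x) (InvMod.tmul m w)
  /-- Compatibility with the universal isomorphisms `O(∞^{1/ℓ})^ℓ ≅ 𝐋_∞ ⊗ spin^{-d}` and
  `O(∞̂) ≅ L₂^{-1} ⊗ (spin^)^{-d̂}`. Suppose that the latter sends `u` to `e₂^{-1} ⊗ s^{-d̂}`, and that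
  `m` corresponds to `e₁^d ⊗ e₂^{-ℓ}` under `L₁^{-d} ⊗ L₂^ℓ ≅ 𝐋_∞^∨`. Then the former sends the
  `ℓ`-th power of the section `t` corresponding to `u` to `m ⊗ σ^{-d}`,
  where `σ` corresponds to `e₁ ⊗ s^{r̂ / r}`. -/
  line_compat : ∀ (x : (D.hat a b).root.obj)
    (e₁ : (D.L₁ a b).obj ((D.hat a b).rootToBase.obj x).base)
    (δ₁ : (D.L₁ a b).dual.obj ((D.hat a b).rootToBase.obj x).base)
    (e₂ : (D.L₂ a b).obj ((D.hat a b).rootToBase.obj x).base)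
    (δ₂ : (D.L₂ a b).dual.obj ((D.hat a b).rootToBase.obj x).base)
    (s : (D.hat a b).spinRoot.obj x) (ς : (D.hat a b).spinRoot.dual.obj x)
    (u : (D.hat a b).lineRoot.obj x)
    (m : D.Linf.obj ((D.hatToX a b).obj ((D.hat a b).rootToBase.obj x).base))
    (σ : D.spinRoot.obj (toIso.functor.obj x)) (σ' : D.spinRoot.dual.obj (toIso.functor.obj x))
    (t : D.lineRoot.obj (toIso.functor.obj x)),
    InvMod.pair δ₁ e₁ = 1 → InvMod.pair δ₂ e₂ = 1 → InvMod.pair ς s = 1 → InvMod.pair σ' σ = 1 →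
    rootPow x u = InvMod.tmul δ₂ (InvMod.pow ς D.dHat) →
    InvMod.pair (((D.hat a b).rootToBase.obj x).base.base.iso
      (InvMod.tmul (InvMod.pow δ₁ D.d) (InvMod.pow e₂ D.ℓ))) m = 1 →
    spinIso.equiv x σ = InvMod.tmul e₁ (InvMod.pow s (D.rHat / D.r)) →
    lineIso.equiv x t = u →
    rootPow (toIso.functor.obj x) t =
      InvMod.tmul (D.Linf.map ((WithLine.forget D.X).map (toIso.triangle.hom.app x)) m)
        (InvMod.pow σ' D.d)

end InputData

end

end LogTarget

open LogTarget

/-!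
Put `c = r̂ / r` and `N = r ℓ / r̂`. Then `ℓ = N c`, `d = N d̂`, and the Bézout condition says
`a c + b d̂ = 1`, which can be solved since `c` and `d̂` are coprime. All assertions come from two
unimodular matrices of exponents.

**The modified stack.** If `(L₁, L₂)` is an object of the modified stack, then `T = L₁^{-d̂} ⊗ L₂^c`
is an `N`-th root of `L₁^{-d} ⊗ L₂^ℓ ≅ 𝐋_∞^∨`, and `L₁^a ⊗ L₂^b` is trivialized. The matrix with
rows `(-d̂, c)` and `(a, b)` is unimodular, so isomorphisms of `L₁` and `L₂` compatible with the
trivialization are the same as isomorphisms of `T` (`InputData.toRootStack_full_faithful`). Thus the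
modified stack is a full substack of the stack of `N`-th roots of `𝐋_∞^∨`. It has objects étale
locally on `∞_𝒳`, and the isomorphisms between two `N`-th roots form a finite étale covering,
locally the spectrum of `A[X]/(X^N - γ)` with `N` and `γ` invertible (`rootStack_exists_isRelProd`).
So it is a gerbe over `∞_𝒳` with finite étale automorphism groups (`AffCat.IsFiniteGerbe`,
`InputData.IsValid.isFiniteGerbe`). Properness, the coarse moduli space, étaleness and smoothness
are established for any such gerbe, by descent along étale sections and along the coverings given by
isomorphisms (`AffCat.IsFiniteGerbe.isProperDM`, `isCoarseModuli`, `isEtaleMap`).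

**The canonical isomorphism.** Let `Ŝ` be the universal root on `∞̂` and `E = O(∞̂)`. The functor
`InputData.canonical` sends `(L₁, L₂, Ŝ, E)` to `(S, E)` with `S = L₁ ⊗ Ŝ^c`. The universal
isomorphisms `S^r ≅ 𝐋_R ⊗ ω` and `E^ℓ ≅ 𝐋_∞ ⊗ S^{-d}` are `InvMod.spinEquiv` and `InvMod.lineEquiv`.
Both are defined by their values on sections which generate locally (`InvMod.exists_equiv_of_swap`),
so all compatibilities are identities between sections. When all line bundles are trivial,
automorphisms are units `t₁`, `t₂`, `s` for `L₁`, `L₂`, `Ŝ`, and `(t₁ s^c, t₂⁻¹ s^{-d̂}, t₁^a t₂^b)`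
is again a unimodular substitution (`unimodular_three`). So `canonical` is fully faithful there, and
objects of `∞^{1/ℓ}` with trivial roots are in its image (`InputData.exists_canonical_hom'`). Since
source and target are stacks, it is an equivalence (`full_faithful_of_local`, `essSurj_of_local`).
That `𝒳 × BG_m` and `Isom(N, N')` are stacks if `𝒳` is one, is flat descent for line bundles and
their isomorphisms (`AffCat.IsStack.withLine`, `AffCat.IsStack.withIso`).

**Log structures.** `canonical` does not change `E`, so the log structures correspond by the
identity. They are log structures because log homogeneous elements of `Sym(E^∨)` descend along flat
coverings (`IsLogHomogeneous.of_map`, `isLog_zeroSectionLog`).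
-/

namespace LogTarget

noncomputable section

section

namespace InvMod

variable {A B C : Type u} [CommRing A] [CommRing B] [CommRing C]

/-! ### Local generators of invertible modules -/

theorem pair_add_left {L : InvMod A} (χ χ' : L.dual) (x : L) :
    pair (χ + χ') x = pair χ x + pair χ' x := rfl

theorem pair_smul_left {L : InvMod A} (a : A) (χ : L.dual) (x : L) :
    pair (a • χ) x = a * pair χ x := rfl

theorem pair_add {L : InvMod A} (χ : L.dual) (x y : L) :
    pair χ (x + y) = pair χ x + pair χ y := map_add (show Module.Dual A L from χ) x y

theorem pair_smul {L : InvMod A} (χ : L.dual) (a : A) (x : L) :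
    pair χ (a • x) = a * pair χ x := map_smul (show Module.Dual A L from χ) a x

theorem pair_sum {L : InvMod A} {ι : Type*} (s : Finset ι) (χ : L.dual) (x : ι → L) :
    pair χ (∑ i ∈ s, x i) = ∑ i ∈ s, pair χ (x i) := map_sum (show Module.Dual A L from χ) x s

theorem dual_ext {L : InvMod A} {χ χ' : L.dual} (h : ∀ x, pair χ x = pair χ' x) : χ = χ' :=
  LinearMap.ext h

theorem pair_comm {L : InvMod A} (χ : L.dual) (x y : L) : pair χ x • y = pair χ y • x :=
  dual_comm L χ x y

/-- The section `χ ⊗ χ'` of the dual of `L ⊗ L'`. -/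
def tdual {L L' : InvMod A} (χ : L.dual) (χ' : L'.dual) : (L.tensor L').dual :=
  (TensorProduct.lid A A).toLinearMap ∘ₗ
    TensorProduct.map (show Module.Dual A L from χ) (show Module.Dual A L' from χ')

theorem pair_tdual {L L' : InvMod A} (χ : L.dual) (χ' : L'.dual) (x : L) (y : L') :
    pair (tdual χ χ') (tmul x y) = pair χ x * pair χ' y := rfl

/-- The section of the dual of the structure sheaf given by the identity. -/
def udual (A : Type u) [CommRing A] : (unit A).dual := (LinearMap.id : A →ₗ[A] A)

/-- The section `χ^{⊗ n}` of the dual of `L^{⊗ n}`. -/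
def powDual {L : InvMod A} (χ : L.dual) : (n : ℕ) → (L.npow n).dual
  | 0 => udual A
  | n + 1 => tdual χ (powDual χ n)

theorem pair_powDual {L : InvMod A} (χ : L.dual) (x : L) :
    ∀ n, pair (powDual χ n) (pow x n) = pair χ x ^ n
  | 0 => by rw [pow_zero]; rfl
  | n + 1 => by
    rw [pow_succ', ← pair_powDual χ x n]
    rfl

/-- Evaluation at `x`, as a section of the double dual. -/
def evalDual {L : InvMod A} (x : L) : L.dual.dual := Module.Dual.eval A L x

theorem tmul_add {L L' : InvMod A} (x : L) (y y' : L') : tmul x (y + y') = tmul x y + tmul x y' :=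
  TensorProduct.tmul_add _ _ _

theorem smul_tmul {L L' : InvMod A} (a : A) (x : L) (y : L') : tmul (a • x) y = a • tmul x y := rfl

theorem tmul_smul {L L' : InvMod A} (a : A) (x : L) (y : L') : tmul x (a • y) = a • tmul x y :=
  TensorProduct.tmul_smul _ _ _

theorem pow_smul {L : InvMod A} (a : A) (x : L) : ∀ n, pow (a • x) n = a ^ n • pow x n
  | 0 => by rw [pow_zero, one_smul]; rfl
  | n + 1 => by
    change tmul (a • x) (pow (a • x) n) = a ^ (n + 1) • tmul x (pow x n)
    rw [pow_smul a x n, smul_tmul, tmul_smul, smul_smul, pow_succ']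

/-- The section `x` generates `L` in a neighbourhood of `p`. -/
def GenAt {L : InvMod A} (p : PrimeSpectrum A) (x : L) : Prop :=
  ∃ χ : L.dual, pair χ x ∉ p.asIdeal

/-- The section `x` is a generator of `L`, so that `L` is trivial. -/
def IsGen {L : InvMod A} (x : L) : Prop := ∃ χ : L.dual, pair χ x = 1

theorem exists_dualBasis (L : InvMod A) : ∃ (n : ℕ) (χ : Fin n → L.dual) (x : Fin n → L),
    ∑ i, pair (χ i) (x i) = 1 := by
  obtain ⟨S, hS⟩ := ((Module.Invertible.linearEquiv A L).symm 1).exists_finset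
  have h1 : (1 : A) = ∑ i ∈ S, i.1 i.2 := by
    have := (LinearEquiv.symm_apply_eq _).mp hS
    simpa [Module.Invertible.linearEquiv] using this
  let e := S.equivFin
  refine ⟨S.card, fun i => (e.symm i).1.1, fun i => (e.symm i).1.2, ?_⟩
  rw [h1, ← Finset.sum_coe_sort S, ← e.symm.sum_comp]
  rfl

theorem exists_genAt (L : InvMod A) (p : PrimeSpectrum A) : ∃ x : L, GenAt p x := by
  obtain ⟨n, χ, x, h⟩ := L.exists_dualBasis
  by_contra! H
  refine p.2.one_notMem (h ▸ Ideal.sum_mem _ fun i _ => ?_)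
  by_contra hi
  exact H (x i) ⟨χ i, hi⟩

variable {φ : A →+* B} {ψ : B →+* C} {L L' : InvMod A} {M M' : InvMod B} {N N' : InvMod C}

theorem GenAt.tmul {p : PrimeSpectrum A} {x : L} {y : L'} (hx : GenAt p x) (hy : GenAt p y) :
    GenAt p (tmul x y) := by
  obtain ⟨χ, hx⟩ := hx
  obtain ⟨χ', hy⟩ := hy
  exact ⟨tdual χ χ', fun h => (p.2.mem_or_mem h).elim hx hy⟩

theorem GenAt.pow {p : PrimeSpectrum A} {x : L} (hx : GenAt p x) (n : ℕ) : GenAt p (pow x n) := by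
  obtain ⟨χ, hx⟩ := hx
  exact ⟨powDual χ n, fun h => hx (p.2.mem_of_pow_mem n (by rwa [pair_powDual] at h))⟩

theorem GenAt.map (f : Map φ L M) {q : PrimeSpectrum B} {x : L}
    (hx : GenAt (PrimeSpectrum.comap φ q) x) : GenAt q (f x) := by
  obtain ⟨χ, hx⟩ := hx
  exact ⟨f.dual χ, fun h => hx (by rwa [f.dual_pair] at h)⟩

theorem IsGen.genAt {x : L} (hx : IsGen x) (p : PrimeSpectrum A) : GenAt p x := by
  obtain ⟨χ, hx⟩ := hx
  exact ⟨χ, by rw [hx]; exact p.2.one_notMem⟩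

theorem IsGen.tmul {x : L} {y : L'} (hx : IsGen x) (hy : IsGen y) : IsGen (tmul x y) := by
  obtain ⟨χ, hx⟩ := hx
  obtain ⟨χ', hy⟩ := hy
  exact ⟨tdual χ χ', by rw [pair_tdual, hx, hy, one_mul]⟩

theorem IsGen.pow {x : L} (hx : IsGen x) (n : ℕ) : IsGen (pow x n) := by
  obtain ⟨χ, hx⟩ := hx
  exact ⟨powDual χ n, by rw [pair_powDual, hx, one_pow]⟩

theorem IsGen.map (f : Map φ L M) {x : L} (hx : IsGen x) : IsGen (f x) := by
  obtain ⟨χ, hx⟩ := hx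
  exact ⟨f.dual χ, by rw [f.dual_pair, hx, map_one]⟩

theorem isGen_unit_one : IsGen (1 : A) (L := unit A) := ⟨udual A, rfl⟩

theorem isGen_dual {x : L} {χ : L.dual} (h : pair χ x = 1) : IsGen χ := ⟨evalDual x, h⟩

theorem isGen_of_isUnit {x : L} {χ : L.dual} (h : IsUnit (pair χ x)) : IsGen x := by
  obtain ⟨b, hb⟩ := h.exists_left_inv
  exact ⟨b • χ, hb⟩

theorem eq_pair_smul {x : L} {χ : L.dual} (h : pair χ x = 1) (y : L) : y = pair χ y • x := by
  rw [← pair_comm, h, one_smul]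

theorem IsGen.equiv (e : L ≃ₗ[A] L') {x : L} (hx : IsGen x) : IsGen (e x) := by
  obtain ⟨χ, hx⟩ := hx
  refine ⟨(show Module.Dual A L from χ) ∘ₗ e.symm.toLinearMap, ?_⟩
  change pair χ (e.symm (e x)) = 1
  rw [e.symm_apply_apply, hx]

/-- An element of a module which is killed locally vanishes. -/
theorem eq_of_forall_prime {K : Type*} [AddCommGroup K] [Module A K] {x y : K}
    (h : ∀ p : PrimeSpectrum A, ∃ f ∉ p.asIdeal, f • x = f • y) : x = y := by
  let I : Ideal A := LinearMap.ker (LinearMap.toSpanSingleton A K (x - y))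
  have hI : I = ⊤ := by
    by_contra hI
    obtain ⟨m, hm, hIm⟩ := Ideal.exists_le_maximal I hI
    obtain ⟨f, hf, hfx⟩ := h ⟨m, hm.isPrime⟩
    refine hf (hIm ?_)
    change f • (x - y) = 0
    rw [smul_sub, hfx, sub_self]
  have h1 : (1 : A) ∈ I := by rw [hI]; trivial
  have h2 : (1 : A) • (x - y) = 0 := h1
  rwa [one_smul, sub_eq_zero] at h2

/-- Semilinear maps on a line bundle agree if they agree on local generators. -/
theorem semilinear_ext {K : Type*} [AddCommGroup K] [Module B K] {F G : L → K}
    (hF : ∀ (a : A) m, F (a • m) = φ a • F m) (hG : ∀ (a : A) m, G (a • m) = φ a • G m)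
    (h : ∀ q : PrimeSpectrum B, ∃ x, GenAt (PrimeSpectrum.comap φ q) x ∧ F x = G x) (y : L) :
    F y = G y := by
  refine eq_of_forall_prime (A := B) fun q => ?_
  obtain ⟨x, ⟨χ, hχ⟩, hx⟩ := h q
  refine ⟨φ (pair χ x), hχ, ?_⟩
  rw [← hF, ← hG, pair_comm, hF, hG, hx]

theorem semilinear_ext_gen {K : Type*} [AddCommGroup K] [Module B K] {F G : L → K}
    (hF : ∀ (a : A) m, F (a • m) = φ a • F m) (hG : ∀ (a : A) m, G (a • m) = φ a • G m)
    {x : L} (hx : IsGen x) (h : F x = G x) (y : L) : F y = G y :=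
  semilinear_ext hF hG (fun _ => ⟨x, hx.genAt _, h⟩) y

theorem linear_ext {K : Type*} [AddCommGroup K] [Module A K] {F G : L → K}
    (hF : ∀ (a : A) m, F (a • m) = a • F m) (hG : ∀ (a : A) m, G (a • m) = a • G m)
    (h : ∀ p : PrimeSpectrum A, ∃ x, GenAt p x ∧ F x = G x) (y : L) : F y = G y :=
  semilinear_ext (φ := RingHom.id A) hF hG h y

theorem Map.ext_gen {f g : Map φ L M} {x : L} (hx : IsGen x) (h : f x = g x) : f = g :=
  Map.ext fun y => semilinear_ext_gen f.map_smul g.map_smul hx h y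

theorem Map.ext_comp {f : Map φ L M} {χ : A →+* C} {g g' : Map ψ M N} {h : Map χ L N}
    (H : h.IsComp f g) (H' : h.IsComp f g') : g = g' :=
  Map.ext fun y => semilinear_ext g.map_smul g'.map_smul (fun q => by
    obtain ⟨x, hx⟩ := L.exists_genAt (PrimeSpectrum.comap φ (PrimeSpectrum.comap ψ q))
    exact ⟨f x, hx.map f, by rw [← H, ← H']⟩) y

theorem mem_of_forall_prime {K : Type*} [AddCommGroup K] [Module A K] (P : Submodule A K) {x : K}
    (h : ∀ p : PrimeSpectrum A, ∃ f ∉ p.asIdeal, f • x ∈ P) : x ∈ P := by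
  rw [← Submodule.Quotient.mk_eq_zero]
  refine eq_of_forall_prime (A := A) fun p => ?_
  obtain ⟨f, hf, hx⟩ := h p
  refine ⟨f, hf, ?_⟩
  rw [smul_zero, ← Submodule.Quotient.mk_smul, Submodule.Quotient.mk_eq_zero]
  exact hx

theorem eq_top_of_genAt (P : Submodule A L) (h : ∀ p : PrimeSpectrum A, ∃ x ∈ P, GenAt p x) :
    P = ⊤ := by
  rw [eq_top_iff]
  intro y _
  refine mem_of_forall_prime P fun p => ?_
  obtain ⟨x, hx, χ, hχ⟩ := h p
  refine ⟨pair χ x, hχ, ?_⟩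
  rw [pair_comm]
  exact P.smul_mem _ hx

/-- A linear map of line bundles which preserves local generators is an isomorphism. -/
theorem bijective_of_genAt (F : L →ₗ[A] L') (h : ∀ p : PrimeSpectrum A, ∃ x, GenAt p (F x)) :
    Function.Bijective F := by
  refine Module.Invertible.bijective_of_surjective ?_
  rw [← LinearMap.range_eq_top]
  exact eq_top_of_genAt _ fun p => (h p).imp' F fun x hx => ⟨⟨x, rfl⟩, hx⟩

theorem bijective_of_isGen (F : L →ₗ[A] L') {x : L} (h : IsGen (F x)) : Function.Bijective F :=
  bijective_of_genAt F fun p => ⟨x, h.genAt p⟩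

/-- A semilinear map of line bundles which preserves local generators is a pullback map. -/
def Map.ofGenAt (F : L →+ M) (hF : ∀ (a : A) m, F (a • m) = φ a • F m)
    (h : ∀ q : PrimeSpectrum B, ∃ x, GenAt q (F x)) : Map φ L M where
  toFun := F
  map_smul := hF
  span_range := eq_top_of_genAt _ fun q => (h q).imp' F fun x hx =>
    ⟨Submodule.subset_span ⟨x, rfl⟩, hx⟩

theorem Map.exists_genAt (f : Map φ L M) (q : PrimeSpectrum B) : ∃ x, GenAt q (f x) :=
  (L.exists_genAt (PrimeSpectrum.comap φ q)).imp fun _ hx => hx.map f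

theorem Map.exists_of_isGen (φ : A →+* B) {x : L} {y : M} (hx : IsGen x) (hy : IsGen y) :
    ∃ f : Map φ L M, f x = y := by
  obtain ⟨χ, hχ⟩ := hx
  have h1 : φ (pair χ x) • y = y := by rw [hχ, map_one, one_smul]
  exact ⟨Map.ofGenAt (AddMonoidHom.mk' (fun m => φ (pair χ m) • y)
    fun m m' => by rw [pair_add, map_add, add_smul])
    (fun a m => by
      change φ (pair χ (a • m)) • y = φ a • φ (pair χ m) • y
      rw [pair_smul, map_mul, mul_smul])
    fun q => ⟨x, by change GenAt q (φ (pair χ x) • y); rw [h1]; exact hy.genAt q⟩, h1⟩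

theorem exists_equiv_of_isGen {x : L} {y : L'} (hx : IsGen x) (hy : IsGen y) :
    ∃ e : L ≃ₗ[A] L', e x = y := by
  obtain ⟨f, hf⟩ := Map.exists_of_isGen (RingHom.id A) hx hy
  let F : L →ₗ[A] L' := { f.toFun with map_smul' := f.map_smul }
  exact ⟨LinearEquiv.ofBijective F (bijective_of_isGen F (x := x)
    (by change IsGen (f x); rwa [hf])), hf⟩

/-- Pullback along `φ` is initial among the maps out of `L` over ring maps that factor
through `φ`. -/
theorem Map.exists_factor (f : Map φ L M) {χ : A →+* C} (hχ : ∀ a, χ a = ψ (φ a))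
    (h : Map χ L N) : ∃ g : Map ψ M N, h.IsComp f g := by
  obtain ⟨n, ξ, x, hx⟩ := L.exists_dualBasis
  let F : M →+ N := AddMonoidHom.mk' (fun m => ∑ i, ψ (pair (f.dual (ξ i)) m) • h (x i))
    fun m m' => by simp only [pair_add, map_add, add_smul, Finset.sum_add_distrib]
  have hF : ∀ m, h m = F (f m) := fun m => by
    change h m = ∑ i, ψ (pair (f.dual (ξ i)) (f m)) • h (x i)
    simp only [f.dual_pair, ← hχ]
    simp only [← h.map_smul, pair_comm _ m]
    rw [← map_sum, ← Finset.sum_smul, hx, one_smul]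
  exact ⟨Map.ofGenAt F (fun a m => by
    change ∑ i, ψ (pair (f.dual (ξ i)) (a • m)) • h (x i) =
      ψ a • ∑ i, ψ (pair (f.dual (ξ i)) m) • h (x i)
    simp only [pair_smul, map_mul, mul_smul, Finset.smul_sum])
    fun q => (h.exists_genAt q).imp' f fun m hm => hF m ▸ hm, hF⟩

/-- The pullback of a line bundle. -/
def pullback (φ : A →+* B) (L : InvMod A) : InvMod B :=
  letI := φ.toAlgebra
  ⟨B ⊗[A] L⟩

/-- The map from a line bundle to its pullback. -/
def toPullback (φ : A →+* B) (L : InvMod A) : Map φ L (pullback φ L) :=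
  letI := φ.toAlgebra
  { toFun := ((TensorProduct.mk A B L) 1).toAddMonoidHom
    map_smul := fun a m => by
      change (1 : B) ⊗ₜ[A] (a • m) = φ a • (1 : B) ⊗ₜ[A] m
      rw [TensorProduct.tmul_smul, ← algebraMap_smul B a]
      rfl
    span_range := by
      rw [eq_top_iff]
      rintro (x : B ⊗[A] L) -
      induction x using TensorProduct.induction_on with
      | zero => exact Submodule.zero_mem _
      | add x y hx hy => exact Submodule.add_mem _ hx hy
      | tmul b m =>
        have : b ⊗ₜ[A] m = b • ((1 : B) ⊗ₜ[A] m) := by rw [TensorProduct.smul_tmul', smul_eq_mul,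
          mul_one]
        rw [this]
        exact Submodule.smul_mem _ b (Submodule.subset_span ⟨m, rfl⟩) }

theorem Map.bijective (f : Map φ L M) (hφ : Function.Bijective φ) : Function.Bijective f := by
  let e := RingEquiv.ofBijective φ hφ
  obtain ⟨g, hg⟩ := f.exists_factor (ψ := e.symm.toRingHom) (χ := RingHom.id A)
    (fun a => (e.symm_apply_apply a).symm) (Map.id (fun _ => rfl) L)
  refine Function.bijective_iff_has_inverse.mpr ⟨g, fun m => (hg m).symm, fun m => ?_⟩
  refine semilinear_ext (L := M) (φ := RingHom.id B) (F := fun m => f (g m)) (G := fun m => m)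
    (fun a m => ?_) (fun _ _ => rfl) (fun q => ?_) m
  · change f (g (a • m)) = a • f (g m)
    rw [g.map_smul, f.map_smul]
    congr 1
    exact e.apply_symm_apply a
  · obtain ⟨x, hx⟩ := f.exists_genAt q
    exact ⟨f x, hx, congrArg f (hg x).symm⟩

/-- Two generators of a line bundle differ by a unit. -/
theorem exists_unit_smul {x y : L} (hx : IsGen x) (hy : IsGen y) : ∃ a : Aˣ, y = a • x := by
  obtain ⟨χ, hχ⟩ := hx
  obtain ⟨ξ, hξ⟩ := hy
  have h : pair ξ x * pair χ y = 1 := by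
    rw [mul_comm, ← pair_smul, ← eq_pair_smul hχ y, hξ]
  exact ⟨⟨pair χ y, pair ξ x, by rw [mul_comm, h], h⟩, eq_pair_smul hχ y⟩

theorem IsGen.smul_inj {x : L} (hx : IsGen x) {a b : A} (h : a • x = b • x) : a = b := by
  obtain ⟨χ, hχ⟩ := hx
  have := congrArg (pair χ) h
  rwa [pair_smul, pair_smul, hχ, mul_one, mul_one] at this

theorem IsGen.units_smul {x : L} (hx : IsGen x) (a : Aˣ) : IsGen (a • x) := by
  obtain ⟨χ, hχ⟩ := hx
  refine isGen_of_isUnit (χ := χ) ?_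
  change IsUnit (pair χ ((a : A) • x))
  rw [pair_smul, hχ, mul_one]
  exact a.isUnit

theorem Map.tensor_apply (f : Map φ L M) (g : Map φ L' M') (x : L) (y : L') :
    f.tensor g (InvMod.tmul x y) = InvMod.tmul (f x) (g y) := rfl

theorem Map.npow_pow (f : Map φ L M) (x : L) :
    ∀ n, f.npow n (pow x n) = pow (f x) n
  | 0 => φ.map_one
  | n + 1 => congrArg (InvMod.tmul (f x)) (Map.npow_pow f x n)

/-- The power `x^{⊗ n}` of a generator `x` with dual generator `χ`. -/
def zgen (x : L) (χ : L.dual) : (n : ℤ) → L.zpow n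
  | Int.ofNat n => pow x n
  | Int.negSucc n => pow χ (n + 1)

theorem isGen_zgen {x : L} {χ : L.dual} (h : pair χ x = 1) : ∀ n, IsGen (zgen x χ n)
  | Int.ofNat n => IsGen.pow (⟨χ, h⟩ : IsGen x) n
  | Int.negSucc n => (isGen_dual h).pow (n + 1)

theorem dual_eq_of_pair_eq_one {x : L} {χ ξ : L.dual} (h : pair χ x = 1) (h' : pair ξ x = 1) :
    χ = ξ :=
  dual_ext fun y => by rw [eq_pair_smul h y, pair_smul, pair_smul, h, h']

/-- The effect of a map on dual generators. -/
theorem Map.dual_gen (f : Map φ L M) {x : L} {χ : L.dual} {y : M} {ξ : M.dual} (h : pair χ x = 1)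
    (h' : pair ξ y = 1) {t : Bˣ} (ht : f x = t • y) : f.dual χ = t⁻¹ • ξ := by
  refine dual_eq_of_pair_eq_one (x := f x) (by rw [f.dual_pair, h, map_one]) ?_
  rw [ht]
  change pair ((↑t⁻¹ : B) • ξ) ((t : B) • y) = 1
  rw [pair_smul_left, pair_smul, h', mul_one, Units.inv_mul]

theorem units_pow_smul (t : Aˣ) (x : L) (n : ℕ) : pow (t • x) n = t ^ n • pow x n := by
  change pow ((t : A) • x) n = ((t ^ n : Aˣ) : A) • pow x n
  rw [pow_smul, Units.val_pow_eq_pow_val]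

/-- The effect of a map on integral powers of generators. -/
theorem Map.zpow_zgen (f : Map φ L M) {x : L} {χ : L.dual} {y : M} {ξ : M.dual} (h : pair χ x = 1)
    (h' : pair ξ y = 1) {t : Bˣ} (ht : f x = t • y) :
    ∀ n, f.zpow n (zgen x χ n) = t ^ n • zgen y ξ n
  | Int.ofNat n => by
    change f.npow n (pow x n) = t ^ (n : ℤ) • pow y n
    rw [npow_pow, ht, units_pow_smul, zpow_natCast]
  | Int.negSucc n => by
    change f.dual.npow (n + 1) (pow χ (n + 1)) = t ^ (Int.negSucc n) • pow ξ (n + 1)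
    rw [npow_pow, f.dual_gen h h' ht, units_pow_smul, zpow_negSucc, inv_pow]

end InvMod

end

/-! ### Flat descent of modules -/

section

section FlatDescent

variable {A : Type u} [CommRing A] {ι : Type} {B : ι → Type u} [∀ i, CommRing (B i)]
  [∀ i, Algebra A (B i)] [∀ i, Module.Flat A (B i)]

/-- An element of a module that dies after base change to every member of a flat, jointly surjective
family is zero. At a prime `q` of `B i` over `p`, the cyclic module generated by `x` would otherwise
be a quotient `A ⧸ I` with `I ≤ p`, so that it maps to `B i ⧸ q` with `1 ↦ 1`. -/
theorem eq_zero_of_one_tmul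
    (hB : ∀ p : PrimeSpectrum A, ∃ i, ∃ q : PrimeSpectrum (B i),
      PrimeSpectrum.comap (algebraMap A (B i)) q = p)
    {Q : Type*} [AddCommGroup Q] [Module A Q] {x : Q}
    (hx : ∀ i, (1 : B i) ⊗ₜ[A] x = 0) : x = 0 := by
  refine InvMod.eq_of_forall_prime (A := A) fun p => ?_
  by_contra! H
  obtain ⟨i, q, hq⟩ := hB p
  let I : Ideal A := LinearMap.ker (LinearMap.toSpanSingleton A Q x)
  have hI : I ≤ p.asIdeal := fun a ha => by
    by_contra hap
    refine H a hap ?_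
    rw [smul_zero]
    exact ha
  let F : (A ⧸ I) →ₗ[A] Q := Submodule.liftQ I (LinearMap.toSpanSingleton A Q x) le_rfl
  have hF : Function.Injective F := by
    rw [← LinearMap.ker_eq_bot]
    exact Submodule.ker_liftQ_eq_bot' _ _ rfl
  let G : (A ⧸ I) →ₗ[A] (B i ⧸ q.asIdeal) := Submodule.liftQ I
    (Algebra.linearMap A (B i ⧸ q.asIdeal)) fun a ha => by
      have : algebraMap A (B i) a ∈ q.asIdeal := by
        have h2 := hI ha
        rw [← hq] at h2
        exact h2
      change algebraMap A (B i ⧸ q.asIdeal) a = 0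
      rw [IsScalarTower.algebraMap_apply A (B i)]
      exact Ideal.Quotient.eq_zero_iff_mem.mpr this
  have h1 : (1 : B i) ⊗ₜ[A] (Submodule.Quotient.mk 1 : A ⧸ I) = 0 := by
    apply Module.Flat.lTensor_preserves_injective_linearMap (M := B i) F hF
    rw [LinearMap.lTensor_tmul, map_zero]
    change (1 : B i) ⊗ₜ[A] ((1 : A) • x) = 0
    rw [one_smul, hx]
  have h2 := congrArg (LinearMap.mul' A (B i ⧸ q.asIdeal) ∘ₗ TensorProduct.map
    (Ideal.Quotient.mkₐ A q.asIdeal).toLinearMap G) h1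
  have h3 : (1 : B i ⧸ q.asIdeal) * algebraMap A _ 1 = 0 := by
    rw [map_zero] at h2
    exact h2
  rw [map_one, mul_one] at h3
  exact q.2.one_notMem (Ideal.Quotient.eq_zero_iff_mem.mp h3)

section Pi

variable [Finite ι] {D : Type u} [CommRing D] [Algebra A D] {N : ι → Type*} [∀ i, AddCommGroup (N i)]
  [∀ i, Module A (N i)] {Q : ι → Type*} [∀ i, AddCommGroup (Q i)] [∀ i, Module A (Q i)]
  [∀ i, Module D (Q i)] [∀ i, IsScalarTower A D (Q i)] {P : ∀ i, N i →ₗ[A] Q i}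

/-- Base change commutes with finite products: elements of `D ⊗ ∏ N i` are determined by their
components. -/
theorem tensor_pi_ext (hP : ∀ i, IsBaseChange D (P i)) {z z' : D ⊗[A] (∀ i, N i)}
    (h : ∀ i, (hP i).equiv ((LinearMap.proj i).lTensor D z) =
      (hP i).equiv ((LinearMap.proj i).lTensor D z')) : z = z' := by
  classical
  have := Fintype.ofFinite ι
  apply (TensorProduct.piRight A A D N).injective
  funext i
  have key : ∀ z, TensorProduct.piRight A A D N z i = (LinearMap.proj i).lTensor D z := fun z => by
    induction z using TensorProduct.induction_on with
    | zero => simp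
    | tmul x y => simp
    | add x y hx hy => rw [map_add, map_add, Pi.add_apply, hx, hy]
  rw [key, key]
  exact (hP i).equiv.injective (h i)

/-- Base change commutes with finite products: the components of an element of `D ⊗ ∏ N i` can be
prescribed. -/
theorem exists_tensor_pi (hP : ∀ i, IsBaseChange D (P i)) (y : ∀ i, Q i) :
    ∃ z : D ⊗[A] (∀ i, N i), ∀ i, (hP i).equiv ((LinearMap.proj i).lTensor D z) = y i := by
  classical
  have := Fintype.ofFinite ι
  refine ⟨(TensorProduct.piRight A A D N).symm fun i => (hP i).equiv.symm (y i), fun i => ?_⟩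
  have key : ∀ z, TensorProduct.piRight A A D N z i = (LinearMap.proj i).lTensor D z := fun z => by
    induction z using TensorProduct.induction_on with
    | zero => simp
    | tmul x y => simp
    | add x y hx hy => rw [map_add, map_add, Pi.add_apply, hx, hy]
  rw [← key, LinearEquiv.apply_symm_apply, LinearEquiv.apply_symm_apply]

end Pi

/-- Two semilinear descriptions of maps out of `D ⊗ N` agree if they agree on `N`. -/
theorem IsBaseChange.equiv_lTensor {D : Type u} [CommRing D] [Algebra A D] {N N' Q Q' : Type*}
    [AddCommGroup N] [Module A N] [AddCommGroup N'] [Module A N'] [AddCommGroup Q] [Module A Q]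
    [Module D Q] [IsScalarTower A D Q] [AddCommGroup Q'] [Module A Q']
    [Module D Q'] [IsScalarTower A D Q'] {P : N →ₗ[A] Q} (hP : IsBaseChange D P)
    {P' : N' →ₗ[A] Q'} (hP' : IsBaseChange D P') (f : N →ₗ[A] N') (V : Q →ₗ[D] Q')
    (h : ∀ n, V (P n) = P' (f n)) (z : D ⊗[A] N) :
    hP'.equiv (f.lTensor D z) = V (hP.equiv z) := by
  induction z using TensorProduct.induction_on with
  | zero => simp
  | tmul b n => simp [IsBaseChange.equiv_tmul, h]
  | add x y hx hy => rw [map_add, map_add, map_add, map_add, hx, hy]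

variable [Finite ι] {M' : ι → Type*} [∀ i, AddCommGroup (M' i)] [∀ i, Module A (M' i)]
  [∀ i, Module (B i) (M' i)] [∀ i, IsScalarTower A (B i) (M' i)]
  {Q : ι → ι → Type*} [∀ l i, AddCommGroup (Q l i)] [∀ l i, Module A (Q l i)]
  [∀ l i, Module (B l) (Q l i)] [∀ l i, IsScalarTower A (B l) (Q l i)]

/-- Flat descent of elements: a compatible family of elements of the base changes of `M` comes from
an element of `M`. -/
theorem exists_descent_element
    (hB : ∀ p : PrimeSpectrum A, ∃ i, ∃ q : PrimeSpectrum (B i),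
      PrimeSpectrum.comap (algebraMap A (B i)) q = p)
    {M : Type*} [AddCommGroup M] [Module A M]
    {F : ∀ i, M →ₗ[A] M' i} (hF : ∀ i, IsBaseChange (B i) (F i))
    {P : ∀ l i, M' i →ₗ[A] Q l i} (hP : ∀ l i, IsBaseChange (B l) (P l i))
    (R : ∀ l i, M' l →ₗ[B l] Q l i) (hRP : ∀ l i m, R l i (F l m) = P l i (F i m))
    (k : ∀ i, M' i) (hk : ∀ l i, R l i (k l) = P l i (k i)) : ∃ m, ∀ i, F i m = k i := by
  let K : Submodule A (∀ i, M' i) :=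
    { carrier := {x | ∀ l i, R l i (x l) = P l i (x i)}
      add_mem' := fun {x y} hx hy l i => by
        rw [Pi.add_apply, Pi.add_apply, map_add, map_add, hx, hy]
      zero_mem' := fun l i => by simp
      smul_mem' := fun a x hx l i => by
        rw [Pi.smul_apply, Pi.smul_apply, map_smul (P l i), ← hx, ← algebraMap_smul (B l) a (x l),
          map_smul, algebraMap_smul] }
  let Φ : M →ₗ[A] K := (LinearMap.pi F).codRestrict K fun m l i => hRP l i m
  have hz : (LinearMap.range Φ).mkQ ⟨k, hk⟩ = 0 := by
    refine eq_zero_of_one_tmul hB fun l => ?_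
    have h1 : (1 : B l) ⊗ₜ[A] (⟨k, hk⟩ : K) = Φ.lTensor (B l) ((hF l).equiv.symm (k l)) := by
      apply Module.Flat.lTensor_preserves_injective_linearMap (M := B l) K.subtype
        K.injective_subtype
      refine tensor_pi_ext (hP l) fun i => ?_
      rw [LinearMap.lTensor_tmul, LinearMap.lTensor_tmul, IsBaseChange.equiv_tmul, one_smul,
        ← LinearMap.lTensor_comp_apply, ← LinearMap.lTensor_comp_apply,
        show (LinearMap.proj i ∘ₗ K.subtype) ∘ₗ Φ = F i from rfl,
        IsBaseChange.equiv_lTensor (hF l) (hP l i) _ (R l i) (fun m => hRP l i m),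
        LinearEquiv.apply_symm_apply]
      exact (hk l i).symm
    rw [← LinearMap.lTensor_tmul, h1, ← LinearMap.comp_apply, ← LinearMap.lTensor_comp,
      LinearMap.range_mkQ_comp, LinearMap.lTensor_zero, LinearMap.zero_apply]
  rw [Submodule.mkQ_apply, Submodule.Quotient.mk_eq_zero] at hz
  obtain ⟨m, hm⟩ := hz
  exact ⟨m, fun i => congrFun (congrArg Subtype.val hm) i⟩

/-- Effectivity of flat descent: the compatible families generate each member of a descent
datum. -/
theorem span_descent
    {P : ∀ l i, M' i →ₗ[A] Q l i} (hP : ∀ l i, IsBaseChange (B l) (P l i))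
    (R : ∀ l i, M' l →ₗ[B l] Q l i)
    (hinj : ∀ l n n', (∀ i, R l i n = R l i n') → n = n')
    {T : ι → ι → ι → Type*} [∀ l i j, AddCommGroup (T l i j)] [∀ l i j, Module A (T l i j)]
    [∀ l i j, Module (B l) (T l i j)] [∀ l i j, IsScalarTower A (B l) (T l i j)]
    {U : ∀ l i j, Q i j →ₗ[A] T l i j} (hU : ∀ l i j, IsBaseChange (B l) (U l i j))
    (V : ∀ l i j, Q l i →ₗ[B l] T l i j) (W : ∀ l i j, Q l j →ₗ[B l] T l i j)
    (hV : ∀ l i j y, V l i j (P l i y) = U l i j (R i j y))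
    (hW : ∀ l i j y, W l i j (P l j y) = U l i j (P i j y))
    (hVW : ∀ l i j n, V l i j (R l i n) = W l i j (R l j n)) (l : ι) (n : M' l) :
    n ∈ Submodule.span (B l) {y | ∃ x : ∀ i, M' i, (∀ i j, R i j (x i) = P i j (x j)) ∧ x l = y} := by
  let δ : (∀ i, M' i) →ₗ[A] (∀ ij : ι × ι, Q ij.1 ij.2) := LinearMap.pi fun ij =>
    (R ij.1 ij.2).restrictScalars A ∘ₗ LinearMap.proj ij.1 - P ij.1 ij.2 ∘ₗ LinearMap.proj ij.2
  obtain ⟨z, hz⟩ := exists_tensor_pi (hP l) fun i => R l i n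
  have hδ : δ.lTensor (B l) z = 0 := by
    refine tensor_pi_ext (fun ij : ι × ι => hU l ij.1 ij.2) fun ij => ?_
    rw [map_zero, map_zero, ← LinearMap.comp_apply, ← LinearMap.lTensor_comp]
    have : LinearMap.proj ij ∘ₗ δ = (R ij.1 ij.2).restrictScalars A ∘ₗ LinearMap.proj ij.1 -
      P ij.1 ij.2 ∘ₗ LinearMap.proj ij.2 := rfl
    rw [this, LinearMap.lTensor_sub, LinearMap.sub_apply, LinearMap.lTensor_comp,
      LinearMap.lTensor_comp, LinearMap.comp_apply, LinearMap.comp_apply, map_sub,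
      IsBaseChange.equiv_lTensor (hP l ij.1) (hU l ij.1 ij.2) _ (V l ij.1 ij.2)
        (fun y => hV l ij.1 ij.2 y),
      IsBaseChange.equiv_lTensor (hP l ij.2) (hU l ij.1 ij.2) _ (W l ij.1 ij.2)
        (fun y => hW l ij.1 ij.2 y), hz, hz, hVW, sub_self]
  have h1 : z ∈ LinearMap.ker (AlgebraTensorModule.lTensor A (B l) δ) := hδ
  rw [Module.Flat.ker_lTensor_eq] at h1
  obtain ⟨t, ht⟩ := h1
  have ht' : (LinearMap.ker δ).subtype.lTensor (B l) t = z := ht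
  let G : (B l) ⊗[A] (LinearMap.ker δ) →ₗ[B l] M' l :=
    LinearMap.liftBaseChange (B l) (LinearMap.proj l ∘ₗ (LinearMap.ker δ).subtype)
  have hker : ∀ x : LinearMap.ker δ, ∀ i j, R i j (x.1 i) = P i j (x.1 j) := fun x i j =>
    sub_eq_zero.mp (congrFun x.2 (i, j))
  have hG : G t = n := by
    refine hinj l _ _ fun i => ?_
    rw [← hz i, ← ht']
    clear hz ht ht' hδ
    induction t using TensorProduct.induction_on with
    | zero => simp
    | tmul b x => simp [G, IsBaseChange.equiv_tmul, hker x l i]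
    | add x y hx hy => simp only [map_add, hx, hy]
  rw [← hG]
  clear hz ht ht' hδ hG
  induction t using TensorProduct.induction_on with
  | zero => simp
  | tmul b x =>
    simp only [G, LinearMap.liftBaseChange_tmul]
    exact Submodule.smul_mem _ _ (Submodule.subset_span ⟨x.1, hker x, rfl⟩)
  | add x y hx hy => rw [map_add]; exact Submodule.add_mem _ hx hy

end FlatDescent

end

/-! ### Cocartesian squares of rings -/

section

section RingSq

variable {A B C D : Type u} [CommRing A] [CommRing B] [CommRing C] [CommRing D]

/-- The square of rings with sides `φ`, `ψ`, `α`, `β` is cocartesian: `D = B ⊗_A C`. -/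
def RingSq (φ : A →+* B) (ψ : A →+* C) (α : B →+* D) (β : C →+* D) : Prop :=
  IsPushout (CommRingCat.ofHom φ) (CommRingCat.ofHom ψ) (CommRingCat.ofHom α) (CommRingCat.ofHom β)

variable {φ : A →+* B} {ψ : A →+* C} {α : B →+* D} {β : C →+* D}

theorem RingSq.symm (h : RingSq φ ψ α β) : RingSq ψ φ β α := h.flip

theorem RingSq.comm (h : RingSq φ ψ α β) (a : A) : α (φ a) = β (ψ a) :=
  congrArg (fun f => f.hom a) h.w

theorem RingSq.exists_desc (h : RingSq φ ψ α β) {E : Type u} [CommRing E] (b : B →+* E)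
    (c : C →+* E) (hbc : ∀ a, b (φ a) = c (ψ a)) :
    ∃ d : D →+* E, (∀ x, d (α x) = b x) ∧ ∀ x, d (β x) = c x := by
  obtain ⟨d, h1, h2⟩ := IsPushout.exists_desc h (CommRingCat.ofHom b) (CommRingCat.ofHom c)
    (CommRingCat.hom_ext (RingHom.ext hbc))
  exact ⟨d.hom, fun x => congrArg (fun f => f.hom x) h1, fun x => congrArg (fun f => f.hom x) h2⟩

theorem RingSq.hom_ext (h : RingSq φ ψ α β) {E : Type u} [CommRing E] {d d' : D →+* E}
    (h1 : ∀ x, d (α x) = d' (α x)) (h2 : ∀ x, d (β x) = d' (β x)) : d = d' := by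
  have := IsPushout.hom_ext h (W := CommRingCat.of E) (k := CommRingCat.ofHom d) (l := CommRingCat.ofHom d')
    (CommRingCat.hom_ext (RingHom.ext h1)) (CommRingCat.hom_ext (RingHom.ext h2))
  exact congrArg CommRingCat.Hom.hom this

/-- The universal property needs to be checked only for existence of the induced map and for joint
epimorphy of `α` and `β`. -/
theorem RingSq.of_exists_desc (hw : ∀ a, α (φ a) = β (ψ a))
    (h : ∀ {E : Type u} [CommRing E] (b : B →+* E) (c : C →+* E), (∀ a, b (φ a) = c (ψ a)) →
      ∃ d : D →+* E, (∀ x, d (α x) = b x) ∧ ∀ x, d (β x) = c x)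
    (h' : ∀ {E : Type u} [CommRing E] (d d' : D →+* E), (∀ x, d (α x) = d' (α x)) →
      (∀ x, d (β x) = d' (β x)) → d = d') : RingSq φ ψ α β := by
  refine ⟨⟨CommRingCat.hom_ext (RingHom.ext hw)⟩, ⟨Limits.PushoutCocone.IsColimit.mk _
    (fun s => CommRingCat.ofHom (h s.inl.hom s.inr.hom
      fun a => congrArg (fun f => f.hom a) s.condition).choose) (fun s => ?_) (fun s => ?_)
    fun s m h1 h2 => ?_⟩⟩
  · exact CommRingCat.hom_ext (RingHom.ext (h s.inl.hom s.inr.hom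
      fun a => congrArg (fun f => f.hom a) s.condition).choose_spec.1)
  · exact CommRingCat.hom_ext (RingHom.ext (h s.inl.hom s.inr.hom
      fun a => congrArg (fun f => f.hom a) s.condition).choose_spec.2)
  · have hs := (h s.inl.hom s.inr.hom fun a => congrArg (fun f => f.hom a) s.condition).choose_spec
    refine CommRingCat.hom_ext (h' _ _ (fun x => ?_) fun x => ?_)
    · exact (congrArg (fun f => f.hom x) h1).trans (hs.1 x).symm
    · exact (congrArg (fun f => f.hom x) h2).trans (hs.2 x).symm

theorem RingSq.isPushout [Algebra A B] [Algebra A C] [Algebra B D] [Algebra C D] [Algebra A D]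
    [IsScalarTower A B D] [IsScalarTower A C D]
    (h : RingSq (algebraMap A B) (algebraMap A C) (algebraMap B D) (algebraMap C D)) :
    Algebra.IsPushout A B C D :=
  CommRingCat.isPushout_iff_isPushout.mp h

theorem RingSq.stable
    {P : ∀ {R S : Type u} [CommRing R] [CommRing S], (R →+* S) → Prop}
    (hP : RingHom.IsStableUnderBaseChange P) (h : RingSq φ ψ α β) (hφ : P φ) : P β := by
  algebraize [φ, ψ, α, β, α.comp φ]
  have : IsScalarTower A C D := .of_algebraMap_eq h.comm
  have : Algebra.IsPushout A B C D := RingSq.isPushout h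
  exact hP A B C D hφ

/-- Points of the two factors over the same point of the base come from a point of the fibre
product. -/
theorem RingSq.exists_prime (h : RingSq φ ψ α β) (q : PrimeSpectrum B) (r : PrimeSpectrum C)
    (hqr : PrimeSpectrum.comap φ q = PrimeSpectrum.comap ψ r) :
    ∃ s : PrimeSpectrum D, PrimeSpectrum.comap α s = q ∧ PrimeSpectrum.comap β s = r := by
  have hi : IsPullback (AlgebraicGeometry.Spec.map (CommRingCat.ofHom α))
      (AlgebraicGeometry.Spec.map (CommRingCat.ofHom β))
      (AlgebraicGeometry.Spec.map (CommRingCat.ofHom φ))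
      (AlgebraicGeometry.Spec.map (CommRingCat.ofHom ψ)) :=
    AlgebraicGeometry.isPullback_SpecMap_of_isPushout _ _ _ _ h
  obtain ⟨s, h1, h2⟩ := AlgebraicGeometry.Scheme.exists_preimage_of_isPullback hi q r hqr
  exact ⟨s, h1, h2⟩

theorem RingSq.surjective (h : RingSq φ ψ α β) (hφ : Function.Surjective (PrimeSpectrum.comap φ)) :
    Function.Surjective (PrimeSpectrum.comap β) := fun r => by
  obtain ⟨q, hq⟩ := hφ (PrimeSpectrum.comap ψ r)
  obtain ⟨s, -, hs⟩ := h.exists_prime q r hq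
  exact ⟨s, hs⟩

/-- Base change along `B → D` of a `B`-module is base change along `A → C` of the underlying
`A`-module, if the square is cocartesian. -/
theorem isBaseChange_of_isPushout [Algebra A B] [Algebra A C] [Algebra B D] [Algebra C D]
    [Algebra A D] [IsScalarTower A B D] [IsScalarTower A C D] [Algebra.IsPushout A B C D]
    {L M : Type*} [AddCommGroup L] [AddCommGroup M] [Module B L] [Module A L] [IsScalarTower A B L]
    [Module D M] [Module B M] [IsScalarTower B D M] [Module A M] [Module C M] [IsScalarTower C D M]
    [IsScalarTower A C M] [IsScalarTower A B M]
    (f : L →ₗ[B] M) (hf : IsBaseChange D f) : IsBaseChange C (f.restrictScalars A) := by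
  have : Algebra.IsPushout A C B D := Algebra.IsPushout.symm inferInstance
  refine IsBaseChange.of_equiv ((Algebra.IsPushout.cancelBaseChange A C B D L).symm ≪≫ₗ
    hf.equiv.restrictScalars C) fun x => ?_
  simp [IsBaseChange.equiv_tmul]

end RingSq

namespace InvMod

variable {A B : Type u} [CommRing A] [CommRing B]

theorem Map.isBaseChange [Algebra A B] {L : InvMod A} {M : InvMod B} (f : Map (algebraMap A B) L M)
    [Module A M] [IsScalarTower A B M] (F : L →ₗ[A] M) (hF : ∀ x, F x = f x) :
    IsBaseChange B F := by
  have hs : Function.Surjective (F.liftBaseChange B) := by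
    rw [← LinearMap.range_eq_top, eq_top_iff, ← f.span_range, Submodule.span_le]
    rintro _ ⟨l, rfl⟩
    exact ⟨1 ⊗ₜ l, by simp [hF]⟩
  refine IsBaseChange.of_equiv (LinearEquiv.ofBijective _
    (Module.Invertible.bijective_of_surjective hs)) fun x => by simp

/-- Pullback reflects generators at a prime. -/
theorem GenAt.of_map {φ : A →+* B} {L : InvMod A} {M : InvMod B} (f : Map φ L M)
    {q : PrimeSpectrum B} {x : L} (h : GenAt q (f x)) : GenAt (PrimeSpectrum.comap φ q) x := by
  by_contra H
  obtain ⟨χ, hχ⟩ := h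
  have h1 : χ ∈ Submodule.span B (Set.range f.dual.toFun) := by rw [f.dual.span_range]; trivial
  refine hχ ?_
  clear hχ
  induction h1 using Submodule.span_induction with
  | zero => exact q.asIdeal.zero_mem
  | add χ χ' _ _ h h' => exact q.asIdeal.add_mem h h'
  | smul b χ _ h => exact q.asIdeal.mul_mem_left b h
  | mem χ hχ =>
    obtain ⟨ξ, rfl⟩ := hχ
    by_contra h2
    exact H ⟨ξ, fun h3 => h2 (by rw [f.dual_pair]; exact h3)⟩

/-- Every spanning set contains a local generator at any given prime. -/
theorem exists_genAt_of_span {L : InvMod A} {s : Set L} (hs : Submodule.span A s = ⊤)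
    (p : PrimeSpectrum A) : ∃ x ∈ s, GenAt p x := by
  obtain ⟨y, χ, hχ⟩ := L.exists_genAt p
  by_contra! H
  have hy : y ∈ Submodule.span A s := by rw [hs]; trivial
  refine hχ ?_
  clear hχ
  induction hy using Submodule.span_induction with
  | zero => rw [show pair χ (0 : L) = 0 from map_zero (show Module.Dual A L from χ)]
            exact p.asIdeal.zero_mem
  | add x y _ _ h h' => rw [pair_add]; exact p.asIdeal.add_mem h h'
  | smul a x _ h => rw [pair_smul]; exact p.asIdeal.mul_mem_left a h
  | mem x hx => by_contra h; exact H x hx ⟨χ, h⟩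

/-- Pullback maps along a jointly faithfully flat family are jointly injective. -/
theorem Map.jointly_injective {ι : Type} {B : ι → Type u} [∀ i, CommRing (B i)]
    {φ : ∀ i, A →+* B i} (hφ : ∀ i, (φ i).Flat)
    (hB : ∀ p : PrimeSpectrum A, ∃ i, ∃ q : PrimeSpectrum (B i), PrimeSpectrum.comap (φ i) q = p)
    {L : InvMod A} {M : ∀ i, InvMod (B i)} (f : ∀ i, Map (φ i) L (M i)) {x y : L}
    (h : ∀ i, f i x = f i y) : x = y := by
  let _ : ∀ i, Algebra A (B i) := fun i => (φ i).toAlgebra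
  let _ : ∀ i, Module A (M i) := fun i => Module.compHom _ (φ i)
  have : ∀ i, IsScalarTower A (B i) (M i) := fun i => ⟨fun a b m => mul_smul _ _ _⟩
  have : ∀ i, Module.Flat A (B i) := hφ
  rw [← sub_eq_zero]
  refine eq_zero_of_one_tmul hB fun i => ?_
  let F : L →ₗ[A] M i := { (f i).toFun with map_smul' := (f i).map_smul }
  apply ((f i).isBaseChange F (fun _ => rfl)).equiv.injective
  rw [IsBaseChange.equiv_tmul, map_zero, one_smul, map_sub, sub_eq_zero]
  exact h i

/-- A module with a perfect pairing of rank one is invertible. -/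
theorem invertible_of_pairing {M M' : Type u} [AddCommGroup M] [AddCommGroup M'] [Module A M]
    [Module A M'] (β : M →ₗ[A] M' →ₗ[A] A) (h1 : ∀ m m' n, β m m' • n = β n m' • m)
    (h2 : ∀ m m' n', β m m' • n' = β m n' • m')
    (h3 : ∀ p : PrimeSpectrum A, ∃ m m', β m m' ∉ p.asIdeal) : Module.Invertible A M := by
  have hinj : Function.Injective (TensorProduct.lift β) := by
    rw [injective_iff_map_eq_zero]
    intro t ht
    refine eq_of_forall_prime (A := A) fun p => ?_
    obtain ⟨m, m', hm⟩ := h3 p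
    refine ⟨_, hm, ?_⟩
    have key : ∀ t : M ⊗[A] M', β m m' • t = TensorProduct.lift β t • (m ⊗ₜ[A] m') := by
      intro t
      induction t using TensorProduct.induction_on with
      | zero => simp
      | tmul x y => rw [TensorProduct.smul_tmul', h1, TensorProduct.smul_tmul, h2,
          TensorProduct.tmul_smul, TensorProduct.lift.tmul]
      | add x y hx hy => rw [smul_add, hx, hy, map_add, add_smul]
    rw [key, ht, zero_smul, smul_zero]
  have hsurj : Function.Surjective (TensorProduct.lift β) := by
    rw [← LinearMap.range_eq_top]
    by_contra H
    obtain ⟨p, hp, hle⟩ := Ideal.exists_le_maximal _ H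
    obtain ⟨m, m', hm⟩ := h3 ⟨p, hp.isPrime⟩
    exact hm (hle ⟨m ⊗ₜ m', TensorProduct.lift.tmul _ _⟩)
  exact Module.Invertible.left (LinearEquiv.ofBijective _ ⟨hinj, hsurj⟩)

end InvMod

end

/-! ### Descent of line bundles along flat coverings -/

section

namespace InvMod

/-- In a cocartesian square of rings, the pullback `L → M` along `C → D` is, over `A`, the base
change of the `A`-module `L` along `A → B`. -/
theorem Map.isBaseChange_of_ringSq {A B C D : Type u} [CommRing A] [CommRing B] [CommRing C]
    [CommRing D] [Algebra A B] {ψ : A →+* C} {α : B →+* D} {β : C →+* D}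
    (h : RingSq (algebraMap A B) ψ α β) {L : InvMod C} {M : InvMod D} (P : Map β L M)
    [Module A L] [Module A M] [Module B M] [IsScalarTower A B M]
    (hL : ∀ (a : A) (x : L), a • x = ψ a • x) (hM : ∀ (b : B) (x : M), b • x = α b • x)
    (G : L →ₗ[A] M) (hG : ∀ x, G x = P x) : IsBaseChange B G := by
  let _ : Algebra A C := ψ.toAlgebra
  let _ : Algebra B D := α.toAlgebra
  let _ : Algebra C D := β.toAlgebra
  let _ : Algebra A D := (α.comp (algebraMap A B)).toAlgebra
  have : IsScalarTower A B D := .of_algebraMap_eq fun _ => rfl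
  have : IsScalarTower A C D := .of_algebraMap_eq fun a => h.comm a
  have : Algebra.IsPushout A C B D := h.symm.isPushout
  let _ : Module C M := Module.compHom _ β
  have : IsScalarTower C D M := ⟨fun a b m => mul_smul _ _ _⟩
  have : IsScalarTower B D M := ⟨fun a b m => by
    rw [hM]; exact mul_smul _ _ _⟩
  have : IsScalarTower A D M := ⟨fun a b m => by
    rw [← algebraMap_smul B a (b • m), hM]; exact mul_smul _ _ _⟩
  have : IsScalarTower A C L := ⟨fun a b m => by
    rw [hL]; exact mul_smul _ _ _⟩
  have : IsScalarTower A C M := ⟨fun a b m => by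
    rw [← algebraMap_smul B a (b • m), hM]
    change β (ψ a * b) • m = _ • β b • m
    rw [map_mul, mul_smul, h.comm]⟩
  let G' : L →ₗ[C] M := { P.toFun with map_smul' := P.map_smul }
  have hG' : IsBaseChange D G' := P.isBaseChange G' fun _ => rfl
  have := isBaseChange_of_isPushout (A := A) (C := B) G' hG'
  exact (show G = G'.restrictScalars A from LinearMap.ext hG) ▸ this

section

variable {A : Type u} [CommRing A] {ι : Type} [Finite ι] {B : ι → Type u} [∀ i, CommRing (B i)]
  {φ : ∀ i, A →+* B i} {C : ι → ι → Type u} [∀ i j, CommRing (C i j)]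
  {α : ∀ i j, B i →+* C i j} {β : ∀ i j, B j →+* C i j}

/-- Compatible families of sections on a flat covering come from a section. -/
theorem exists_glue (hφ : ∀ i, (φ i).Flat)
    (hB : ∀ p : PrimeSpectrum A, ∃ i, ∃ q : PrimeSpectrum (B i), PrimeSpectrum.comap (φ i) q = p)
    (hC : ∀ i j, RingSq (φ i) (φ j) (α i j) (β i j)) {L : InvMod A} {M : ∀ i, InvMod (B i)}
    (F : ∀ i, Map (φ i) L (M i)) {Q : ∀ i j, InvMod (C i j)}
    (R : ∀ i j, Map (α i j) (M i) (Q i j)) (P : ∀ i j, Map (β i j) (M j) (Q i j))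
    (hRP : ∀ i j m, R i j (F i m) = P i j (F j m)) (k : ∀ i, M i)
    (hk : ∀ i j, R i j (k i) = P i j (k j)) : ∃ m, ∀ i, F i m = k i := by
  let _ : ∀ i, Algebra A (B i) := fun i => (φ i).toAlgebra
  let _ : ∀ i j, Algebra (B i) (C i j) := fun i j => (α i j).toAlgebra
  let _ : ∀ i, Module A (M i) := fun i => Module.compHom _ (φ i)
  have : ∀ i, IsScalarTower A (B i) (M i) := fun i => ⟨fun a b m => mul_smul _ _ _⟩
  have : ∀ i, Module.Flat A (B i) := hφ
  let _ : ∀ i j, Module (B i) (Q i j) := fun i j => Module.compHom _ (α i j)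
  let _ : ∀ i j, Module A (Q i j) := fun i j => Module.compHom _ ((α i j).comp (φ i))
  have : ∀ i j, IsScalarTower A (B i) (Q i j) := fun i j => ⟨fun a b m => by
    change α i j (φ i a * b) • m = α i j (φ i a) • α i j b • m
    rw [map_mul, mul_smul]⟩
  let F' : ∀ i, L →ₗ[A] M i := fun i => { (F i).toFun with map_smul' := (F i).map_smul }
  let P' : ∀ l i, M i →ₗ[A] Q l i := fun l i =>
    { (P l i).toFun with
      map_smul' := fun a m => by
        change P l i (φ i a • m) = α l i (φ l a) • P l i m
        rw [(P l i).map_smul, (hC l i).comm] }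
  let R' : ∀ l i, M l →ₗ[B l] Q l i := fun l i =>
    { (R l i).toFun with map_smul' := (R l i).map_smul }
  have hP' : ∀ l i, IsBaseChange (B l) (P' l i) := fun l i =>
    (P l i).isBaseChange_of_ringSq (hC l i) (fun _ _ => rfl) (fun _ _ => rfl) _ fun _ => rfl
  obtain ⟨m, hm⟩ := exists_descent_element hB
    (F := F') (fun i => (F i).isBaseChange (F' i) fun _ => rfl) hP' R' hRP k hk
  exact ⟨m, hm⟩

/-- Effectivity of descent for line bundles: the compatible families generate each member of a
descent datum. -/
theorem span_glue (hφ : ∀ i, (φ i).Flat)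
    (hC : ∀ i j, RingSq (φ i) (φ j) (α i j) (β i j)) {M : ∀ i, InvMod (B i)}
    {Q : ∀ i j, InvMod (C i j)}
    (R : ∀ i j, Map (α i j) (M i) (Q i j)) (P : ∀ i j, Map (β i j) (M j) (Q i j))
    (hinj : ∀ l n n', (∀ i, R l i n = R l i n') → n = n')
    {E : ι → ι → ι → Type u} [∀ l i j, CommRing (E l i j)] {T : ∀ l i j, InvMod (E l i j)}
    {α' : ∀ l i j, B l →+* E l i j} {β' : ∀ l i j, C i j →+* E l i j}
    (hE : ∀ l i j, RingSq (φ l) ((α i j).comp (φ i)) (α' l i j) (β' l i j))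
    (U : ∀ l i j, Map (β' l i j) (Q i j) (T l i j))
    {γ' : ∀ l i j, C l i →+* E l i j}
    {δ' : ∀ l i j, C l j →+* E l i j}
    (V : ∀ l i j, Map (γ' l i j) (Q l i) (T l i j)) (W : ∀ l i j, Map (δ' l i j) (Q l j) (T l i j))
    (hγ : ∀ l i j b, γ' l i j (α l i b) = α' l i j b)
    (hδ : ∀ l i j b, δ' l i j (α l j b) = α' l i j b)
    (hV : ∀ l i j y, V l i j (P l i y) = U l i j (R i j y))
    (hW : ∀ l i j y, W l i j (P l j y) = U l i j (P i j y))
    (hVW : ∀ l i j n, V l i j (R l i n) = W l i j (R l j n)) (l : ι) :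
    Submodule.span (B l) {y | ∃ x : ∀ i, M i, (∀ i j, R i j (x i) = P i j (x j)) ∧ x l = y} =
      ⊤ := by
  let _ : ∀ i, Algebra A (B i) := fun i => (φ i).toAlgebra
  let _ : ∀ i j, Algebra (B i) (C i j) := fun i j => (α i j).toAlgebra
  let _ : ∀ i, Module A (M i) := fun i => Module.compHom _ (φ i)
  have : ∀ i, IsScalarTower A (B i) (M i) := fun i => ⟨fun a b m => mul_smul _ _ _⟩
  have : ∀ i, Module.Flat A (B i) := hφ
  let _ : ∀ i j, Module (B i) (Q i j) := fun i j => Module.compHom _ (α i j)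
  let _ : ∀ i j, Module A (Q i j) := fun i j => Module.compHom _ ((α i j).comp (φ i))
  have : ∀ i j, IsScalarTower A (B i) (Q i j) := fun i j => ⟨fun a b m => by
    change α i j (φ i a * b) • m = α i j (φ i a) • α i j b • m
    rw [map_mul, mul_smul]⟩
  let _ : ∀ l i j, Module (B l) (T l i j) := fun l i j => Module.compHom _ (α' l i j)
  let _ : ∀ l i j, Module A (T l i j) := fun l i j => Module.compHom _ ((α' l i j).comp (φ l))
  have : ∀ l i j, IsScalarTower A (B l) (T l i j) := fun l i j => ⟨fun a b m => by
    change α' l i j (φ l a * b) • m = α' l i j (φ l a) • α' l i j b • m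
    rw [map_mul, mul_smul]⟩
  let P' : ∀ l i, M i →ₗ[A] Q l i := fun l i =>
    { (P l i).toFun with
      map_smul' := fun a m => by
        change P l i (φ i a • m) = α l i (φ l a) • P l i m
        rw [(P l i).map_smul, (hC l i).comm] }
  let R' : ∀ l i, M l →ₗ[B l] Q l i := fun l i =>
    { (R l i).toFun with map_smul' := (R l i).map_smul }
  let U' : ∀ l i j, Q i j →ₗ[A] T l i j := fun l i j =>
    { (U l i j).toFun with
      map_smul' := fun a m => by
        change U l i j (α i j (φ i a) • m) = α' l i j (φ l a) • U l i j m
        rw [(U l i j).map_smul, (hE l i j).comm]; rfl }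
  let V' : ∀ l i j, Q l i →ₗ[B l] T l i j := fun l i j =>
    { (V l i j).toFun with
      map_smul' := fun a m => by
        change V l i j (α l i a • m) = α' l i j a • V l i j m
        rw [(V l i j).map_smul, hγ] }
  let W' : ∀ l i j, Q l j →ₗ[B l] T l i j := fun l i j =>
    { (W l i j).toFun with
      map_smul' := fun a m => by
        change W l i j (α l j a • m) = α' l i j a • W l i j m
        rw [(W l i j).map_smul, hδ] }
  rw [eq_top_iff]
  intro n _
  exact span_descent (P := P') (fun l i => (P l i).isBaseChange_of_ringSq (hC l i)
      (fun _ _ => rfl) (fun _ _ => rfl) _ fun _ => rfl) R' hinj (U := U')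
    (fun l i j => (U l i j).isBaseChange_of_ringSq (hE l i j)
      (fun _ _ => rfl) (fun _ _ => rfl) _ fun _ => rfl) V' W' hV hW hVW l n

end

end InvMod

end

section

theorem InvMod.pair_smul_comm {A : Type u} [CommRing A] {L : InvMod A} (ξ ζ : L.dual) (x : L) :
    pair ξ x • ζ = pair ζ x • ξ := dual_ext fun y => by
  rw [pair_smul_left, pair_smul_left, ← pair_smul, pair_comm, pair_smul, mul_comm]

/-- A covering of `Spec A` by a category `J` of affine schemes `Spec (B V)` over it: `J` has fibre
products, and it contains a finite flat jointly surjective family. -/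
structure FlatCover (A : Type u) [CommRing A] (J : Type*) [Category.{u} J] where
  B : J → Type u
  [ring : ∀ V, CommRing (B V)]
  r : ∀ {V W : J}, (V ⟶ W) → B W →+* B V
  φ : ∀ V, A →+* B V
  r_comp : ∀ {V W Z : J} (f : V ⟶ W) (g : W ⟶ Z) (b : B Z), r (f ≫ g) b = r f (r g b)
  comm : ∀ {V W : J} (f : V ⟶ W) (a : A), r f (φ W a) = φ V a
  prod : ∀ V W : J, ∃ (P : J) (a : P ⟶ V) (b : P ⟶ W), RingSq (φ V) (φ W) (r a) (r b) ∧
    ∀ (Z : J) (c : Z ⟶ V) (d : Z ⟶ W), ∃ e : Z ⟶ P, e ≫ a = c ∧ e ≫ b = d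
  pb : ∀ {V W Z : J} (f : V ⟶ Z) (g : W ⟶ Z), ∃ (P : J) (a : P ⟶ V) (b : P ⟶ W),
    a ≫ f = b ≫ g ∧ RingSq (r f) (r g) (r a) (r b)
  cover : ∃ (n : ℕ) (V : Fin n → J), (∀ i, (φ (V i)).Flat) ∧
    ∀ p : PrimeSpectrum A, ∃ i, ∃ q : PrimeSpectrum (B (V i)), PrimeSpectrum.comap (φ (V i)) q = p

namespace FlatCover

attribute [instance] ring

variable {A : Type u} [CommRing A] {J : Type*} [Category.{u} J] (K : FlatCover A J)

/-- A descent datum for line bundles. -/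
structure Datum where
  N : ∀ V, InvMod (K.B V)
  ρ : ∀ {V W : J} (f : V ⟶ W), InvMod.Map (K.r f) (N W) (N V)
  ρ_comp : ∀ {V W Z : J} (f : V ⟶ W) (g : W ⟶ Z), (ρ (f ≫ g)).IsComp (ρ g) (ρ f)

variable {K}

/-- The dual descent datum. -/
@[reducible]
def Datum.dual (D : K.Datum) : K.Datum where
  N V := (D.N V).dual
  ρ f := (D.ρ f).dual
  ρ_comp f g := (D.ρ_comp f g).dual (K.r_comp f g)

theorem Datum.ρ_congr (D : K.Datum) {V W W' Z : J} {f : V ⟶ W} {g : W ⟶ Z} {f' : V ⟶ W'}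
    {g' : W' ⟶ Z} (h : f ≫ g = f' ≫ g') (m : D.N Z) : D.ρ f (D.ρ g m) = D.ρ f' (D.ρ g' m) := by
  rw [← D.ρ_comp, ← D.ρ_comp, h]

/-- The pullback of a descent datum to a member of the covering is determined by its values on a
covering. -/
theorem Datum.ext_of_cover (D : K.Datum) {n : ℕ} {V : Fin n → J} (hV : ∀ i, (K.φ (V i)).Flat)
    (hs : ∀ p : PrimeSpectrum A, ∃ i, ∃ q : PrimeSpectrum (K.B (V i)),
      PrimeSpectrum.comap (K.φ (V i)) q = p) {W : J} {x y : D.N W}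
    (h : ∀ i (Z : J) (a : Z ⟶ W) (_ : Z ⟶ V i), D.ρ a x = D.ρ a y) : x = y := by
  choose P a b sq _ using K.prod
  refine InvMod.Map.jointly_injective (φ := fun i => K.r (a W (V i)))
    (fun i => (sq W (V i)).symm.stable RingHom.Flat.isStableUnderBaseChange (hV i)) (fun q => ?_)
    (fun i => D.ρ (a W (V i))) fun i => h i _ _ (b W (V i))
  obtain ⟨i, q', hq'⟩ := hs (PrimeSpectrum.comap (K.φ W) q)
  obtain ⟨s, h1, -⟩ := (sq W (V i)).exists_prime q q' hq'.symm
  exact ⟨i, s, h1⟩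

/-- Matching families on a covering of a member of the covering can be glued. -/
theorem Datum.exists_of_cover (D : K.Datum) {n : ℕ} {V : Fin n → J} (hV : ∀ i, (K.φ (V i)).Flat)
    (hs : ∀ p : PrimeSpectrum A, ∃ i, ∃ q : PrimeSpectrum (K.B (V i)),
      PrimeSpectrum.comap (K.φ (V i)) q = p) (x : ∀ i, D.N (V i))
    (hx : ∀ i j (Z : J) (a : Z ⟶ V i) (b : Z ⟶ V j), D.ρ a (x i) = D.ρ b (x j)) (W : J) :
    ∃ m : D.N W, ∀ i (Z : J) (a : Z ⟶ W) (b : Z ⟶ V i), D.ρ a m = D.ρ b (x i) := by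
  choose P a b sq univ using K.prod
  choose Q p q hpq sq' using fun i j => K.pb (a W (V i)) (a W (V j))
  obtain ⟨m, hm⟩ := InvMod.exists_glue (φ := fun i => K.r (a W (V i)))
    (fun i => (sq W (V i)).symm.stable RingHom.Flat.isStableUnderBaseChange (hV i)) (fun s => by
      obtain ⟨i, q', hq'⟩ := hs (PrimeSpectrum.comap (K.φ W) s)
      obtain ⟨s, h1, -⟩ := (sq W (V i)).exists_prime s q' hq'.symm
      exact ⟨i, s, h1⟩) sq' (fun i => D.ρ (a W (V i))) (fun i j => D.ρ (p i j))
    (fun i j => D.ρ (q i j)) (fun i j m => D.ρ_congr (hpq i j) m)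
    (fun i => D.ρ (b W (V i)) (x i)) fun i j => by
      rw [← D.ρ_comp, ← D.ρ_comp]; exact hx _ _ _ _ _
  refine ⟨m, fun i Z c d => ?_⟩
  obtain ⟨e, rfl, rfl⟩ := univ W (V i) Z c d
  rw [D.ρ_comp, D.ρ_comp, hm]

/-- If the descent datum is the pullback of `L`, its compatible families of sections are the
sections of `L`. -/
theorem Datum.exists_unique_glue (D : K.Datum) {L : InvMod A}
    (F : ∀ V, InvMod.Map (K.φ V) L (D.N V)) (hF : ∀ {V W : J} (f : V ⟶ W) m,
      D.ρ f (F W m) = F V m) (k : ∀ V, D.N V) (hk : ∀ {V W : J} (f : V ⟶ W), D.ρ f (k W) = k V) :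
    ∃! m, ∀ V, F V m = k V := by
  obtain ⟨n, V, hV, hs⟩ := K.cover
  choose P a b sq univ using K.prod
  obtain ⟨m, hm⟩ := InvMod.exists_glue hV hs (fun i j => sq (V i) (V j)) (fun i => F (V i))
    (fun i j => D.ρ (a _ _)) (fun i j => D.ρ (b _ _)) (fun i j m => by rw [hF, hF])
    (fun i => k (V i)) fun i j => by rw [hk, hk]
  refine ⟨m, fun W => D.ext_of_cover hV hs fun i Z c d => ?_, fun m' hm' =>
    InvMod.Map.jointly_injective hV hs (fun i => F (V i)) fun i => by rw [hm, hm']⟩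
  rw [hk, hF, ← hF d, hm, hk]

/-- Compatible families generate. -/
theorem Datum.exists_genAt (D : K.Datum) {n : ℕ} {V : Fin n → J} (hV : ∀ i, (K.φ (V i)).Flat)
    (hs : ∀ p : PrimeSpectrum A, ∃ i, ∃ q : PrimeSpectrum (K.B (V i)),
      PrimeSpectrum.comap (K.φ (V i)) q = p) (l : Fin n) (q : PrimeSpectrum (K.B (V l))) :
    ∃ x : ∀ i, D.N (V i),
      (∀ i j (Z : J) (a : Z ⟶ V i) (b : Z ⟶ V j), D.ρ a (x i) = D.ρ b (x j)) ∧
      InvMod.GenAt q (x l) := by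
  choose P a b sq univ using K.prod
  choose γ hγa hγb using fun l i j => univ (V l) (V i) _ (a (V l) (P (V i) (V j)))
    (b (V l) (P (V i) (V j)) ≫ a (V i) (V j))
  choose δ hδa hδb using fun l i j => univ (V l) (V j) _ (a (V l) (P (V i) (V j)))
    (b (V l) (P (V i) (V j)) ≫ b (V i) (V j))
  have H := InvMod.span_glue hV (fun i j => sq (V i) (V j)) (M := fun i => D.N (V i))
    (fun i j => D.ρ (a _ _)) (fun i j => D.ρ (b _ _)) (fun l x y h => D.ext_of_cover hV hs
      fun i Z c d => by
        obtain ⟨e, rfl, rfl⟩ := univ _ _ Z c d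
        rw [D.ρ_comp, D.ρ_comp, h])
    (fun l i j => by
      have : (K.r (a (V i) (V j))).comp (K.φ (V i)) = K.φ (P (V i) (V j)) :=
        RingHom.ext fun x => K.comm _ x
      rw [this]
      exact sq (V l) (P (V i) (V j))) (fun l i j => D.ρ (b (V l) (P (V i) (V j))))
    (fun l i j => D.ρ (γ l i j)) (fun l i j => D.ρ (δ l i j))
    (fun l i j x => by rw [← K.r_comp, hγa]) (fun l i j x => by rw [← K.r_comp, hδa])
    (fun l i j y => D.ρ_congr (hγb l i j) y) (fun l i j y => D.ρ_congr (hδb l i j) y)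
    (fun l i j y => D.ρ_congr ((hγa l i j).trans (hδa l i j).symm) y) l
  obtain ⟨y, ⟨x, hx, rfl⟩, hq⟩ := InvMod.exists_genAt_of_span H q
  refine ⟨x, fun i j Z c d => ?_, hq⟩
  obtain ⟨e, rfl, rfl⟩ := univ _ _ Z c d
  rw [D.ρ_comp, D.ρ_comp, hx]

/-- Descent of line bundles is effective: the descended module consists of the matching families of
sections on a finite flat covering; it is invertible since it pairs perfectly with the module
obtained from the dual descent datum. -/
theorem Datum.effective (D : K.Datum) : ∃ (L : InvMod A) (F : ∀ V, InvMod.Map (K.φ V) L (D.N V)),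
    ∀ {V W : J} (f : V ⟶ W) m, D.ρ f (F W m) = F V m := by
  obtain ⟨n, V, hV, hs⟩ := K.cover
  let mod : ∀ (D : K.Datum) i, Module A (D.N (V i)) := fun D i => Module.compHom _ (K.φ (V i))
  let M : ∀ D : K.Datum, Submodule A (∀ i, D.N (V i)) := fun D =>
    { carrier := {x | ∀ i j (Z : J) (a : Z ⟶ V i) (b : Z ⟶ V j), D.ρ a (x i) = D.ρ b (x j)}
      add_mem' := fun {x y} hx hy i j Z a b => by
        rw [Pi.add_apply, Pi.add_apply, map_add, map_add, hx i j Z a b, hy i j Z a b]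
      zero_mem' := fun i j Z a b => by rw [Pi.zero_apply, Pi.zero_apply, map_zero, map_zero]
      smul_mem' := fun c x hx i j Z a b => by
        change D.ρ a (K.φ (V i) c • x i) = D.ρ b (K.φ (V j) c • x j)
        rw [(D.ρ a).map_smul, (D.ρ b).map_smul, K.comm, K.comm, hx i j Z a b] }
  have hpair : ∀ (ξ : M D.dual) (x : M D), ∃ c : A, ∀ i,
      K.φ (V i) c = InvMod.pair (ξ.1 i) (x.1 i) := fun ξ x => by
    choose P a b sq univ using K.prod
    obtain ⟨m, hm⟩ := InvMod.exists_glue hV hs (fun i j => sq (V i) (V j))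
      (fun i => InvMod.Map.unit (K.φ (V i)))
      (fun i j => InvMod.Map.unit (K.r (a (V i) (V j))))
      (fun i j => InvMod.Map.unit (K.r (b (V i) (V j)))) (fun i j m => (sq _ _).comm m)
      (fun i => InvMod.pair (A := K.B (V i)) (ξ.1 i) (x.1 i)) fun i j => by
        change K.r (a (V i) (V j)) (InvMod.pair (ξ.1 i) (x.1 i)) =
          K.r (b (V i) (V j)) (InvMod.pair (ξ.1 j) (x.1 j))
        rw [← (D.ρ _).dual_pair, ← (D.ρ _).dual_pair, x.2 i j _ (a _ _) (b _ _)]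
        exact congrArg (fun χ => InvMod.pair χ _) (ξ.2 i j _ (a _ _) (b _ _))
    exact ⟨m, hm⟩
  have hinj : ∀ c c' : A, (∀ i, K.φ (V i) c = K.φ (V i) c') → c = c' := fun c c' h =>
    InvMod.Map.jointly_injective hV hs (fun i => InvMod.Map.unit (K.φ (V i))) h
  choose β hβ using hpair
  let β' : M D →ₗ[A] M D.dual →ₗ[A] A := LinearMap.mk₂ A (fun x ξ => β ξ x)
    (fun x y ξ => hinj _ _ fun i => by
      rw [map_add, hβ, hβ, hβ]; exact InvMod.pair_add _ _ _)
    (fun c x ξ => hinj _ _ fun i => by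
      rw [smul_eq_mul, map_mul, hβ, hβ]; exact InvMod.pair_smul _ _ _)
    (fun x ξ ζ => hinj _ _ fun i => by
      rw [map_add, hβ, hβ, hβ]; exact InvMod.pair_add_left _ _ _)
    (fun c x ξ => hinj _ _ fun i => by
      rw [smul_eq_mul, map_mul, hβ, hβ]; exact InvMod.pair_smul_left _ _ _)
  have hinv : Module.Invertible A (M D) := by
    refine InvMod.invertible_of_pairing β' (fun x ξ y => Subtype.ext (funext fun i => ?_))
      (fun x ξ ζ => Subtype.ext (funext fun i => ?_)) fun p => ?_
    · change K.φ (V i) (β ξ x) • y.1 i = K.φ (V i) (β ξ y) • x.1 i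
      rw [hβ, hβ, InvMod.pair_comm]
    · change K.φ (V i) (β ξ x) • ζ.1 i = K.φ (V i) (β ζ x) • ξ.1 i
      rw [hβ, hβ]
      exact InvMod.pair_smul_comm _ _ _
    · obtain ⟨l, q, rfl⟩ := hs p
      obtain ⟨x, hx, χ, hχ⟩ := D.exists_genAt hV hs l q
      obtain ⟨ξ, hξ, Ξ, hΞ⟩ := D.dual.exists_genAt hV hs l q
      refine ⟨⟨x, hx⟩, ⟨ξ, hξ⟩, fun h => ?_⟩
      have h1 : InvMod.pair (ξ l) (x l) ∈ q.asIdeal := by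
        rw [← hβ ⟨ξ, hξ⟩ ⟨x, hx⟩ l]; exact h
      have h2 : InvMod.pair (ξ l) (x l) • χ = InvMod.pair χ (x l) • ξ l :=
        InvMod.pair_smul_comm _ _ _
      have h3 := congrArg (InvMod.pair Ξ) h2
      rw [InvMod.pair_smul Ξ, InvMod.pair_smul Ξ] at h3
      exact (q.2.mem_or_mem (h3 ▸ q.asIdeal.mul_mem_right _ h1)).elim hχ hΞ
  choose F hF using fun W (x : M D) => D.exists_of_cover hV hs x.1 x.2 W
  have hF' : ∀ i x, F (V i) x = x.1 i := fun i x => D.ext_of_cover hV hs fun j Z a b => by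
    rw [hF (V i) x i Z a a]
  refine ⟨⟨M D⟩, fun W => InvMod.Map.ofGenAt (AddMonoidHom.mk' (F W) fun x y =>
    D.ext_of_cover hV hs fun i Z a b => ?_) (fun c x =>
    D.ext_of_cover hV hs fun i Z a b => ?_) (fun q => ?_), fun {W W'} f x =>
    D.ext_of_cover hV hs fun i Z a b => ?_⟩
  · rw [map_add, hF W _ i Z a b, hF W x i Z a b, hF W y i Z a b]
    exact map_add (D.ρ b).toFun _ _
  · change D.ρ a (F W (c • x)) = D.ρ a (K.φ W c • F W x)
    rw [(D.ρ a).map_smul, hF W _ i Z a b, hF W x i Z a b]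
    refine ((D.ρ b).map_smul _ _).trans ?_
    exact congrArg (· • _) ((K.comm b c).trans (K.comm a c).symm)
  · choose P a b sq univ using K.prod
    obtain ⟨i, q', hq'⟩ := hs (PrimeSpectrum.comap (K.φ W) q)
    obtain ⟨s, rfl, rfl⟩ := (sq W (V i)).exists_prime q q' hq'.symm
    obtain ⟨x, hx, hg⟩ := D.exists_genAt hV hs i (PrimeSpectrum.comap (K.r (b W (V i))) s)
    refine ⟨⟨x, hx⟩, InvMod.GenAt.of_map (D.ρ (a W (V i))) ?_⟩
    have := hg.map (D.ρ (b W (V i)))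
    rw [← hF W ⟨x, hx⟩ i _ (a W (V i)) (b W (V i))] at this
    exact this
  · change D.ρ a (D.ρ f (F W' x)) = D.ρ a (F W x)
    rw [← D.ρ_comp, hF W' x i Z (a ≫ f) b, hF W x i Z a b]

end FlatCover

end

/-! ### Fibrations in groupoids -/

section

section Fibration

universe v₁ v₂ v₃ u₁ u₂ u₃

variable {C : Type u₁} [Category.{v₁} C] {D : Type u₂} [Category.{v₂} D] {E : Type u₃}
  [Category.{v₃} E]

/-- `G` is fibred in groupoids: morphisms of the base can be lifted, and every morphism is
cartesian. -/
structure IsGpdFibration (G : C ⥤ D) : Prop where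
  exists_lift : ∀ {d : D} {c : C} (f : d ⟶ G.obj c),
    ∃ (c' : C) (g : c' ⟶ c) (h : G.obj c' = d), G.map g = eqToHom h ≫ f
  cartesian : ∀ {c c' c'' : C} (g : c' ⟶ c) (g' : c'' ⟶ c) (w : G.obj c'' ⟶ G.obj c'),
    w ≫ G.map g = G.map g' → ∃! t, G.map t = w ∧ t ≫ g = g'

namespace IsGpdFibration

variable {G : C ⥤ D} {H : D ⥤ E}

theorem comp (hG : IsGpdFibration G) (hH : IsGpdFibration H) : IsGpdFibration (G ⋙ H) where
  exists_lift {e c} f := by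
    obtain ⟨d, g, rfl, hg⟩ := hH.exists_lift f
    obtain ⟨c', g', rfl, hg'⟩ := hG.exists_lift g
    refine ⟨c', g', rfl, ?_⟩
    rw [Functor.comp_map, hg', eqToHom_refl, Category.id_comp, hg]
  cartesian {c c' c''} g g' w hw := by
    obtain ⟨t, ⟨ht, htg⟩, huniq⟩ := hH.cartesian (G.map g) (G.map g') w hw
    obtain ⟨s, ⟨hs, hsg⟩, huniq'⟩ := hG.cartesian g g' t htg
    refine ⟨s, ⟨by rw [Functor.comp_map, hs, ht], hsg⟩, fun s' hs' => huniq' s' ⟨?_, hs'.2⟩⟩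
    exact huniq _ ⟨hs'.1, by rw [← G.map_comp, hs'.2]⟩

theorem hom_ext (hG : IsGpdFibration G) {c c' c'' : C} {g : c' ⟶ c} {t t' : c'' ⟶ c'}
    (h : G.map t = G.map t') (h' : t ≫ g = t' ≫ g) : t = t' :=
  (hG.cartesian g (t ≫ g) (G.map t) (by rw [G.map_comp])).unique ⟨rfl, rfl⟩ ⟨h.symm, h'.symm⟩

theorem isIso (hG : IsGpdFibration G) {c c' : C} (g : c' ⟶ c) [IsIso (G.map g)] : IsIso g := by
  obtain ⟨t, ⟨ht, htg⟩, -⟩ := hG.cartesian g (𝟙 c) (inv (G.map g)) (by simp)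
  refine ⟨t, hG.hom_ext (g := g) ?_ ?_, htg⟩
  · rw [G.map_comp, ht, IsIso.hom_inv_id, G.map_id]
  · rw [Category.assoc, htg, Category.comp_id, Category.id_comp]

/-- A commutative square in `C` lying over a cartesian square is cartesian. -/
theorem isPullback_of_map (hG : IsGpdFibration G) {x y z w : C} {a : w ⟶ x} {b : w ⟶ y}
    {f : x ⟶ z} {g : y ⟶ z} (h : a ≫ f = b ≫ g)
    (hw : IsPullback (G.map a) (G.map b) (G.map f) (G.map g)) : IsPullback a b f g := by
  have H : ∀ s : Limits.PullbackCone f g, ∃ t, t ≫ a = s.fst ∧ t ≫ b = s.snd := fun s => by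
    have hs : G.map s.fst ≫ G.map f = G.map s.snd ≫ G.map g := by
      rw [← G.map_comp, s.condition, G.map_comp]
    obtain ⟨t, ⟨ht, hta⟩, -⟩ := hG.cartesian a s.fst (hw.lift _ _ hs) (hw.lift_fst _ _ hs)
    refine ⟨t, hta, hG.hom_ext (g := g) ?_ ?_⟩
    · rw [G.map_comp, ht, hw.lift_snd]
    · rw [Category.assoc, ← h, ← Category.assoc, hta, s.condition]
  choose t h1 h2 using H
  refine ⟨⟨h⟩, ⟨Limits.PullbackCone.IsLimit.mk _ t h1 h2 fun s m ha hb =>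
    hG.hom_ext (g := a) (hw.hom_ext ?_ ?_) (ha.trans (h1 s).symm)⟩⟩
  · rw [← G.map_comp, ← G.map_comp, ha, h1]
  · rw [← G.map_comp, ← G.map_comp, hb, h2]

/-- Fibre products in the base lift to `C`. -/
theorem exists_isPullback (hG : IsGpdFibration G) {x y z : C} (f : x ⟶ z) (g : y ⟶ z)
    [Limits.HasPullback (G.map f) (G.map g)] : ∃ (w : C) (a : w ⟶ x) (b : w ⟶ y),
      IsPullback a b f g ∧ IsPullback (G.map a) (G.map b) (G.map f) (G.map g) := by
  obtain ⟨w, b, hw, hb⟩ := hG.exists_lift (Limits.pullback.snd (G.map f) (G.map g))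
  obtain ⟨a, ⟨ha, haf⟩, -⟩ := hG.cartesian f (b ≫ g)
    (eqToHom hw ≫ Limits.pullback.fst (G.map f) (G.map g))
    (by rw [Category.assoc, Limits.pullback.condition, G.map_comp, hb, Category.assoc])
  have h : IsPullback (G.map a) (G.map b) (G.map f) (G.map g) := by
    rw [ha, hb]
    exact (IsPullback.of_hasPullback (G.map f) (G.map g)).of_iso (eqToIso hw.symm) (Iso.refl _)
      (Iso.refl _) (Iso.refl _) (by simp) (by simp) (by simp) (by simp)
  exact ⟨w, a, b, hG.isPullback_of_map haf h, h⟩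

/-- Every fibre product is mapped to a fibre product. -/
theorem map_isPullback (hG : IsGpdFibration G) {x y z w : C} {a : w ⟶ x} {b : w ⟶ y}
    {f : x ⟶ z} {g : y ⟶ z} (h : IsPullback a b f g)
    [Limits.HasPullback (G.map f) (G.map g)] :
    IsPullback (G.map a) (G.map b) (G.map f) (G.map g) := by
  obtain ⟨w', a', b', h1, h2⟩ := hG.exists_isPullback f g
  exact h2.of_iso (G.mapIso (h1.isoIsPullback _ _ h)) (Iso.refl _)
    (Iso.refl _) (Iso.refl _) (by rw [Functor.mapIso_hom, ← G.map_comp]; simp)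
    (by rw [Functor.mapIso_hom, ← G.map_comp]; simp) (by simp) (by simp)

end IsGpdFibration

end Fibration

variable {k : Type u} [Field k]

/-- Lifting of morphisms and cartesianness of all morphisms, restated without `IsHomLift`. -/
theorem AffCat.IsFibredInGroupoids.gpd {X : AffCat k} (hX : X.IsFibredInGroupoids) :
    IsGpdFibration X.p where
  exists_lift {d c} f := by
    have := hX.fibered
    obtain ⟨c', g, hg⟩ := Functor.IsPreFibered.exists_isCartesian' (p := X.p) f
    refine ⟨c', g, IsHomLift.domain_eq X.p f g, ?_⟩
    rw [IsHomLift.fac' X.p f g, eqToHom_refl, Category.comp_id]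
  cartesian {c c' c''} g g' w hw := by
    have := hX.cartesian g
    have : X.p.IsHomLift (w ≫ X.p.map g) g' := hw ▸ inferInstance
    obtain ⟨t, ⟨ht, htg⟩, hu⟩ :=
      Functor.IsStronglyCartesian.universal_property' (p := X.p) (f := X.p.map g) (φ := g) w g'
    refine ⟨t, ⟨(IsHomLift.eq_of_isHomLift X.p w t).symm, htg⟩, fun t' ht' => hu t' ⟨?_, ht'.2⟩⟩
    exact ht'.1 ▸ inferInstance

/-- The converse of `AffCat.IsFibredInGroupoids.gpd`. -/
theorem AffCat.isFibredInGroupoids {X : AffCat k} (hX : IsGpdFibration X.p) :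
    X.IsFibredInGroupoids := by
  have h : ∀ {x y : X.obj} (f : x ⟶ y), X.p.IsStronglyCartesian (X.p.map f) f := fun {x y} f => {
    universal_property' := fun {z} w f' hf' => by
      obtain ⟨t, ⟨ht, htg⟩, hu⟩ := hX.cartesian f f' w (IsHomLift.eq_of_isHomLift X.p _ f')
      refine ⟨t, ⟨ht ▸ inferInstance, htg⟩, fun t' ht' => hu t' ⟨?_, ht'.2⟩⟩
      have := ht'.1
      exact (IsHomLift.eq_of_isHomLift X.p w t').symm }
  refine ⟨Functor.IsFibered.of_exists_isStronglyCartesian fun x R f => ?_, h⟩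
  obtain ⟨y, g, rfl, hg⟩ := hX.exists_lift f
  refine ⟨y, g, ?_⟩
  rw [eqToHom_refl, Category.id_comp] at hg
  exact hg ▸ h g

theorem WithLine.gpd_forget (X : AffCat k) : IsGpdFibration (WithLine.forget X) where
  exists_lift {x c} f := ⟨⟨x, c.line.pullback (X.pull f)⟩, ⟨f, c.line.toPullback (X.pull f)⟩, rfl,
    (Category.id_comp f).symm⟩
  cartesian {c c' c''} g g' (w : c''.base ⟶ c'.base) (hw : w ≫ g.base = g'.base) := by
    have hχ : ∀ a, X.pull g'.base a = X.pull w (X.pull g.base a) := fun a => by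
      rw [← X.pull_comp]
      exact congrArg (fun f => X.pull f a) hw.symm
    obtain ⟨t, ht⟩ := g.line.exists_factor hχ g'.line
    refine ⟨⟨w, t⟩, ⟨rfl, WithLine.Hom.ext hw fun m => (ht m).symm⟩, ?_⟩
    rintro ⟨w', t'⟩ ⟨rfl, h2⟩
    refine WithLine.Hom.ext rfl fun m => ?_
    have : t' = t := by
      subst h2
      exact InvMod.Map.ext_comp (fun m => rfl) ht
    rw [this]

theorem WithIso.gpd_forget {X : AffCat k} (N N' : LineBundle X) :
    IsGpdFibration (WithIso.forget N N') where
  exists_lift {x c} (f : x ⟶ c.base) := by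
    obtain ⟨t, ht⟩ := (N.map f).exists_factor (ψ := RingHom.id _) (χ := X.pull f) (fun _ => rfl)
      (InvMod.Map.comp (φ := RingHom.id _) (χ := X.pull f) (fun _ => rfl)
        ⟨c.iso.toLinearMap.toAddMonoidHom, fun a m => c.iso.map_smul a m, by
          rw [show Set.range c.iso.toLinearMap.toAddMonoidHom = Set.univ from c.iso.surjective.range_eq]
          exact Submodule.span_univ⟩ (N'.map f))
    let e : N.obj x ≃ₗ[X.O x] N'.obj x := LinearEquiv.ofBijective
      { t.toFun with map_smul' := t.map_smul } (t.bijective Function.bijective_id)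
    exact ⟨⟨x, e⟩, ⟨f, fun m => (ht m).symm⟩, rfl, (Category.id_comp f).symm⟩
  cartesian {c c' c''} g g' (w : c''.base ⟶ c'.base) (hw : w ≫ g.base = g'.base) := by
    refine ⟨⟨w, fun m => ?_⟩, ⟨rfl, WithIso.Hom.ext hw⟩, fun t' ht' => WithIso.Hom.ext ht'.1⟩
    refine InvMod.semilinear_ext (φ := X.pull w) (F := fun m => c''.iso (N.map w m))
      (G := fun m => N'.map w (c'.iso m)) (fun a m => ?_) (fun a m => ?_) (fun q => ?_) m
    · rw [(N.map w).map_smul]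
      exact c''.iso.map_smul _ _
    · have : c'.iso (a • m) = a • c'.iso m := c'.iso.map_smul _ _
      rw [this, (N'.map w).map_smul]
    · obtain ⟨x, hx⟩ := (N.map g.base).exists_genAt (PrimeSpectrum.comap (X.pull w) q)
      refine ⟨_, hx, ?_⟩
      rw [← N.map_comp, hw, g'.comm, g.comm, ← N'.map_comp, hw]

/-- A fibre product of affine schemes is a cocartesian square of rings. -/
theorem ringSq_of_isPullback {U V W Z : AffSch k} {a : W ⟶ U} {b : W ⟶ V} {f : U ⟶ Z} {g : V ⟶ Z}
    (h : IsPullback a b f g) : RingSq f.unop.hom.toRingHom g.unop.hom.toRingHom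
      a.unop.hom.toRingHom b.unop.hom.toRingHom := by
  refine RingSq.of_exists_desc (fun x => ?_) (fun {E} _ φ ψ hφψ => ?_) fun {E} _ d d' h1 h2 => ?_
  · exact congrArg (fun t => t.unop.hom x) h.w
  · let _ : Algebra k E := (φ.comp (algebraMap k U.unop)).toAlgebra
    let φ' : U.unop →ₐ[k] E := { φ with commutes' := fun _ => rfl }
    have hψ : ∀ c, ψ (algebraMap k _ c) = φ (algebraMap k _ c) := fun c => by
      rw [← g.unop.hom.commutes c, ← f.unop.hom.commutes c]
      exact (hφψ _).symm
    let ψ' : V.unop →ₐ[k] E := { ψ with commutes' := hψ }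
    obtain ⟨d, hd1, hd2⟩ := h.exists_lift (W := op (CommAlgCat.of k E)) (Quiver.Hom.op (CommAlgCat.ofHom φ'))
      (Quiver.Hom.op (CommAlgCat.ofHom ψ'))
      (Quiver.Hom.unop_inj (CommAlgCat.hom_ext (AlgHom.ext hφψ)))
    refine ⟨d.unop.hom.toRingHom, fun x => ?_, fun x => ?_⟩
    · exact congrArg (fun t : _ ⟶ U => t.unop.hom x) hd1
    · exact congrArg (fun t : _ ⟶ V => t.unop.hom x) hd2
  · let _ : Algebra k E := (d.comp (algebraMap k W.unop)).toAlgebra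
    let e : W.unop →ₐ[k] E := { d with commutes' := fun _ => rfl }
    have hd : ∀ c, d' (algebraMap k _ c) = d (algebraMap k _ c) := fun c => by
      rw [← a.unop.hom.commutes c]
      exact (h1 _).symm
    let e' : W.unop →ₐ[k] E := { d' with commutes' := hd }
    have := h.hom_ext (W := op (CommAlgCat.of k E)) (k := Quiver.Hom.op (CommAlgCat.ofHom e))
      (l := Quiver.Hom.op (CommAlgCat.ofHom e'))
      (Quiver.Hom.unop_inj (CommAlgCat.hom_ext (AlgHom.ext h1)))
      (Quiver.Hom.unop_inj (CommAlgCat.hom_ext (AlgHom.ext h2)))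
    exact RingHom.ext fun x => congrArg (fun t => t.unop.hom x) this

end

/-! ### The stacks `𝒳 × BG_m` and `Isom(N, N')` -/

section

variable {k : Type u} [Field k]

/-- The ring homomorphism underlying a morphism of affine schemes. -/
abbrev ringMap {U V : AffSch k} (f : U ⟶ V) : V.unop →+* U.unop := f.unop.hom.toRingHom

theorem bijective_of_isIso {U V : AffSch k} (f : U ⟶ V) [IsIso f] :
    Function.Bijective (ringMap f) := by
  refine Function.bijective_iff_has_inverse.mpr ⟨ringMap (inv f), fun x => ?_, fun x => ?_⟩
  · exact congrArg (fun t : V ⟶ V => t.unop.hom x) (IsIso.inv_hom_id f)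
  · exact congrArg (fun t : U ⟶ U => t.unop.hom x) (IsIso.hom_inv_id f)

theorem InvMod.GenAt.equiv {A : Type u} [CommRing A] {L L' : InvMod A} (e : L ≃ₗ[A] L')
    {p : PrimeSpectrum A} {x : L} (hx : GenAt p x) : GenAt p (e x) := by
  obtain ⟨χ, hχ⟩ := hx
  refine ⟨(show Module.Dual A L from χ) ∘ₗ e.symm.toLinearMap, fun h => hχ ?_⟩
  change pair χ (e.symm (e x)) ∈ _ at h
  rwa [e.symm_apply_apply] at h

/-- The covering of `Spec O(x)` given by a descent datum with descended object `x`. -/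
def stackCover (X : AffCat k) {U : AffSch k} {S : Sieve U} (hS : IsEtaleSieve S)
    (D : S.arrows.category ⥤ X.obj) (θ : D ⋙ X.p ≅ S.arrows.diagram) {x : X.obj}
    (e : X.p.obj x ≅ U) (c : ∀ V, D.obj V ⟶ x)
    (hc : ∀ V, X.p.map (c V) ≫ e.hom = θ.hom.app V ≫ V.obj.hom)
    (hcc : ∀ {V W} (g : V ⟶ W), D.map g ≫ c W = c V) : FlatCover (X.O x) S.arrows.category where
  B V := X.O (D.obj V)
  r f := X.pull (D.map f)
  φ V := X.pull (c V)
  r_comp f g b := by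
    rw [D.map_comp, X.pull_comp]
  comm f a := by rw [← X.pull_comp, hcc]
  prod V W := by
    let P : S.arrows.category :=
      ⟨Over.mk (Limits.pullback.fst V.obj.hom W.obj.hom ≫ V.obj.hom),
        S.downward_closed V.property _⟩
    let a : P ⟶ V := ObjectProperty.homMk (Over.homMk (Limits.pullback.fst V.obj.hom W.obj.hom))
    let b : P ⟶ W := ObjectProperty.homMk (Over.homMk (Limits.pullback.snd V.obj.hom W.obj.hom)
      Limits.pullback.condition.symm)
    refine ⟨P, a, b, ringSq_of_isPullback (f := X.p.map (c V)) (g := X.p.map (c W))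
      (a := X.p.map (D.map a)) (b := X.p.map (D.map b)) ?_, fun Z f g => ?_⟩
    · exact (IsPullback.of_hasPullback V.obj.hom W.obj.hom).of_iso (θ.symm.app P) (θ.symm.app V)
        (θ.symm.app W) e.symm (θ.inv.naturality a) (θ.inv.naturality b)
        (by rw [Iso.symm_hom, Iso.comp_inv_eq, Category.assoc, hc]
            exact (θ.inv_hom_id_app_assoc V V.obj.hom).symm)
        (by rw [Iso.symm_hom, Iso.comp_inv_eq, Category.assoc, hc]
            exact (θ.inv_hom_id_app_assoc W W.obj.hom).symm)
    · refine ⟨ObjectProperty.homMk (Over.homMk (Limits.pullback.lift f.hom.left g.hom.left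
        ((Over.w f.hom).trans (Over.w g.hom).symm)) ?_), ?_, ?_⟩
      · change _ ≫ _ ≫ _ = _
        rw [Limits.pullback.lift_fst_assoc]
        exact Over.w f.hom
      · exact ObjectProperty.hom_ext _ (Over.OverMorphism.ext (Limits.pullback.lift_fst _ _ _))
      · exact ObjectProperty.hom_ext _ (Over.OverMorphism.ext (Limits.pullback.lift_snd _ _ _))
  pb {V W Z} f g := by
    let P : S.arrows.category :=
      ⟨Over.mk (Limits.pullback.fst f.hom.left g.hom.left ≫ V.obj.hom),
        S.downward_closed V.property _⟩
    let a : P ⟶ V := ObjectProperty.homMk (Over.homMk (Limits.pullback.fst f.hom.left g.hom.left))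
    let b : P ⟶ W := ObjectProperty.homMk (Over.homMk (Limits.pullback.snd f.hom.left g.hom.left)
      (by
        change _ = _ ≫ _
        rw [← Over.w g.hom, ← Over.w f.hom, ← Category.assoc, ← Category.assoc,
          Limits.pullback.condition]))
    refine ⟨P, a, b, ?_, ringSq_of_isPullback (f := X.p.map (D.map f)) (g := X.p.map (D.map g))
      (a := X.p.map (D.map a)) (b := X.p.map (D.map b)) ?_⟩
    · exact ObjectProperty.hom_ext _ (Over.OverMorphism.ext Limits.pullback.condition)
    · exact (IsPullback.of_hasPullback f.hom.left g.hom.left).of_iso (θ.symm.app P)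
        (θ.symm.app V) (θ.symm.app W) (θ.symm.app Z) (θ.inv.naturality a) (θ.inv.naturality b)
        (θ.inv.naturality f) (θ.inv.naturality g)
  cover := by
    obtain ⟨n, V, v, ⟨hv, hs⟩, hSv⟩ := hS
    let V' : Fin n → S.arrows.category := fun i => ⟨Over.mk (v i), hSv i⟩
    have hV : ∀ i, X.p.map (c (V' i)) = θ.hom.app (V' i) ≫ v i ≫ e.inv := fun i => by
      have := hc (V' i)
      rw [← Iso.eq_comp_inv] at this
      exact this.trans (Category.assoc _ _ _)
    have hV' : ∀ i, X.pull (c (V' i)) = (ringMap (θ.hom.app (V' i))).comp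
        ((ringMap (v i)).comp (ringMap e.inv)) := fun i => by
      rw [AffCat.pull, hV]; rfl
    refine ⟨n, V', fun i => ?_, fun p => ?_⟩
    · rw [hV']
      refine RingHom.Flat.comp (RingHom.Flat.comp ?_ ?_) ?_
      · exact RingHom.Flat.of_bijective (bijective_of_isIso _)
      · exact (RingHom.Etale.iff_flat_and_formallyUnramified.mp (hv i)).1
      · exact RingHom.Flat.of_bijective (bijective_of_isIso _)
    · obtain ⟨i, q, hq⟩ := hs (PrimeSpectrum.comap (ringMap e.hom) p)
      refine ⟨i, PrimeSpectrum.comap (ringMap (θ.inv.app (V' i))) q, ?_⟩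
      have h1 : (ringMap (θ.inv.app (V' i))).comp (X.pull (c (V' i))) =
          (ringMap (v i)).comp (ringMap e.inv) := by
        rw [hV']
        refine RingHom.ext fun x => ?_
        exact congrArg (fun t : V i ⟶ V i => t.unop.hom (ringMap (v i) (ringMap e.inv x)))
          (θ.inv_hom_id_app (V' i))
      have h2 : (ringMap e.hom).comp (ringMap e.inv) = RingHom.id _ := RingHom.ext fun a =>
        congrArg (fun t : X.p.obj x ⟶ X.p.obj x => t.unop.hom a) e.hom_inv_id
      refine (PrimeSpectrum.comap_comp_apply _ _ _).symm.trans
        ((congrArg (fun f => PrimeSpectrum.comap f q) h1).trans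
          ((PrimeSpectrum.comap_comp_apply _ _ _).trans ?_))
      refine (congrArg (PrimeSpectrum.comap (ringMap e.inv)) hq).trans
        ((PrimeSpectrum.comap_comp_apply _ _ _).symm.trans ?_)
      rw [h2, PrimeSpectrum.comap_id]

theorem FlatCover.exists_prime {A : Type u} [CommRing A] {J : Type*} [Category.{u} J]
    (K : FlatCover A J) (p : PrimeSpectrum A) :
    ∃ V, ∃ q : PrimeSpectrum (K.B V), PrimeSpectrum.comap (K.φ V) q = p := by
  obtain ⟨n, V, -, h⟩ := K.cover
  obtain ⟨i, q, hq⟩ := h p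
  exact ⟨V i, q, hq⟩

theorem AffCat.IsStack.gpd {X : AffCat k} (hX : X.IsStack) : IsGpdFibration X.p :=
  hX.toIsFibredInGroupoids.gpd

theorem WithLine.line_congr {X : AffCat k} {a b : WithLine X} {f g : a ⟶ b} (h : f = g)
    (m : b.line) : f.line m = g.line m := by subst h; rfl

theorem LineBundle.map_comp' {X : AffCat k} (N : LineBundle X) {x y z : X.obj} {f : x ⟶ y}
    {g : y ⟶ z} {h : x ⟶ z} (H : f ≫ g = h) (m : N.obj z) : N.map h m = N.map f (N.map g m) := by
  subst H
  exact N.map_comp f g m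

theorem LineBundle.map_congr {X : AffCat k} (N : LineBundle X) {x y : X.obj} {f g : x ⟶ y}
    (h : f = g) (m : N.obj y) : N.map f m = N.map g m := by
  subst h
  rfl

/-- `𝒳 × BG_m` is a stack, by descent for line bundles. -/
theorem AffCat.IsStack.withLine {X : AffCat k} (hX : X.IsStack) : X.withLine.IsStack where
  toIsFibredInGroupoids := AffCat.isFibredInGroupoids ((WithLine.gpd_forget X).comp hX.gpd)
  descent U S hS D θ := by
    obtain ⟨x, e, c, hc, hcc, hglue⟩ := hX.descent U S hS (D ⋙ WithLine.forget X) θ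
    let K := stackCover X hS (D ⋙ WithLine.forget X) θ e c hc hcc
    let N : K.Datum :=
      { N V := (D.obj V).line
        ρ f := (D.map f).line
        ρ_comp f g m := WithLine.line_congr (D.map_comp f g) m }
    obtain ⟨L, F, hF⟩ := N.effective
    refine ⟨⟨x, L⟩, e, fun V => ⟨c V, F V⟩, hc, fun {V W} g => WithLine.Hom.ext (hcc g)
      fun m => hF g m, fun y w c' hc' hw => ?_⟩
    obtain ⟨h, ⟨hh, hch⟩, hu⟩ := hglue y.base w (fun V => (c' V).base)
      (fun g => congrArg WithLine.Hom.base (hc' g)) hw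
    have key : ∀ l : y.line, ∃! m : L, ∀ V, F V m = (c' V).line l := fun l =>
      N.exists_unique_glue F hF (fun V => (c' V).line l) fun {V W} g => by
        rw [← hc' g]; rfl
    choose m hm hmu using key
    let G : InvMod.Map (X.pull h) y.line L := InvMod.Map.ofGenAt
      (AddMonoidHom.mk' m fun l l' => (hmu (l + l') _ fun V => by
        rw [map_add, hm, hm]; exact (map_add (c' V).line.toFun l l').symm).symm)
      (fun a l => (hmu (a • l) _ fun V => by
        rw [(F V).map_smul]
        refine (congrArg _ (hm l V)).trans (Eq.trans ?_ ((c' V).line.map_smul a l).symm)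
        have : X.pull (c' V).base a = X.pull (c V) (X.pull h a) := by
          rw [← X.pull_comp, hch]
          rfl
        exact congrArg (fun b : X.O (D.obj V).base => b • (c' V).line l) this.symm).symm)
      (fun q => by
        obtain ⟨V, q, rfl⟩ := K.exists_prime q
        obtain ⟨l, hl⟩ := (c' V).line.exists_genAt q
        refine ⟨l, InvMod.GenAt.of_map (F V) ?_⟩
        have := hm l V
        exact this ▸ hl)
    refine ⟨⟨h, G⟩, ⟨hh, fun V => WithLine.Hom.ext (hch V) fun l => hm l V⟩, ?_⟩
    rintro ⟨h', G'⟩ ⟨hh', hch'⟩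
    obtain rfl : h' = h := hu h' ⟨hh', fun V => congrArg WithLine.Hom.base (hch' V)⟩
    refine WithLine.Hom.ext rfl fun l => hmu l _ fun V => ?_
    rw [← hch' V]
    rfl

/-- `Isom(N, N')` is a stack, since isomorphisms of line bundles can be glued. -/
theorem AffCat.IsStack.withIso {X : AffCat k} (hX : X.IsStack) (N N' : LineBundle X) :
    (X.withIso N N').IsStack where
  toIsFibredInGroupoids := AffCat.isFibredInGroupoids ((WithIso.gpd_forget N N').comp hX.gpd)
  descent U S hS D θ := by
    obtain ⟨x, e, c, hc, hcc, hglue⟩ := hX.descent U S hS (D ⋙ WithIso.forget N N') θ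
    let K := stackCover X hS (D ⋙ WithIso.forget N N') θ e c hc hcc
    let M : K.Datum :=
      { N V := N'.obj (D.obj V).base
        ρ f := N'.map (D.map f).base
        ρ_comp f g m := N'.map_comp' (congrArg WithIso.Hom.base (D.map_comp f g)).symm m }
    have key : ∀ l : N.obj x, ∃! m : N'.obj x, ∀ V, N'.map (c V) m =
        (D.obj V).iso (N.map (c V) l) := fun l =>
      M.exists_unique_glue (fun V => N'.map (c V)) (fun {V W} f m =>
        (N'.map_comp' (hcc f) m).symm) (fun V => (D.obj V).iso (N.map (c V) l))
        fun {V W} f => by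
          refine ((D.map f).comm _).symm.trans ?_
          exact congrArg (D.obj V).iso (N.map_comp' (hcc f) l).symm
    choose m hm hmu using key
    let G : N.obj x →ₗ[X.O x] N'.obj x :=
      { toFun := m
        map_add' := fun l l' => (hmu (l + l') _ fun V => by
          rw [map_add, map_add, hm, hm]; exact (map_add (D.obj V).iso _ _).symm).symm
        map_smul' := fun a l => (hmu (a • l) _ fun V => by
          rw [RingHom.id_apply, (N'.map (c V)).map_smul, hm, (N.map (c V)).map_smul]
          exact ((D.obj V).iso.map_smul _ _).symm).symm }
    have hG : Function.Bijective G := InvMod.bijective_of_genAt G fun q => by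
      obtain ⟨V, q, rfl⟩ := K.exists_prime q
      obtain ⟨l, hl⟩ := (N.map (c V)).exists_genAt q
      refine ⟨l, InvMod.GenAt.of_map (N'.map (c V)) ?_⟩
      exact hm l V ▸ InvMod.GenAt.equiv (D.obj V).iso hl
    let z : WithIso N N' := ⟨x, LinearEquiv.ofBijective G hG⟩
    refine ⟨z, e, fun V => ⟨c V, fun l => (hm l V).symm⟩, hc, fun {V W} g =>
      WithIso.Hom.ext (hcc g), fun y w c' hc' hw => ?_⟩
    obtain ⟨h, ⟨hh, hch⟩, hu⟩ := hglue y.base w (fun V => (c' V).base)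
      (fun g => congrArg WithIso.Hom.base (hc' g)) hw
    refine ⟨⟨h, fun l => (hmu _ _ fun V => ?_).symm⟩,
      ⟨hh, fun V => WithIso.Hom.ext (hch V)⟩, fun h' hh' => WithIso.Hom.ext
        (hu h'.base ⟨hh'.1, fun V => congrArg WithIso.Hom.base (hh'.2 V)⟩)⟩
    rw [← N.map_comp, ← N'.map_comp, hch]
    exact ((c' V).comm l).symm

end

/-! ### Gluing along étale coverings -/

section

/-- The ring homomorphism `φ` defines a surjective étale morphism of affine schemes. -/
structure EtSurj {A B : Type u} [CommRing A] [CommRing B] (φ : A →+* B) : Prop where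
  etale : φ.Etale
  surjective : Function.Surjective (PrimeSpectrum.comap φ)

namespace EtSurj

variable {A B C D : Type u} [CommRing A] [CommRing B] [CommRing C] [CommRing D]

theorem flat {φ : A →+* B} (h : φ.Etale) : φ.Flat :=
  (RingHom.Etale.iff_flat_and_formallyUnramified.mp h).1

theorem faithfullyFlat {φ : A →+* B} (h : EtSurj φ) : φ.FaithfullyFlat :=
  RingHom.FaithfullyFlat.iff_flat_and_comap_surjective.mpr ⟨flat h.etale, h.surjective⟩

theorem of_bijective {φ : A →+* B} (h : Function.Bijective φ) : EtSurj φ :=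
  ⟨RingHom.Etale.of_bijective h, (RingHom.FaithfullyFlat.iff_flat_and_comap_surjective.mp
    (RingHom.FaithfullyFlat.of_bijective h)).2⟩

theorem comp {φ : A →+* B} {ψ : B →+* C} (hψ : EtSurj ψ) (hφ : EtSurj φ) : EtSurj (ψ.comp φ) :=
  ⟨RingHom.Etale.stableUnderComposition _ _ hφ.etale hψ.etale, fun p => by
    obtain ⟨q, rfl⟩ := hφ.surjective p
    obtain ⟨r, rfl⟩ := hψ.surjective q
    exact ⟨r, PrimeSpectrum.comap_comp_apply _ _ _⟩⟩

theorem stable {φ : A →+* B} {ψ : A →+* C} {α : B →+* D} {β : C →+* D} (h : RingSq φ ψ α β)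
    (hφ : EtSurj φ) : EtSurj β :=
  ⟨h.stable RingHom.Etale.isStableUnderBaseChange hφ.etale, h.surjective hφ.surjective⟩

end EtSurj

variable {k : Type u} [Field k]

namespace EtSurj

variable {U V W : AffSch k}

theorem of_eq {f g : U ⟶ V} (h : f = g) (hg : EtSurj (ringMap g)) : EtSurj (ringMap f) := h ▸ hg

theorem comp_ringMap {f : U ⟶ V} {g : V ⟶ W} (hf : EtSurj (ringMap f)) (hg : EtSurj (ringMap g)) :
    EtSurj (ringMap (f ≫ g)) := hf.comp hg

theorem of_isIso_ringMap (f : U ⟶ V) [IsIso f] : EtSurj (ringMap f) :=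
  of_bijective (bijective_of_isIso f)

end EtSurj

/-- The morphism `g : Spec O(x') → Spec O(x)` is étale and surjective. -/
abbrev AffCat.EtCover (X : AffCat k) {x' x : X.obj} (g : x' ⟶ x) : Prop := EtSurj (X.pull g)

namespace AffCat.EtCover

variable {X : AffCat k}

theorem comp {x y z : X.obj} {f : x ⟶ y} {g : y ⟶ z} (hf : X.EtCover f) (hg : X.EtCover g) :
    X.EtCover (f ≫ g) := by
  have : X.pull (f ≫ g) = (X.pull f).comp (X.pull g) := RingHom.ext fun a => X.pull_comp f g a
  rw [EtCover, this]
  exact EtSurj.comp hf hg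

theorem of_isIso {x y : X.obj} (f : x ⟶ y) [IsIso (X.p.map f)] : X.EtCover f :=
  EtSurj.of_bijective (bijective_of_isIso _)

theorem of_isPullback (hX : IsGpdFibration X.p) {x y z w : X.obj} {a : w ⟶ x} {b : w ⟶ y}
    {f : x ⟶ z} {g : y ⟶ z} (h : IsPullback a b f g) (hf : X.EtCover f) : X.EtCover b :=
  EtSurj.stable (ringSq_of_isPullback (hX.map_isPullback h)) hf

end AffCat.EtCover

/-- Compatible objects over the members of a diagram form a functor, if they map to a fixed object
of a category fibred in groupoids. -/
theorem exists_functor_of_lifts {E Z B J : Type*} [Category* E] [Category* Z] [Category* B]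
    [Category* J] (Ψ : E ⥤ Z) [Ψ.Full] [Ψ.Faithful] {p : Z ⥤ B} (hp : IsGpdFibration p) (F : J ⥤ B)
    {z : Z} (α : ∀ V, F.obj V ⟶ p.obj z) (hα : ∀ {V W} (f : V ⟶ W), F.map f ≫ α W = α V)
    (H : ∀ V, ∃ (e : E) (l : Ψ.obj e ⟶ z) (i : p.obj (Ψ.obj e) ≅ F.obj V),
      p.map l = i.hom ≫ α V) :
    ∃ (D : J ⥤ E) (θ : D ⋙ Ψ ⋙ p ≅ F) (l : ∀ V, Ψ.obj (D.obj V) ⟶ z),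
      (∀ V, p.map (l V) = θ.hom.app V ≫ α V) ∧
      ∀ {V W} (f : V ⟶ W), Ψ.map (D.map f) ≫ l W = l V := by
  choose e l i hl using H
  have key : ∀ {V W} (f : V ⟶ W), ∃ t : e V ⟶ e W,
      p.map (Ψ.map t) = (i V).hom ≫ F.map f ≫ (i W).inv ∧ Ψ.map t ≫ l W = l V := fun {V W} f => by
    obtain ⟨t, ⟨h1, h2⟩, -⟩ := hp.cartesian (l W) (l V) ((i V).hom ≫ F.map f ≫ (i W).inv)
      (by rw [hl, hl, Category.assoc, Category.assoc, Iso.inv_hom_id_assoc, hα])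
    exact ⟨Ψ.preimage t, by rw [Ψ.map_preimage, h1], by rw [Ψ.map_preimage, h2]⟩
  choose t ht htl using @key
  have hext : ∀ {V W} {a b : e V ⟶ e W}, p.map (Ψ.map a) = p.map (Ψ.map b) →
      Ψ.map a ≫ l W = Ψ.map b ≫ l W → a = b := fun {V W a b} h h' =>
    Ψ.map_injective (hp.hom_ext h h')
  let D : J ⥤ E :=
    { obj := e
      map := t
      map_id := fun V => hext (by rw [ht]; simp) (by rw [htl]; simp)
      map_comp := fun f g => hext (by rw [ht]; simp [ht]) (by rw [htl]; simp [htl]) }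
  exact ⟨D, NatIso.ofComponents i fun f => by
    change p.map (Ψ.map (t f)) ≫ _ = _
    rw [ht]; simp, l, hl, htl⟩

/-- The covering sieve generated by a surjective étale morphism. -/
theorem isEtaleSieve_generate {U V : AffSch k} {g : V ⟶ U} (hg : EtSurj (ringMap g)) :
    IsEtaleSieve (Sieve.generate (Presieve.singleton g)) :=
  ⟨1, fun _ => V, fun _ => g, ⟨fun _ => hg.etale, fun p => ⟨0, hg.surjective p⟩⟩, fun _ =>
    Sieve.le_generate _ _ _ ⟨⟩⟩

/-- Morphisms to an object of a stack can be glued along étale coverings. -/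
theorem AffCat.IsStack.exists_unique_hom {X : AffCat k} (hX : X.IsStack) {x' x y : X.obj}
    {g : x' ⟶ x} (hg : X.EtCover g) (w : X.p.obj x ⟶ X.p.obj y) (c : x' ⟶ y)
    (hw : X.p.map c = X.p.map g ≫ w)
    (hc : ∀ (z : X.obj) (a b : z ⟶ x'), a ≫ g = b ≫ g → a ≫ c = b ≫ c) :
    ∃! h : x ⟶ y, X.p.map h = w ∧ g ≫ h = c := by
  let S : Sieve (X.p.obj x) := Sieve.generate (Presieve.singleton (X.p.map g))
  obtain ⟨D, θ, l, hl, hD⟩ := exists_functor_of_lifts (𝟭 X.obj) hX.gpd S.arrows.diagram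
    (z := x) (fun V => V.obj.hom) (fun f => Over.w f.hom) fun V => by
      obtain ⟨e, l, h, hl⟩ := hX.gpd.exists_lift V.obj.hom
      exact ⟨e, l, eqToIso h, hl⟩
  obtain ⟨x₀, e, d, hd, hdd, hglue⟩ := hX.descent _ S (isEtaleSieve_generate hg) D θ
  obtain ⟨m, ⟨hm, hdm⟩, -⟩ := hglue x e.hom l hD fun V => (hl V).trans (hd V).symm
  have hmi : IsIso m := by
    have : IsIso (X.p.map m) := hm ▸ inferInstance
    exact hX.gpd.isIso m
  have ht : ∀ V, ∃ t : D.obj V ⟶ x', t ≫ g = l V := fun V => by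
    obtain ⟨_, s, _, ⟨⟩, hs⟩ := V.property
    obtain ⟨t, ⟨-, h⟩, -⟩ := hX.gpd.cartesian g (l V) (θ.hom.app V ≫ s)
      ((Category.assoc _ _ _).trans ((congrArg (θ.hom.app V ≫ ·) hs).trans (hl V).symm))
    exact ⟨t, h⟩
  choose t ht using ht
  let V₀ : S.arrows.category := ⟨Over.mk (X.p.map g), Sieve.le_generate _ _ _ ⟨⟩⟩
  obtain ⟨s, ⟨-, hs⟩, -⟩ := hX.gpd.cartesian (l V₀) g (θ.inv.app V₀) (by
    rw [hl]; exact θ.inv_hom_id_app_assoc V₀ (X.p.map g))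
  obtain ⟨h, ⟨hh, hhc⟩, hu⟩ := hglue y (e.hom ≫ w) (fun V => t V ≫ c)
    (fun {V W} f => by
      rw [← Category.assoc]
      refine hc _ _ _ ?_
      rw [Category.assoc, ht, ht]
      exact hD f)
    (fun V => by
      rw [X.p.map_comp, hw, ← Category.assoc, ← X.p.map_comp, ht, ← Category.assoc, hd, hl])
  have hVt : ∀ V, t V ≫ g ≫ inv m = d V := fun V => by
    rw [← Category.assoc, ht, ← hdm, Category.assoc, IsIso.hom_inv_id, Category.comp_id]
  refine ⟨inv m ≫ h, ⟨?_, ?_⟩, fun h' hh' => ?_⟩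
  · rw [X.p.map_comp, hh, ← hm, ← Category.assoc, ← X.p.map_comp, IsIso.inv_hom_id, X.p.map_id,
      Category.id_comp]
  · rw [← hs, ← hdm, Category.assoc, Category.assoc, IsIso.hom_inv_id_assoc, hhc,
      ← Category.assoc]
    refine (hc _ _ (𝟙 _) ?_).trans (Category.id_comp c)
    rw [Category.assoc, ht]
    exact hs.trans (Category.id_comp g).symm
  · rw [IsIso.eq_inv_comp]
    refine hu _ ⟨by rw [X.p.map_comp, hm, hh'.1], fun V => ?_⟩
    rw [← Category.assoc, hdm, ← ht, Category.assoc, hh'.2]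

section Criterion

variable {Z : AffCat k} {C : Type (u + 1)} [Category.{u} C] (Ψ : C ⥤ Z.obj)

/-- A morphism of stacks is fully faithful if it is so on objects which satisfy a condition that
holds étale locally. -/
theorem full_faithful_of_local (hZ : Z.IsStack) (hC : (Z.comap Ψ).IsStack) (P : C → Prop)
    (hloc : ∀ y : C, ∃ (y' : C) (g : y' ⟶ y), P y' ∧ (Z.comap Ψ).EtCover g)
    (hinj : ∀ {x y : C}, P x → P y → ∀ f g : x ⟶ y, Ψ.map f = Ψ.map g → f = g)
    (hsurj : ∀ {x y : C}, P x → P y → ∀ h : Ψ.obj x ⟶ Ψ.obj y, ∃ f : x ⟶ y, Ψ.map f = h) :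
    Ψ.Full ∧ Ψ.Faithful := by
  have hΨ := hC.gpd
  -- Covers on which a morphism `Ψ x ⟶ Ψ y` comes from `C`.
  have key : ∀ {x y : C} (h : Ψ.obj x ⟶ Ψ.obj y) {y' : C} (g' : y' ⟶ y), P y' →
      (Z.comap Ψ).EtCover g' → ∃ (x' : C) (g : x' ⟶ x) (m : x' ⟶ y'), P x' ∧
        (Z.comap Ψ).EtCover g ∧ Ψ.map m ≫ Ψ.map g' = Ψ.map g ≫ h := by
    intro x y h y' g' hy' hg'
    let q := Z.p.map (Ψ.map g')
    obtain ⟨x₁, g₁, hx₁, hg₁⟩ := hΨ.exists_lift (c := x) (Limits.pullback.snd q (Z.p.map h))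
    have hg₁' : (Z.comap Ψ).EtCover g₁ := by
      have h1 := EtSurj.stable (ringSq_of_isPullback (IsPullback.of_hasPullback q (Z.p.map h))) hg'
      exact .of_eq hg₁ (.comp_ringMap (.of_isIso_ringMap _) h1)
    obtain ⟨β, ⟨-, hβ⟩, -⟩ := hZ.gpd.cartesian (Ψ.map g') (Ψ.map g₁ ≫ h)
      (eqToHom hx₁ ≫ Limits.pullback.fst q (Z.p.map h)) (by
        rw [Category.assoc, Limits.pullback.condition, Z.p.map_comp, ← Category.assoc]
        exact congrArg (· ≫ Z.p.map h) hg₁.symm)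
    obtain ⟨x₂, g₂, hx₂, hg₂⟩ := hloc x₁
    obtain ⟨m, hm⟩ := hsurj hx₂ hy' (Ψ.map g₂ ≫ β)
    exact ⟨x₂, g₂ ≫ g₁, m, hx₂, hg₂.comp hg₁', by
      rw [hm, Category.assoc, hβ, Ψ.map_comp, Category.assoc]⟩
  have hfaith : ∀ {x y : C} (f f' : x ⟶ y), Ψ.map f = Ψ.map f' → f = f' := by
    intro x y f f' hff
    obtain ⟨y', g', hy', hg'⟩ := hloc y
    obtain ⟨x', g, m, hx', hg, hm⟩ := key (Ψ.map f) g' hy' hg'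
    have hlift : ∀ f'' : x ⟶ y, Ψ.map f'' = Ψ.map f → ∃ t : x' ⟶ y', Ψ.map t = Ψ.map m ∧
        t ≫ g' = g ≫ f'' := fun f'' hf => by
      have h1 : Ψ.map m ≫ Ψ.map g' = Ψ.map (g ≫ f'') := by rw [hm, Ψ.map_comp, hf]
      obtain ⟨t, ⟨ht, htg⟩, -⟩ := hΨ.cartesian g' (g ≫ f'') (Z.p.map (Ψ.map m))
        ((Z.p.map_comp _ _).symm.trans (congrArg Z.p.map h1))
      refine ⟨t, hZ.gpd.hom_ext (g := Ψ.map g') ht ?_, htg⟩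
      rw [← Ψ.map_comp, htg, h1]
    obtain ⟨t, ht, htg⟩ := hlift f rfl
    obtain ⟨t', ht', htg'⟩ := hlift f' hff.symm
    have h2 : g ≫ f = g ≫ f' := by
      rw [← htg, ← htg', hinj hx' hy' t t' (ht.trans ht'.symm)]
    refine (hC.exists_unique_hom hg (Z.p.map (Ψ.map f)) (g ≫ f) ((Z.comap Ψ).p.map_comp _ _)
      fun z a b hab => ?_).unique ⟨rfl, rfl⟩ ⟨congrArg Z.p.map hff.symm, h2.symm⟩
    rw [← Category.assoc, hab, Category.assoc]
  refine ⟨⟨fun {x y} h => ?_⟩, ⟨fun {x y f f'} h => hfaith f f' h⟩⟩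
  obtain ⟨y', g', hy', hg'⟩ := hloc y
  obtain ⟨x', g, m, hx', hg, hm⟩ := key h g' hy' hg'
  obtain ⟨f, ⟨hf, hgf⟩, -⟩ := hC.exists_unique_hom hg (Z.p.map h) (m ≫ g')
    (by
      change Z.p.map (Ψ.map (m ≫ g')) = Z.p.map (Ψ.map g) ≫ Z.p.map h
      rw [Ψ.map_comp, hm, Z.p.map_comp])
    fun z a b hab => hfaith _ _ (by
      rw [Ψ.map_comp a, Ψ.map_comp b, Ψ.map_comp m, hm, ← Category.assoc, ← Category.assoc,
        ← Ψ.map_comp, ← Ψ.map_comp, hab])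
  refine ⟨f, (hZ.exists_unique_hom (show Z.EtCover (Ψ.map g) from hg) (Z.p.map h) (Ψ.map g ≫ h)
    (Z.p.map_comp _ _) fun z a b hab => ?_).unique ⟨hf, ?_⟩ ⟨rfl, rfl⟩⟩
  · rw [← Category.assoc, hab, Category.assoc]
  · rw [← Ψ.map_comp, hgf, Ψ.map_comp, hm]

/-- A fully faithful morphism of stacks is an equivalence if it is étale locally essentially
surjective. -/
theorem essSurj_of_local [Ψ.Full] [Ψ.Faithful] (hZ : Z.IsStack) (hC : (Z.comap Ψ).IsStack)
    (hloc : ∀ z : Z.obj, ∃ (c : C) (g : Ψ.obj c ⟶ z), Z.EtCover g) : Ψ.EssSurj := by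
  refine ⟨fun z => ?_⟩
  obtain ⟨c₀, g, hg⟩ := hloc z
  let S : Sieve (Z.p.obj z) := Sieve.generate (Presieve.singleton (Z.p.map g))
  obtain ⟨D, θ, l, hl, hD⟩ := exists_functor_of_lifts Ψ hZ.gpd S.arrows.diagram
    (z := z) (fun V => V.obj.hom) (fun f => Over.w f.hom) fun V => by
      obtain ⟨_, s, _, ⟨⟩, hs⟩ := V.property
      obtain ⟨e, l, h, hl⟩ := hC.gpd.exists_lift (c := c₀) s
      refine ⟨e, Ψ.map l ≫ g, eqToIso h, ?_⟩
      rw [Z.p.map_comp]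
      refine (congrArg (· ≫ Z.p.map g) hl).trans ?_
      exact (Category.assoc _ _ _).trans (congrArg _ hs)
  obtain ⟨c, e, d, hd, hdd, -⟩ := hC.descent _ S (isEtaleSieve_generate hg) D θ
  let V₀ : S.arrows.category := ⟨Over.mk (Z.p.map g), Sieve.le_generate _ _ _ ⟨⟩⟩
  have hcov : Z.EtCover (Ψ.map (d V₀)) := by
    have h1 : Z.p.map (Ψ.map (d V₀)) = θ.hom.app V₀ ≫ Z.p.map g ≫ e.inv := by
      refine Eq.trans ?_ (Category.assoc _ _ _)
      exact (Iso.eq_comp_inv e).mpr (hd V₀)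
    exact .of_eq h1 (.comp_ringMap (.of_isIso_ringMap _) (.comp_ringMap hg (.of_isIso_ringMap _)))
  obtain ⟨m, ⟨hm, -⟩, -⟩ := hZ.exists_unique_hom hcov e.hom (l V₀)
    ((hl V₀).trans (hd V₀).symm) fun y a b hab => by
      -- Both composites come from the descent datum, over the same object of the sieve.
      obtain ⟨x, α₀, i, hi⟩ := hC.gpd.exists_lift (c := D.obj V₀) (Z.p.map a)
      obtain ⟨j, ⟨hj, hja⟩, -⟩ := hZ.gpd.cartesian a (Ψ.map α₀) (eqToHom i) hi.symm
      have : IsIso (Z.p.map j) := by rw [hj]; infer_instance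
      have := hZ.gpd.isIso j
      obtain ⟨β₀, hβ⟩ := Ψ.map_surjective (j ≫ b)
      have hd' : α₀ ≫ d V₀ = β₀ ≫ d V₀ := Ψ.map_injective (by
        rw [Ψ.map_comp, Ψ.map_comp, ← hja, hβ, Category.assoc, Category.assoc, hab])
      have hbase : ∀ γ : x ⟶ D.obj V₀, α₀ ≫ d V₀ = γ ≫ d V₀ →
          (Z.comap Ψ).p.map γ ≫ θ.hom.app V₀ ≫ V₀.obj.hom =
            (Z.comap Ψ).p.map α₀ ≫ θ.hom.app V₀ ≫ V₀.obj.hom := fun γ hγ => by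
        rw [← hd V₀, ← Category.assoc, ← Category.assoc, ← Functor.map_comp, ← Functor.map_comp, hγ]
      let V₁ : S.arrows.category := ⟨Over.mk ((Z.comap Ψ).p.map α₀ ≫ θ.hom.app V₀ ≫ V₀.obj.hom),
        S.downward_closed (S.downward_closed V₀.property _) _⟩
      obtain ⟨s, ⟨hs, hsd⟩, -⟩ := hC.gpd.cartesian (d V₁) (α₀ ≫ d V₀) (θ.inv.app V₁) (by
        refine (cancel_mono e.hom).mp ((Category.assoc _ _ _).trans
          ((congrArg (θ.inv.app V₁ ≫ ·) (hd V₁)).trans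
            ((θ.inv_hom_id_app_assoc V₁ V₁.obj.hom).trans ?_)))
        rw [Functor.map_comp, Category.assoc, hd V₀]
        rfl)
      have hsγ : ∀ γ : x ⟶ D.obj V₀, α₀ ≫ d V₀ = γ ≫ d V₀ → Ψ.map s ≫ l V₁ = Ψ.map γ ≫ l V₀ :=
        fun γ hγ => by
          let f : V₁ ⟶ V₀ := ObjectProperty.homMk (Over.homMk ((Z.comap Ψ).p.map γ ≫ θ.hom.app V₀)
            ((Category.assoc _ _ _).trans (hbase γ hγ)))
          have h1 : s ≫ D.map f = γ := by
            refine hC.gpd.hom_ext (g := d V₀) ?_ ?_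
            · rw [Functor.map_comp, hs]
              refine (θ.inv.naturality f).symm.trans ?_
              refine (Category.assoc _ _ _).trans ?_
              refine (congrArg (_ ≫ ·) (θ.hom_inv_id_app V₀)).trans ?_
              exact Category.comp_id _
            · rw [Category.assoc, hdd, hsd, hγ]
          rw [← hD f, ← Category.assoc, ← Ψ.map_comp, h1]
      rw [← cancel_epi j, ← Category.assoc, ← Category.assoc, hja, ← hβ, ← hsγ α₀ rfl,
        ← hsγ β₀ hd']
  have : IsIso (Z.p.map m) := hm ▸ inferInstance
  have := hZ.gpd.isIso m
  exact ⟨c, ⟨asIso m⟩⟩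

end Criterion

end

/-! ### Rings of roots -/

section

section AdjoinRoots

open Polynomial

variable {A : Type u} [CommRing A]

/-- The ring `A[X] / (X^n - γ)`. -/
abbrev RootRing (γ : A) (n : ℕ) : Type u := AdjoinRoot (X ^ n - C γ : A[X])

variable {γ : A} {n : ℕ}

theorem RootRing.root_pow : (AdjoinRoot.root (X ^ n - C γ : A[X])) ^ n = AdjoinRoot.of _ γ := by
  have := AdjoinRoot.eval₂_root (X ^ n - C γ : A[X])
  rwa [eval₂_sub, eval₂_pow, eval₂_X, eval₂_C, sub_eq_zero] at this

theorem RootRing.finite (hn : n ≠ 0) : (AdjoinRoot.of (X ^ n - C γ : A[X])).Finite :=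
  RingHom.finite_algebraMap.mpr (monic_X_pow_sub_C γ hn).finite_adjoinRoot

theorem RootRing.exists_lift {B : Type u} [CommRing B] (ψ : A →+* B) (b : B) (hb : b ^ n = ψ γ) :
    ∃ χ : RootRing γ n →+* B, (∀ a, χ (AdjoinRoot.of _ a) = ψ a) ∧ χ (AdjoinRoot.root _) = b :=
  ⟨AdjoinRoot.lift ψ b (by rw [eval₂_sub, eval₂_pow, eval₂_X, eval₂_C, hb, sub_self]),
    fun a => AdjoinRoot.lift_of _, AdjoinRoot.lift_root _⟩

theorem RootRing.hom_ext {B : Type u} [CommRing B] {χ χ' : RootRing γ n →+* B}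
    (h : ∀ a, χ (AdjoinRoot.of _ a) = χ' (AdjoinRoot.of _ a))
    (h' : χ (AdjoinRoot.root _) = χ' (AdjoinRoot.root _)) : χ = χ' := by
  refine Ideal.Quotient.ringHom_ext (Polynomial.ringHom_ext (fun a => h a) h')

/-- Over an algebraic closure of the residue field at `p` the element `γ` has an `n`-th root, so `p`
lifts to `A[X]/(X^n - γ)`. -/
theorem RootRing.surjective (hn : n ≠ 0) :
    Function.Surjective (PrimeSpectrum.comap (AdjoinRoot.of (X ^ n - C γ : A[X]))) := fun p => by
  let K := AlgebraicClosure p.asIdeal.ResidueField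
  let ψ : A →+* K := (algebraMap p.asIdeal.ResidueField K).comp (algebraMap A _)
  obtain ⟨b, hb⟩ := IsAlgClosed.exists_pow_nat_eq (ψ γ) (Nat.pos_of_ne_zero hn)
  obtain ⟨χ, hχ, -⟩ := RootRing.exists_lift ψ b hb
  refine ⟨PrimeSpectrum.comap χ ⊥, ?_⟩
  rw [← PrimeSpectrum.comap_comp_apply]
  ext a
  change χ (AdjoinRoot.of _ a) = 0 ↔ _
  rw [hχ]
  change algebraMap p.asIdeal.ResidueField K (algebraMap A _ a) = 0 ↔ _
  rw [map_eq_zero, Ideal.algebraMap_residueField_eq_zero]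

/-- If `n` and `γ` are invertible then `X^n - γ` is separable. -/
theorem RootRing.etale (hn : IsUnit (n : A)) (hγ : IsUnit γ) (h0 : n ≠ 0) :
    (AdjoinRoot.of (X ^ n - C γ : A[X])).Etale := by
  obtain ⟨u, hu⟩ := hn
  obtain ⟨v, hv⟩ := hγ
  let P : StandardEtalePair A :=
    { f := X ^ n - C γ
      monic_f := monic_X_pow_sub_C γ h0
      g := 1
      cond := by
        refine ⟨C (↑(u⁻¹ * v⁻¹) : A) * X, -C (↑v⁻¹ : A), 0, ?_⟩
        have h1 : C (n : A) * C (↑(u⁻¹ * v⁻¹) : A) = C (↑v⁻¹ : A) := by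
          rw [← C_mul, ← hu, ← Units.val_mul, mul_inv_cancel_left]
        have h2 : C γ * C (↑v⁻¹ : A) = 1 := by
          rw [← C_mul, ← hv, ← Units.val_mul, mul_inv_cancel, Units.val_one, C_1]
        have h3 : (X : A[X]) ^ (n - 1) * X = X ^ n := pow_sub_one_mul h0 _
        rw [derivative_sub, derivative_X_pow, derivative_C, sub_zero, pow_zero]
        linear_combination (X : A[X]) ^ n * h1 + h2 + C (n : A) * C (↑(u⁻¹ * v⁻¹) : A) * h3 }
  have hr : P.HasMap (AdjoinRoot.root (X ^ n - C γ : A[X])) := ⟨AdjoinRoot.eval₂_root _, by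
    change IsUnit (aeval _ (1 : A[X]))
    rw [map_one]
    exact isUnit_one⟩
  let g : AdjoinRoot (X ^ n - C γ : A[X]) →ₐ[A] P.Ring :=
    AdjoinRoot.liftAlgHom _ (Algebra.ofId A _) P.X P.hasMap_X.1
  have hg : g (AdjoinRoot.root _) = P.X := AdjoinRoot.liftAlgHom_root _ _ _ _
  have hl : P.lift _ hr P.X = AdjoinRoot.root _ := P.lift_X _ hr
  let e : P.Ring ≃ₐ[A] AdjoinRoot (X ^ n - C γ : A[X]) := .ofAlgHom (P.lift _ hr) g
    (AdjoinRoot.algHom_ext ((congrArg (P.lift _ hr) hg).trans hl))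
    (P.hom_ext ((congrArg g hl).trans hg))
  have h := Algebra.Etale.of_equiv e
  rw [← RingHom.etale_algebraMap] at h
  exact h

end AdjoinRoots

/-- A property of ring homomorphisms which codescends along faithfully flat maps can be checked
after the base change given by a cocartesian square. -/
theorem RingSq.codescend {P : ∀ {R S : Type u} [CommRing R] [CommRing S], (R →+* S) → Prop}
    (hP : RingHom.CodescendsAlong P RingHom.FaithfullyFlat) {A B C D : Type u} [CommRing A]
    [CommRing B] [CommRing C] [CommRing D] {φ : A →+* B} {ψ : A →+* C} {α : B →+* D} {β : C →+* D}
    (h : RingSq φ ψ α β) (hψ : ψ.FaithfullyFlat) (hβ : P β) : P φ := by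
  let _ := φ.toAlgebra
  let _ := ψ.toAlgebra
  let _ := α.toAlgebra
  let _ := β.toAlgebra
  let _ := (α.comp φ).toAlgebra
  have : IsScalarTower A B D := .of_algebraMap_eq fun _ => rfl
  have : IsScalarTower A C D := .of_algebraMap_eq fun a => h.comm a
  have := RingSq.isPushout (A := A) (B := B) (C := C) (D := D) h
  exact hP (R := A) (S := B) (R' := C) (S' := D) hψ hβ

namespace InvMod

variable {A R : Type u} [CommRing A] [CommRing R]

theorem GenAt.pair_notMem {L : InvMod A} {p : PrimeSpectrum A} {x : L} {χ : L.dual}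
    (hx : GenAt p x) {y : L} (hχ : pair χ y ∉ p.asIdeal) : pair χ x ∉ p.asIdeal := by
  obtain ⟨ξ, hξ⟩ := hx
  intro h
  have := congrArg (pair χ) (pair_comm ξ x y)
  rw [pair_smul, pair_smul, mul_comm (pair ξ y)] at this
  exact (p.2.mem_or_mem (this ▸ Ideal.mul_mem_right _ _ h : pair ξ x * pair χ y ∈ _)).elim hξ hχ

/-- A section of the structure sheaf, as a function. -/
def val (a : unit A) : A := a

theorem Map.val_smul {φ : A →+* R} {L : InvMod A} (f : Map φ L (InvMod.unit R)) (a : A) (x : L) :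
    val (f (a • x)) = φ a * val (f x) := congrArg val (f.map_smul a x)

theorem exists_val_eq (a : A) : ∃ x : unit A, val x = a := ⟨a, rfl⟩

theorem isGen_of_isUnit_val {x : unit A} (h : IsUnit (val x)) : IsGen x :=
  isGen_of_isUnit (χ := udual A) h

variable {T₁ T₂ : InvMod A} {N : ℕ}

/-- Let `θ : T₂^N ≅ T₁^N`. The ring `R` is the universal `A`-algebra with an isomorphism `T₁ ≅ T₂`
of line bundles over `R` whose `N`-th power is `θ`. Such an isomorphism is given as a
trivialization `v` of `T₁^∨ ⊗ T₂`. -/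
structure IsIsomRing (θ : T₂.npow N ≃ₗ[A] T₁.npow N) (φ : A →+* R)
    (v : Map φ (T₁.dual.tensor T₂) (unit R)) : Prop where
  rel : ∀ (χ : T₁.dual) (y : T₂),
    val (v (tmul χ y)) ^ N = φ (pair (powDual χ N) (θ (pow y N)))
  desc : ∀ {B : Type u} [CommRing B] (ψ : A →+* B) (u : Map ψ (T₁.dual.tensor T₂) (unit B)),
    (∀ (χ : T₁.dual) (y : T₂),
      val (u (tmul χ y)) ^ N = ψ (pair (powDual χ N) (θ (pow y N)))) →
    ∃! c : R →+* B, (∀ a, c (φ a) = ψ a) ∧ ∀ q, c (val (v q)) = val (u q)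

/-- The scheme of isomorphisms between two `N`-th roots `T₁`, `T₂` of the same line bundle is
affine: it is the spectrum of the quotient of `Sym(T₁^∨ ⊗ T₂)` by the relations `(χ ⊗ y)^N = ⟨χ^N,
θ(y^N)⟩`. These relations make the universal map `T₁^∨ ⊗ T₂ → O` surjective, since its `N`-th power
is. -/
theorem exists_isIsomRing (θ : T₂.npow N ≃ₗ[A] T₁.npow N) (hN : N ≠ 0) :
    ∃ (R : Type u) (_ : CommRing R) (φ : A →+* R) (v : Map φ (T₁.dual.tensor T₂) (unit R)),
      IsIsomRing θ φ v := by
  let Q := T₁.dual.tensor T₂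
  let F : T₁.dual → T₂ → A := fun χ y => pair (powDual χ N) (θ (pow y N))
  let I : Ideal (SymmetricAlgebra A Q) := Ideal.span (Set.range fun z : T₁.dual × T₂ =>
    SymmetricAlgebra.ι A Q (tmul z.1 z.2) ^ N - algebraMap A _ (F z.1 z.2))
  let φ : A →+* SymmetricAlgebra A Q ⧸ I := (Ideal.Quotient.mk I).comp (algebraMap A _)
  let v₀ : Q →+ unit (SymmetricAlgebra A Q ⧸ I) := AddMonoidHom.mk'
    (fun q => Ideal.Quotient.mk I (SymmetricAlgebra.ι A Q q)) fun q q' => by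
      rw [map_add]; exact map_add (Ideal.Quotient.mk I) _ _
  have hv₀ : ∀ (χ : T₁.dual) (y : T₂), val (v₀ (tmul χ y)) ^ N =
      φ (F χ y) := fun χ y => by
    change Ideal.Quotient.mk I _ ^ N = Ideal.Quotient.mk I _
    rw [← map_pow]
    exact Ideal.Quotient.eq.mpr (Ideal.subset_span ⟨(χ, y), rfl⟩)
  -- At each prime, `(ξ ⊗ y)^N` is a unit for local generators `ξ` and `y`, hence so is `ξ ⊗ y`.
  let v : Map φ Q (unit (SymmetricAlgebra A Q ⧸ I)) := Map.ofGenAt v₀ (fun a q => by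
      change Ideal.Quotient.mk I (SymmetricAlgebra.ι A Q (a • q)) = _
      rw [map_smul, Algebra.smul_def, map_mul]
      rfl) fun q => by
    obtain ⟨x, ξ, hx⟩ := T₁.exists_genAt (PrimeSpectrum.comap φ q)
    obtain ⟨y, hy⟩ := T₂.exists_genAt (PrimeSpectrum.comap φ q)
    refine ⟨tmul ξ y, udual _, fun h => ?_⟩
    have h1 : pair (powDual ξ N) (pow x N) ∉ (PrimeSpectrum.comap φ q).asIdeal := by
      rw [pair_powDual]
      exact fun h => hx ((PrimeSpectrum.comap φ q).2.mem_of_pow_mem _ h)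
    refine ((hy.pow N).equiv θ).pair_notMem h1 ?_
    change φ (F ξ y) ∈ q.asIdeal
    rw [← hv₀]
    exact Ideal.pow_mem_of_mem _ h _ (Nat.pos_of_ne_zero hN)
  refine ⟨SymmetricAlgebra A Q ⧸ I, inferInstance, φ, v, hv₀, fun {B} _ ψ u hu => ?_⟩
  let _ := ψ.toAlgebra
  let u' : Q →ₗ[A] B :=
    { toFun := fun q => u q
      map_add' := fun q q' => map_add u.toFun q q'
      map_smul' := fun a q => u.map_smul a q }
  let c₀ := SymmetricAlgebra.lift u'
  refine ⟨Ideal.Quotient.lift I c₀.toRingHom fun t ht => ?_, ⟨fun a => ?_, fun q => ?_⟩, ?_⟩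
  · refine (Ideal.span_le (I := RingHom.ker c₀.toRingHom)).mpr ?_ ht
    rintro _ ⟨⟨χ, y⟩, rfl⟩
    change c₀ _ = 0
    rw [map_sub, map_pow, SymmetricAlgebra.lift_ι_apply, c₀.commutes, sub_eq_zero]
    exact hu χ y
  · exact c₀.commutes a
  · exact SymmetricAlgebra.lift_ι_apply (f := u') q
  · rintro c ⟨hc, hc'⟩
    refine Ideal.Quotient.ringHom_ext (RingHom.ext fun t => sym_hom_ext (fun a => ?_) (fun q => ?_) t)
    · exact (hc a).trans (c₀.commutes a).symm
    · exact (hc' q).trans (SymmetricAlgebra.lift_ι_apply (f := u') q).symm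

/-- Line bundles are trivial Zariski locally, hence on a surjective étale morphism. -/
theorem exists_etSurj_isGen (L : InvMod A) : ∃ (B : Type u) (_ : CommRing B) (φ : A →+* B),
    EtSurj φ ∧ ∃ x : pullback φ L, IsGen x := by
  obtain ⟨n, χ, x, h⟩ := L.exists_dualBasis
  let B := ∀ i : Fin n, Localization.Away (pair (χ i) (x i))
  have : ∀ i, Algebra.Etale A (Localization.Away (pair (χ i) (x i))) := fun i =>
    Algebra.Etale.of_isLocalizationAway (pair (χ i) (x i))
  have : Algebra.Etale A B := inferInstance
  refine ⟨B, inferInstance, algebraMap A B, ⟨RingHom.etale_algebraMap.mpr this, fun p => ?_⟩,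
    ∑ i, (Pi.single i 1 : B) • toPullback (algebraMap A B) L (x i), ?_⟩
  · obtain ⟨i, hi⟩ : ∃ i, pair (χ i) (x i) ∉ p.asIdeal := by
      by_contra! hp
      exact p.2.one_notMem (h ▸ Ideal.sum_mem _ fun i _ => hp i)
    have hr : p ∈ Set.range (PrimeSpectrum.comap
        (algebraMap A (Localization.Away (pair (χ i) (x i))))) := by
      rw [PrimeSpectrum.localization_away_comap_range (Localization.Away (pair (χ i) (x i))) (pair (χ i) (x i))]
      exact hi
    obtain ⟨q, rfl⟩ := hr
    exact ⟨PrimeSpectrum.comap (Pi.evalRingHom _ i) q,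
      (PrimeSpectrum.comap_comp_apply _ _ _).symm⟩
  · refine isGen_of_isUnit
      (χ := ∑ i, (Pi.single i 1 : B) • (toPullback (algebraMap A B) L).dual (χ i)) ?_
    have h1 : ∀ (s : Finset (Fin n)) (ξ : Fin n → (pullback (algebraMap A B) L).dual)
        (y : pullback (algebraMap A B) L), pair (∑ i ∈ s, ξ i) y = ∑ i ∈ s, pair (ξ i) y :=
      fun s ξ y => LinearMap.sum_apply _ _ _
    rw [h1, Pi.isUnit_iff]
    intro j
    rw [Finset.sum_apply, Finset.sum_eq_single j]
    · rw [pair_smul_left, pair_sum, Pi.mul_apply, Finset.sum_apply, Finset.sum_eq_single j]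
      · rw [pair_smul, Map.dual_pair, Pi.mul_apply, Pi.single_eq_same, one_mul, one_mul]
        exact IsLocalization.Away.algebraMap_isUnit (pair (χ j) (x j))
      · intro i _ hi
        rw [pair_smul, Pi.mul_apply, Pi.single_eq_of_ne hi.symm, zero_mul]
      · exact fun h => absurd (Finset.mem_univ _) h
    · intro i _ hi
      rw [pair_smul_left, Pi.mul_apply, Pi.single_eq_of_ne hi.symm, zero_mul]
    · exact fun h => absurd (Finset.mem_univ _) h

theorem Map.dual_powDual {B : Type u} [CommRing B] {φ : A →+* B} {L : InvMod A} {M : InvMod B}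
    (f : Map φ L M) (χ : L.dual) (n : ℕ) (z : L.npow n) :
    pair (powDual (f.dual χ) n) (f.npow n z) = φ (pair (powDual χ n) z) := by
  refine semilinear_ext (φ := φ) (K := B)
    (F := fun z => pair (powDual (f.dual χ) n) (f.npow n z))
    (G := fun z => φ (pair (powDual χ n) z))
    (fun a m => ?_) (fun a m => ?_) (fun q => ?_) z
  · exact (congrArg _ ((f.npow n).map_smul a m)).trans (pair_smul _ _ _)
  · exact (congrArg φ (pair_smul _ a m)).trans (φ.map_mul _ _)
  · obtain ⟨x, hx⟩ := L.exists_genAt (PrimeSpectrum.comap φ q)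
    refine ⟨pow x n, hx.pow n, ?_⟩
    rw [Map.npow_pow, pair_powDual, pair_powDual, f.dual_pair, map_pow]

theorem powDual_smul {L : InvMod A} (a : A) (χ : L.dual) (n : ℕ) :
    powDual (a • χ) n = a ^ n • powDual χ n := by
  refine dual_ext fun z => ?_
  refine linear_ext (K := A) (F := fun z => pair (powDual (a • χ) n) z)
    (G := fun z => pair (a ^ n • powDual χ n) z) (pair_smul _) (pair_smul _) (fun p => ?_) z
  obtain ⟨x, hx⟩ := L.exists_genAt p
  refine ⟨pow x n, hx.pow n, ?_⟩
  rw [pair_powDual, pair_smul_left, pair_smul_left, pair_powDual, mul_pow]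

/-- After a base change `A → A'` which trivializes `T₁` and `T₂`, the universal ring is the ring of
`N`-th roots of a unit. -/
theorem IsIsomRing.exists_ringSq {θ : T₂.npow N ≃ₗ[A] T₁.npow N} {φ : A →+* R}
    {v : Map φ (T₁.dual.tensor T₂) (unit R)} (h : IsIsomRing θ φ v) (hN : N ≠ 0) {A' : Type u}
    [CommRing A'] (φ₀ : A →+* A') {T₁' T₂' : InvMod A'} (t₁ : Map φ₀ T₁ T₁') (t₂ : Map φ₀ T₂ T₂')
    (h₁ : ∃ x : T₁', IsGen x) (h₂ : ∃ y : T₂', IsGen y) :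
    ∃ γ : A', IsUnit γ ∧ ∃ α : R →+* RootRing γ N, RingSq φ φ₀ α (AdjoinRoot.of _) := by
  obtain ⟨x, ξ, hx⟩ := h₁
  obtain ⟨y, η, hy⟩ := h₂
  obtain ⟨e, he⟩ : ∃ e : Map φ₀ (T₂.npow N) (T₁'.npow N), ∀ z, e z = t₁.npow N (θ z) :=
    ⟨.ofGenAt ((t₁.npow N).toFun.comp θ.toLinearMap.toAddMonoidHom) (fun a m => by
      change t₁.npow N (θ (a • m)) = _
      rw [map_smul, Map.map_smul]; rfl) fun q => by
        obtain ⟨z, hz⟩ := (t₁.npow N).exists_genAt q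
        exact ⟨θ.symm z, by change GenAt q (t₁.npow N (θ (θ.symm z))); rwa [θ.apply_symm_apply]⟩,
      fun _ => rfl⟩
  obtain ⟨g, hg⟩ := (t₂.npow N).exists_factor (ψ := RingHom.id A') (χ := φ₀) (fun _ => rfl) e
  let γ : A' := pair (powDual ξ N) (g (pow y N))
  have hγ : IsUnit γ := by
    obtain ⟨c, hc⟩ := exists_unit_smul (IsGen.pow ⟨ξ, hx⟩ N)
      ((IsGen.pow (⟨η, hy⟩ : IsGen y) N).map g)
    have : γ = c := by
      change pair _ _ = _
      rw [hc]
      refine (pair_smul _ (c : A') _).trans ?_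
      rw [pair_powDual, hx, one_pow, mul_one]
    exact this ▸ c.isUnit
  let κ : T₁.dual → T₂ → A' := fun χ z => pair (t₁.dual χ) x * pair η (t₂ z)
  have hκ : ∀ χ z, φ₀ (pair (powDual χ N) (θ (pow z N))) = κ χ z ^ N * γ := fun χ z => by
    have h1 : t₁.dual χ = pair (t₁.dual χ) x • ξ := by
      refine eq_pair_smul (x := ξ) (χ := evalDual x) hx _
    have h2 : t₂ z = pair η (t₂ z) • y := eq_pair_smul hy _
    rw [← t₁.dual_powDual, ← he, hg, Map.npow_pow, h1, h2, powDual_smul, pow_smul]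
    change pair _ (g (_ • _)) = _
    rw [g.map_smul, pair_smul_left, pair_smul, mul_pow]
    change _ * (_ * γ) = _ * _ * γ
    rw [mul_assoc]; rfl
  let t := t₁.dual.tensor t₂
  have ht : ∀ χ z, t (tmul χ z) = κ χ z • tmul ξ y := fun χ z => by
    have h1 : t₁.dual χ = pair (t₁.dual χ) x • ξ := by
      refine eq_pair_smul (x := ξ) (χ := evalDual x) hx _
    have h2 : t₂ z = pair η (t₂ z) • y := eq_pair_smul hy _
    refine (Map.tensor_apply _ _ _ _).trans ((congrArg₂ tmul h1 h2).trans ?_)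
    rw [smul_tmul, tmul_smul, smul_smul]
  have hw : IsGen (tmul ξ y) := (isGen_dual hx).tmul ⟨η, hy⟩
  have hloc : ∀ {E : Type u} [CommRing E] (c : A' →+* E) (q : PrimeSpectrum E),
      ∃ χ z, c (κ χ z) ∉ q.asIdeal := fun c q => by
    obtain ⟨x', χ, hχ⟩ := T₁.exists_genAt (PrimeSpectrum.comap (c.comp φ₀) q)
    obtain ⟨z, hz⟩ := T₂.exists_genAt (PrimeSpectrum.comap (c.comp φ₀) q)
    refine ⟨χ, z, fun hc => ?_⟩
    have h3 : pair χ x' ^ N ∉ (PrimeSpectrum.comap (c.comp φ₀) q).asIdeal :=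
      fun h => hχ ((PrimeSpectrum.comap (c.comp φ₀) q).2.mem_of_pow_mem N h)
    refine ((hz.pow N).equiv θ).pair_notMem
      (χ := powDual χ N) (y := pow x' N) (by rwa [pair_powDual]) ?_
    change c (φ₀ (pair (powDual χ N) (θ (pow z N)))) ∈ q.asIdeal
    rw [hκ, map_mul, map_pow]
    exact Ideal.mul_mem_right _ _ (Ideal.pow_mem_of_mem _ hc _ (Nat.pos_of_ne_zero hN))
  let β : A' →+* RootRing γ N := AdjoinRoot.of _
  have hroot : IsUnit (AdjoinRoot.root (Polynomial.X ^ N - Polynomial.C γ)) :=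
    (isUnit_pow_iff hN).mp (RootRing.root_pow (γ := γ) (n := N) ▸ hγ.map β)
  obtain ⟨ρ, hρ⟩ := exists_val_eq (AdjoinRoot.root (Polynomial.X ^ N - Polynomial.C γ))
  obtain ⟨m, hm⟩ := Map.exists_of_isGen β hw (isGen_of_isUnit_val (hρ ▸ hroot : IsUnit (val ρ)))
  have hmt : ∀ χ z, val (m (t (tmul χ z))) = β (κ χ z) *
      AdjoinRoot.root (Polynomial.X ^ N - Polynomial.C γ) := fun χ z => by
    rw [ht, m.val_smul, hm, hρ]
  obtain ⟨α, ⟨hα, hα'⟩, -⟩ := h.desc (β.comp φ₀) (Map.comp (fun _ => rfl) t m) fun χ z => by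
    change val (m (t (tmul χ z))) ^ N = β (φ₀ _)
    rw [hmt, mul_pow (β (κ χ z)), RootRing.root_pow, hκ, β.map_mul (κ χ z ^ N), β.map_pow (κ χ z)]
  refine ⟨γ, hγ, α, .of_exists_desc hα (fun {E} _ b c hbc => ?_) fun {E} _ d d' h1 h2 => ?_⟩
  · obtain ⟨m', hm'⟩ := t.exists_factor (ψ := c) (χ := b.comp φ) hbc
      (Map.comp (fun _ => rfl) v (Map.unit b))
    have hm't : ∀ χ z, b (val (v (tmul χ z))) = c (κ χ z) * val (m' (tmul ξ y)) :=
      fun χ z => (congrArg val (hm' (tmul χ z))).trans (by rw [ht, m'.val_smul])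
    have htγ : val (m' (tmul ξ y)) ^ N = c γ := by
      refine eq_of_forall_prime (A := E) fun q => ?_
      obtain ⟨χ, z, hz⟩ := hloc c q
      refine ⟨c (κ χ z) ^ N, fun h => hz (q.2.mem_of_pow_mem _ h), ?_⟩
      change c (κ χ z) ^ N * _ = c (κ χ z) ^ N * _
      rw [← mul_pow, ← hm't, ← map_pow, h.rel, hbc, hκ, map_mul, map_pow]
    obtain ⟨d, hd, hd'⟩ := RootRing.exists_lift c _ htγ
    refine ⟨d, ?_, hd⟩
    have hu := (h.desc (b.comp φ) (Map.comp (fun _ => rfl) v (Map.unit b)) fun χ z => by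
      change b (val (v (tmul χ z))) ^ N = b (φ _)
      rw [← map_pow, h.rel]).unique (y₁ := d.comp α) (y₂ := b) ⟨fun a => ?_, fun q => ?_⟩
        ⟨fun _ => rfl, fun _ => rfl⟩
    · exact fun x => RingHom.congr_fun hu x
    · change d (α (φ a)) = b (φ a)
      rw [hα, hbc]
      exact hd _
    · change d (α (val (v q))) = b (val (v q))
      rw [hα']
      refine Eq.trans ?_ (congrArg val (hm' q)).symm
      refine semilinear_ext_gen (φ := c) (K := E) (F := fun w => d (val (m w)))
        (G := fun w => val (m' w)) (fun a w => ?_) m'.val_smul hw ?_ (t q)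
      · rw [m.val_smul, map_mul, hd, smul_eq_mul]
      · rw [hm, hρ, hd']
  · refine RootRing.hom_ext h2 ?_
    refine eq_of_forall_prime (A := E) fun q => ?_
    obtain ⟨χ, z, hz⟩ := hloc (d.comp β) q
    refine ⟨d (β (κ χ z)), hz, ?_⟩
    change d _ * d _ = d _ * d' _
    have h3 : ∀ d : RootRing γ N →+* E, d (β (κ χ z)) * d (AdjoinRoot.root _) =
        d (α (val (v (tmul χ z)))) := fun d => by
      rw [← map_mul, ← hmt, hα']; rfl
    rw [h3, h1, ← h3]
    exact congrArg (· * _) (h2 _).symm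

/-- Isomorphisms between two `N`-th roots form a finite étale covering if `N` is invertible. Étale
locally the roots are trivial, and then the ring is `A[X]/(X^N - γ)` with `γ` a unit. -/
theorem IsIsomRing.finite_etSurj {θ : T₂.npow N ≃ₗ[A] T₁.npow N} {φ : A →+* R}
    {v : Map φ (T₁.dual.tensor T₂) (unit R)} (h : IsIsomRing θ φ v) (hN : N ≠ 0)
    (hu : IsUnit (N : A)) : φ.Finite ∧ EtSurj φ := by
  obtain ⟨A₁, _, φ₁, hφ₁, x, hx⟩ := T₁.exists_etSurj_isGen
  obtain ⟨A₂, _, φ₂, hφ₂, y, hy⟩ := (pullback φ₁ T₂).exists_etSurj_isGen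
  have hφ := hφ₂.comp hφ₁
  obtain ⟨γ, hγ, α, hα⟩ := h.exists_ringSq hN (φ₂.comp φ₁)
    (Map.comp (fun _ => rfl) (toPullback φ₁ T₁) (toPullback φ₂ _))
    (Map.comp (fun _ => rfl) (toPullback φ₁ T₂) (toPullback φ₂ _))
    ⟨_, hx.map (toPullback φ₂ _)⟩ ⟨_, hy⟩
  refine ⟨hα.codescend RingHom.Finite.codescendsAlong_faithfullyFlat hφ.faithfullyFlat
    (RootRing.finite hN), hα.codescend RingHom.Etale.codescendsAlong_faithfullyFlat
    hφ.faithfullyFlat (RootRing.etale (by simpa using hu.map (φ₂.comp φ₁)) hγ hN), fun p => ?_⟩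
  obtain ⟨q, rfl⟩ := hφ.surjective p
  obtain ⟨s, hs⟩ := RootRing.surjective (γ := γ) hN q
  refine ⟨PrimeSpectrum.comap α s, ?_⟩
  rw [← hs]
  ext a
  change α (φ a) ∈ s.asIdeal ↔ AdjoinRoot.of _ _ ∈ s.asIdeal
  rw [hα.comm]

end InvMod

end

/-! ### Relative products and root stacks -/

section

section RelProd

universe v₁ v₂ u₁ u₂

variable {C : Type u₁} [Category.{v₁} C] {D : Type u₂} [Category.{v₂} D]

/-- `z` is the product of `c₁` and `c₂` relative to `w`: for a fibration `G` in groupoids, `z ⟶ w`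
represents the isomorphisms between the pullbacks of `c₁` and `c₂` to `w`. -/
structure IsRelProd (G : C ⥤ D) {c₁ c₂ z : C} {w : D} (p₁ : w ⟶ G.obj c₁) (p₂ : w ⟶ G.obj c₂)
    (q₁ : z ⟶ c₁) (q₂ : z ⟶ c₂) (h : G.obj z ⟶ w) : Prop where
  w₁ : h ≫ p₁ = G.map q₁
  w₂ : h ≫ p₂ = G.map q₂
  exists_unique : ∀ (t : C) (a₁ : t ⟶ c₁) (a₂ : t ⟶ c₂) (b : G.obj t ⟶ w), b ≫ p₁ = G.map a₁ →
    b ≫ p₂ = G.map a₂ → ∃! m : t ⟶ z, m ≫ q₁ = a₁ ∧ m ≫ q₂ = a₂ ∧ G.map m ≫ h = b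

/-- A relative product depends only on the composites with morphisms of `C`, which are cartesian. -/
theorem IsRelProd.comp {G : C ⥤ D} (hG : IsGpdFibration G) {c₁ c₂ z : C} {w : D}
    {p₁ : w ⟶ G.obj c₁} {p₂ : w ⟶ G.obj c₂} {q₁ : z ⟶ c₁} {q₂ : z ⟶ c₂} {h : G.obj z ⟶ w}
    (H : IsRelProd G p₁ p₂ q₁ q₂ h) {d₁ d₂ : C} (g₁ : c₁ ⟶ d₁) (g₂ : c₂ ⟶ d₂)
    {p₁' : w ⟶ G.obj d₁} {p₂' : w ⟶ G.obj d₂} (hp₁ : p₁ ≫ G.map g₁ = p₁')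
    (hp₂ : p₂ ≫ G.map g₂ = p₂') : IsRelProd G p₁' p₂' (q₁ ≫ g₁) (q₂ ≫ g₂) h where
  w₁ := by rw [← hp₁, ← Category.assoc, H.w₁, G.map_comp]
  w₂ := by rw [← hp₂, ← Category.assoc, H.w₂, G.map_comp]
  exists_unique t a₁ a₂ b h₁ h₂ := by
    subst hp₁ hp₂
    obtain ⟨t₁, ⟨ht₁, hta₁⟩, hu₁⟩ := hG.cartesian g₁ a₁ (b ≫ p₁) (by rw [Category.assoc, h₁])
    obtain ⟨t₂, ⟨ht₂, hta₂⟩, hu₂⟩ := hG.cartesian g₂ a₂ (b ≫ p₂) (by rw [Category.assoc, h₂])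
    obtain ⟨m, ⟨hm₁, hm₂, hm⟩, hu⟩ := H.exists_unique t t₁ t₂ b ht₁.symm ht₂.symm
    refine ⟨m, ⟨by rw [← Category.assoc, hm₁, hta₁], by rw [← Category.assoc, hm₂, hta₂], hm⟩, ?_⟩
    rintro m' ⟨hm₁', hm₂', hm'⟩
    refine hu m' ⟨hu₁ _ ⟨?_, by rw [Category.assoc, hm₁']⟩, hu₂ _ ⟨?_, by rw [Category.assoc, hm₂']⟩,
      hm'⟩
    · rw [G.map_comp, ← H.w₁, ← Category.assoc, hm']
    · rw [G.map_comp, ← H.w₂, ← Category.assoc, hm']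

end RelProd

namespace InvMod

variable {A R : Type u} [CommRing A] [CommRing R] {φ : A →+* R} {L L₁ L₂ : InvMod A} {M : InvMod R}

theorem Map.eq_of_pair (f : Map φ L M) {e e' : M}
    (h : ∀ χ, pair (f.dual χ) e = pair (f.dual χ) e') : e = e' := by
  refine eq_of_forall_prime (A := R) fun q => ?_
  obtain ⟨x, χ, hχ⟩ := L.exists_genAt (PrimeSpectrum.comap φ q)
  refine ⟨φ (pair χ x), hχ, ?_⟩
  rw [← f.dual_pair, pair_comm _ _ e, pair_comm _ _ e', h]

/-- Maps `f₁ : L₁ → M` and `f₂ : L₂ → M` define a trivialization of the pullback of `L₁^∨ ⊗ L₂`. -/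
theorem exists_trivialization (f₁ : Map φ L₁ M) (f₂ : Map φ L₂ M) :
    ∃ u : Map φ (L₁.dual.tensor L₂) (unit R),
      ∀ χ y, val (u (tmul χ y)) = pair (f₁.dual χ) (f₂ y) := by
  let e : M.dual.tensor M →ₗ[R] unit R := contractLeft R M
  let g : Map (RingHom.id R) (M.dual.tensor M) (unit R) :=
    .ofGenAt e.toAddMonoidHom (fun a m => e.map_smul a m) fun q => by
      obtain ⟨x, χ, hχ⟩ := M.exists_genAt q
      exact ⟨tmul χ x, udual R, hχ⟩
  exact ⟨Map.comp (fun _ => rfl) (f₁.dual.tensor f₂) g, fun χ y => rfl⟩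

/-- A trivialization of the pullback of `L₁^∨ ⊗ L₂` makes a pullback of `L₁` a pullback of `L₂`. -/
theorem exists_map_of_trivialization (f₁ : Map φ L₁ M)
    (u : Map φ (L₁.dual.tensor L₂) (unit R)) :
    ∃ f₂ : Map φ L₂ M, ∀ χ y, val (u (tmul χ y)) = pair (f₁.dual χ) (f₂ y) := by
  obtain ⟨n, ξ, x, h⟩ := L₁.exists_dualBasis
  let F : L₂ →+ M := AddMonoidHom.mk' (fun y => ∑ i, val (u (tmul (ξ i) y)) • f₁ (x i))
    fun y y' => by
      rw [← Finset.sum_add_distrib]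
      refine Finset.sum_congr rfl fun i _ => ?_
      rw [← add_smul, tmul_add, map_add]
      rfl
  have hF : ∀ χ y, pair (f₁.dual χ) (F y) = val (u (tmul χ y)) := fun χ y => by
    refine (pair_sum (L := M) Finset.univ (f₁.dual χ)
      fun i => val (u (tmul (ξ i) y)) • f₁ (x i)).trans ?_
    have h1 : ∀ i, pair (f₁.dual χ) (val (u (tmul (ξ i) y)) • f₁ (x i)) =
        φ (pair (ξ i) (x i)) * val (u (tmul χ y)) := fun i => by
      have h2 : pair χ (x i) • tmul (ξ i) y = pair (ξ i) (x i) • tmul χ y := by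
        rw [← smul_tmul (pair χ (x i)), ← smul_tmul (pair (ξ i) (x i)), pair_smul_comm]
      rw [pair_smul, f₁.dual_pair, mul_comm, ← u.val_smul, ← u.val_smul, h2]
    rw [Finset.sum_congr rfl fun i _ => h1 i, ← Finset.sum_mul, ← map_sum, h, map_one, one_mul]
  refine ⟨.ofGenAt F (fun a y => ?_) fun q => ?_, fun χ y => (hF χ y).symm⟩
  · refine f₁.eq_of_pair fun χ => ?_
    rw [hF, tmul_smul, u.val_smul, pair_smul, hF]
  · by_contra! hq
    -- The image of `u` would consist of functions vanishing at `q`.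
    obtain ⟨z, ζ, hz⟩ := u.exists_genAt q
    have h0 : ∀ χ y, val (u (tmul χ y)) ∈ q.asIdeal := fun χ y => by
      by_contra h
      exact hq y ⟨f₁.dual χ, by rwa [hF]⟩
    have h1 : ∀ z, val (u z) ∈ q.asIdeal := fun z => by
      change L₁.dual ⊗[A] L₂ at z
      induction z using TensorProduct.induction_on with
      | zero => exact (congrArg val (map_zero u.toFun) : val (u.toFun 0) = 0) ▸ zero_mem _
      | tmul χ y => exact h0 χ y
      | add x y hx hy =>
        exact (congrArg val (map_add u.toFun x y) : _ = val (u x) + val (u y)) ▸ add_mem hx hy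
    refine hz ?_
    have := pair_smul ζ (val (u z)) (show unit R from (1 : R))
    rw [show u z = val (u z) • (show unit R from (1 : R)) from (mul_one (val (u z))).symm]
    exact this ▸ Ideal.mul_mem_right _ _ (h1 z)

/-- The isomorphism `L₁ ≅ L₂` given by `f₁` and `f₂` is compatible with `θ : L₂^N ≅ L₁^N` if and
only if it satisfies the equations of `IsIsomRing`. -/
theorem npow_compat_iff {N : ℕ} {f₁ : Map φ L₁ M} {f₂ : Map φ L₂ M}
    {u : Map φ (L₁.dual.tensor L₂) (unit R)}
    (hu : ∀ χ y, val (u (tmul χ y)) = pair (f₁.dual χ) (f₂ y))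
    (θ : L₂.npow N ≃ₗ[A] L₁.npow N) :
    (∀ m, f₁.npow N (θ m) = f₂.npow N m) ↔
      ∀ χ y, val (u (tmul χ y)) ^ N = φ (pair (powDual χ N) (θ (pow y N))) := by
  have h1 : ∀ χ y, φ (pair (powDual χ N) (θ (pow y N))) =
      pair (powDual (f₁.dual χ) N) (f₁.npow N (θ (pow y N))) :=
    fun χ y => (f₁.dual_powDual _ _ _).symm
  have h2 : ∀ χ y, val (u (tmul χ y)) ^ N =
      pair (powDual (f₁.dual χ) N) (f₂.npow N (pow y N)) := fun χ y => by
    rw [hu, Map.npow_pow, pair_powDual]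
  refine ⟨fun h χ y => by rw [h1, h2, h], fun h m => ?_⟩
  refine semilinear_ext (φ := φ) (F := fun m => f₁.npow N (θ m)) (G := fun m => f₂.npow N m)
    (fun a m => ?_) (f₂.npow N).map_smul (fun q => ?_) m
  · exact (congrArg _ (θ.map_smul a m)).trans ((f₁.npow N).map_smul _ _)
  · obtain ⟨y, hy⟩ := L₂.exists_genAt (PrimeSpectrum.comap φ q)
    refine ⟨pow y N, hy.pow N, ?_⟩
    refine eq_of_forall_prime (A := R) fun q => ?_
    obtain ⟨x, χ, hχ⟩ := L₁.exists_genAt (PrimeSpectrum.comap φ q)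
    refine ⟨pair (powDual (f₁.dual χ) N) (f₁.npow N (pow x N)), ?_, ?_⟩
    · rw [f₁.dual_powDual, pair_powDual]
      exact fun h => hχ ((PrimeSpectrum.comap φ q).2.mem_of_pow_mem N h)
    · rw [pair_comm _ _ (f₁.npow N (θ (pow y N))), pair_comm _ _ (f₂.npow N (pow y N)), ← h1, ← h2,
        h]

end InvMod

variable {k : Type u} [Field k]

/-- A ring homomorphism under a `k`-algebra is automatically `k`-linear. -/
theorem exists_hom_of_ringHom {U V W : AffSch k} (q : V ⟶ W) (a : U ⟶ W) (c : V.unop →+* U.unop)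
    (hc : ∀ x, c (ringMap q x) = ringMap a x) :
    ∃ m : U ⟶ V, (∀ x, ringMap m x = c x) ∧ m ≫ q = a := by
  let c' : V.unop →ₐ[k] U.unop :=
    { c with
      commutes' := fun r => by
        have h1 : algebraMap k V.unop r = ringMap q (algebraMap k W.unop r) :=
          (q.unop.hom.commutes r).symm
        have h2 : algebraMap k U.unop r = ringMap a (algebraMap k W.unop r) :=
          (a.unop.hom.commutes r).symm
        exact (congrArg c h1).trans ((hc _).trans h2.symm) }
  refine ⟨(CommAlgCat.ofHom c').op, fun _ => rfl, ?_⟩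
  refine Quiver.Hom.unop_inj (CommAlgCat.hom_ext (AlgHom.ext fun x => hc x))

/-- An algebra over the coordinate ring of an object defines a morphism of affine schemes. -/
theorem exists_ringMap_eq {W : AffSch k} {R : Type u} [CommRing R] (φ : W.unop →+* R)
    (P : ∀ {R : Type u} [CommRing R], (W.unop →+* R) → Prop) (hP : P φ) :
    ∃ (U : AffSch k) (f : U ⟶ W), P (ringMap f) := by
  let _ : Algebra k R := (φ.comp (algebraMap k W.unop)).toAlgebra
  let f : W.unop →ₐ[k] R := { φ with commutes' := fun _ => rfl }
  exact ⟨op (CommAlgCat.of k R), (CommAlgCat.ofHom f).op, hP⟩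

/-- A ring homomorphism out of `O(c)` lifts to a morphism of `C`. The target of the lift has this
ring only up to equality, so the statement is about an arbitrary property `P` of ring homomorphisms.
-/
theorem IsGpdFibration.exists_lift_ringMap {C : Type*} [Category* C] {p : C ⥤ AffSch k}
    (hp : IsGpdFibration p) (c : C) {R : Type u} [CommRing R] (φ : (p.obj c).unop →+* R)
    (P : ∀ {R : Type u} [CommRing R], ((p.obj c).unop →+* R) → Prop) (hP : P φ) :
    ∃ (c' : C) (g : c' ⟶ c), P (ringMap (p.map g)) := by
  obtain ⟨U, f, hf⟩ := exists_ringMap_eq φ P hP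
  obtain ⟨c', g, h, hg⟩ := hp.exists_lift f
  have : ∀ (V : AffSch k) (h : V = U), P (ringMap (eqToHom h ≫ f)) := by
    rintro _ rfl
    rw [eqToHom_refl, Category.id_comp]
    exact hf
  exact ⟨c', g, hg ▸ this _ h⟩

section RootStack

variable {X : AffCat k} {N : ℕ} {L : LineBundle X}

theorem rootProj_gpd (X : AffCat k) (N : ℕ) (L : LineBundle X) : IsGpdFibration (rootProj X N L) :=
  (WithIso.gpd_forget _ _).comp (WithLine.gpd_forget X)

/-- Two `N`-th roots of the same line bundle are isomorphic étale locally, and their isomorphisms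
are represented by a finite étale scheme. -/
theorem rootStack_exists_isRelProd_same (hX : IsGpdFibration X.p) (hN : N ≠ 0) {w : X.obj}
    (hu : IsUnit (N : X.O w))
    (T₁ T₂ : InvMod (X.O w)) (i₁ : T₁.npow N ≃ₗ[X.O w] L.obj w)
    (i₂ : T₂.npow N ≃ₗ[X.O w] L.obj w) :
    ∃ (z : RootObj X N L) (q₁ : z ⟶ ⟨⟨w, T₁⟩, i₁⟩) (q₂ : z ⟶ ⟨⟨w, T₂⟩, i₂⟩)
      (h : (rootProj X N L).obj z ⟶ w),
      IsRelProd (rootProj X N L) (c₁ := ⟨⟨w, T₁⟩, i₁⟩) (c₂ := ⟨⟨w, T₂⟩, i₂⟩) (𝟙 w) (𝟙 w) q₁ q₂ h ∧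
      (X.pull h).Finite ∧ X.EtCover h := by
  let c₁ : RootObj X N L := ⟨⟨w, T₁⟩, i₁⟩
  let c₂ : RootObj X N L := ⟨⟨w, T₂⟩, i₂⟩
  let θ : T₂.npow N ≃ₗ[X.O w] T₁.npow N := i₂.trans i₁.symm
  have hp : IsGpdFibration (rootStack X N L).p := (rootProj_gpd X N L).comp hX
  obtain ⟨R, _, φ, v, hv⟩ := InvMod.exists_isIsomRing θ hN
  obtain ⟨z, q₁, v, hv⟩ := hp.exists_lift_ringMap c₁ φ
    (fun {R} _ φ => ∃ v : InvMod.Map φ (T₁.dual.tensor T₂) (InvMod.unit R), InvMod.IsIsomRing θ φ v)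
    ⟨v, hv⟩
  let g : z.base.base ⟶ w := q₁.base.base
  change InvMod.Map (X.pull g) (T₁.dual.tensor T₂) (InvMod.unit (X.O z.base.base)) at v
  change InvMod.IsIsomRing θ (X.pull g) v at hv
  let τ₁ : InvMod.Map (X.pull g) T₁ z.base.line := q₁.base.line
  obtain ⟨τ₂, hτ₂⟩ := InvMod.exists_map_of_trivialization τ₁ v
  have hz : ∀ m, z.iso (τ₁.npow N m) = L.map g (i₁ m) := q₁.comm
  have hc := (InvMod.npow_compat_iff hτ₂ θ).mpr hv.rel
  have hz₂ : ∀ m : T₂.npow N, z.iso (τ₂.npow N m) = L.map g (i₂ m) := fun m =>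
    (congrArg z.iso (hc m).symm).trans ((hz _).trans (congrArg _ (i₁.apply_symm_apply _)))
  let q₂ : z ⟶ c₂ := ⟨⟨g, τ₂⟩, hz₂⟩
  refine ⟨z, q₁, q₂, g, ⟨Category.comp_id _, Category.comp_id _, ?_⟩, hv.finite_etSurj hN hu⟩
  rintro t a₁ ⟨⟨b₂, σ₂⟩, hσ₂⟩ b h₁ h₂
  obtain rfl : b = b₂ := (Category.comp_id b).symm.trans h₂
  obtain ⟨⟨b₁, σ₁⟩, hσ₁⟩ := a₁
  obtain rfl : b = b₁ := (Category.comp_id b).symm.trans h₁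
  change ∀ m, t.iso (σ₂.npow N m) = L.map b (i₂ m) at hσ₂
  change ∀ m, t.iso (σ₁.npow N m) = L.map b (i₁ m) at hσ₁
  obtain ⟨u, hu⟩ := InvMod.exists_trivialization σ₁ σ₂
  obtain ⟨c, ⟨hcφ, hcv⟩, hcu⟩ := hv.desc (X.pull b) u ((InvMod.npow_compat_iff hu θ).mp fun m =>
    t.iso.injective (by
      rw [hσ₂]
      refine (hσ₁ _).trans (congrArg _ (i₁.apply_symm_apply _))))
  let a₁ : t ⟶ c₁ := ⟨⟨b, σ₁⟩, hσ₁⟩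
  obtain ⟨m₀, hm₀, hm₀'⟩ := exists_hom_of_ringHom ((rootStack X N L).p.map q₁)
    ((rootStack X N L).p.map a₁) c hcφ
  obtain ⟨m, ⟨hm, hma⟩, hmu⟩ := hp.cartesian q₁ a₁ m₀ hm₀'
  have hpull : ∀ x, X.pull m.base.base x = c x := fun x =>
    (congrArg (fun m : (rootStack X N L).p.obj t ⟶ (rootStack X N L).p.obj z => ringMap m x) hm).trans
      (hm₀ x)
  -- The values of the pairing of `σ₁` and `σ₂` determine the morphism to `z`.
  have key : ∀ m : t ⟶ z, m ≫ q₁ = a₁ → ∀ χ y, InvMod.pair (σ₁.dual χ) (m.base.line (τ₂ y)) =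
      X.pull m.base.base (InvMod.val (v (InvMod.tmul χ y))) := fun m hm χ y => by
    have hb : m.base.base ≫ g = b := congrArg (fun f : t ⟶ c₁ => f.base.base) hm
    have h1 : σ₁.IsComp τ₁ m.base.line := fun x =>
      (WithLine.line_congr (congrArg (fun f : t ⟶ c₁ => f.base) hm) x).symm
    rw [h1.dual (fun x => by rw [← hb, X.pull_comp]), InvMod.Map.dual_pair, hτ₂]
  refine ⟨m, ⟨hma, ?_, congrArg (fun f : t ⟶ c₁ => f.base.base) hma⟩, ?_⟩
  · refine WithIso.Hom.ext (WithLine.Hom.ext (congrArg (fun f : t ⟶ c₁ => f.base.base) hma)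
      fun y => ?_)
    refine σ₁.eq_of_pair fun χ => ?_
    refine (key m hma χ y).trans ?_
    exact (hpull _).trans ((hcv _).trans (hu χ y))
  · rintro m' ⟨h1, h2, -⟩
    refine hmu m' ⟨?_, h1⟩
    have h3 : X.pull m'.base.base = c := hcu _ ⟨fun x => ?_, fun q => ?_⟩
    · refine Quiver.Hom.unop_inj (CommAlgCat.hom_ext (AlgHom.ext fun x => ?_))
      exact (RingHom.congr_fun h3 x).trans (hm₀ x).symm
    · have hb : m'.base.base ≫ g = b := congrArg (fun f : t ⟶ c₁ => f.base.base) h1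
      rw [← hb]
      exact (X.pull_comp _ _ _).symm
    · refine DFunLike.congr_fun (InvMod.tensor_hom_ext (M := InvMod.unit (X.O t.base.base))
        (f := (InvMod.Map.unit (X.pull m'.base.base)).toFun.comp v.toFun) (g := u.toFun)
        fun χ y => ?_) q
      refine (key m' h1 χ y).symm.trans (Eq.trans ?_ (hu χ y).symm)
      exact congrArg _ (WithLine.line_congr (congrArg (fun f : t ⟶ c₂ => f.base) h2) y)

/-- Two `N`-th roots over the same base are isomorphic over a finite étale covering, and this
covering represents the isomorphisms between them. -/
theorem rootStack_exists_isRelProd (hX : IsGpdFibration X.p) (hN : N ≠ 0)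
    (hu : ∀ x : X.obj, IsUnit (N : X.O x)) (c₁ c₂ : RootObj X N L) {w : X.obj}
    (p₁ : w ⟶ (rootProj X N L).obj c₁) (p₂ : w ⟶ (rootProj X N L).obj c₂) :
    ∃ (z : RootObj X N L) (q₁ : z ⟶ c₁) (q₂ : z ⟶ c₂) (h : (rootProj X N L).obj z ⟶ w),
      IsRelProd (rootProj X N L) p₁ p₂ q₁ q₂ h ∧ (X.pull h).Finite ∧ X.EtCover h := by
  have hG := rootProj_gpd X N L
  have key : ∀ c (p : w ⟶ (rootProj X N L).obj c), ∃ (T : InvMod (X.O w))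
      (i : T.npow N ≃ₗ[X.O w] L.obj w) (g : (⟨⟨w, T⟩, i⟩ : RootObj X N L) ⟶ c),
      (rootProj X N L).map g = p := fun c p => by
    obtain ⟨⟨⟨w', T⟩, i⟩, g, h, hg⟩ := hG.exists_lift p
    obtain rfl : w' = w := h
    exact ⟨T, i, g, hg.trans (Category.id_comp p)⟩
  obtain ⟨T₁, i₁, g₁, rfl⟩ := key c₁ p₁
  obtain ⟨T₂, i₂, g₂, rfl⟩ := key c₂ p₂
  obtain ⟨z, q₁, q₂, h, H, hf⟩ := rootStack_exists_isRelProd_same hX hN (hu w) T₁ T₂ i₁ i₂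
  exact ⟨z, _, _, h, H.comp hG g₁ g₂ (Category.id_comp _) (Category.id_comp _), hf⟩

end RootStack

end

/-! ### Isomorphisms between tensor monomials -/

section

namespace InvMod

variable {A B : Type u} [CommRing A] [CommRing B] {L L' P Q : InvMod A}

/-- `F` is homogeneous of degree `n`. -/
def Homog (n : ℕ) (F : L → P) : Prop := ∀ (a : A) (x : L), F (a • x) = a ^ n • F x

theorem Homog.swap {n : ℕ} {F : L → P} {G : L → Q} (hF : Homog n F) (hG : Homog n G) (x x' : L) :
    tmul (F x) (G x') = tmul (F x') (G x) := by
  refine eq_of_forall_prime (A := A) fun p => ?_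
  obtain ⟨y, χ, hχ⟩ := L.exists_genAt p
  refine ⟨pair χ y ^ n * pair χ y ^ n, fun h => ?_, ?_⟩
  · exact (p.2.mem_or_mem h).elim (fun h => hχ (p.2.mem_of_pow_mem _ h))
      fun h => hχ (p.2.mem_of_pow_mem _ h)
  · have key : ∀ x x', (pair χ y ^ n * pair χ y ^ n) • tmul (F x) (G x') =
        (pair χ x ^ n * pair χ x' ^ n) • tmul (F y) (G y) := fun x x' => by
      rw [mul_smul, mul_smul, ← tmul_smul, ← smul_tmul, ← tmul_smul, ← smul_tmul, ← hF, ← hG,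
        ← hF, ← hG, pair_comm χ y, pair_comm χ y]
    rw [key, key, mul_comm]

/-- The symmetry `F s ⊗ G s' = F s' ⊗ G s` can be checked in one variable at a time, if `F` and `G`
are homogeneous of the same degree `n` in the first one. -/
theorem swap_prod {S : Type*} {n : ℕ} {F : L × S → P} {G : L × S → Q}
    (hF : ∀ s, Homog n fun x => F (x, s)) (hG : ∀ s, Homog n fun x => G (x, s))
    (h : ∀ x x' s s', tmul (F (x, s)) (G (x', s')) = tmul (F (x, s')) (G (x', s)))
    (s s' : L × S) : tmul (F s) (G s') = tmul (F s') (G s) :=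
  (h s.1 s'.1 s.2 s'.2).trans ((hF s'.2).swap (hG s.2) s.1 s'.1)

/-- Let `F s` and `G s` be sections of `P` and `Q` which depend on a parameter `s`, generate `P`
and `Q` locally, and change by the same factor when `s` changes. Then `F s ↦ G s` defines an
isomorphism. -/
theorem exists_equiv_of_swap {S : Type u} (F : S → P) (G : S → Q)
    (hF : ∀ p : PrimeSpectrum A, ∃ s, GenAt p (F s))
    (hG : ∀ p : PrimeSpectrum A, ∃ s, GenAt p (G s))
    (h : ∀ s s', tmul (F s) (G s') = tmul (F s') (G s)) :
    ∃ e : P ≃ₗ[A] Q, ∀ s, e (F s) = G s := by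
  have h1 : Ideal.span (Set.range fun i : P.dual × S => pair i.1 (F i.2)) = ⊤ := by
    by_contra hI
    obtain ⟨p, hp, hle⟩ := Ideal.exists_le_maximal _ hI
    obtain ⟨s, χ, hs⟩ := hF ⟨p, hp.isPrime⟩
    exact hs (hle (Ideal.subset_span ⟨(χ, s), rfl⟩))
  obtain ⟨c, hc⟩ := Finsupp.mem_span_range_iff_exists_finsupp.mp ((Ideal.eq_top_iff_one _).mp h1)
  let E : P →ₗ[A] Q := ∑ i ∈ c.support, c i • (LinearMap.toSpanSingleton A Q (G i.2)).comp
    (show Module.Dual A P from i.1)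
  have hE : ∀ s, E (F s) = G s := fun s => by
    have h2 : ∀ i : P.dual × S, pair i.1 (F s) • G i.2 = pair i.1 (F i.2) • G s := fun i =>
      congrArg ((TensorProduct.lid A Q).toLinearMap ∘ₗ LinearMap.rTensor Q
        (show Module.Dual A P from i.1)) (h s i.2)
    refine (LinearMap.sum_apply _ _ _).trans ?_
    have h3 : ∀ i : P.dual × S, (c i • (LinearMap.toSpanSingleton A Q (G i.2)).comp
        (show Module.Dual A P from i.1)) (F s) = (c i • pair i.1 (F i.2)) • G s := fun i => by
      rw [smul_assoc, ← h2]; rfl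
    rw [Finset.sum_congr rfl fun i _ => h3 i, ← Finset.sum_smul]
    exact (congrArg (· • G s) hc).trans (one_smul _ _)
  refine ⟨LinearEquiv.ofBijective E (bijective_of_genAt E fun p => ?_), hE⟩
  obtain ⟨s, hs⟩ := hG p
  exact ⟨F s, by rwa [hE]⟩

/-- `(L^m ⊗ L'^n)^N ≅ L^{N m} ⊗ L'^{N n}`. -/
theorem exists_powEquiv (L L' : InvMod A) {m n N m' n' : ℕ} (hm : m' = N * m) (hn : n' = N * n) :
    ∃ e : ((L.npow m).tensor (L'.npow n)).npow N ≃ₗ[A] ((L.npow m').tensor (L'.npow n')),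
      ∀ x y, e (pow (tmul (pow x m) (pow y n)) N) = tmul (pow x m') (pow y n') := by
  have h1 : ∀ p : PrimeSpectrum A, ∃ (x : L) (y : L'), GenAt p x ∧ GenAt p y := fun p => by
    obtain ⟨x, hx⟩ := L.exists_genAt p
    obtain ⟨y, hy⟩ := L'.exists_genAt p
    exact ⟨x, y, hx, hy⟩
  let F : L × L' → ((L.npow m).tensor (L'.npow n)).npow N :=
    fun s => pow (tmul (pow s.1 m) (pow s.2 n)) N
  let G : L × L' → (L.npow m').tensor (L'.npow n') := fun s => tmul (pow s.1 m') (pow s.2 n')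
  have hs : ∀ s s', tmul (F s) (G s') = tmul (F s') (G s) := by
    refine swap_prod (n := m') (fun y a x => ?_) (fun y a x => ?_) fun x x' =>
      Homog.swap (n := n') (fun a y => ?_) (fun a y => ?_)
    · simp only [F, pow_smul, smul_tmul, ← pow_mul, hm, mul_comm]
    · simp only [G, pow_smul, smul_tmul]
    · simp only [F, pow_smul, tmul_smul, ← pow_mul, hn, mul_comm]
    · simp only [G, pow_smul, tmul_smul]
  obtain ⟨e, he⟩ := exists_equiv_of_swap F G (fun p => by
      obtain ⟨x, y, hx, hy⟩ := h1 p
      exact ⟨(x, y), ((hx.pow m).tmul (hy.pow n)).pow N⟩) (fun p => by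
      obtain ⟨x, y, hx, hy⟩ := h1 p
      exact ⟨(x, y), (hx.pow m').tmul (hy.pow n')⟩) hs
  exact ⟨e, fun x y => he (x, y)⟩

end InvMod

end

/-! ### The modified stack as a root stack -/

section

namespace InvMod

variable {A B : Type u} [CommRing A] [CommRing B] {φ : A →+* B}

/-- The isomorphism `(L^m ⊗ L'^n)^N ≅ L^{N m} ⊗ L'^{N n}`. -/
def powEquiv (L L' : InvMod A) {m n N m' n' : ℕ} (hm : m' = N * m) (hn : n' = N * n) :
    ((L.npow m).tensor (L'.npow n)).npow N ≃ₗ[A] ((L.npow m').tensor (L'.npow n')) :=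
  (exists_powEquiv L L' hm hn).choose

theorem powEquiv_apply {L L' : InvMod A} {m n N m' n' : ℕ} (hm : m' = N * m) (hn : n' = N * n)
    (x : L) (y : L') :
    powEquiv L L' hm hn (pow (tmul (pow x m) (pow y n)) N) = tmul (pow x m') (pow y n') :=
  (exists_powEquiv L L' hm hn).choose_spec x y

theorem powEquiv_map {L L' : InvMod A} {M M' : InvMod B} (f : Map φ L M) (f' : Map φ L' M')
    {m n N m' n' : ℕ} (hm : m' = N * m) (hn : n' = N * n)
    (z : ((L.npow m).tensor (L'.npow n)).npow N) :
    powEquiv M M' hm hn (((f.npow m).tensor (f'.npow n)).npow N z) =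
      (f.npow m').tensor (f'.npow n') (powEquiv L L' hm hn z) := by
  refine semilinear_ext (φ := φ)
    (F := fun z => powEquiv M M' hm hn (((f.npow m).tensor (f'.npow n)).npow N z))
    (G := fun z => (f.npow m').tensor (f'.npow n') (powEquiv L L' hm hn z))
    (fun a z => ?_) (fun a z => ?_) (fun q => ?_) z
  · exact (congrArg _ (Map.map_smul _ a z)).trans (map_smul _ _ _)
  · exact (congrArg _ (map_smul _ a z)).trans (Map.map_smul _ _ _)
  · obtain ⟨x, hx⟩ := L.exists_genAt (PrimeSpectrum.comap φ q)
    obtain ⟨y, hy⟩ := L'.exists_genAt (PrimeSpectrum.comap φ q)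
    refine ⟨_, ((hx.pow m).tmul (hy.pow n)).pow N, ?_⟩
    simp only [Map.npow_pow, Map.tensor_apply, powEquiv_apply]

variable {L L' : InvMod A} {M M' : InvMod B} {f : Map φ L M} {f' : Map φ L' M'} {x : L} {χ : L.dual}
  {y : L'} {ζ : L'.dual} {x₀ : M} {χ₀ : M.dual} {y₀ : M'} {ζ₀ : M'.dual} {t t' : Bˣ}

theorem Map.tensor_npow_dual (hx : pair χ x = 1) (hx₀ : pair χ₀ x₀ = 1) (ht : f x = t • x₀)
    (ht' : f' y = t' • y₀) (m n : ℕ) :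
    (f.dual.npow m).tensor (f'.npow n) (tmul (pow χ m) (pow y n)) =
      (t⁻¹ ^ m * t' ^ n) • tmul (pow χ₀ m) (pow y₀ n) := by
  rw [Map.tensor_apply, Map.npow_pow, Map.npow_pow, Map.dual_gen f hx hx₀ ht, ht', units_pow_smul,
    units_pow_smul]
  rw [Units.smul_def, Units.smul_def, Units.smul_def, smul_tmul, tmul_smul, smul_smul,
    Units.val_mul]

theorem Map.tensor_zpow (hx : pair χ x = 1) (hx₀ : pair χ₀ x₀ = 1) (ht : f x = t • x₀)
    (hy : pair ζ y = 1) (hy₀ : pair ζ₀ y₀ = 1) (ht' : f' y = t' • y₀) (m n : ℤ) :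
    (f.zpow m).tensor (f'.zpow n) (tmul (zgen x χ m) (zgen y ζ n)) =
      (t ^ m * t' ^ n) • tmul (zgen x₀ χ₀ m) (zgen y₀ ζ₀ n) := by
  rw [Map.tensor_apply, Map.zpow_zgen f hx hx₀ ht, Map.zpow_zgen f' hy hy₀ ht']
  rw [Units.smul_def, Units.smul_def, Units.smul_def, smul_tmul, tmul_smul, smul_smul,
    Units.val_mul]

end InvMod

section Unimodular

variable {a b : ℤ} {c d : ℕ}

theorem unimodular_add {M : Type*} [AddCommGroup M] (h : a * c + b * d = 1) (x y : M) :
    x = (-b) • (d • (-x) + c • y) + c • (a • x + b • y) ∧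
      y = a • (d • (-x) + c • y) + d • (a • x + b • y) := by
  simp only [← natCast_zsmul]
  constructor
  · linear_combination (norm := module) (-h) • x
  · linear_combination (norm := module) (-h) • y

/-- The inverse of the matrix of exponents of `(x⁻¹ ^ d * y ^ c, x ^ a * y ^ b)`. -/
theorem unimodular {M : Type*} [CommGroup M] (h : a * c + b * d = 1) (x y : M) :
    x = (x⁻¹ ^ d * y ^ c) ^ (-b) * (x ^ a * y ^ b) ^ c ∧
      y = (x⁻¹ ^ d * y ^ c) ^ a * (x ^ a * y ^ b) ^ d :=
  unimodular_add (M := Additive M) h x y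

theorem unimodular_add' {M : Type*} [AddCommGroup M] (h : a * c + b * d = 1) (s v : M) :
    d • (-((-b) • s + c • v)) + c • (a • s + d • v) = s ∧
      a • ((-b) • s + c • v) + b • (a • s + d • v) = v := by
  simp only [← natCast_zsmul]
  constructor
  · linear_combination (norm := module) h • s
  · linear_combination (norm := module) h • v

theorem unimodular' {M : Type*} [CommGroup M] (h : a * c + b * d = 1) (s v : M) :
    (s ^ (-b) * v ^ c)⁻¹ ^ d * (s ^ a * v ^ d) ^ c = s ∧
      (s ^ (-b) * v ^ c) ^ a * (s ^ a * v ^ d) ^ b = v :=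
  unimodular_add' (M := Additive M) h s v

end Unimodular

variable {k : Type u} [Field k]

theorem LineBundle.exists_isGen {X : AffCat k} (hX : IsGpdFibration X.p) (L : LineBundle X)
    (x : X.obj) : ∃ (x' : X.obj) (g : x' ⟶ x), X.EtCover g ∧ ∃ e : L.obj x', InvMod.IsGen e := by
  obtain ⟨B, _, φ, hφ, y, hy⟩ := (L.obj x).exists_etSurj_isGen
  obtain ⟨x', g, hg, y, hy⟩ := hX.exists_lift_ringMap x φ
    (fun {R} _ φ => EtSurj φ ∧ ∃ y : (L.obj x).pullback φ, InvMod.IsGen y) ⟨hφ, y, hy⟩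
  obtain ⟨f, -⟩ := ((L.obj x).toPullback (X.pull g)).exists_factor (ψ := RingHom.id _)
    (fun _ => rfl) (L.map g)
  exact ⟨x', g, hg, f y, hy.map f⟩

namespace InputData

variable (D : InputData k) (a b : ℤ)

theorem gpd_hatToX₂ : IsGpdFibration (D.hatToX₂ a b) :=
  (WithIso.gpd_forget _ _).comp (WithIso.gpd_forget _ _)

theorem gpd_hatToX : IsGpdFibration (D.hatToX a b) :=
  (D.gpd_hatToX₂ a b).comp ((WithLine.gpd_forget _).comp (WithLine.gpd_forget _))

variable {D}

theorem isStack_XHat (hX : D.X.IsStack) : (D.XHat a b).IsStack :=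
  (hX.withLine.withLine.withIso D.N₁ D.LinfDual).withIso (D.N₂ a b) (LineBundle.unit D.X₃)

/-- The line bundles `L₁` and `L₂` are trivial at `y`. -/
def IsTrivial {a b : ℤ} (y : D.HatObj a b) : Prop :=
  (∃ e : (D.L₁ a b).obj y, InvMod.IsGen e) ∧ ∃ e : (D.L₂ a b).obj y, InvMod.IsGen e

theorem exists_isTrivial {a b : ℤ} (hX : D.X.IsStack) (y : D.HatObj a b) :
    ∃ (y' : D.HatObj a b) (g : y' ⟶ y), IsTrivial y' ∧ (D.XHat a b).EtCover g := by
  obtain ⟨y₁, g₁, h₁, e₁, he₁⟩ := (D.L₁ a b).exists_isGen (isStack_XHat a b hX).gpd y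
  obtain ⟨y₂, g₂, h₂, e₂, he₂⟩ := (D.L₂ a b).exists_isGen (isStack_XHat a b hX).gpd y₁
  exact ⟨y₂, g₂ ≫ g₁, ⟨⟨_, he₁.map ((D.L₁ a b).map g₂)⟩, _, he₂⟩, .comp h₂ h₁⟩

variable {N c d : ℕ} (hd : D.d = N * d) (hc : D.ℓ = N * c)

/-- The line bundle `L₁^{-d} ⊗ L₂^c`. -/
def rootLine (D : InputData k) (a b : ℤ) (d c : ℕ) : LineBundle (D.XHat a b) :=
  ((D.L₁ a b).dual.npow d).tensor ((D.L₂ a b).npow c)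

/-- The universal isomorphism `L₁^{-d} ⊗ L₂^ℓ ≅ 𝐋_∞^∨`. -/
def hatIso {a b : ℤ} (y : D.HatObj a b) :
    (((D.L₁ a b).obj y).dual.npow D.d).tensor (((D.L₂ a b).obj y).npow D.ℓ) ≃ₗ[(D.XHat a b).O y]
      (D.Linf.dual.comap (D.hatToX a b)).obj y :=
  y.base.iso

/-- The isomorphism `(L₁^{-d'} ⊗ L₂^c)^N ≅ L₁^{-d} ⊗ L₂^ℓ ≅ 𝐋_∞^∨`. -/
def rootIso {a b : ℤ} (y : D.HatObj a b) :
    ((rootLine D a b d c).obj y).npow N ≃ₗ[(D.XHat a b).O y]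
      (D.Linf.dual.comap (D.hatToX a b)).obj y :=
  (InvMod.powEquiv ((D.L₁ a b).obj y).dual ((D.L₂ a b).obj y) hd hc).trans (hatIso y)

theorem rootIso_map {a b : ℤ} {x y : D.HatObj a b} (g : x ⟶ y)
    (z : ((rootLine D a b d c).obj y).npow N) :
    rootIso hd hc x (((rootLine D a b d c).map g).npow N z) =
      D.Linf.dual.map ((D.hatToX a b).map g) (rootIso hd hc y z) :=
  (congrArg x.base.iso (InvMod.powEquiv_map ((D.L₁ a b).map g).dual ((D.L₂ a b).map g) hd hc
    z)).trans (g.base.comm _)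

/-- The modified stack maps to the stack of `N`-th roots of `𝐋_∞^∨`, where `d = N d'` and `ℓ = N c`,
by `(L₁, L₂) ↦ L₁^{-d'} ⊗ L₂^c`. -/
def toRootStack : D.HatObj a b ⥤ RootObj D.X N D.Linf.dual where
  obj y := ⟨⟨(D.hatToX a b).obj y, (rootLine D a b d c).obj y⟩, rootIso hd hc y⟩
  map g := ⟨⟨(D.hatToX a b).map g, (rootLine D a b d c).map g⟩, rootIso_map hd hc g⟩
  map_id y := WithIso.Hom.ext (WithLine.Hom.ext rfl ((rootLine D a b d c).map_id y))
  map_comp f g := WithIso.Hom.ext (WithLine.Hom.ext rfl ((rootLine D a b d c).map_comp f g))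

end InputData

end

section

variable {k : Type u} [Field k]

namespace InvMod

variable {A B : Type u} [CommRing A] [CommRing B] {φ : A →+* B} {L : InvMod A} {M : InvMod B}

/-- A pullback map sends generators to generators. -/
theorem Map.exists_units (f : Map φ L M) {x : L} {y : M} (hx : IsGen x) (hy : IsGen y) :
    ∃ t : Bˣ, f x = t • y :=
  exists_unit_smul hy (hx.map f)

/-- Two maps of line bundles commute with isomorphisms if they do so on a generator. -/
theorem Map.comm_of_isGen {L' : InvMod A} {M' : InvMod B} (f : Map φ L M) (f' : Map φ L' M')
    (e : L ≃ₗ[A] L') (e' : M ≃ₗ[B] M') {x : L} (hx : IsGen x) (h : e' (f x) = f' (e x)) (m : L) :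
    e' (f m) = f' (e m) :=
  semilinear_ext_gen (F := fun m => e' (f m)) (G := fun m => f' (e m))
    (fun a m => (congrArg e' (f.map_smul a m)).trans (e'.map_smul _ _))
    (fun a m => (congrArg f' (e.map_smul a m)).trans (f'.map_smul _ _)) hx h m

end InvMod

namespace InputData

open InvMod

variable {D : InputData k} {a b : ℤ}

/-- The universal isomorphism `L₁^a ⊗ L₂^b ≅ O`. -/
def hatTriv (y : D.HatObj a b) :
    (((D.L₁ a b).obj y).zpow a).tensor (((D.L₂ a b).obj y).zpow b) ≃ₗ[(D.XHat a b).O y]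
      InvMod.unit ((D.XHat a b).O y) :=
  y.iso

theorem hatIso_map {x y : D.HatObj a b} (g : x ⟶ y)
    (m : (((D.L₁ a b).obj y).dual.npow D.d).tensor (((D.L₂ a b).obj y).npow D.ℓ)) :
    hatIso x ((((D.L₁ a b).map g).dual.npow D.d).tensor (((D.L₂ a b).map g).npow D.ℓ) m) =
      D.Linf.dual.map ((D.hatToX a b).map g) (hatIso y m) :=
  g.base.comm m

theorem hatTriv_map {x y : D.HatObj a b} (g : x ⟶ y)
    (m : (((D.L₁ a b).obj y).zpow a).tensor (((D.L₂ a b).obj y).zpow b)) :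
    hatTriv x ((((D.L₁ a b).map g).zpow a).tensor (((D.L₂ a b).map g).zpow b) m) =
      Map.unit ((D.XHat a b).pull g) (hatTriv y m) :=
  g.comm m

theorem hatObj_hom_ext {x y : D.HatObj a b} {f g : x ⟶ y}
    (h : (D.hatToX a b).map f = (D.hatToX a b).map g)
    (h₁ : ∀ m, (D.L₁ a b).map f m = (D.L₁ a b).map g m)
    (h₂ : ∀ m, (D.L₂ a b).map f m = (D.L₂ a b).map g m) : f = g :=
  WithIso.Hom.ext (WithIso.Hom.ext (WithLine.Hom.ext (WithLine.Hom.ext h h₁) h₂))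

/-- A morphism of the modified stack is a morphism `f` of `∞_𝒳` with pullback maps along `f` for
`L₁` and `L₂`, compatible with the universal isomorphisms. -/
theorem exists_hatObj_hom {x y : D.HatObj a b} (f : (D.hatToX a b).obj x ⟶ (D.hatToX a b).obj y)
    (τ₁ : Map (D.X.pull f) ((D.L₁ a b).obj y) ((D.L₁ a b).obj x))
    (τ₂ : Map (D.X.pull f) ((D.L₂ a b).obj y) ((D.L₂ a b).obj x))
    (h₁ : ∀ m, hatIso x ((τ₁.dual.npow D.d).tensor (τ₂.npow D.ℓ) m) =
      D.Linf.dual.map f (hatIso y m))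
    (h₂ : ∀ m, hatTriv x ((τ₁.zpow a).tensor (τ₂.zpow b) m) =
      Map.unit (D.X.pull f) (hatTriv y m)) :
    ∃ g : x ⟶ y, (D.hatToX a b).map g = f ∧ (∀ m, (D.L₁ a b).map g m = τ₁ m) ∧
      ∀ m, (D.L₂ a b).map g m = τ₂ m :=
  ⟨⟨⟨⟨⟨f, τ₁⟩, τ₂⟩, h₁⟩, h₂⟩, rfl, fun _ => rfl, fun _ => rfl⟩

/-- Morphisms of the modified stack with the same image in `∞_𝒳` scale a generator of
`L₁^a ⊗ L₂^b` in the same way. -/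
theorem hat_zpow_eq {x y : D.HatObj a b} {f g : x ⟶ y}
    (h : (D.hatToX a b).map f = (D.hatToX a b).map g)
    (m : (((D.L₁ a b).obj y).zpow a).tensor (((D.L₂ a b).obj y).zpow b)) :
    (((D.L₁ a b).map f).zpow a).tensor (((D.L₂ a b).map f).zpow b) m =
      (((D.L₁ a b).map g).zpow a).tensor (((D.L₂ a b).map g).zpow b) m := by
  refine (hatTriv x).injective ((hatTriv_map f m).trans (Eq.trans ?_ (hatTriv_map g m).symm))
  change D.X.pull ((D.hatToX a b).map f) _ = D.X.pull ((D.hatToX a b).map g) _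
  rw [h]

variable {N c d : ℕ}

/-- `(t₁, t₂)` is determined by `t₁^{-d} t₂^c` and `t₁^a t₂^b`, because the matrix of exponents has
determinant `-(a c + b d) = -1`. So `toRootStack` is injective on morphisms between objects with
trivial line bundles. -/
theorem toRootStack_injective (hd : D.d = N * d) (hc : D.ℓ = N * c) (hab : a * c + b * d = 1)
    {x y : D.HatObj a b} (hx : IsTrivial x) (hy : IsTrivial y) (f g : x ⟶ y)
    (h : (toRootStack a b hd hc).map f = (toRootStack a b hd hc).map g) : f = g := by
  obtain ⟨⟨e₁, δ₁, h₁⟩, e₂, δ₂, h₂⟩ := hx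
  obtain ⟨⟨e₁', δ₁', h₁'⟩, e₂', δ₂', h₂'⟩ := hy
  have hb : (D.hatToX a b).map f = (D.hatToX a b).map g := congrArg (fun h => h.base.base) h
  obtain ⟨t₁, ht₁⟩ := ((D.L₁ a b).map f).exists_units ⟨δ₁', h₁'⟩ ⟨δ₁, h₁⟩
  obtain ⟨t₂, ht₂⟩ := ((D.L₂ a b).map f).exists_units ⟨δ₂', h₂'⟩ ⟨δ₂, h₂⟩
  obtain ⟨s₁, hs₁⟩ := ((D.L₁ a b).map g).exists_units ⟨δ₁', h₁'⟩ ⟨δ₁, h₁⟩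
  obtain ⟨s₂, hs₂⟩ := ((D.L₂ a b).map g).exists_units ⟨δ₂', h₂'⟩ ⟨δ₂, h₂⟩
  have key₁ : t₁⁻¹ ^ d * t₂ ^ c = s₁⁻¹ ^ d * s₂ ^ c := by
    refine Units.ext (((isGen_dual h₁).pow d).tmul (IsGen.pow ⟨δ₂, h₂⟩ c) |>.smul_inj ?_)
    exact (Map.tensor_npow_dual h₁' h₁ ht₁ ht₂ d c).symm.trans
      ((WithLine.line_congr (congrArg (fun h => h.base) h) _).trans
        (Map.tensor_npow_dual h₁' h₁ hs₁ hs₂ d c))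
  have key₂ : t₁ ^ a * t₂ ^ b = s₁ ^ a * s₂ ^ b := by
    refine Units.ext (((isGen_zgen h₁ a).tmul (isGen_zgen h₂ b)).smul_inj ?_)
    exact (Map.tensor_zpow h₁' h₁ ht₁ h₂' h₂ ht₂ a b).symm.trans
      ((hat_zpow_eq hb _).trans (Map.tensor_zpow h₁' h₁ hs₁ h₂' h₂ hs₂ a b))
  have e₁ : t₁ = s₁ := by
    rw [(unimodular hab t₁ t₂).1, key₁, key₂, ← (unimodular hab s₁ s₂).1]
  have e₂ : t₂ = s₂ := by
    rw [(unimodular hab t₁ t₂).2, key₁, key₂, ← (unimodular hab s₁ s₂).2]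
  have hp : ∀ z, (D.XHat a b).pull f z = (D.XHat a b).pull g z := fun z => by
    change D.X.pull ((D.hatToX a b).map f) _ = D.X.pull ((D.hatToX a b).map g) _
    rw [hb]
  refine hatObj_hom_ext hb ?_ ?_
  · exact semilinear_ext_gen ((D.L₁ a b).map f).map_smul
      (fun z m => (Map.map_smul _ _ _).trans (by rw [hp])) ⟨δ₁', h₁'⟩
      (ht₁.trans ((congrArg (· • _) e₁).trans hs₁.symm))
  · exact semilinear_ext_gen ((D.L₂ a b).map f).map_smul
      (fun z m => (Map.map_smul _ _ _).trans (by rw [hp])) ⟨δ₂', h₂'⟩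
      (ht₂.trans ((congrArg (· • _) e₂).trans hs₂.symm))

/-- By unimodularity of the matrix of exponents, units `t₁`, `t₂` with prescribed `t₁^{-d} t₂^c` and
`t₁^a t₂^b` exist. So a morphism of roots between objects with trivial line bundles is induced by
isomorphisms of `L₁` and `L₂` which are compatible with the trivialization of `L₁^a ⊗ L₂^b`. -/
theorem exists_hatObj_hom_of_rootLine (hd : D.d = N * d) (hc : D.ℓ = N * c)
    (hab : a * c + b * d = 1) {x y : D.HatObj a b} (hx : IsTrivial x) (hy : IsTrivial y)
    (f : (D.hatToX a b).obj x ⟶ (D.hatToX a b).obj y)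
    (σ : Map (D.X.pull f) ((rootLine D a b d c).obj y) ((rootLine D a b d c).obj x))
    (hσ : ∀ m, rootIso hd hc x (σ.npow N m) = D.Linf.dual.map f (rootIso hd hc y m)) :
    ∃ g : x ⟶ y, (D.hatToX a b).map g = f ∧ ∀ m, (rootLine D a b d c).map g m = σ m := by
  obtain ⟨⟨e₁, δ₁, h₁⟩, e₂, δ₂, h₂⟩ := hx
  obtain ⟨⟨e₁', δ₁', h₁'⟩, e₂', δ₂', h₂'⟩ := hy
  obtain ⟨s, hs⟩ : ∃ s : ((D.XHat a b).O x)ˣ, σ (InvMod.tmul (pow δ₁' d) (pow e₂' c)) =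
      s • InvMod.tmul (pow δ₁ d) (pow e₂ c) := σ.exists_units
    (((isGen_dual h₁').pow d).tmul (IsGen.pow ⟨δ₂', h₂'⟩ c))
    (((isGen_dual h₁).pow d).tmul (IsGen.pow ⟨δ₂, h₂⟩ c))
  obtain ⟨v, hv⟩ := exists_unit_smul (((isGen_zgen h₁ a).tmul (isGen_zgen h₂ b)).equiv (hatTriv x))
    ((((isGen_zgen h₁' a).tmul (isGen_zgen h₂' b)).equiv (hatTriv y)).map (Map.unit (D.X.pull f)))
  obtain ⟨hs', hv'⟩ := unimodular' hab s v
  obtain ⟨τ₁, hτ₁⟩ := Map.exists_of_isGen (D.X.pull f) (⟨δ₁', h₁'⟩ : IsGen e₁')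
    (IsGen.units_smul ⟨δ₁, h₁⟩ (s ^ (-b) * v ^ c))
  obtain ⟨τ₂, hτ₂⟩ := Map.exists_of_isGen (D.X.pull f) (⟨δ₂', h₂'⟩ : IsGen e₂')
    (IsGen.units_smul ⟨δ₂, h₂⟩ (s ^ a * v ^ d))
  have hσ' : (τ₁.dual.npow d).tensor (τ₂.npow c) = σ :=
    Map.ext_gen (((isGen_dual h₁').pow d).tmul (IsGen.pow ⟨δ₂', h₂'⟩ c))
      ((Map.tensor_npow_dual h₁' h₁ hτ₁ hτ₂ d c).trans
        ((congrArg (· • InvMod.tmul (pow δ₁ d) (pow e₂ c)) hs').trans hs.symm))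
  obtain ⟨g, rfl, hg₁, hg₂⟩ := exists_hatObj_hom f τ₁ τ₂ (fun m => by
      obtain ⟨z, rfl⟩ := (powEquiv ((D.L₁ a b).obj y).dual ((D.L₂ a b).obj y) hd hc).surjective m
      refine Eq.trans ?_ (hσ z)
      rw [← hσ']
      exact congrArg (hatIso x) (powEquiv_map τ₁.dual τ₂ hd hc z).symm)
    (Map.comm_of_isGen _ _ _ _ ((isGen_zgen h₁' a).tmul (isGen_zgen h₂' b))
      ((congrArg (hatTriv x) ((Map.tensor_zpow h₁' h₁ hτ₁ h₂' h₂ hτ₂ a b).trans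
        (congrArg (· • InvMod.tmul (zgen e₁ δ₁ a) (zgen e₂ δ₂ b)) hv'))).trans
          (((hatTriv x).map_smul _ _).trans hv.symm)))
  refine ⟨g, rfl, fun m => ?_⟩
  have e₁ : (D.L₁ a b).map g = τ₁ := Map.ext hg₁
  have e₂ : (D.L₂ a b).map g = τ₂ := Map.ext hg₂
  change (((D.L₁ a b).map g).dual.npow d).tensor (((D.L₂ a b).map g).npow c) m = σ m
  rw [← hσ', e₁, e₂]
  rfl

theorem toRootStack_surjective (hd : D.d = N * d) (hc : D.ℓ = N * c) (hab : a * c + b * d = 1)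
    {x y : D.HatObj a b} (hx : IsTrivial x) (hy : IsTrivial y)
    (h : (toRootStack a b hd hc).obj x ⟶ (toRootStack a b hd hc).obj y) :
    ∃ f : x ⟶ y, (toRootStack a b hd hc).map f = h := by
  obtain ⟨g, hg, hg'⟩ := exists_hatObj_hom_of_rootLine hd hc hab hx hy h.base.base h.base.line
    h.comm
  exact ⟨g, WithIso.Hom.ext (WithLine.Hom.ext hg hg')⟩

/-- The modified stack is a full substack of the stack of `N`-th roots of `𝐋_∞^∨`. -/
theorem toRootStack_full_faithful (hX : D.X.IsStack) (hd : D.d = N * d) (hc : D.ℓ = N * c)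
    (hab : a * c + b * d = 1) : (toRootStack a b hd hc).Full ∧
      (toRootStack a b hd hc).Faithful :=
  full_faithful_of_local (Z := rootStack D.X N D.Linf.dual) (toRootStack a b hd hc)
    (hX.withLine.withIso _ _) (isStack_XHat a b hX) IsTrivial (exists_isTrivial hX)
    (toRootStack_injective hd hc hab) (toRootStack_surjective hd hc hab)

end InputData

end

section

section

universe v₁ v₂ v₃ u₁ u₂ u₃

variable {C : Type u₁} [Category.{v₁} C] {D : Type u₂} [Category.{v₂} D] {E : Type u₃}
  [Category.{v₃} E]

/-- Relative products are preserved by passing to a full subcategory of a fibration in groupoids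
which is again fibred over the base. -/
theorem exists_isRelProd_of_full_faithful (Ψ : C ⥤ E) [Ψ.Full] [Ψ.Faithful] {H : E ⥤ D}
    (hG : IsGpdFibration (Ψ ⋙ H)) (hH : IsGpdFibration H) {c₁ c₂ : C} {w : D}
    {p₁ : w ⟶ (Ψ ⋙ H).obj c₁} {p₂ : w ⟶ (Ψ ⋙ H).obj c₂} {z : E} {q₁ : z ⟶ Ψ.obj c₁}
    {q₂ : z ⟶ Ψ.obj c₂} {h : H.obj z ⟶ w} (hz : IsRelProd H p₁ p₂ q₁ q₂ h) :
    ∃ (c : C) (r₁ : c ⟶ c₁) (r₂ : c ⟶ c₂) (i : (Ψ ⋙ H).obj c ⟶ H.obj z), IsIso i ∧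
      IsRelProd (Ψ ⋙ H) p₁ p₂ r₁ r₂ (i ≫ h) := by
  obtain ⟨c, r₁, e, hr₁⟩ := hG.exists_lift (H.map q₁)
  obtain ⟨j, ⟨hj, hjq⟩, -⟩ := hH.cartesian q₁ (Ψ.map r₁) (eqToHom e) hr₁.symm
  have : IsIso (H.map j) := by rw [hj]; infer_instance
  have := hH.isIso j
  obtain ⟨r₂, hr₂⟩ := Ψ.map_surjective (j ≫ q₂)
  refine ⟨c, r₁, r₂, H.map j, inferInstance, ⟨?_, ?_, fun t a₁ a₂ b h₁ h₂ => ?_⟩⟩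
  · rw [Category.assoc, hz.w₁, ← H.map_comp, hjq]; rfl
  · rw [Category.assoc, hz.w₂, ← H.map_comp, ← hr₂]; rfl
  · obtain ⟨m, ⟨hm₁, hm₂, hm⟩, hu⟩ := hz.exists_unique (Ψ.obj t) (Ψ.map a₁) (Ψ.map a₂) b h₁ h₂
    obtain ⟨m', hm'⟩ := Ψ.map_surjective (m ≫ inv j)
    have key : ∀ s : t ⟶ c, s ≫ r₁ = a₁ ∧ s ≫ r₂ = a₂ ∧ (Ψ ⋙ H).map s ≫ H.map j ≫ h = b ↔
        Ψ.map s ≫ j = m := fun s => by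
      have e₁ : (Ψ.map s ≫ j) ≫ q₁ = Ψ.map (s ≫ r₁) := by rw [Category.assoc, hjq, Ψ.map_comp]
      have e₂ : (Ψ.map s ≫ j) ≫ q₂ = Ψ.map (s ≫ r₂) := by rw [Category.assoc, ← hr₂, Ψ.map_comp]
      have e₃ : H.map (Ψ.map s ≫ j) ≫ h = (Ψ ⋙ H).map s ≫ H.map j ≫ h := by
        rw [H.map_comp, Category.assoc]; rfl
      constructor
      · rintro ⟨rfl, rfl, rfl⟩
        exact hu _ ⟨e₁, e₂, e₃⟩
      · rintro rfl
        exact ⟨Ψ.map_injective (e₁.symm.trans hm₁), Ψ.map_injective (e₂.symm.trans hm₂),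
          e₃.symm.trans hm⟩
    refine ⟨m', (key m').mpr (by rw [hm', Category.assoc, IsIso.inv_hom_id, Category.comp_id]),
      fun s hs => Ψ.map_injective ?_⟩
    rw [hm', ← (key s).mp hs, Category.assoc, IsIso.hom_inv_id, Category.comp_id]

end

variable {k : Type u} [Field k]

theorem AffCat.pull_finite_of_isIso {X : AffCat k} {x y z : X.obj} (f : x ⟶ y) [IsIso f]
    {g : y ⟶ z} (hg : (X.pull g).Finite) : (X.pull (f ≫ g)).Finite := by
  have h1 : X.pull (f ≫ g) = (X.pull f).comp (X.pull g) := RingHom.ext (X.pull_comp f g)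
  rw [h1]
  exact .comp (.of_surjective _ (bijective_of_isIso (X.p.map f)).surjective) hg

namespace InputData

variable {D : InputData k} {a b : ℤ} {N c d : ℕ}

/-- Any two objects of the modified stack over the same base are isomorphic over a finite étale
covering, which represents the isomorphisms between them. -/
theorem hatToX_exists_isRelProd (hX : D.X.IsStack) (hd : D.d = N * d) (hc : D.ℓ = N * c)
    (hab : a * c + b * d = 1) (hN : N ≠ 0) (hu : ∀ x : D.X.obj, IsUnit (N : D.X.O x))
    (c₁ c₂ : D.HatObj a b) {w : D.X.obj} (p₁ : w ⟶ (D.hatToX a b).obj c₁)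
    (p₂ : w ⟶ (D.hatToX a b).obj c₂) :
    ∃ (z : D.HatObj a b) (q₁ : z ⟶ c₁) (q₂ : z ⟶ c₂) (h : (D.hatToX a b).obj z ⟶ w),
      IsRelProd (D.hatToX a b) p₁ p₂ q₁ q₂ h ∧ (D.X.pull h).Finite ∧ D.X.EtCover h := by
  obtain ⟨_, _⟩ := toRootStack_full_faithful hX hd hc hab
  obtain ⟨z, q₁, q₂, h, H, hf, he⟩ := rootStack_exists_isRelProd hX.gpd hN hu
    ((toRootStack a b hd hc).obj c₁) ((toRootStack a b hd hc).obj c₂) p₁ p₂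
  obtain ⟨z', r₁, r₂, i, hi, H'⟩ := exists_isRelProd_of_full_faithful (toRootStack a b hd hc)
    (show IsGpdFibration (toRootStack a b hd hc ⋙ rootProj D.X N D.Linf.dual) from
      D.gpd_hatToX a b) (rootProj_gpd _ _ _) H
  exact ⟨z', r₁, r₂, i ≫ h, H', AffCat.pull_finite_of_isIso i hf, .comp (.of_isIso i) he⟩

/-- The modified stack has sections étale locally on `∞_𝒳`: where `𝐋_∞` is trivial, take for `L₁`
and `L₂` the trivial line bundle. -/
theorem exists_hatToX_etCover (hX : D.X.IsStack) (a b : ℤ) (x : D.X.obj) :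
    ∃ (y : D.HatObj a b) (g : (D.hatToX a b).obj y ⟶ x), D.X.EtCover g := by
  obtain ⟨x', g, hg, e, he⟩ := D.Linf.dual.exists_isGen hX.gpd x
  let U : InvMod (D.X.O x') := InvMod.unit _
  have hU : InvMod.pair (InvMod.udual _) (1 : D.X.O x') (L := U) = 1 := rfl
  have h1 : InvMod.IsGen (InvMod.tmul (InvMod.pow (InvMod.udual _ : U.dual) D.d)
      (InvMod.pow (1 : D.X.O x') D.ℓ (L := U))) :=
    .tmul (.pow (InvMod.isGen_dual hU) _) (.pow ⟨_, hU⟩ _)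
  obtain ⟨i, -⟩ := InvMod.exists_equiv_of_isGen h1 he
  have h2 : InvMod.IsGen (InvMod.tmul (InvMod.zgen _ _ a) (InvMod.zgen _ _ b)) :=
    .tmul (InvMod.isGen_zgen hU a) (InvMod.isGen_zgen hU b)
  obtain ⟨j, -⟩ := InvMod.exists_equiv_of_isGen h2 (InvMod.isGen_unit_one (A := D.X.O x'))
  exact ⟨⟨⟨⟨⟨x', U⟩, U⟩, i⟩, j⟩, g, hg⟩

end InputData

end

/-! ### Étale ring homomorphisms -/

section

section SourceDescent

variable {A B C : Type u} [CommRing A] [CommRing B] [CommRing C]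

/-- If `A → C` is flat and `B → C` is faithfully flat, then `A → B` is flat. -/
theorem flat_of_flat_comp_faithfullyFlat [Algebra A B] [Algebra B C] [Algebra A C]
    [IsScalarTower A B C] [Module.FaithfullyFlat B C] [Module.Flat A C] : Module.Flat A B := by
  refine (Module.Flat.iff_lTensor_preserves_injective_linearMap (R := A) (M := B)).mpr
    fun {M N} _ _ _ _ f hf => ?_
  have h1 : Function.Injective (f.lTensor C) := Module.Flat.lTensor_preserves_injective_linearMap f hf
  have h2 : Function.Injective ((f.baseChange B).lTensor C) := by
    have key : ∀ z, AlgebraTensorModule.cancelBaseChange A B C C N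
        ((f.baseChange B).baseChange C z) = f.baseChange C
          (AlgebraTensorModule.cancelBaseChange A B C C M z) := fun z => by
      induction z using TensorProduct.induction_on with
      | zero => simp
      | add x y hx hy => simp only [map_add, hx, hy]
      | tmul c y =>
        induction y using TensorProduct.induction_on with
        | zero => simp
        | add x y hx hy => simp only [TensorProduct.tmul_add, map_add, hx, hy]
        | tmul b m => simp
    intro z z' hz
    refine (AlgebraTensorModule.cancelBaseChange A B C C M).injective (h1 ?_)
    exact (key z).symm.trans ((congrArg _ hz).trans (key z'))
  exact (Module.FaithfullyFlat.lTensor_injective_iff_injective B C (f.baseChange B)).mp h2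

/-- Étaleness descends along a finite étale covering of the source. -/
theorem etale_of_comp_finite_etSurj [IsNoetherianRing A] {φ : A →+* B} {ψ : B →+* C}
    (hψ : EtSurj ψ) (hfin : ψ.Finite) (h : (ψ.comp φ).Etale) : φ.Etale := by
  let _ := φ.toAlgebra
  let _ := ψ.toAlgebra
  let _ := (ψ.comp φ).toAlgebra
  have : IsScalarTower A B C := .of_algebraMap_eq fun _ => rfl
  have : Algebra.Etale A C := h
  have : Algebra.Etale B C := hψ.etale
  have : Module.Finite B C := hfin
  have : Module.FaithfullyFlat B C := hψ.faithfullyFlat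
  have hft : Algebra.FiniteType A B := ⟨fg_of_fg_of_fg A B C Algebra.FiniteType.out
    Module.Finite.fg_top (FaithfulSMul.algebraMap_injective B C)⟩
  have : Algebra.FinitePresentation A B := Algebra.FinitePresentation.of_finiteType.mp hft
  have : Module.Flat A B := flat_of_flat_comp_faithfullyFlat (C := C)
  have : Algebra.FormallyUnramified A B := by
    refine ⟨?_⟩
    have : Subsingleton (C ⊗[B] Ω[B⁄A]) :=
      (KaehlerDifferential.tensorKaehlerEquivOfFormallyEtale A B C).toEquiv.subsingleton
    exact Module.FaithfullyFlat.lTensor_reflects_triviality B C _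
  exact RingHom.Etale.iff_flat_and_formallyUnramified.mpr ⟨‹_›, ‹_›, ‹_›⟩

/-- Étaleness can be checked on an étale covering of the target by a finite family. -/
theorem etale_of_etale_cover {φ : A →+* B} {n : ℕ} {A' B' : Fin n → Type u}
    [∀ i, CommRing (A' i)] [∀ i, CommRing (B' i)] {ψ : ∀ i, A →+* A' i} {α : ∀ i, B →+* B' i}
    {β : ∀ i, A' i →+* B' i} (h : ∀ i, RingSq φ (ψ i) (α i) (β i)) (hψ : ∀ i, (ψ i).Etale)
    (hs : ∀ p : PrimeSpectrum A, ∃ i, ∃ q, PrimeSpectrum.comap (ψ i) q = p)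
    (hβ : ∀ i, (β i).Etale) : φ.Etale := by
  classical
  let _ := φ.toAlgebra
  let _ : ∀ i, Algebra A (A' i) := fun i => (ψ i).toAlgebra
  let _ : ∀ i, Algebra B (B' i) := fun i => (α i).toAlgebra
  let _ : ∀ i, Algebra (A' i) (B' i) := fun i => (β i).toAlgebra
  let _ : ∀ i, Algebra A (B' i) := fun i => ((α i).comp φ).toAlgebra
  have : ∀ i, IsScalarTower A B (B' i) := fun i => .of_algebraMap_eq fun _ => rfl
  have : ∀ i, IsScalarTower A (A' i) (B' i) := fun i => .of_algebraMap_eq fun a => (h i).comm a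
  have hp : ∀ i, Algebra.IsPushout A B (A' i) (B' i) := fun i => RingSq.isPushout (h i)
  let γ : (∀ i, A' i) →+* ∀ i, B' i :=
    RingHom.pi fun i => (β i).comp (Pi.evalRingHom A' i)
  have hγ : γ.Etale := by
    let _ : ∀ i, Algebra (∀ i, A' i) (A' i) := fun i => (Pi.evalRingHom A' i).toAlgebra
    let _ : ∀ i, Algebra (∀ i, A' i) (B' i) := fun i => ((β i).comp (Pi.evalRingHom A' i)).toAlgebra
    have : ∀ i, IsScalarTower (∀ i, A' i) (A' i) (B' i) := fun i => .of_algebraMap_eq fun _ => rfl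
    have : ∀ i, IsLocalization.Away (Pi.single i 1 : ∀ i, A' i) (A' i) := fun i => by
      refine IsLocalization.away_of_isIdempotentElem ?_ (RingHom.ker_evalRingHom _ _)
        ((Pi.evalRingHom A' i).surjective)
      simp [IsIdempotentElem, ← Pi.single_mul_left]
    have : ∀ i, Algebra.Etale (∀ i, A' i) (A' i) := fun i =>
      Algebra.Etale.of_isLocalizationAway (Pi.single i 1 : ∀ i, A' i)
    have : ∀ i, Algebra.Etale (A' i) (B' i) := hβ
    have : ∀ i, Algebra.Etale (∀ i, A' i) (B' i) := fun i => Algebra.Etale.comp _ (A' i) _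
    let _ : Algebra (∀ i, A' i) (∀ i, B' i) := Pi.algebra _ _
    have h1 : Algebra.Etale (∀ i, A' i) (∀ i, B' i) := inferInstance
    exact h1
  have hψ' : (algebraMap A (∀ i, A' i)).FaithfullyFlat := by
    refine RingHom.FaithfullyFlat.iff_flat_and_comap_surjective.mpr ⟨?_, fun p => ?_⟩
    · have : ∀ i, Algebra.Etale A (A' i) := hψ
      exact EtSurj.flat (RingHom.etale_algebraMap.mpr inferInstance)
    · obtain ⟨i, q, rfl⟩ := hs p
      exact ⟨PrimeSpectrum.comap (Pi.evalRingHom A' i) q, rfl⟩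
  have : IsScalarTower A (∀ i, A' i) (∀ i, B' i) := .of_algebraMap_eq fun a =>
    funext fun i => (h i).comm a
  have : Algebra.IsPushout A B (∀ i, A' i) (∀ i, B' i) :=
    ⟨IsBaseChange.pi (f := fun i => (IsScalarTower.toAlgHom A (A' i) (B' i)).toLinearMap)
      fun i => (hp i).out⟩
  exact RingHom.Etale.codescendsAlong_faithfullyFlat (R := A) (S := B) (R' := ∀ i, A' i)
    (S' := ∀ i, B' i) hψ' hγ

theorem EtSurj.isClosed_of_preimage {φ : A →+* B} (hφ : EtSurj φ) {Z : Set (PrimeSpectrum A)}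
    (hZ : IsClosed (PrimeSpectrum.comap φ ⁻¹' Z)) : IsClosed Z := by
  let _ := φ.toAlgebra
  have : Algebra.Etale A B := hφ.etale
  have h1 : IsOpenMap (PrimeSpectrum.comap φ) :=
    PrimeSpectrum.isOpenMap_comap_of_hasGoingDown_of_finitePresentation (R := A) (S := B)
  exact ((h1.isQuotientMap (PrimeSpectrum.continuous_comap _) hφ.surjective).isClosed_preimage).mp hZ

/-- Étale coverings of the spectrum of an algebraically closed field have sections. -/
theorem EtSurj.exists_section {K : Type u} [Field K] [IsAlgClosed K] {φ : K →+* B}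
    (hφ : EtSurj φ) : ∃ σ : B →+* K, ∀ a, σ (φ a) = a := by
  let _ := φ.toAlgebra
  have : Algebra.Etale K B := hφ.etale
  obtain ⟨q, -⟩ := hφ.surjective ⊥
  have : Nontrivial B := q.nontrivial
  obtain ⟨m, hm⟩ := Ideal.exists_maximal B
  let _ := Ideal.Quotient.field m
  have : Module.Finite K (B ⧸ m) := finite_of_finite_type_of_isJacobsonRing K (B ⧸ m)
  have hb := IsAlgClosed.algebraMap_bijective_of_isIntegral (k := K) (K := B ⧸ m)
  let e := RingEquiv.ofBijective _ hb
  exact ⟨e.symm.toRingHom.comp (Ideal.Quotient.mk m), fun a => e.symm_apply_apply a⟩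

end SourceDescent

end

/-! ### Finite étale gerbes -/

section

variable {k : Type u} [Field k]

namespace AffCat

variable {X : AffCat k}

theorem IsFibreProduct.exists_unique {x y z : X.obj} {f : z ⟶ x} {g : z ⟶ y}
    (h : X.IsFibreProduct f g) {t : X.obj} (a : t ⟶ x) (b : t ⟶ y) :
    ∃! m : t ⟶ z, m ≫ f = a ∧ m ≫ g = b := by
  obtain ⟨h⟩ := h
  refine ⟨h.lift (Limits.BinaryFan.mk a b), ⟨h.fac _ ⟨.left⟩, h.fac _ ⟨.right⟩⟩, fun m hm => ?_⟩
  refine Limits.BinaryFan.IsLimit.hom_ext h ?_ ?_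
  · exact hm.1.trans (h.fac (Limits.BinaryFan.mk a b) ⟨.left⟩).symm
  · exact hm.2.trans (h.fac (Limits.BinaryFan.mk a b) ⟨.right⟩).symm

theorem isFibreProduct_of_exists_unique {x y z : X.obj} {f : z ⟶ x} {g : z ⟶ y}
    (h : ∀ (t : X.obj) (a : t ⟶ x) (b : t ⟶ y), ∃! m : t ⟶ z, m ≫ f = a ∧ m ≫ g = b) :
    X.IsFibreProduct f g := by
  choose l hl hu using fun t a b => h t a b
  exact ⟨Limits.BinaryFan.IsLimit.mk _ (fun {t} a b => l t a b) (fun a b => (hl _ a b).1)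
    (fun a b => (hl _ a b).2) fun a b m h₁ h₂ => hu _ a b m ⟨h₁, h₂⟩⟩

theorem IsFibreProduct.symm {x y z : X.obj} {f : z ⟶ x} {g : z ⟶ y} (h : X.IsFibreProduct f g) :
    X.IsFibreProduct g f :=
  isFibreProduct_of_exists_unique fun _ a b => by
    simpa only [and_comm] using h.exists_unique b a

/-- Two fibre products differ by an isomorphism. -/
theorem IsFibreProduct.exists_isIso {x y z z' : X.obj} {f : z ⟶ x} {g : z ⟶ y} {f' : z' ⟶ x}
    {g' : z' ⟶ y} (h : X.IsFibreProduct f g) (h' : X.IsFibreProduct f' g') :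
    ∃ i : z' ⟶ z, IsIso i ∧ i ≫ f = f' ∧ i ≫ g = g' := by
  obtain ⟨i, ⟨hi, hi'⟩, -⟩ := h.exists_unique f' g'
  obtain ⟨j, ⟨hj, hj'⟩, -⟩ := h'.exists_unique f g
  refine ⟨i, ⟨j, (h'.exists_unique f' g').unique ⟨?_, ?_⟩ ⟨Category.id_comp _, Category.id_comp _⟩,
    (h.exists_unique f g).unique ⟨?_, ?_⟩ ⟨Category.id_comp _, Category.id_comp _⟩⟩, hi, hi'⟩ <;>
  simp only [Category.assoc, hi, hi', hj, hj']

/-- The fibre product with `x'` is the pullback along `x' ⟶ x` of the fibre product with `x`. -/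
theorem IsFibreProduct.of_isPullback {x x' y z w : X.obj} {f : z ⟶ x} {g : z ⟶ y}
    (h : X.IsFibreProduct f g) {u : x' ⟶ x} {a : w ⟶ x'} {b : w ⟶ z} (hw : IsPullback a b u f) :
    X.IsFibreProduct a (b ≫ g) := by
  refine isFibreProduct_of_exists_unique fun t c d => ?_
  obtain ⟨m, ⟨hm, hm'⟩, hu⟩ := h.exists_unique (c ≫ u) d
  refine ⟨hw.lift c m hm.symm, ⟨hw.lift_fst _ _ _, ?_⟩, fun l hl => hw.hom_ext ?_ ?_⟩
  · rw [hw.lift_snd_assoc, hm']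
  · rw [hw.lift_fst, hl.1]
  · rw [hw.lift_snd]
    exact hu _ ⟨by rw [Category.assoc, ← hw.w, ← hl.1, Category.assoc],
      by rw [Category.assoc, hl.2]⟩

theorem pull_comp_eq {x y z : X.obj} (f : x ⟶ y) (g : y ⟶ z) :
    X.pull (f ≫ g) = (X.pull f).comp (X.pull g) := RingHom.ext (X.pull_comp f g)

theorem etale_comp {x y z : X.obj} {f : x ⟶ y} {g : y ⟶ z} (hf : (X.pull f).Etale)
    (hg : (X.pull g).Etale) : (X.pull (f ≫ g)).Etale := by
  rw [pull_comp_eq]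
  exact RingHom.Etale.stableUnderComposition _ _ hg hf

theorem etale_of_isIso {x y : X.obj} (f : x ⟶ y) [IsIso f] : (X.pull f).Etale :=
  (EtCover.of_isIso f).etale

theorem etale_of_isPullback (hX : IsGpdFibration X.p) {x y z w : X.obj} {a : w ⟶ x} {b : w ⟶ y}
    {f : x ⟶ z} {g : y ⟶ z} (h : IsPullback a b f g) (hf : (X.pull f).Etale) : (X.pull b).Etale :=
  (ringSq_of_isPullback (hX.map_isPullback h)).stable RingHom.Etale.isStableUnderBaseChange hf

theorem surjective_of_isPullback (hX : IsGpdFibration X.p) {x y z w : X.obj} {a : w ⟶ x}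
    {b : w ⟶ y} {f : x ⟶ z} {g : y ⟶ z} (h : IsPullback a b f g) (q : PrimeSpectrum (X.O x))
    (r : PrimeSpectrum (X.O y))
    (hqr : PrimeSpectrum.comap (X.pull f) q = PrimeSpectrum.comap (X.pull g) r) :
    ∃ s : PrimeSpectrum (X.O w), PrimeSpectrum.comap (X.pull a) s = q ∧
      PrimeSpectrum.comap (X.pull b) s = r :=
  (ringSq_of_isPullback (hX.map_isPullback h)).exists_prime q r hqr

theorem comap_pull_comp {x y z : X.obj} (f : x ⟶ y) (g : y ⟶ z) (p : PrimeSpectrum (X.O x)) :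
    PrimeSpectrum.comap (X.pull (f ≫ g)) p =
      PrimeSpectrum.comap (X.pull g) (PrimeSpectrum.comap (X.pull f) p) := by
  rw [pull_comp_eq]
  exact PrimeSpectrum.comap_comp_apply _ _ _

/-- An affine scheme étale over an étale chart is an étale chart. -/
theorem IsEtaleChart.of_etale (hX : IsGpdFibration X.p) {x x' : X.obj} (hx : X.IsEtaleChart x)
    {u : x' ⟶ x} (hu : (X.pull u).Etale) : X.IsEtaleChart x' := fun y => by
  obtain ⟨z, f, g, h, hg⟩ := hx y
  obtain ⟨w, a, b, hw, -⟩ := hX.exists_isPullback u f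
  exact ⟨w, a, b ≫ g, h.of_isPullback hw, etale_comp (etale_of_isPullback hX hw hu) hg⟩

theorem finiteType_of_etale {x x' : X.obj} {u : x' ⟶ x} (hu : (X.pull u).Etale)
    (hx : Algebra.FiniteType k (X.O x)) : Algebra.FiniteType k (X.O x') := by
  let _ := (X.pull u).toAlgebra
  have : IsScalarTower k (X.O x) (X.O x') :=
    .of_algebraMap_eq fun a => ((X.p.map u).unop.hom.commutes a).symm
  have : Algebra.Etale (X.O x) (X.O x') := hu
  exact Algebra.FiniteType.trans hx inferInstance

/-- `G : 𝒴 → 𝒳` is a gerbe with finite étale automorphism groups: it has sections étale locally on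
`𝒳`, and any two sections over an affine scheme `Spec O(w)` become isomorphic over a finite étale
covering `Spec O(z)`, which represents the isomorphisms between them. -/
structure IsFiniteGerbe (X : AffCat k) {C : Type (u + 1)} [Category.{u} C] (G : C ⥤ X.obj) :
    Prop where
  gpd : IsGpdFibration G
  exists_section : ∀ x : X.obj, ∃ (c : C) (g : G.obj c ⟶ x), X.EtCover g
  exists_relProd : ∀ (c₁ c₂ : C) {w : X.obj} (p₁ : w ⟶ G.obj c₁) (p₂ : w ⟶ G.obj c₂),
    ∃ (z : C) (q₁ : z ⟶ c₁) (q₂ : z ⟶ c₂) (h : G.obj z ⟶ w),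
      IsRelProd G p₁ p₂ q₁ q₂ h ∧ (X.pull h).Finite ∧ X.EtCover h

namespace IsFiniteGerbe

variable {C : Type (u + 1)} [Category.{u} C] {G : C ⥤ X.obj}

theorem isFibreProduct {c₁ c₂ z : C} {w : X.obj} {p₁ : w ⟶ G.obj c₁} {p₂ : w ⟶ G.obj c₂}
    {q₁ : z ⟶ c₁} {q₂ : z ⟶ c₂} {h : G.obj z ⟶ w} (H : IsRelProd G p₁ p₂ q₁ q₂ h)
    (hw : X.IsFibreProduct p₁ p₂) : (X.comap G).IsFibreProduct q₁ q₂ := by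
  refine isFibreProduct_of_exists_unique fun t a b => ?_
  obtain ⟨n, ⟨hn, hn'⟩, hnu⟩ := hw.exists_unique (G.map a) (G.map b)
  obtain ⟨m, ⟨hm, hm', -⟩, hmu⟩ := H.exists_unique t a b n hn hn'
  refine ⟨m, ⟨hm, hm'⟩, fun l hl => hmu l ⟨hl.1, hl.2, hnu _ ⟨?_, ?_⟩⟩⟩
  · rw [Category.assoc, H.w₁, ← G.map_comp]; exact congrArg _ hl.1
  · rw [Category.assoc, H.w₂, ← G.map_comp]; exact congrArg _ hl.2

/-- `c₁ ×_C c₂` is finite over `G(c₁) ×_𝒳 G(c₂)`. -/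
theorem hasFiniteDiagonal (hG : X.IsFiniteGerbe G) (hX : X.HasFiniteDiagonal) :
    (X.comap G).HasFiniteDiagonal := fun c₁ c₂ => by
  obtain ⟨w, p₁, p₂, hw, hf⟩ := hX (G.obj c₁) (G.obj c₂)
  obtain ⟨z, q₁, q₂, h, H, hh, -⟩ := hG.exists_relProd c₁ c₂ p₁ p₂
  refine ⟨z, q₁, q₂, isFibreProduct H hw, ?_⟩
  have h1 : (Algebra.TensorProduct.productMap ((X.comap G).p.map q₁).unop.hom
      ((X.comap G).p.map q₂).unop.hom) = ((X.p.map h).unop.hom).comp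
        (Algebra.TensorProduct.productMap (X.p.map p₁).unop.hom (X.p.map p₂).unop.hom) := by
    have e₁ : (X.p.map (G.map q₁)).unop.hom = (X.p.map h).unop.hom.comp (X.p.map p₁).unop.hom := by
      rw [← H.w₁, X.p.map_comp]; rfl
    have e₂ : (X.p.map (G.map q₂)).unop.hom = (X.p.map h).unop.hom.comp (X.p.map p₂).unop.hom := by
      rw [← H.w₂, X.p.map_comp]; rfl
    refine Algebra.TensorProduct.ext' fun a b => ?_
    refine (Algebra.TensorProduct.productMap_apply_tmul _ _ _ _).trans ?_
    refine Eq.trans ?_ (congrArg (X.p.map h).unop.hom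
      (Algebra.TensorProduct.productMap_apply_tmul _ _ _ _)).symm
    refine Eq.trans ?_ (map_mul (X.p.map h).unop.hom _ _).symm
    exact congrArg₂ (· * ·) (AlgHom.congr_fun e₁ a) (AlgHom.congr_fun e₂ b)
  rw [h1]
  exact RingHom.Finite.comp hh hf

/-- Objects over étale charts are étale charts. -/
theorem isEtaleChart (hG : X.IsFiniteGerbe G) {c : C} (hc : X.IsEtaleChart (G.obj c)) :
    (X.comap G).IsEtaleChart c := fun y => by
  obtain ⟨w, p₁, p₂, hw, he⟩ := hc (G.obj y)
  obtain ⟨z, q₁, q₂, h, H, -, hh⟩ := hG.exists_relProd c y p₁ p₂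
  refine ⟨z, q₁, q₂, isFibreProduct H hw, ?_⟩
  change (X.pull (G.map q₂)).Etale
  rw [← H.w₂]
  exact etale_comp hh.etale he

/-- Étale local sections of the gerbe over an atlas of `𝒳` form an atlas of the gerbe. -/
theorem exists_atlas (hG : X.IsFiniteGerbe G) (hX : IsGpdFibration X.p) {n : ℕ} {x : Fin n → X.obj}
    (hx : X.IsJointlySurjective x) {c : Fin n → C} {g : ∀ i, G.obj (c i) ⟶ x i}
    (hg : ∀ i, X.EtCover (g i)) : (X.comap G).IsJointlySurjective c := fun y p => by
  obtain ⟨i, z, f, e, q, rfl⟩ := hx (G.obj y) p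
  obtain ⟨w, a, b, hw, -⟩ := hX.exists_isPullback (g i) f
  obtain ⟨r, rfl⟩ := (EtCover.of_isPullback hX hw (hg i)).surjective q
  obtain ⟨v, q₁, q₂, h, H, -, hh⟩ := hG.exists_relProd (c i) y a (b ≫ e)
  obtain ⟨s, rfl⟩ := hh.surjective r
  refine ⟨i, v, q₁, q₂, s, ?_⟩
  change PrimeSpectrum.comap (X.pull (G.map q₂)) s = _
  rw [← H.w₂]
  exact (comap_pull_comp _ _ _).trans (comap_pull_comp _ _ _)

/-- The morphism `G` is étale. After base change to an affine scheme which is étale over an étale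
chart and lifts to the gerbe, étaleness descends along the finite étale coverings given by the
isomorphisms between sections of the gerbe. -/
theorem isEtaleMap (hG : X.IsFiniteGerbe G) (hX : IsGpdFibration X.p) (hd : X.HasFiniteDiagonal)
    {n : ℕ} {x : Fin n → X.obj} (hx : X.IsJointlySurjective x)
    (hx' : ∀ i, X.IsEtaleChart (x i) ∧ Algebra.FiniteType k (X.O (x i))) : X.IsEtaleMap G := by
  intro y hy t
  choose c g hg using fun i => hG.exists_section (x i)
  -- The fibre product over the gerbe is a finite étale covering of the one over `𝒳`, so étaleness
  -- over the section `c i` descends from the former to the latter.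
  have key : ∀ i, ∃ (P : X.obj) (f : P ⟶ G.obj y) (e : P ⟶ G.obj (c i)), X.IsFibreProduct f e ∧
      (X.pull e).Etale := fun i => by
    obtain ⟨P, f, e, hP, -⟩ := hd (G.obj y) (G.obj (c i))
    obtain ⟨v, q₁, q₂, h, H, hfin, hh⟩ := hG.exists_relProd y (c i) f e
    obtain ⟨v', q₁', q₂', hv', he⟩ := hy (c i)
    obtain ⟨j, _, -, hj⟩ := hv'.exists_isIso (isFibreProduct H hP)
    have h1 : (X.pull (G.map q₂)).Etale := by
      rw [← hj]
      exact etale_comp (X := X.comap G) (etale_of_isIso j) he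
    have : IsNoetherianRing (X.O (G.obj (c i))) :=
      have := finiteType_of_etale (hg i).etale (hx' i).2
      Algebra.FiniteType.isNoetherianRing k _
    refine ⟨P, f, e, hP, etale_of_comp_finite_etSurj hh hfin ?_⟩
    rwa [← pull_comp_eq, H.w₂]
  obtain ⟨z, f, e, hz, -⟩ := hd (G.obj y) t
  refine ⟨z, f, e, hz, ?_⟩
  choose u v s hu hs using fun i => (hx' i).1 t
  choose w a b hw using fun i => hX.exists_isPullback (g i) (v i)
  choose z' l m hz' using fun i => hX.exists_isPullback (b i ≫ s i) e
  have hl : ∀ i, (X.pull (l i)).Etale := fun i => by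
    obtain ⟨P, f', e', hP, he'⟩ := key i
    obtain ⟨P', a', b', hP', -⟩ := hX.exists_isPullback e' (a i)
    obtain ⟨j, _, hj, -⟩ := (hP.symm.of_isPullback hP'.flip).exists_isIso
      (hz.symm.of_isPullback (hz' i).1)
    rw [← hj]
    exact etale_comp (etale_of_isIso j) (etale_of_isPullback hX hP' he')
  refine etale_of_etale_cover (fun i => (ringSq_of_isPullback (hz' i).2).symm)
    (fun i => etale_comp (EtCover.of_isPullback hX (hw i).1 (hg i)).etale (hs i)) (fun p => ?_) hl
  obtain ⟨i, t', f', g', q, rfl⟩ := hx t p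
  obtain ⟨o, ⟨-, rfl⟩, -⟩ := (hu i).exists_unique f' g'
  obtain ⟨r, hr⟩ := (EtCover.of_isPullback hX (hw i).1 (hg i)).surjective
    (PrimeSpectrum.comap (X.pull o) q)
  refine ⟨i, r, ?_⟩
  refine (comap_pull_comp _ _ _).trans ?_
  rw [hr]
  exact (comap_pull_comp _ _ _).symm

end IsFiniteGerbe

end AffCat

end

section

variable {k : Type u} [Field k]

namespace AffCat

variable {X : AffCat k} {C : Type (u + 1)} [Category.{u} C] {G : C ⥤ X.obj}

theorem algHom_comp {x y z : X.obj} (f : x ⟶ y) (g : y ⟶ z) {B : CommAlgCat.{u} k}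
    (φ : B →ₐ[k] X.O z) : (X.p.map (f ≫ g)).unop.hom.comp φ =
      (X.p.map f).unop.hom.comp ((X.p.map g).unop.hom.comp φ) := by
  rw [X.p.map_comp]; rfl

namespace IsFiniteGerbe

/-- A closed subset of the gerbe is the preimage of a closed subset of `𝒳`. -/
theorem isUniversallyClosed (hG : X.IsFiniteGerbe G) (hp : IsGpdFibration X.p)
    (hX : X.IsUniversallyClosed) : (X.comap G).IsUniversallyClosed := by
  intro B Z hZ hZc
  -- The image of `Z` in `𝒳`.
  let Z' : ∀ x : X.obj, (B →ₐ[k] X.O x) → Set (PrimeSpectrum (X.O x)) := fun x φ =>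
    {p | ∃ (c : C) (g : G.obj c ⟶ x), ∃ q ∈ Z c ((X.p.map g).unop.hom.comp φ),
      PrimeSpectrum.comap (X.pull g) q = p}
  have hc : ∀ {x y : X.obj} (f : x ⟶ y) (φ : B →ₐ[k] X.O y),
      Z' x ((X.p.map f).unop.hom.comp φ) = PrimeSpectrum.comap (X.pull f) ⁻¹' Z' y φ := by
    intro x y f φ
    ext p
    constructor
    · rintro ⟨c, g, q, hq, rfl⟩
      refine ⟨c, g ≫ f, q, ?_, comap_pull_comp _ _ _⟩
      rwa [algHom_comp]
    · rintro ⟨c, g, q, hq, hqp⟩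
      obtain ⟨w, a, b, hw, -⟩ := hp.exists_isPullback g f
      obtain ⟨s, rfl, rfl⟩ := surjective_of_isPullback hp hw q p hqp
      obtain ⟨c', j, rfl, hj⟩ := hG.gpd.exists_lift a
      obtain rfl : G.map j = a := hj.trans (Category.id_comp a)
      have h1 := hZc j ((X.p.map g).unop.hom.comp φ)
      refine ⟨c', b, s, ?_, rfl⟩
      rw [← algHom_comp, ← hw.w, algHom_comp]
      exact h1.symm ▸ hq
  -- Two objects of the gerbe with the same image are isomorphic over a covering, so `Z` is the
  -- preimage of `Z'`.
  have hcl : ∀ (c : C) (φ : B →ₐ[k] X.O (G.obj c)), Z' (G.obj c) φ = Z c φ := fun c φ => by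
    ext p
    constructor
    · rintro ⟨c', g, q, hq, rfl⟩
      obtain ⟨z, q₁, q₂, h, H, -, hh⟩ := hG.exists_relProd c' c (𝟙 (G.obj c')) g
      obtain ⟨s, rfl⟩ := hh.surjective q
      have h1 : s ∈ Z z ((X.p.map (G.map q₁)).unop.hom.comp ((X.p.map g).unop.hom.comp φ)) := by
        refine (hZc q₁ ((X.p.map g).unop.hom.comp φ)).symm ▸ ?_
        change PrimeSpectrum.comap (X.pull (G.map q₁)) s ∈ Z c' ((X.p.map g).unop.hom.comp φ)
        rwa [← H.w₁, Category.comp_id]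
      rw [← algHom_comp, ← H.w₁, Category.comp_id, H.w₂] at h1
      have h2 : PrimeSpectrum.comap (X.pull (G.map q₂)) s ∈ Z c φ := by
          have h3 : s ∈ PrimeSpectrum.comap ((X.comap G).pull q₂) ⁻¹' Z c φ := hZc q₂ φ ▸ h1
          exact h3
      rwa [← H.w₂, comap_pull_comp] at h2
    · intro hpz
      refine ⟨c, 𝟙 _, p, ?_, ?_⟩
      · have h1 : (X.p.map (𝟙 (G.obj c))).unop.hom.comp φ = φ := by
          rw [X.p.map_id]; rfl
        rwa [h1]
      · have h1 : X.pull (𝟙 (G.obj c)) = RingHom.id _ := RingHom.ext (X.pull_id _)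
        rw [h1]
        exact congrFun PrimeSpectrum.comap_id p
  convert! hX B Z' (fun x φ => ?_) hc using 1
  · ext b
    constructor
    · rintro ⟨c, φ, q, hq, rfl⟩
      exact ⟨G.obj c, φ, q, (hcl c φ).symm ▸ hq, rfl⟩
    · rintro ⟨x, φ, _, ⟨c, g, q, hq, rfl⟩, rfl⟩
      exact ⟨c, _, q, hq, rfl⟩
  · obtain ⟨c, g, hg⟩ := hG.exists_section x
    refine hg.isClosed_of_preimage ?_
    rw [← hc g φ, hcl]
    exact hZ _ _

end IsFiniteGerbe

/-- A point of `𝒳` over an algebraically closed field lifts to any étale covering. -/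
theorem EtCover.exists_point {x' x : X.obj} {g : x' ⟶ x} (hg : X.EtCover g) {K : Type u} [Field K]
    [Algebra k K] [IsAlgClosed K] (e : op (CommAlgCat.of k K) ≅ X.p.obj x) :
    ∃ s : op (CommAlgCat.of k K) ⟶ X.p.obj x', s ≫ X.p.map g = e.hom := by
  obtain ⟨σ, hσ⟩ := EtSurj.exists_section (K := K) (EtSurj.comp (φ := ringMap e.inv) hg
    (EtSurj.of_isIso_ringMap e.inv))
  obtain ⟨m, -, hm⟩ := exists_hom_of_ringHom (X.p.map g) e.hom σ fun x => by
    have h1 : ringMap e.inv (ringMap e.hom x) = x := by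
      have := congrArg (fun f => ringMap f x) e.inv_hom_id
      exact this
    conv_lhs => rw [← h1]
    exact hσ _
  exact ⟨m, hm⟩

end AffCat

/-- Points of an algebraic space are determined after a surjective étale ring homomorphism. -/
theorem IsAlgebraicSpace.eq_of_etSurj {F : (AffSch k)ᵒᵖ ⥤ Type u} (hF : IsAlgebraicSpace F)
    {U V : AffSch k} {v : V ⟶ U} (hv : EtSurj (ringMap v)) {s t : F.obj (op U)}
    (h : F.map v.op s = F.map v.op t) : s = t :=
  (hF.sheaf U 1 (fun _ => V) (fun _ => v) ⟨fun _ => hv.etale, fun p =>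
    ⟨0, hv.surjective p⟩⟩ (fun _ => F.map v.op t) (fun _ _ W g h hgh => by
      rw [← Functor.map_comp_apply, ← Functor.map_comp_apply, ← op_comp, ← op_comp,
        hgh])).unique (fun _ => h) fun _ => rfl

/-- Points of an algebraic space descend along surjective étale ring homomorphisms. -/
theorem IsAlgebraicSpace.exists_of_etSurj {F : (AffSch k)ᵒᵖ ⥤ Type u} (hF : IsAlgebraicSpace F)
    {U V : AffSch k} {v : V ⟶ U} (hv : EtSurj (ringMap v)) (s : F.obj (op V))
    (h : ∀ (W : AffSch k) (a b : W ⟶ V), a ≫ v = b ≫ v → F.map a.op s = F.map b.op s) :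
    ∃ t : F.obj (op U), F.map v.op t = s := by
  obtain ⟨t, ht, -⟩ := hF.sheaf U 1 (fun _ => V) (fun _ => v) ⟨fun _ => hv.etale, fun p =>
    ⟨0, hv.surjective p⟩⟩ (fun _ => s) (fun _ _ => h)
  exact ⟨t, ht 0⟩

namespace AffCat

variable {X : AffCat k} {C : Type (u + 1)} [Category.{u} C] {G : C ⥤ X.obj}

theorem MapTo.map_comp {F : (AffSch k)ᵒᵖ ⥤ Type u} (t : X.MapTo F) {x y : X.obj} (f : x ⟶ y)
    {U : AffSch k} (a : U ⟶ X.p.obj x) :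
    F.map (a ≫ X.p.map f).op (t.app y) = F.map a.op (t.app x) := by
  rw [op_comp, Functor.map_comp_apply, t.naturality]

namespace IsFiniteGerbe

/-- Morphisms from a gerbe over `𝒳` to an algebraic space factor uniquely through `𝒳`. -/
theorem exists_mapTo (hG : X.IsFiniteGerbe G) (hp : IsGpdFibration X.p)
    {F : (AffSch k)ᵒᵖ ⥤ Type u} (hF : IsAlgebraicSpace F) (t : (X.comap G).MapTo F) :
    ∃ t' : X.MapTo F, ∀ c, t'.app (G.obj c) = t.app c := by
  have hsep : ∀ {c₁ c₂ : C} {w : X.obj} (p₁ : w ⟶ G.obj c₁) (p₂ : w ⟶ G.obj c₂),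
      F.map (X.p.map p₁).op (t.app c₁) = F.map (X.p.map p₂).op (t.app c₂) := fun {c₁ c₂ w} p₁ p₂ => by
    obtain ⟨z, q₁, q₂, h, H, -, hh⟩ := hG.exists_relProd c₁ c₂ p₁ p₂
    refine hF.eq_of_etSurj hh ?_
    rw [← Functor.map_comp_apply, ← Functor.map_comp_apply, ← op_comp, ← op_comp,
      ← X.p.map_comp, ← X.p.map_comp, H.w₁, H.w₂]
    exact (t.naturality q₁).trans (t.naturality q₂).symm
  have hex : ∀ x : X.obj, ∃ s : F.obj (op (X.p.obj x)), ∀ (c : C) (w : X.obj) (a : w ⟶ x)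
      (b : w ⟶ G.obj c), F.map (X.p.map a).op s = F.map (X.p.map b).op (t.app c) := fun x => by
    obtain ⟨c₀, g, hg⟩ := hG.exists_section x
    obtain ⟨s, hs⟩ := hF.exists_of_etSurj hg (t.app c₀) fun W a b hab => by
      obtain ⟨w, α, rfl, hα⟩ := hp.exists_lift a
      obtain rfl : X.p.map α = a := hα.trans (Category.id_comp a)
      obtain ⟨β, ⟨rfl, -⟩, -⟩ := hp.cartesian g (α ≫ g) b (by rw [X.p.map_comp, hab])
      exact hsep α β
    refine ⟨s, fun c w a b => ?_⟩
    obtain ⟨v, α, β, hv, -⟩ := hp.exists_isPullback g a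
    refine hF.eq_of_etSurj (EtCover.of_isPullback hp hv hg) ?_
    rw [← Functor.map_comp_apply, ← Functor.map_comp_apply, ← op_comp, ← op_comp,
      ← X.p.map_comp, ← X.p.map_comp, ← hv.w, X.p.map_comp, op_comp,
      Functor.map_comp_apply, hs]
    exact hsep α (β ≫ b)
  choose s hs using hex
  refine ⟨⟨s, fun {x y} f => ?_⟩, fun c => ?_⟩
  · obtain ⟨c, g, hg⟩ := hG.exists_section x
    refine hF.eq_of_etSurj hg ?_
    rw [← Functor.map_comp_apply, ← op_comp, ← X.p.map_comp, hs y c _ (g ≫ f) (𝟙 _),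
      hs x c _ g (𝟙 _)]
  · have := hs (G.obj c) c _ (𝟙 _) (𝟙 _)
    simpa using this

/-- A gerbe over `𝒳` has the same coarse moduli space as `𝒳`. -/
theorem isCoarseModuli (hG : X.IsFiniteGerbe G) (hp : IsGpdFibration X.p)
    {M : Over (AlgebraicGeometry.Spec (CommRingCat.of k))} {π : X.MapTo (points M)}
    (h : IsCoarseModuli X M π) : IsCoarseModuli (X.comap G) M
      ⟨fun c => π.app (G.obj c), fun f => π.naturality (G.map f)⟩ where
  initial F hF t := by
    obtain ⟨t', ht'⟩ := hG.exists_mapTo hp hF t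
    obtain ⟨φ, hφ, hu⟩ := h.initial F hF t'
    refine ⟨φ, fun c => (hφ _).trans (ht' c), fun φ' hφ' => hu _ fun x => ?_⟩
    obtain ⟨c, g, hg⟩ := hG.exists_section x
    refine hF.eq_of_etSurj hg ?_
    rw [← NatTrans.naturality_apply, π.naturality, t'.naturality, ht']
    exact hφ' c
  surjective K _ _ _ m := by
    obtain ⟨x, e, rfl⟩ := h.surjective K m
    obtain ⟨c₀, g, hg⟩ := hG.exists_section x
    obtain ⟨s, hs⟩ := hg.exists_point e
    obtain ⟨c, γ, i, hγ⟩ := (hG.gpd.comp hp).exists_lift (c := c₀) s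
    refine ⟨c, eqToIso i.symm, ?_⟩
    refine (π.map_comp (G.map γ ≫ g) (eqToHom i.symm)).symm.trans ?_
    have h1 : eqToHom i.symm ≫ X.p.map (G.map γ ≫ g) = e.hom := by
      rw [X.p.map_comp]
      refine Eq.trans (congrArg (fun f => eqToHom i.symm ≫ f ≫ X.p.map g) hγ) ?_
      rw [Category.assoc, eqToHom_trans_assoc, eqToHom_refl, Category.id_comp, hs]
    rw [h1]
  injective K _ _ _ c d e e' he := by
    obtain ⟨f, hf⟩ := h.injective K (G.obj c) (G.obj d) e e' he
    obtain ⟨z, q₁, q₂, h', H, -, hh⟩ := hG.exists_relProd c d (𝟙 (G.obj c)) f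
    obtain ⟨s, hs⟩ := hh.exists_point e
    obtain ⟨z', γ, i, hγ⟩ := (hG.gpd.comp hp).exists_lift (c := z) s
    have h1 : X.p.map (G.map (γ ≫ q₁)) = eqToHom i ≫ e.hom := by
      rw [G.map_comp, ← H.w₁, Category.comp_id, X.p.map_comp, ← hs]
      exact (congrArg (· ≫ X.p.map h') hγ).trans (Category.assoc _ _ _)
    have h2 : X.p.map (G.map (γ ≫ q₂)) = eqToHom i ≫ e'.hom := by
      rw [G.map_comp, ← H.w₂, X.p.map_comp, X.p.map_comp, ← hf, ← hs, Category.assoc]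
      exact (congrArg (· ≫ X.p.map h' ≫ X.p.map f) hγ).trans (Category.assoc _ _ _)
    have : IsIso ((G ⋙ X.p).map (γ ≫ q₁)) := by
      change IsIso (X.p.map (G.map (γ ≫ q₁)))
      rw [h1]; infer_instance
    have := (hG.gpd.comp hp).isIso (γ ≫ q₁)
    refine ⟨inv (γ ≫ q₁) ≫ γ ≫ q₂, ?_⟩
    rw [← cancel_epi (eqToHom i), ← Category.assoc, ← h1]
    change (X.comap G).p.map _ ≫ _ = _
    rw [← Functor.map_comp, IsIso.hom_inv_id_assoc]
    exact h2

/-- A finite étale gerbe over a proper Deligne--Mumford stack is a proper Deligne--Mumford stack. -/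
theorem isProperDM (hG : X.IsFiniteGerbe G) (hX : X.IsProperDM) (hC : (X.comap G).IsStack) :
    (X.comap G).IsProperDM where
  toIsStack := hC
  finite_diagonal := hG.hasFiniteDiagonal hX.finite_diagonal
  atlas := by
    obtain ⟨n, x, hx, hx'⟩ := hX.atlas
    choose c g hg using fun i => hG.exists_section (x i)
    exact ⟨n, c, hG.exists_atlas hX.toIsStack.gpd hx hg, fun i =>
      ⟨hG.isEtaleChart ((hx' i).1.of_etale hX.toIsStack.gpd (hg i).etale),
        finiteType_of_etale (X := X) (hg i).etale (hx' i).2⟩⟩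
  universallyClosed := hG.isUniversallyClosed hX.toIsStack.gpd hX.universallyClosed

end IsFiniteGerbe

end AffCat

end

section

variable {k : Type u} [Field k]

namespace InputData

variable (D : InputData k)

/-! ### Arithmetic of the modified input -/

/-- The integer `N = r ℓ / r̂`. -/
def index : ℕ := D.r * D.ℓ / D.rHat

/-- The integer `c = r̂ / r`. -/
abbrev ratio : ℕ := D.rHat / D.r

variable {D}

theorem IsValid.rHat_pos (hD : D.IsValid) : 0 < D.rHat :=
  Nat.lcm_pos hD.r_pos D.fraction.den_pos

theorem dRed_div : (D.dRed : ℚ) / D.rRed = D.fraction := by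
  have h0 : 0 ≤ D.fraction.num := Rat.num_nonneg.mpr (by unfold fraction; positivity)
  have h1 : ((D.dRed : ℤ) : ℚ) = D.fraction.num := by rw [dRed, Int.toNat_of_nonneg h0]
  rw [← Int.cast_natCast, h1]
  exact D.fraction.num_div_den

theorem IsValid.dRed_mul (hD : D.IsValid) : D.dRed * (D.r * D.ℓ) = D.d * D.rRed := by
  have h := dRed_div (D := D)
  have h1 : (D.rRed : ℚ) ≠ 0 := Nat.cast_ne_zero.mpr D.fraction.den_nz
  have h2 : (D.r * D.ℓ : ℚ) ≠ 0 := mul_ne_zero (Nat.cast_ne_zero.mpr hD.r_pos.ne')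
    (Nat.cast_ne_zero.mpr hD.ℓ_pos.ne')
  rw [fraction, div_eq_div_iff h1 h2] at h
  exact_mod_cast h

theorem coprime_dRed_rRed : Nat.Coprime D.dRed D.rRed := by
  have h0 : 0 ≤ D.fraction.num := Rat.num_nonneg.mpr (by unfold fraction; positivity)
  have h := D.fraction.reduced
  rwa [show D.fraction.num.natAbs = D.dRed by unfold dRed; omega] at h

theorem rRed_dvd (hD : D.IsValid) : D.rRed ∣ D.r * D.ℓ :=
  coprime_dRed_rRed.symm.dvd_of_dvd_mul_left (hD.dRed_mul ▸ Dvd.intro_left _ rfl)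

theorem rHat_eq : D.rHat = D.r * D.ratio :=
  (Nat.mul_div_cancel' (Nat.dvd_lcm_left _ _)).symm

theorem IsValid.mul_rHat (hD : D.IsValid) : D.index * D.rHat = D.r * D.ℓ :=
  Nat.div_mul_cancel (Nat.lcm_dvd (Dvd.intro _ rfl) (rRed_dvd hD))

theorem IsValid.ℓ_eq (hD : D.IsValid) : D.ℓ = D.index * D.ratio := by
  have h := hD.mul_rHat
  rw [rHat_eq (D := D)] at h
  exact Nat.eq_of_mul_eq_mul_left hD.r_pos (by rw [← h]; ring)

theorem dHat_mul : D.dHat * D.rRed = D.dRed * D.rHat :=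
  Nat.div_mul_cancel (Dvd.dvd.mul_left (Nat.dvd_lcm_right _ _) _)

theorem IsValid.d_eq (hD : D.IsValid) : D.d = D.index * D.dHat := by
  have h : D.d * D.rRed = D.index * D.dHat * D.rRed := by
    rw [← hD.dRed_mul, mul_assoc, dHat_mul (D := D), ← hD.mul_rHat]; ring
  exact Nat.eq_of_mul_eq_mul_right D.fraction.den_pos h

theorem IsValid.index_ne_zero (hD : D.IsValid) : D.index ≠ 0 := fun h =>
  hD.ℓ_pos.ne' (by rw [hD.ℓ_eq, h, zero_mul])

theorem IsValid.dHat_pos (hD : D.IsValid) : 0 < D.dHat :=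
  Nat.pos_of_ne_zero fun h => hD.d_pos.ne' (by rw [hD.d_eq, h, mul_zero])

/-- After clearing denominators the Bézout condition reads `a c + b d̂ = 1` with `c = r̂ / r`. -/
theorem IsValid.isBezout_iff (hD : D.IsValid) {a b : ℤ} :
    D.IsBezout a b ↔ a * D.ratio + b * D.dHat = 1 := by
  have h1 : (D.rHat : ℚ) ≠ 0 := Nat.cast_ne_zero.mpr hD.rHat_pos.ne'
  have h2 : (D.r : ℚ) ≠ 0 := Nat.cast_ne_zero.mpr hD.r_pos.ne'
  have h3 : (D.rRed : ℚ) ≠ 0 := Nat.cast_ne_zero.mpr D.fraction.den_nz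
  have e1 : (D.rHat : ℚ) = D.r * D.ratio := by exact_mod_cast rHat_eq (D := D)
  have e2 : (D.dHat : ℚ) * D.rRed = D.dRed * D.rHat := by exact_mod_cast dHat_mul (D := D)
  have h4 : (a : ℚ) / D.r = a * D.ratio / D.rHat := by
    rw [div_eq_div_iff h2 h1, e1]; ring
  have h5 : (b : ℚ) * D.dRed / D.rRed = b * D.dHat / D.rHat := by
    rw [div_eq_div_iff h3 h1]; linear_combination -b * e2
  rw [IsBezout, h4, h5, ← add_div, div_left_inj' h1, eq_comm]
  have h6 : ∀ m n : ℕ, (a : ℚ) * m + b * n = 1 ↔ a * m + b * n = 1 := fun m n => by norm_cast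
  exact h6 _ _

/-- With `g = gcd(r, r')` one has `c = r' / g` and `d̂ = d' (r / g)`. Here `c` is prime to `r / g`,
and it is prime to `d'` as a divisor of `r'`. -/
theorem IsValid.coprime_ratio_dHat (hD : D.IsValid) : Nat.Coprime D.ratio D.dHat := by
  have hg : D.rRed * (D.rHat / D.rRed) = D.rHat := Nat.mul_div_cancel' (Nat.dvd_lcm_right _ _)
  have hd : D.dHat = D.dRed * (D.rHat / D.rRed) :=
    Nat.mul_div_assoc _ (Nat.dvd_lcm_right _ _)
  rw [hd]
  have hr := rHat_eq (D := D)
  -- The cofactors of a least common multiple are coprime.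
  have hco : Nat.Coprime D.ratio (D.rHat / D.rRed) := by
    have h := Nat.coprime_div_gcd_div_gcd (Nat.gcd_pos_of_pos_left D.rRed hD.r_pos)
    have h1 : D.ratio = D.rRed / Nat.gcd D.r D.rRed := by
      refine Nat.eq_of_mul_eq_mul_left hD.r_pos ?_
      rw [← hr, ← Nat.mul_div_assoc _ (Nat.gcd_dvd_right _ _)]; rfl
    have h2 : D.rHat / D.rRed = D.r / Nat.gcd D.r D.rRed := by
      refine Nat.eq_of_mul_eq_mul_left D.fraction.den_pos ?_
      refine hg.trans ?_
      rw [← Nat.mul_div_assoc _ (Nat.gcd_dvd_left _ _)]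
      change _ = D.rRed * D.r / _
      rw [mul_comm]; rfl
    rw [h1, h2]
    exact h.symm
  refine Nat.Coprime.mul_right ?_ hco
  have h1 : D.ratio ∣ D.rRed := by
    have h : D.r * D.ratio ∣ D.r * D.rRed := hr ▸ Nat.lcm_dvd_mul _ _
    exact Nat.dvd_of_mul_dvd_mul_left hD.r_pos h
  exact (Nat.Coprime.coprime_dvd_right h1 coprime_dRed_rRed).symm

theorem IsValid.exists_isBezout (hD : D.IsValid) : ∃ a b : ℤ, D.IsBezout a b := by
  obtain ⟨a, b, h⟩ := Nat.isCoprime_iff_coprime.mpr hD.coprime_ratio_dHat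
  exact ⟨a, b, hD.isBezout_iff.mpr h⟩

/-- The index `N` is invertible in characteristic zero, so the modified stack is a finite étale
gerbe over `∞_𝒳`, banded by the `N`-th roots of unity. -/
theorem IsValid.isFiniteGerbe [CharZero k] (hD : D.IsValid) {a b : ℤ} (hab : D.IsBezout a b) :
    D.X.IsFiniteGerbe (D.hatToX a b) where
  gpd := D.gpd_hatToX a b
  exists_section := exists_hatToX_etCover hD.properDM.toIsStack a b
  exists_relProd c₁ c₂ _ p₁ p₂ := hatToX_exists_isRelProd hD.properDM.toIsStack hD.d_eq hD.ℓ_eq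
    (hD.isBezout_iff.mp hab) hD.index_ne_zero (fun x => by
      have h := (IsUnit.mk0 (D.index : k) (Nat.cast_ne_zero.mpr hD.index_ne_zero)).map
        (algebraMap k (D.X.O x))
      rwa [map_natCast] at h) c₁ c₂ p₁ p₂

/-- The coarse moduli space does not change. -/
theorem IsValid.hat [CharZero k] (hD : D.IsValid) {a b : ℤ} (hab : D.IsBezout a b) :
    (D.hat a b).IsValid where
  properDM := (hD.isFiniteGerbe hab).isProperDM hD.properDM
    (isStack_XHat a b hD.properDM.toIsStack)
  projectiveCoarse := by
    obtain ⟨M, π, h, hM⟩ := hD.projectiveCoarse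
    exact ⟨M, _, (hD.isFiniteGerbe hab).isCoarseModuli hD.properDM.toIsStack.gpd h, hM⟩
  r_pos := hD.rHat_pos
  d_pos := hD.dHat_pos
  ℓ_pos := Nat.one_pos

theorem IsValid.isEtaleMap [CharZero k] (hD : D.IsValid) {a b : ℤ} (hab : D.IsBezout a b) :
    D.X.IsEtaleMap (D.hatToX a b) := by
  obtain ⟨n, x, hx, hx'⟩ := hD.properDM.atlas
  exact (hD.isFiniteGerbe hab).isEtaleMap hD.properDM.toIsStack.gpd hD.properDM.finite_diagonal
    hx hx'

theorem IsValid.isSmooth [CharZero k] (hD : D.IsValid) {a b : ℤ} (hab : D.IsBezout a b)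
    (h : D.X.IsSmooth) : (D.hat a b).X.IsSmooth := fun y hy =>
  h _ (hD.isEtaleMap hab y hy)

end InputData

end

/-! ### Deligne--Faltings log structures -/

section

/-- Flat maps detect, near the image of a prime `q`, whether an element vanishes. -/
theorem exists_notMem_of_flat {A B : Type u} [CommRing A] [CommRing B] {φ : A →+* B} (hφ : φ.Flat)
    (q : PrimeSpectrum B) {c : A} {f : B} (hf : f ∉ q.asIdeal) (h : f * φ c = 0) :
    ∃ g ∉ (PrimeSpectrum.comap φ q).asIdeal, g * c = 0 := by
  algebraize [φ]
  obtain ⟨m, a, y, hy, ha⟩ := Module.Flat.isTrivialRelation_of_sum_smul_eq_zero (R := A) (M := B)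
    (ι := Unit) (f := fun _ => c) (x := fun _ => f) (by
      rw [Fintype.sum_unique, Algebra.smul_def, mul_comm]
      exact h)
  by_contra hc
  refine hf ?_
  rw [show f = ∑ j, a () j • y j from hy ()]
  refine Ideal.sum_mem _ fun j _ => ?_
  rw [Algebra.smul_def]
  refine Ideal.mul_mem_right _ _ ?_
  by_contra hj
  refine hc ⟨a () j, hj, ?_⟩
  have := ha j
  rwa [Fintype.sum_unique, mul_comm] at this

section Sym

variable {A B C D : Type u} [CommRing A] [CommRing B] [CommRing C] [CommRing D]
  {φ : A →+* B} {N : InvMod A} {N' : InvMod B}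

/-- The universal property of `N'` as the base change of `N`, for semilinear maps. -/
theorem InvMod.Map.exists_extend (F : InvMod.Map φ N N') {E : Type u} [CommRing E] (b : B →+* E)
    (c : N →+ E) (hc : ∀ (a : A) n, c (a • n) = b (φ a) * c n) :
    ∃ d : N' →+ E, (∀ (x : B) n, d (x • n) = b x * d n) ∧ ∀ n, d (F n) = c n := by
  let _ := φ.toAlgebra
  let _ := b.toAlgebra
  let _ := (b.comp φ).toAlgebra
  have : IsScalarTower A B E := .of_algebraMap_eq fun _ => rfl
  let _ : Module A N' := Module.compHom _ φ
  have : IsScalarTower A B N' := ⟨fun a b m => mul_smul _ _ _⟩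
  let F' : N →ₗ[A] N' := { F.toFun with map_smul' := F.map_smul }
  have hF : IsBaseChange B F' := F.isBaseChange F' fun _ => rfl
  let c' : N →ₗ[A] E := { c with map_smul' := fun a n => (hc a n).trans (Algebra.smul_def a (c n)).symm }
  refine ⟨(hF.lift c').toAddMonoidHom, fun x n => ?_, fun n => hF.lift_eq c' n⟩
  exact ((hF.lift c').map_smul x n).trans (Algebra.smul_def _ _)

/-- The symmetric algebra is compatible with base change. -/
theorem symMap_ringSq (F : InvMod.Map φ N N') :
    RingSq φ (algebraMap A (SymmetricAlgebra A N)) (algebraMap B (SymmetricAlgebra B N'))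
      (symMap F) := by
  refine RingSq.of_exists_desc (fun a => (symMap_algebraMap F a).symm) (fun {E} _ b c hbc => ?_)
    fun {E} _ d d' h h' => ?_
  · obtain ⟨e, he, heF⟩ := F.exists_extend b
      (c.toAddMonoidHom.comp (SymmetricAlgebra.ι A N).toAddMonoidHom) fun a n => by
        change c (SymmetricAlgebra.ι A N (a • n)) = b (φ a) * c (SymmetricAlgebra.ι A N n)
        rw [map_smul, Algebra.smul_def, map_mul, hbc]
    let _ := b.toAlgebra
    let e' : N' →ₗ[B] E := { e with map_smul' := fun x n => (he x n).trans (Algebra.smul_def x (e n)).symm }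
    have h1 : ∀ n, SymmetricAlgebra.lift e' (SymmetricAlgebra.ι B N' n) = e n := fun n =>
      SymmetricAlgebra.lift_ι_apply _ n
    refine ⟨(SymmetricAlgebra.lift e').toRingHom, fun x => (SymmetricAlgebra.lift e').commutes x,
      fun t => sym_hom_ext (f := (SymmetricAlgebra.lift e').toRingHom.comp (symMap F)) (g := c)
        (fun a => ?_) (fun n => ?_) t⟩
    · change SymmetricAlgebra.lift e' (symMap F (algebraMap A _ a)) = _
      rw [symMap_algebraMap, ← hbc]
      exact (SymmetricAlgebra.lift e').commutes _
    · change SymmetricAlgebra.lift e' (symMap F (SymmetricAlgebra.ι A N n)) = _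
      rw [symMap_ι, h1, heF]
      rfl
  · refine RingHom.ext fun t => sym_hom_ext h (fun n => ?_) t
    obtain ⟨e, he, heF⟩ := F.exists_extend (d.comp (algebraMap B _))
      (d.toAddMonoidHom.comp ((SymmetricAlgebra.ι B N').toAddMonoidHom.comp F.toFun)) fun a n => by
        change d (SymmetricAlgebra.ι B N' (F.toFun (a • n))) =
          d (algebraMap B _ (φ a)) * d (SymmetricAlgebra.ι B N' (F n))
        rw [F.map_smul, map_smul, Algebra.smul_def, map_mul]
    have key : ∀ g : SymmetricAlgebra B N' →+* E, (∀ x, g (algebraMap B _ x) = d (algebraMap B _ x)) →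
        (∀ x, g (symMap F x) = d (symMap F x)) → ∀ n, g (SymmetricAlgebra.ι B N' n) = e n :=
      fun g hg hg' n => by
        have hn : n ∈ Submodule.span B (Set.range F.toFun) := by rw [F.span_range]; trivial
        induction hn using Submodule.span_induction with
        | zero => simp
        | add x y _ _ hx hy => rw [map_add, map_add, map_add, hx, hy]
        | smul c x _ hx => rw [map_smul, Algebra.smul_def, map_mul, hx, hg, he]; rfl
        | mem x hx =>
          obtain ⟨y, rfl⟩ := hx
          rw [← symMap_ι, hg', heF, symMap_ι]
          rfl
    exact (key d (fun _ => rfl) (fun _ => rfl) n).trans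
      (key d' (fun x => (h x).symm) (fun x => (h' x).symm) n).symm

theorem symMap_comm {ψ : A →+* C} {α : B →+* D} {β : C →+* D} {M : InvMod C} {Q : InvMod D}
    (h : ∀ a, α (φ a) = β (ψ a)) (F : InvMod.Map φ N N') (G : InvMod.Map ψ N M)
    (R : InvMod.Map α N' Q) (P : InvMod.Map β M Q) (hRP : ∀ n, R (F n) = P (G n))
    (t : SymmetricAlgebra A N) : symMap R (symMap F t) = symMap P (symMap G t) :=
  sym_hom_ext (f := (symMap R).comp (symMap F)) (g := (symMap P).comp (symMap G))
    (fun a => by simp only [RingHom.comp_apply, symMap_algebraMap, h])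
    (fun n => by simp only [RingHom.comp_apply, symMap_ι, hRP]) t

/-- The symmetric algebras of the pullbacks of `N` to a cocartesian square form a cocartesian
square. -/
theorem symMap_ringSq_of_ringSq {ψ : A →+* C} {α : B →+* D} {β : C →+* D} {M : InvMod C}
    {Q : InvMod D} (h : RingSq φ ψ α β) (F : InvMod.Map φ N N') (G : InvMod.Map ψ N M)
    (R : InvMod.Map α N' Q) (P : InvMod.Map β M Q) (hRP : ∀ n, R (F n) = P (G n)) :
    RingSq (symMap F) (symMap G) (symMap R) (symMap P) := by
  have hc := symMap_comm h.comm F G R P hRP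
  refine RingSq.of_exists_desc hc (fun {E} _ b c hbc => ?_) fun {E} _ d d' h₁ h₂ => ?_
  · obtain ⟨e, he, he'⟩ := h.exists_desc (b.comp (algebraMap B _)) (c.comp (algebraMap C _))
      fun a => by
        simp only [RingHom.comp_apply, ← symMap_algebraMap F, ← symMap_algebraMap G, hbc]
    obtain ⟨d, hd, hd'⟩ := (symMap_ringSq R).exists_desc e b he
    refine ⟨d, hd', RingHom.congr_fun ((symMap_ringSq G).hom_ext (d := d.comp (symMap P)) (d' := c)
      (fun x => ?_) fun x => ?_)⟩
    · rw [RingHom.comp_apply, symMap_algebraMap, hd, he']; rfl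
    · rw [RingHom.comp_apply, ← hc, hd', hbc]
  · refine (symMap_ringSq R).hom_ext (fun x => ?_) h₁
    refine RingHom.congr_fun (h.hom_ext (d := d.comp (algebraMap D _))
      (d' := d'.comp (algebraMap D _)) (fun b => ?_) fun c => ?_) x
    · simp only [RingHom.comp_apply, ← symMap_algebraMap R, h₁]
    · simp only [RingHom.comp_apply, ← symMap_algebraMap P, h₂]

end Sym

end

section

section Sym

variable {A B : Type u} [CommRing A] [CommRing B] {φ : A →+* B} {N : InvMod A} {N' : InvMod B}

open Polynomial InvMod

/-- Up to powers of `χ(g)`, the elements of the symmetric algebra are polynomials in `g`. -/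
theorem exists_eq_aeval (χ : N.dual) (g : N) (t : SymmetricAlgebra A N) :
    ∃ (m : ℕ) (P : A[X]), pair χ g ^ m • t = aeval (SymmetricAlgebra.ι A N g) P := by
  induction t using SymmetricAlgebra.induction with
  | algebraMap a => exact ⟨0, C a, by rw [pow_zero, one_smul, aeval_C]⟩
  | ι n =>
    refine ⟨1, C (pair χ n) * X, ?_⟩
    rw [pow_one, ← map_smul, pair_comm, map_smul, map_mul, aeval_C, aeval_X, Algebra.smul_def]
  | mul a b ha hb =>
    obtain ⟨m, P, hP⟩ := ha
    obtain ⟨n, Q, hQ⟩ := hb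
    exact ⟨m + n, P * Q, by rw [map_mul, ← hP, ← hQ, smul_mul_smul_comm, pow_add]⟩
  | add a b ha hb =>
    obtain ⟨m, P, hP⟩ := ha
    obtain ⟨n, Q, hQ⟩ := hb
    refine ⟨m + n, C (pair χ g ^ n) * P + C (pair χ g ^ m) * Q, ?_⟩
    rw [map_add, map_mul, map_mul, aeval_C, aeval_C, ← hP, ← hQ, ← Algebra.smul_def,
      ← Algebra.smul_def, smul_smul, smul_smul, pow_add, smul_add, mul_comm (pair χ g ^ n)]

/-- The homogeneous components of the powers of `g` are independent, up to powers of `χ(g)`. -/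
theorem eq_of_aeval_eq (χ : N.dual) (g : N) {P Q : A[X]}
    (h : aeval (SymmetricAlgebra.ι A N g) P = aeval (SymmetricAlgebra.ι A N g) Q) (i : ℕ) :
    pair χ g ^ i * P.coeff i = pair χ g ^ i * Q.coeff i := by
  let χ' : Module.Dual A N := χ
  let e : SymmetricAlgebra A N →ₐ[A] A[X] :=
    SymmetricAlgebra.lift ((LinearMap.toSpanSingleton A A[X] X) ∘ₗ χ')
  have he : e (SymmetricAlgebra.ι A N g) = C (pair χ g) * X :=
    (SymmetricAlgebra.lift_ι_apply _ g).trans (smul_eq_C_mul _)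
  have h1 : ∀ P : A[X], (e (aeval (SymmetricAlgebra.ι A N g) P)).coeff i =
      pair χ g ^ i * P.coeff i := fun P => by
    rw [← aeval_algHom_apply, he]
    change (P.comp (C (pair χ g) * X)).coeff i = _
    rw [comp_C_mul_X_coeff, mul_comm]
  rw [← h1, ← h1, h]

/-- Log homogeneity descends along flat coverings. -/
theorem IsLogHomogeneous.of_map (hφ : φ.Flat) (F : InvMod.Map φ N N') {t : SymmetricAlgebra A N}
    (ht : IsLogHomogeneous (symMap F t)) (q : PrimeSpectrum B) :
    ∃ f ∉ (PrimeSpectrum.comap φ q).asIdeal, ∃ u ∉ (PrimeSpectrum.comap φ q).asIdeal, ∃ (g : N)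
      (n : ℕ), (∀ x : N, ∃ a : A, f • x = a • g) ∧ f • t = u • SymmetricAlgebra.ι A N g ^ n := by
  obtain ⟨f, hf, u, hu, g', n, hg', ht⟩ := ht q
  obtain ⟨g, χ, hχ⟩ := N.exists_genAt (PrimeSpectrum.comap φ q)
  obtain ⟨m, P, hP⟩ := exists_eq_aeval χ g t
  have hmul : ∀ {y z : B}, y ∉ q.asIdeal → z ∉ q.asIdeal → y * z ∉ q.asIdeal :=
    fun hy hz h => (q.2.mem_or_mem h).elim hy hz
  have hpow : ∀ {y : B}, y ∉ q.asIdeal → ∀ m, y ^ m ∉ q.asIdeal :=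
    fun hy m h => hy (q.2.mem_of_pow_mem m h)
  -- The image of `g` is a multiple of `g'` up to a unit at `q`.
  have hF : pair (F.dual χ) (F g) = φ (pair χ g) := F.dual_pair χ g
  have hs : φ (pair χ g) ∉ q.asIdeal := hχ
  have hgg : φ (pair χ g) • g' = pair (F.dual χ) g' • F g := by
    rw [← hF, pair_comm]
  have hv : pair (F.dual χ) g' ∉ q.asIdeal := by
    obtain ⟨a, ha⟩ := hg' (F g)
    intro h
    refine hmul hf hs ?_
    have := congrArg (pair (F.dual χ)) ha
    rw [pair_smul, pair_smul, hF] at this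
    rw [this]
    exact Ideal.mul_mem_left _ _ h
  set s := pair χ g with hsdef
  set v := pair (F.dual χ) g' with hvdef
  -- Compare the two expressions of the image of `t` as polynomials in the image of `g`.
  have key : aeval (SymmetricAlgebra.ι B N' (F g)) (C (φ s ^ n * f) * P.map φ) =
      aeval (SymmetricAlgebra.ι B N' (F g)) (C (φ s ^ m * u * v ^ n) * X ^ n) := by
    have h1 : aeval (SymmetricAlgebra.ι B N' (F g)) (P.map φ) = φ s ^ m • symMap F t := by
      have h2 := congrArg (symMap F) hP
      rw [Algebra.smul_def, map_mul, symMap_algebraMap, map_pow, ← Algebra.smul_def] at h2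
      rw [h2, aeval_def, eval₂_map, aeval_def, hom_eval₂, symMap_ι]
      congr 1
      exact RingHom.ext fun a => (symMap_algebraMap F a).symm
    have h3 : φ s ^ n • SymmetricAlgebra.ι B N' g' ^ n =
        v ^ n • SymmetricAlgebra.ι B N' (F g) ^ n := by
      rw [← _root_.smul_pow, ← _root_.smul_pow, ← map_smul, ← map_smul, hgg]
    have h4 : ∀ (c : B) (Q : Polynomial B), aeval (SymmetricAlgebra.ι B N' (F g)) (C c * Q) =
        c • aeval (SymmetricAlgebra.ι B N' (F g)) Q := fun c Q => by
      rw [map_mul, aeval_C, Algebra.smul_def]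
    rw [h4, h4, h1, map_pow, aeval_X, smul_smul,
      show φ s ^ n * f * φ s ^ m = φ s ^ n * φ s ^ m * f by ring,
      mul_smul _ f, ht, smul_smul, show φ s ^ n * φ s ^ m * u = φ s ^ m * u * φ s ^ n by ring,
      mul_smul, h3, smul_smul]
  have hcoef : ∀ i, φ s ^ i * (φ s ^ n * f * φ (P.coeff i)) =
      φ s ^ i * (φ s ^ m * u * v ^ n * if i = n then 1 else 0) := fun i => by
    have := eq_of_aeval_eq (F.dual χ) (F g) key i
    rwa [hF, coeff_C_mul, coeff_C_mul, coeff_map, coeff_X_pow] at this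
  have hn : P.coeff n ∉ (PrimeSpectrum.comap φ q).asIdeal := fun h => by
    have h1 := hcoef n
    rw [if_pos rfl, mul_one] at h1
    refine hmul (hpow hs n) (hmul (hmul (hpow hs m) hu) (hpow hv n)) ?_
    rw [← h1]
    exact Ideal.mul_mem_left _ _ (Ideal.mul_mem_left _ _ h)
  have hz : ∀ i, ∃ h ∉ (PrimeSpectrum.comap φ q).asIdeal, i ≠ n → h * P.coeff i = 0 := fun i => by
    by_cases hi : i = n
    · exact ⟨1, (PrimeSpectrum.comap φ q).2.one_notMem, fun h => (h hi).elim⟩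
    · have h1 := hcoef i
      rw [if_neg hi, mul_zero, mul_zero, ← mul_assoc] at h1
      obtain ⟨h, hh, hh'⟩ := exists_notMem_of_flat hφ q
        (hmul (hpow hs i) (hmul (hpow hs n) hf)) h1
      exact ⟨h, hh, fun _ => hh'⟩
  choose h hh hh' using hz
  set H := ∏ i ∈ P.support, h i with hH
  have hHn : H ∉ (PrimeSpectrum.comap φ q).asIdeal := fun h1 => by
    obtain ⟨i, _, hi⟩ := ((PrimeSpectrum.comap φ q).2.prod_mem_iff).mp h1
    exact hh i hi
  have hHP : H • P = C (H * P.coeff n) * X ^ n := by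
    ext i
    rw [coeff_smul, coeff_C_mul, coeff_X_pow, smul_eq_mul]
    by_cases hi : i = n
    · rw [if_pos hi, mul_one, hi]
    · rw [if_neg hi, mul_zero]
      by_cases hiP : i ∈ P.support
      · rw [hH, ← Finset.prod_erase_mul _ _ hiP, mul_assoc, hh' i hi, mul_zero]
      · rw [notMem_support_iff.mp hiP, mul_zero]
  have hmulA : ∀ {y z : A}, y ∉ (PrimeSpectrum.comap φ q).asIdeal →
      z ∉ (PrimeSpectrum.comap φ q).asIdeal → y * z ∉ (PrimeSpectrum.comap φ q).asIdeal :=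
    fun hy hz h => ((PrimeSpectrum.comap φ q).2.mem_or_mem h).elim hy hz
  have hsA : s ∉ (PrimeSpectrum.comap φ q).asIdeal := hχ
  refine ⟨s * (H * s ^ m), hmulA hsA (hmulA hHn fun h => hsA
    ((PrimeSpectrum.comap φ q).2.mem_of_pow_mem m h)), s * (H * P.coeff n),
    hmulA hsA (hmulA hHn hn), g, n, fun x => ⟨H * s ^ m * pair χ x, ?_⟩, ?_⟩
  · rw [mul_comm, mul_smul, hsdef, pair_comm, smul_smul]
  · have h1 := congrArg (aeval (SymmetricAlgebra.ι A N g)) hHP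
    rw [map_smul, ← hP, map_mul, aeval_C, map_pow, aeval_X, ← Algebra.smul_def] at h1
    rw [mul_smul, mul_smul H, h1, mul_smul s]

end Sym

variable {k : Type u} [Field k]

theorem isLogHomogeneous_algebraMap {A : Type u} [CommRing A] {N : InvMod A} {a : A}
    (ha : IsUnit a) : IsLogHomogeneous (algebraMap A (SymmetricAlgebra A N) a) := fun p => by
  obtain ⟨f, hf, g, hg⟩ := exists_local_generator N p
  refine ⟨f, hf, f * a, fun h => (p.2.mem_or_mem h).elim hf fun h =>
    p.2.ne_top (Ideal.eq_top_of_isUnit_mem _ h ha), g, 0, hg, ?_⟩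
  rw [pow_zero, Algebra.smul_def, Algebra.smul_def, mul_one, map_mul]

/-- Log homogeneous elements which do not vanish on the zero section have degree zero. -/
theorem IsLogHomogeneous.eq_algebraMap {A : Type u} [CommRing A] {N : InvMod A}
    {t : SymmetricAlgebra A N} (ht : IsLogHomogeneous t)
    (h : IsUnit (SymmetricAlgebra.algebraMapInv t)) :
    t = algebraMap A _ (SymmetricAlgebra.algebraMapInv t) := by
  refine InvMod.eq_of_forall_prime (A := A) fun p => ?_
  obtain ⟨f, hf, u, hu, g, n, -, h1⟩ := ht p
  have h2 := congrArg SymmetricAlgebra.algebraMapInv h1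
  rw [map_smul, map_smul, map_pow, SymmetricAlgebra.algebraMapInv_ι] at h2
  refine ⟨f, hf, ?_⟩
  obtain rfl | hn := Nat.eq_zero_or_pos n
  · rw [pow_zero, smul_eq_mul, smul_eq_mul, mul_one] at h2
    rw [h1, pow_zero, ← h2, Algebra.smul_def, Algebra.smul_def, map_mul, mul_one]
  · rw [zero_pow hn.ne', smul_zero, smul_eq_mul] at h2
    exact (hf (by rw [h.mul_left_eq_zero.mp h2]; exact p.asIdeal.zero_mem)).elim

/-- The Deligne--Faltings log structure of a line bundle is a log structure. Its sections glue since
the symmetric algebra of the dual line bundle and log homogeneity are compatible with flat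
descent. -/
theorem isLog_zeroSectionLog {X : AffCat k} (hX : IsGpdFibration X.p) (E : LineBundle X) :
    (zeroSectionLog E).IsLog where
  units x a ha := by
    refine ⟨⟨algebraMap _ _ a, isLogHomogeneous_algebraMap ha⟩,
      SymmetricAlgebra.algebraMap_leftInverse _ a, fun m hm => Subtype.ext ?_⟩
    have h1 : SymmetricAlgebra.algebraMapInv m.1 = a := hm
    exact (m.2.eq_algebraMap (h1 ▸ ha)).trans (congrArg _ h1)
  sheaf x n y f hf s hs := by
    have hfl : ∀ i, (X.pull (f i)).Flat := fun i => EtSurj.flat (hf.1 i)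
    have hB : ∀ p : PrimeSpectrum (X.O x), ∃ i, ∃ q, PrimeSpectrum.comap (X.pull (f i)) q = p := hf.2
    choose z a b hz using fun i j => hX.exists_isPullback (f i) (f j)
    have hsq := fun i j => ringSq_of_isPullback (hz i j).2
    have hsym := fun i j => symMap_ringSq_of_ringSq (hsq i j) (E.dual.map (f i)) (E.dual.map (f j))
      (E.dual.map (a i j)) (E.dual.map (b i j)) fun m => by
        rw [← E.dual.map_comp' rfl, ← E.dual.map_comp' rfl, E.dual.map_congr (hz i j).1.w]
    have hfl' : ∀ i, (symMap (E.dual.map (f i))).Flat := fun i =>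
      (symMap_ringSq _).stable RingHom.Flat.isStableUnderBaseChange (hfl i)
    have hB' : ∀ p : PrimeSpectrum (SymmetricAlgebra (X.O x) (E.dual.obj x)), ∃ i, ∃ q,
        PrimeSpectrum.comap (symMap (E.dual.map (f i))) q = p := fun p => by
      obtain ⟨i, q, hq⟩ := hB (PrimeSpectrum.comap (algebraMap _ _) p)
      obtain ⟨r, -, hr⟩ := (symMap_ringSq (E.dual.map (f i))).exists_prime q p hq
      exact ⟨i, r, hr⟩
    obtain ⟨t, ht⟩ := InvMod.exists_glue hfl' hB' hsym
      (fun i => InvMod.Map.unit (symMap (E.dual.map (f i))))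
      (fun i j => InvMod.Map.unit (symMap (E.dual.map (a i j))))
      (fun i j => InvMod.Map.unit (symMap (E.dual.map (b i j)))) (fun i j => (hsym i j).comm)
      (fun i => (s i).1) fun i j => congrArg Subtype.val (hs i j _ (a i j) (b i j) (hz i j).1.w)
    refine ⟨⟨t, fun p => ?_⟩, fun i => Subtype.ext (ht i), fun m hm => Subtype.ext ?_⟩
    · obtain ⟨i, q, rfl⟩ := hB p
      refine IsLogHomogeneous.of_map (hfl i) (E.dual.map (f i)) ?_ q
      exact (show symMap (E.dual.map (f i)) t = (s i).1 from ht i) ▸ (s i).2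
    · exact InvMod.Map.jointly_injective hfl' hB'
        (fun i => InvMod.Map.unit (symMap (E.dual.map (f i)))) fun i =>
          (congrArg Subtype.val (hm i)).trans (ht i).symm

end

/-! ### The targets are stacks -/

section

variable {k : Type u} [Field k]

theorem AffCat.IsStack.rootStack {X : AffCat k} (hX : X.IsStack) (n : ℕ) (N : LineBundle X) :
    (rootStack X n N).IsStack :=
  hX.withLine.withIso _ _

namespace InputData

variable {D : InputData k}

theorem isStack_infty (hX : D.X.IsStack) : D.infty.IsStack := hX.withLine.rootStack _ _

theorem isStack_root (hX : D.X.IsStack) : D.root.IsStack := (isStack_infty hX).rootStack _ _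

theorem isLog_target (hX : D.X.IsStack) : D.target.log.IsLog :=
  isLog_zeroSectionLog (isStack_root hX).gpd D.lineRoot

theorem isLog_hatTarget (a b : ℤ) (hX : D.X.IsStack) : (D.hatTarget a b).log.IsLog :=
  isLog_zeroSectionLog (isStack_root (D := D.hat a b) (isStack_XHat a b hX)).gpd
    (D.hat a b).lineRoot

end InputData

end

/-! ### Local generators of dual line bundles -/

section

namespace InvMod

variable {A B : Type u} [CommRing A] [CommRing B] {φ : A →+* B}

theorem GenAt.smul {L : InvMod A} {p : PrimeSpectrum A} {x : L} (hx : GenAt p x) {f : A}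
    (hf : f ∉ p.asIdeal) : GenAt p (f • x) := by
  obtain ⟨χ, hχ⟩ := hx
  exact ⟨χ, fun h => (p.2.mem_or_mem (pair_smul χ f x ▸ h)).elim hf hχ⟩

theorem exists_genAt_pair (L : InvMod A) (p : PrimeSpectrum A) :
    ∃ (x : L) (χ : L.dual), GenAt p x ∧ GenAt p χ ∧ pair χ x ∉ p.asIdeal := by
  obtain ⟨x, χ, h⟩ := L.exists_genAt p
  exact ⟨x, χ, ⟨χ, h⟩, ⟨evalDual x, h⟩, h⟩

theorem GenAt.exists_pair {L : InvMod A} {p : PrimeSpectrum A} {χ : L.dual} (hχ : GenAt p χ) :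
    ∃ x : L, GenAt p x ∧ pair χ x ∉ p.asIdeal := by
  obtain ⟨x, ξ, hx, -, h⟩ := L.exists_genAt_pair p
  obtain ⟨ζ, hζ⟩ := hχ
  refine ⟨x, hx, fun h1 => ?_⟩
  refine (p.2.mem_or_mem (?_ : pair ξ x * pair ζ χ ∈ p.asIdeal)).elim h hζ
  have h2 : pair ξ x • χ = pair χ x • ξ := dual_ext fun y => by
    have h3 := congrArg (pair χ) (pair_comm ξ x y)
    rw [pair_smul, pair_smul] at h3
    rw [pair_smul_left, pair_smul_left, h3, mul_comm]
  rw [← pair_smul, h2, pair_smul]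
  exact Ideal.mul_mem_right _ _ h1

theorem GenAt.tdual {L L' : InvMod A} {p : PrimeSpectrum A} {χ : L.dual} {ξ : L'.dual}
    (hχ : GenAt p χ) (hξ : GenAt p ξ) : GenAt p (tdual χ ξ) := by
  obtain ⟨x, -, hx⟩ := hχ.exists_pair
  obtain ⟨y, -, hy⟩ := hξ.exists_pair
  exact ⟨evalDual (InvMod.tmul x y), fun h => (p.2.mem_or_mem h).elim hx hy⟩

theorem GenAt.powDual {L : InvMod A} {p : PrimeSpectrum A} {χ : L.dual} (hχ : GenAt p χ) (n : ℕ) :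
    GenAt p (powDual χ n) := by
  obtain ⟨x, -, hx⟩ := hχ.exists_pair
  exact ⟨evalDual (InvMod.pow x n), fun h => hx (p.2.mem_of_pow_mem n (pair_powDual χ x n ▸ h))⟩

theorem tdual_smul_left {L L' : InvMod A} (a : A) (χ : L.dual) (ξ : L'.dual) :
    tdual (a • χ) ξ = a • tdual χ ξ :=
  dual_ext fun z => by
    refine DFunLike.congr_fun (tensor_hom_ext (M := A)
      (f := ((show Module.Dual A (L.tensor L') from tdual (a • χ) ξ)).toAddMonoidHom)
      (g := (show Module.Dual A (L.tensor L') from a • tdual χ ξ).toAddMonoidHom)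
      fun x y => mul_assoc a (pair χ x) (pair ξ y)) z

theorem tdual_smul_right {L L' : InvMod A} (a : A) (χ : L.dual) (ξ : L'.dual) :
    tdual χ (a • ξ) = a • tdual χ ξ :=
  dual_ext fun z => by
    refine DFunLike.congr_fun (tensor_hom_ext (M := A)
      (f := ((show Module.Dual A (L.tensor L') from tdual χ (a • ξ))).toAddMonoidHom)
      (g := (show Module.Dual A (L.tensor L') from a • tdual χ ξ).toAddMonoidHom)
      fun x y => mul_left_comm (pair χ x) a (pair ξ y)) z

theorem Map.dual_tdual {L L' : InvMod A} {M M' : InvMod B} (f : Map φ L M) (g : Map φ L' M')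
    (χ : L.dual) (ξ : L'.dual) :
    (f.tensor g).dual (tdual χ ξ) = tdual (f.dual χ) (g.dual ξ) := by
  refine (f.tensor g).dual_ext fun z => ?_
  refine ((f.tensor g).dual_pair (tdual χ ξ) z).trans ?_
  refine DFunLike.congr_fun (tensor_hom_ext (M := B)
    (f := φ.toAddMonoidHom.comp (show Module.Dual A (L.tensor L') from tdual χ ξ).toAddMonoidHom)
    (g := (show Module.Dual B (M.tensor M') from
      tdual (f.dual χ) (g.dual ξ)).toAddMonoidHom.comp (f.tensor g).toFun)
    fun x y => ?_) z
  change φ (pair χ x * pair ξ y) = pair (f.dual χ) (f x) * pair (g.dual ξ) (g y)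
  rw [f.dual_pair, g.dual_pair, map_mul]

theorem Map.npow_dual_powDual {L : InvMod A} {M : InvMod B} (f : Map φ L M) (χ : L.dual) (n : ℕ) :
    (f.npow n).dual (powDual χ n) = powDual (f.dual χ) n :=
  (f.npow n).dual_ext fun z => ((f.npow n).dual_pair _ z).trans (f.dual_powDual χ n z).symm

/-! ### The universal isomorphism of the spin structure -/

/-- `(L₁ ⊗ S^c)^r ≅ L₁^r ⊗ S^{r c}`. -/
theorem exists_mulPowEquiv (L S : InvMod A) {c r r' : ℕ} (hr : r' = r * c) :
    ∃ e : (L.tensor (S.npow c)).npow r ≃ₗ[A] (L.npow r).tensor (S.npow r'),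
      ∀ x s, e (pow (tmul x (pow s c)) r) = tmul (pow x r) (pow s r') := by
  have h1 : ∀ p : PrimeSpectrum A, ∃ (x : L) (y : S), GenAt p x ∧ GenAt p y := fun p => by
    obtain ⟨x, hx⟩ := L.exists_genAt p
    obtain ⟨y, hy⟩ := S.exists_genAt p
    exact ⟨x, y, hx, hy⟩
  let F : L × S → (L.tensor (S.npow c)).npow r := fun s => pow (tmul s.1 (pow s.2 c)) r
  let G : L × S → (L.npow r).tensor (S.npow r') := fun s => tmul (pow s.1 r) (pow s.2 r')
  -- Both sides have degree `r` in `x` and degree `r c` in `s`.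
  have hs : ∀ s s', tmul (F s) (G s') = tmul (F s') (G s) := by
    refine swap_prod (n := r) (fun y a x => ?_) (fun y a x => ?_) fun x x' =>
      Homog.swap (n := r') (fun a y => ?_) (fun a y => ?_)
    · simp only [F, pow_smul, smul_tmul]
    · simp only [G, pow_smul, smul_tmul]
    · simp only [F, pow_smul, tmul_smul, ← pow_mul, hr, mul_comm]
    · simp only [G, pow_smul, tmul_smul]
  obtain ⟨e, he⟩ := exists_equiv_of_swap F G (fun p => by
      obtain ⟨x, y, hx, hy⟩ := h1 p
      exact ⟨(x, y), (hx.tmul (hy.pow c)).pow r⟩) (fun p => by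
      obtain ⟨x, y, hx, hy⟩ := h1 p
      exact ⟨(x, y), (hx.pow r).tmul (hy.pow r')⟩) hs
  exact ⟨e, fun x y => he (x, y)⟩

/-- The contraction `L^n ⊗ ((M ⊗ L^{-n}) ⊗ W) ≅ M ⊗ W`. -/
theorem exists_contractEquiv (L M W : InvMod A) (n : ℕ) :
    ∃ e : (L.npow n).tensor ((M.tensor (L.dual.npow n)).tensor W) ≃ₗ[A] M.tensor W,
      ∀ x δ m w, e (tmul (pow x n) (tmul (tmul m (pow δ n)) w)) = pair δ x ^ n • tmul m w := by
  let F : L × L.dual × M × W → (L.npow n).tensor ((M.tensor (L.dual.npow n)).tensor W) :=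
    fun s => tmul (pow s.1 n) (tmul (tmul s.2.2.1 (pow s.2.1 n)) s.2.2.2)
  let G : L × L.dual × M × W → M.tensor W :=
    fun s => pair s.2.1 s.1 ^ n • tmul s.2.2.1 s.2.2.2
  -- Both sides have degrees `n`, `n`, `1`, `1` in `x`, `δ`, `m`, `w`.
  have hs : ∀ s s', tmul (F s) (G s') = tmul (F s') (G s) := by
    refine swap_prod (n := n) (fun y a x => ?_) (fun y a x => ?_) fun x x' =>
      swap_prod (F := fun s => F (x, s)) (G := fun s => G (x', s)) (n := n)
        (fun y a δ => ?_) (fun y a δ => ?_) fun δ δ' =>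
      swap_prod (F := fun s => F (x, δ, s)) (G := fun s => G (x', δ', s)) (n := 1)
        (fun w a m => ?_) (fun w a m => ?_) fun m m' =>
      Homog.swap (n := 1) (fun a w => ?_) (fun a w => ?_)
    · simp only [F, pow_smul, smul_tmul]
    · simp only [G, pair_smul, mul_pow, mul_smul]
    · simp only [F, pow_smul, tmul_smul, smul_tmul]
    · simp only [G, pair_smul_left, mul_pow, mul_smul]
    · simp only [F, pow_one, tmul_smul, smul_tmul]
    · simp only [G, pow_one, smul_tmul]
      exact smul_comm _ _ _
    · simp only [F, pow_one, tmul_smul]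
    · simp only [G, pow_one, tmul_smul]
      exact smul_comm _ _ _
  have hg : ∀ p : PrimeSpectrum A, ∃ s, GenAt p (F s) ∧ GenAt p (G s) := fun p => by
    obtain ⟨x, δ, hx, hδ, h⟩ := L.exists_genAt_pair p
    obtain ⟨m, hm⟩ := M.exists_genAt p
    obtain ⟨w, hw⟩ := W.exists_genAt p
    exact ⟨(x, δ, m, w), (hx.pow n).tmul ((hm.tmul (hδ.pow n)).tmul hw),
      (hm.tmul hw).smul fun h1 => h (p.2.mem_of_pow_mem n h1)⟩
  obtain ⟨e, he⟩ := exists_equiv_of_swap F G (fun p => (hg p).imp fun _ h => h.1)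
    (fun p => (hg p).imp fun _ h => h.2) hs
  exact ⟨e, fun x δ m w => he (x, δ, m, w)⟩

end InvMod

end

section

namespace InvMod

variable {A B : Type u} [CommRing A] [CommRing B] {φ : A →+* B}

theorem tmul_left_inj {L L' : InvMod A} {x : L} (hx : IsGen x) {y y' : L'}
    (h : tmul x y = tmul x y') : y = y' := by
  obtain ⟨χ, hχ⟩ := hx
  have h1 : pair χ x • y = pair χ x • y' :=
    congrArg ((TensorProduct.lid A L').toLinearMap ∘ₗ LinearMap.rTensor L'
      (show Module.Dual A L from χ)) h
  rwa [hχ, one_smul, one_smul] at h1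

theorem exists_tmul_left_eq {L L' : InvMod A} {x : L} (hx : IsGen x) {z : L.tensor L'}
    (hz : IsGen z) : ∃ y : L', IsGen y ∧ tmul x y = z := by
  obtain ⟨χ, hχ⟩ := hx
  have h1 : ∃ y : L', tmul x y = z := by
    clear hz
    change L ⊗[A] L' at z
    induction z using TensorProduct.induction_on with
    | zero => exact ⟨0, TensorProduct.tmul_zero _ _⟩
    | tmul x' y => exact ⟨pair χ x' • y, by rw [tmul_smul, ← smul_tmul, ← eq_pair_smul hχ]; rfl⟩
    | add z z' hz hz' =>
      obtain ⟨y, rfl⟩ := hz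
      obtain ⟨y', rfl⟩ := hz'
      exact ⟨y + y', tmul_add x y y'⟩
  obtain ⟨y, rfl⟩ := h1
  obtain ⟨ζ, hζ⟩ := hz
  exact ⟨y, ⟨(show Module.Dual A (L.tensor L') from ζ).comp (TensorProduct.mk A L L' x), hζ⟩, rfl⟩

theorem exists_tmul_right_eq {L L' : InvMod A} {y : L'} (hy : IsGen y) {z : L.tensor L'}
    (hz : IsGen z) : ∃ x : L, IsGen x ∧ tmul x y = z := by
  obtain ⟨x, hx, h⟩ := exists_tmul_left_eq (L' := L) hy
    (hz.equiv (L' := L'.tensor L) (TensorProduct.comm A L L'))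
  exact ⟨x, hx, (TensorProduct.comm A L L').injective h⟩

/-- The isomorphism `L ⊗ M ≅ L ⊗ M'` induced by `M ≅ M'`. -/
def lTensorEquiv (L : InvMod A) {M M' : InvMod A} (e : M ≃ₗ[A] M') :
    L.tensor M ≃ₗ[A] L.tensor M' :=
  TensorProduct.congr (LinearEquiv.refl A L) e

section Spin

variable {L S M W : InvMod A} {L' S' M' W' : InvMod B} {c r r' : ℕ}

/-- The isomorphism `(L ⊗ S^c)^r ≅ L^r ⊗ S^{r c}`. -/
def mulPowEquiv (L S : InvMod A) (hr : r' = r * c) :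
    (L.tensor (S.npow c)).npow r ≃ₗ[A] (L.npow r).tensor (S.npow r') :=
  (exists_mulPowEquiv L S hr).choose

theorem mulPowEquiv_pow (hr : r' = r * c) (x : L) (s : S) :
    mulPowEquiv L S hr (pow (tmul x (pow s c)) r) = tmul (pow x r) (pow s r') :=
  (exists_mulPowEquiv L S hr).choose_spec x s

/-- The contraction `L^n ⊗ ((M ⊗ L^{-n}) ⊗ W) ≅ M ⊗ W`. -/
def contractEquiv (L M W : InvMod A) (n : ℕ) :
    (L.npow n).tensor ((M.tensor (L.dual.npow n)).tensor W) ≃ₗ[A] M.tensor W :=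
  (exists_contractEquiv L M W n).choose

theorem contractEquiv_tmul {n : ℕ} (x : L) (δ : L.dual) (m : M) (w : W) :
    contractEquiv L M W n (tmul (pow x n) (tmul (tmul m (pow δ n)) w)) =
      pair δ x ^ n • tmul m w :=
  (exists_contractEquiv L M W n).choose_spec x δ m w

/-- The contraction is compatible with pullback. -/
theorem contractEquiv_map (f : Map φ L L') (h : Map φ M M') (k : Map φ W W') {n : ℕ}
    (z : (L.npow n).tensor ((M.tensor (L.dual.npow n)).tensor W)) :
    contractEquiv L' M' W' n
        ((f.npow n).tensor ((h.tensor (f.dual.npow n)).tensor k) z) =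
      h.tensor k (contractEquiv L M W n z) := by
  refine semilinear_ext (φ := φ)
    (F := fun z => contractEquiv L' M' W' n
        ((f.npow n).tensor ((h.tensor (f.dual.npow n)).tensor k) z))
    (G := fun z => h.tensor k (contractEquiv L M W n z))
    (fun a z => ?_) (fun a z => ?_) (fun q => ?_) z
  · exact (congrArg _ (Map.map_smul _ a z)).trans (map_smul _ _ _)
  · exact (congrArg _ (map_smul _ a z)).trans (Map.map_smul _ _ _)
  · obtain ⟨x, δ, hx, hδ, -⟩ := L.exists_genAt_pair (PrimeSpectrum.comap φ q)
    obtain ⟨m, hm⟩ := M.exists_genAt (PrimeSpectrum.comap φ q)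
    obtain ⟨w, hw⟩ := W.exists_genAt (PrimeSpectrum.comap φ q)
    refine ⟨_, (hx.pow n).tmul ((hm.tmul (hδ.pow n)).tmul hw), ?_⟩
    simp only [Map.tensor_apply, Map.npow_pow, contractEquiv_tmul, Map.map_smul, Map.dual_pair,
      map_pow]

/-- The isomorphism `(L ⊗ S^c)^r ≅ M ⊗ W` given by `Θ : S^{r c} ≅ M ⊗ L^{-r} ⊗ W`. -/
def spinEquiv (hr : r' = r * c) (Θ : S.npow r' ≃ₗ[A] (M.tensor (L.dual.npow r)).tensor W) :
    (L.tensor (S.npow c)).npow r ≃ₗ[A] M.tensor W :=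
  (mulPowEquiv L S hr).trans ((lTensorEquiv (L.npow r) Θ).trans (contractEquiv L M W r))

variable {hr : r' = r * c} {Θ : S.npow r' ≃ₗ[A] (M.tensor (L.dual.npow r)).tensor W}
  {Θ' : S'.npow r' ≃ₗ[B] (M'.tensor (L'.dual.npow r)).tensor W'}

theorem spinEquiv_pow (x : L) (s : S) : spinEquiv hr Θ (pow (tmul x (pow s c)) r) =
    contractEquiv L M W r (tmul (pow x r) (Θ (pow s r'))) :=
  congrArg (fun z => contractEquiv L M W r (lTensorEquiv (L.npow r) Θ z)) (mulPowEquiv_pow hr x s)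

/-- The value of `spinEquiv` if the sections of `L` are normalized. -/
theorem spinEquiv_eq {x : L} {δ : L.dual} {s : S} {m : M} {w : W} (h : pair δ x = 1)
    (hs : Θ (pow s r') = tmul (tmul m (pow δ r)) w) :
    spinEquiv hr Θ (pow (tmul x (pow s c)) r) = tmul m w := by
  rw [spinEquiv_pow, hs, contractEquiv_tmul, h, one_pow, one_smul]

variable {f : Map φ L L'} {g : Map φ S S'} {h : Map φ M M'} {k : Map φ W W'}

/-- If the pullbacks are compatible with `Θ` and `Θ'`, they are compatible with the isomorphisms
constructed from these. -/
theorem spinEquiv_map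
    (H : ∀ z, Θ' (g.npow r' z) = (h.tensor (f.dual.npow r)).tensor k (Θ z))
    (z : (L.tensor (S.npow c)).npow r) :
    spinEquiv hr Θ' ((f.tensor (g.npow c)).npow r z) = h.tensor k (spinEquiv hr Θ z) := by
  refine semilinear_ext (φ := φ)
    (F := fun z => spinEquiv hr Θ' ((f.tensor (g.npow c)).npow r z))
    (G := fun z => h.tensor k (spinEquiv hr Θ z))
    (fun a z => ?_) (fun a z => ?_) (fun q => ?_) z
  · exact (congrArg _ (Map.map_smul _ a z)).trans (map_smul _ _ _)
  · exact (congrArg _ (map_smul _ a z)).trans (Map.map_smul _ _ _)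
  · obtain ⟨x, hx⟩ := L.exists_genAt (PrimeSpectrum.comap φ q)
    obtain ⟨s, hs⟩ := S.exists_genAt (PrimeSpectrum.comap φ q)
    refine ⟨_, (hx.tmul (hs.pow c)).pow r, ?_⟩
    simp only [Map.npow_pow, Map.tensor_apply, spinEquiv_pow, ← contractEquiv_map f h k, ← H]

/-- If `L` is trivial, compatibility with `spinEquiv` implies compatibility with `Θ`. -/
theorem map_of_spinEquiv_map {x : L} (hx : IsGen x)
    (H : ∀ z, spinEquiv hr Θ' ((f.tensor (g.npow c)).npow r z) = h.tensor k (spinEquiv hr Θ z))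
    (z : S.npow r') : Θ' (g.npow r' z) = (h.tensor (f.dual.npow r)).tensor k (Θ z) := by
  refine semilinear_ext (φ := φ) (F := fun z => Θ' (g.npow r' z))
    (G := fun z => (h.tensor (f.dual.npow r)).tensor k (Θ z))
    (fun a z => ?_) (fun a z => ?_) (fun q => ?_) z
  · exact (congrArg _ (Map.map_smul _ a z)).trans (map_smul _ _ _)
  · exact (congrArg _ (map_smul _ a z)).trans (Map.map_smul _ _ _)
  · obtain ⟨s, hs⟩ := S.exists_genAt (PrimeSpectrum.comap φ q)
    refine ⟨_, hs.pow r', ?_⟩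
    have h1 := H (pow (tmul x (pow s c)) r)
    simp only [Map.npow_pow, Map.tensor_apply, spinEquiv_pow, ← contractEquiv_map f h k] at h1
    rw [Map.npow_pow]
    exact tmul_left_inj ((hx.map f).pow r) ((contractEquiv L' M' W' r).injective h1)

/-- If the line bundles are trivial, every isomorphism `(L ⊗ S^c)^r ≅ M ⊗ W` arises from some `Θ`.
-/
theorem exists_spinEquiv_eq (hr : r' = r * c) {x : L} (hx : IsGen x) {s : S} (hs : IsGen s)
    {t : M.tensor W} (ht : IsGen t) :
    ∃ Θ : S.npow r' ≃ₗ[A] (M.tensor (L.dual.npow r)).tensor W,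
      spinEquiv hr Θ (pow (tmul x (pow s c)) r) = t := by
  obtain ⟨y, hy, hyt⟩ := exists_tmul_left_eq (hx.pow r) (ht.equiv (contractEquiv L M W r).symm)
  obtain ⟨Θ, hΘ⟩ := exists_equiv_of_isGen (hs.pow r') hy
  exact ⟨Θ, by rw [spinEquiv_pow, hΘ, hyt, LinearEquiv.apply_symm_apply]⟩

end Spin

/-! ### The universal isomorphism of the line bundle of the log structure -/

section Line

variable {L K S E P : InvMod A} {L' K' S' E' P' : InvMod B} {c d d' l : ℕ}

/-- The isomorphism `E^l ≅ P ⊗ (L ⊗ S^c)^{-d}` obtained from `E ≅ K^{-1} ⊗ S^{-d'}` and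
`P^{-1} ≅ L^{-d} ⊗ K^l`. It exists because `S` has the exponent `-d' l = -d c` on both sides. It is
specified on arbitrary sections, with pairings in place of inverses. -/
theorem exists_lineEquiv (hd : d * c = d' * l) (ε : E ≃ₗ[A] K.dual.tensor (S.dual.npow d'))
    (η : (L.dual.npow d).tensor (K.npow l) ≃ₗ[A] P.dual) :
    ∃ e : E.npow l ≃ₗ[A] P.tensor ((L.tensor (S.npow c)).dual.npow d), ∀ m δ κ ξ ς,
      e (pair (η (tmul (pow δ d) (pow κ l))) m • pow (ε.symm (tmul ξ (pow ς d'))) l) =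
        pair ξ κ ^ l • tmul m (pow (tdual δ (powDual ς c)) d) := by
  let F : P × L.dual × K × K.dual × S.dual → E.npow l := fun s =>
    pair (η (tmul (pow s.2.1 d) (pow s.2.2.1 l))) s.1 •
      pow (ε.symm (tmul s.2.2.2.1 (pow s.2.2.2.2 d'))) l
  let G : P × L.dual × K × K.dual × S.dual → P.tensor ((L.tensor (S.npow c)).dual.npow d) :=
    fun s => pair s.2.2.2.1 s.2.2.1 ^ l • tmul s.1 (pow (tdual s.2.1 (powDual s.2.2.2.2 c)) d)
  -- Both sides have degrees `1`, `d`, `l`, `l`, `d c` in `m`, `δ`, `κ`, `ξ`, `ς`; the degree in `ς`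
  -- is `d' l` on the left.
  have hs : ∀ s s', tmul (F s) (G s') = tmul (F s') (G s) := by
    refine swap_prod (n := 1) (fun y a x => ?_) (fun y a x => ?_) fun m m' =>
      swap_prod (F := fun s => F (m, s)) (G := fun s => G (m', s)) (n := d)
        (fun y a δ => ?_) (fun y a δ => ?_) fun δ δ' =>
      swap_prod (F := fun s => F (m, δ, s)) (G := fun s => G (m', δ', s)) (n := l)
        (fun w a κ => ?_) (fun w a κ => ?_) fun κ κ' =>
      swap_prod (F := fun s => F (m, δ, κ, s)) (G := fun s => G (m', δ', κ', s)) (n := l)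
        (fun w a ξ => ?_) (fun w a ξ => ?_) fun ξ ξ' =>
      Homog.swap (n := d * c) (fun a ς => ?_) (fun a ς => ?_)
    · simp only [F, pair_smul, pow_one, mul_smul]
    · simp only [G, smul_tmul, pow_one]
      exact smul_comm _ _ _
    · simp only [F, pow_smul, smul_tmul, map_smul, pair_smul_left, mul_smul]
    · simp only [G, tdual_smul_left, pow_smul, tmul_smul]
      exact smul_comm _ _ _
    · simp only [F, pow_smul, tmul_smul, map_smul, pair_smul_left, mul_smul]
    · simp only [G, pair_smul, mul_pow, mul_smul]
    · simp only [F, smul_tmul, map_smul, pow_smul]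
      exact smul_comm _ _ _
    · simp only [G, pair_smul_left, mul_pow, mul_smul]
    · simp only [F, pow_smul, tmul_smul, map_smul, ← pow_mul, hd]
      exact smul_comm _ _ _
    · simp only [G, powDual_smul, tdual_smul_right, pow_smul, tmul_smul, ← pow_mul, mul_comm]
      exact smul_comm _ _ _
  have hg : ∀ p : PrimeSpectrum A, ∃ s, GenAt p (F s) ∧ GenAt p (G s) := fun p => by
    obtain ⟨x, δ, hx, hδ, -⟩ := L.exists_genAt_pair p
    obtain ⟨κ, ξ, hκ, hξ, h⟩ := K.exists_genAt_pair p
    obtain ⟨s, ς, hs, hς, -⟩ := S.exists_genAt_pair p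
    obtain ⟨m, hm, h'⟩ := (((hδ.pow d).tmul (hκ.pow l)).equiv η).exists_pair
    exact ⟨(m, δ, κ, ξ, ς), ((GenAt.equiv ε.symm (hξ.tmul (hς.pow d'))).pow l).smul h',
      (hm.tmul ((hδ.tdual (hς.powDual c)).pow d)).smul fun h1 => h (p.2.mem_of_pow_mem l h1)⟩
  obtain ⟨e, he⟩ := exists_equiv_of_swap F G (fun p => (hg p).imp fun _ h => h.1)
    (fun p => (hg p).imp fun _ h => h.2) hs
  exact ⟨e, fun m δ κ ξ ς => he (m, δ, κ, ξ, ς)⟩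

/-- The isomorphism `E^l ≅ P ⊗ (L ⊗ S^c)^{-d}` given by `ε : E ≅ K^{-1} ⊗ S^{-d'}` and
`η : L^{-d} ⊗ K^l ≅ P^{-1}`. -/
def lineEquiv (hd : d * c = d' * l) (ε : E ≃ₗ[A] K.dual.tensor (S.dual.npow d'))
    (η : (L.dual.npow d).tensor (K.npow l) ≃ₗ[A] P.dual) :
    E.npow l ≃ₗ[A] P.tensor ((L.tensor (S.npow c)).dual.npow d) :=
  (exists_lineEquiv hd ε η).choose

variable {hd : d * c = d' * l} {ε : E ≃ₗ[A] K.dual.tensor (S.dual.npow d')}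
  {η : (L.dual.npow d).tensor (K.npow l) ≃ₗ[A] P.dual}
  {ε' : E' ≃ₗ[B] K'.dual.tensor (S'.dual.npow d')}
  {η' : (L'.dual.npow d).tensor (K'.npow l) ≃ₗ[B] P'.dual}

theorem lineEquiv_pow {u : E} {ξ : K.dual} {ς : S.dual} (hu : ε u = tmul ξ (pow ς d'))
    (m : P) (δ : L.dual) (κ : K) :
    lineEquiv hd ε η (pair (η (tmul (pow δ d) (pow κ l))) m • pow u l) =
      pair ξ κ ^ l • tmul m (pow (tdual δ (powDual ς c)) d) := by
  rw [← (exists_lineEquiv hd ε η).choose_spec m δ κ ξ ς, ← hu, LinearEquiv.symm_apply_apply]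
  rfl

variable {f : Map φ L L'} {g : Map φ S S'} {e : Map φ E E'} {h : Map φ P P'} {k : Map φ K K'}

/-- If the pullbacks are compatible with `ε`, `ε'` and with `η`, `η'`, they are compatible with the
isomorphisms constructed from these. -/
theorem lineEquiv_map (H : ∀ z, ε' (e z) = k.dual.tensor (g.dual.npow d') (ε z))
    (H' : ∀ z, η' ((f.dual.npow d).tensor (k.npow l) z) = h.dual (η z)) (z : E.npow l) :
    lineEquiv hd ε' η' (e.npow l z) =
      h.tensor ((f.tensor (g.npow c)).dual.npow d) (lineEquiv hd ε η z) := by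
  refine semilinear_ext (φ := φ) (F := fun z => lineEquiv hd ε' η' (e.npow l z))
    (G := fun z => h.tensor ((f.tensor (g.npow c)).dual.npow d) (lineEquiv hd ε η z))
    (fun a z => ?_) (fun a z => ?_) (fun q => ?_) z
  · exact (congrArg _ (Map.map_smul _ a z)).trans (map_smul _ _ _)
  · exact (congrArg _ (map_smul _ a z)).trans (Map.map_smul _ _ _)
  · obtain ⟨-, δ, -, hδ, -⟩ := L.exists_genAt_pair (PrimeSpectrum.comap φ q)
    obtain ⟨κ, ξ, hκ, hξ, -⟩ := K.exists_genAt_pair (PrimeSpectrum.comap φ q)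
    obtain ⟨-, ς, -, hς, -⟩ := S.exists_genAt_pair (PrimeSpectrum.comap φ q)
    obtain ⟨m, -, h'⟩ := (((hδ.pow d).tmul (hκ.pow l)).equiv η).exists_pair
    obtain ⟨u, hu⟩ := ε.surjective (tmul ξ (pow ς d'))
    have hu' : ε' (e u) = tmul (k.dual ξ) (pow (g.dual ς) d') := by
      rw [H, hu, Map.tensor_apply, Map.npow_pow]
    have hg : GenAt (PrimeSpectrum.comap φ q) u := by
      have := GenAt.equiv ε.symm (hξ.tmul (hς.pow d'))
      rwa [← hu, LinearEquiv.symm_apply_apply] at this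
    refine ⟨_, (hg.pow l).smul h', ?_⟩
    have h1 := lineEquiv_pow (hd := hd) (η := η') hu' (h m) (f.dual δ) (k κ)
    have h2 : η' (tmul (pow (f.dual δ) d) (pow (k κ) l)) =
        h.dual (η (tmul (pow δ d) (pow κ l))) := by
      rw [← H', Map.tensor_apply, Map.npow_pow, Map.npow_pow]
    rw [h2, h.dual_pair, k.dual_pair] at h1
    simp only [lineEquiv_pow hu, Map.map_smul, Map.npow_pow, Map.tensor_apply, Map.dual_tdual,
      Map.npow_dual_powDual, map_pow]
    exact h1

/-- If the line bundles are trivial, compatibility with `lineEquiv` and `ε` implies compatibility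
with `η`. -/
theorem map_of_lineEquiv_map {δ : L.dual} (hδ : IsGen δ) {κ : K} {ξ : K.dual}
    (hκ : pair ξ κ = 1) {ς : S.dual} (hς : IsGen ς)
    (H : ∀ z, ε' (e z) = k.dual.tensor (g.dual.npow d') (ε z))
    (H' : ∀ z, lineEquiv hd ε' η' (e.npow l z) =
      h.tensor ((f.tensor (g.npow c)).dual.npow d) (lineEquiv hd ε η z))
    (z : (L.dual.npow d).tensor (K.npow l)) :
    η' ((f.dual.npow d).tensor (k.npow l) z) = h.dual (η z) := by
  obtain ⟨u, hu⟩ := ε.surjective (tmul ξ (pow ς d'))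
  have hu' : ε' (e u) = tmul (k.dual ξ) (pow (g.dual ς) d') := by
    rw [H, hu, Map.tensor_apply, Map.npow_pow]
  have hg : IsGen u := by
    have := ((isGen_dual hκ).tmul (hς.pow d')).equiv ε.symm
    rwa [← hu, LinearEquiv.symm_apply_apply] at this
  refine semilinear_ext_gen (φ := φ) (F := fun z => η' ((f.dual.npow d).tensor (k.npow l) z))
    (G := fun z => h.dual (η z)) (fun a z => ?_) (fun a z => ?_)
    ((hδ.pow d).tmul (IsGen.pow ⟨ξ, hκ⟩ l)) ?_ z
  · exact (congrArg _ (Map.map_smul _ a z)).trans (map_smul _ _ _)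
  · exact (congrArg _ (map_smul _ a z)).trans (Map.map_smul _ _ _)
  · refine h.dual_ext fun m => ?_
    have h1 := lineEquiv_pow (hd := hd) (η := η') hu' (h m) (f.dual δ) (k κ)
    have h2 := H' (pair (η (tmul (pow δ d) (pow κ l))) m • pow u l)
    simp only [lineEquiv_pow hu, Map.map_smul, Map.npow_pow, Map.tensor_apply, Map.dual_tdual,
      Map.npow_dual_powDual, map_pow] at h2
    rw [k.dual_pair, ← h2] at h1
    have h3 := ((hg.map e).pow l).smul_inj ((lineEquiv hd ε' η').injective h1)
    rw [Map.tensor_apply, Map.npow_pow, Map.npow_pow]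
    exact h3.trans (h.dual_pair _ _).symm

/-- If the line bundles are trivial and `ε` is fixed, every value at `u^l` is attained by
`lineEquiv` for some `η`. -/
theorem exists_lineEquiv_eq (hd : d * c = d' * l) {u : E} {δ : L.dual} (hδ : IsGen δ) {κ : K}
    {ξ : K.dual} (hκ : pair ξ κ = 1) {ς : S.dual} (hu : ε u = tmul ξ (pow ς d'))
    {t : P.tensor ((L.tensor (S.npow c)).dual.npow d)} (ht : IsGen t)
    (hδς : IsGen (tdual δ (powDual ς c))) :
    ∃ η : (L.dual.npow d).tensor (K.npow l) ≃ₗ[A] P.dual, lineEquiv hd ε η (pow u l) = t := by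
  obtain ⟨m, ⟨χ, hm⟩, rfl⟩ := exists_tmul_right_eq (hδς.pow d) ht
  obtain ⟨η, hη⟩ := exists_equiv_of_isGen ((hδ.pow d).tmul (IsGen.pow ⟨ξ, hκ⟩ l)) (isGen_dual hm)
  refine ⟨η, ?_⟩
  have := lineEquiv_pow (hd := hd) (η := η) hu m δ κ
  rwa [hη, hm, hκ, one_pow, one_smul, one_smul] at this

end Line

end InvMod

end

/-! ### The canonical morphism -/

section

namespace InvMod

variable {A B : Type u} [CommRing A] [CommRing B] {φ : A →+* B}

/-- The isomorphism `E^1 ≅ E`. -/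
def oneEquiv (E : InvMod A) : E.npow 1 ≃ₗ[A] E := TensorProduct.rid A E

end InvMod

variable {k : Type u} [Field k]

open InvMod

namespace InputData

variable {D : InputData k} {a b : ℤ}

section Components

/-- The objects of the target of the modified input. -/
abbrev HatRoot (D : InputData k) (a b : ℤ) : Type (u + 1) :=
  RootObj (D.hat a b).infty (D.hat a b).ℓ (D.hat a b).lineInfty

/-- The point of the modified stack underlying a point of the target. -/
abbrev hatPoint (x : D.HatRoot a b) : D.HatObj a b := x.base.base.base.base.base

/-- The coordinate ring of a point of the target. -/
abbrev hatRing (x : D.HatRoot a b) : Type u := D.X.O ((D.hatToX a b).obj (hatPoint x))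

/-- The value of `ω` at a point of the target. -/
abbrev hatOmega (x : D.HatRoot a b) : InvMod (hatRing x) := x.base.base.base.base.line

/-- The value of the universal root at a point of the target. -/
abbrev hatSpin (x : D.HatRoot a b) : InvMod (hatRing x) := x.base.base.base.line

/-- The value of `O(∞̂)` at a point of the target. -/
abbrev hatLine (x : D.HatRoot a b) : InvMod (hatRing x) := x.base.line

/-- The value of `L₁` at a point of the target. -/
abbrev hatL₁ (x : D.HatRoot a b) : InvMod (hatRing x) := (D.L₁ a b).obj (hatPoint x)

/-- The value of `L₂` at a point of the target. -/
abbrev hatL₂ (x : D.HatRoot a b) : InvMod (hatRing x) := (D.L₂ a b).obj (hatPoint x)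

/-- The value of `𝐋_R` at a point of the target. -/
abbrev hatLR (x : D.HatRoot a b) : InvMod (hatRing x) :=
  D.LR.obj ((D.hatToX a b).obj (hatPoint x))

/-- The value of `𝐋_∞` at a point of the target. -/
abbrev hatLinf (x : D.HatRoot a b) : InvMod (hatRing x) :=
  D.Linf.obj ((D.hatToX a b).obj (hatPoint x))

/-- The universal isomorphism of the `r̂`-th root with `𝐋_R ⊗ L₁^{-r} ⊗ ω`. -/
def hatSpinIso (x : D.HatRoot a b) : (hatSpin x).npow D.rHat ≃ₗ[hatRing x]
    ((hatLR x).tensor ((hatL₁ x).dual.npow D.r)).tensor (hatOmega x) :=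
  x.base.base.iso

/-- The universal isomorphism of `O(∞̂)^1` with `L₂^{-1} ⊗ S^{-d̂}`. -/
def hatRootIso (x : D.HatRoot a b) : (hatLine x).npow 1 ≃ₗ[hatRing x]
    (hatL₂ x).dual.tensor ((hatSpin x).dual.npow D.dHat) :=
  x.iso

/-- The isomorphism of `O(∞̂)` with `L₂^{-1} ⊗ S^{-d̂}`. -/
def hatLineIso (x : D.HatRoot a b) : hatLine x ≃ₗ[hatRing x]
    (hatL₂ x).dual.tensor ((hatSpin x).dual.npow D.dHat) :=
  (oneEquiv (hatLine x)).symm.trans (hatRootIso x)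

/-- The universal isomorphism of `L₁^{-d} ⊗ L₂^ℓ` with `𝐋_∞^∨`. -/
def hatLinfIso (x : D.HatRoot a b) :
    ((hatL₁ x).dual.npow D.d).tensor ((hatL₂ x).npow D.ℓ) ≃ₗ[hatRing x] (hatLinf x).dual :=
  hatIso (hatPoint x)

variable {x y : D.HatRoot a b}

/-- The morphism of the base underlying a morphism of the target. -/
abbrev hatHom (f : x ⟶ y) : (D.hatToX a b).obj (hatPoint x) ⟶ (D.hatToX a b).obj (hatPoint y) :=
  (D.hatToX a b).map f.base.base.base.base.base

/-- The pullback of `ω` along a morphism of the target. -/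
abbrev omegaMap (f : x ⟶ y) : Map (D.X.pull (hatHom f)) (hatOmega y) (hatOmega x) :=
  f.base.base.base.base.line

/-- The pullback of the universal root along a morphism of the target. -/
abbrev spinMap (f : x ⟶ y) : Map (D.X.pull (hatHom f)) (hatSpin y) (hatSpin x) :=
  f.base.base.base.line

/-- The pullback of `O(∞̂)` along a morphism of the target. -/
abbrev lineMap (f : x ⟶ y) : Map (D.X.pull (hatHom f)) (hatLine y) (hatLine x) := f.base.line

/-- The pullback of `L₁` along a morphism of the target. -/
abbrev map₁ (f : x ⟶ y) : Map (D.X.pull (hatHom f)) (hatL₁ y) (hatL₁ x) :=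
  (D.L₁ a b).map f.base.base.base.base.base

/-- The pullback of `L₂` along a morphism of the target. -/
abbrev map₂ (f : x ⟶ y) : Map (D.X.pull (hatHom f)) (hatL₂ y) (hatL₂ x) :=
  (D.L₂ a b).map f.base.base.base.base.base

theorem hatSpinIso_map (f : x ⟶ y) (z : (hatSpin y).npow D.rHat) :
    hatSpinIso x ((spinMap f).npow D.rHat z) =
      ((D.LR.map (hatHom f)).tensor ((map₁ f).dual.npow D.r)).tensor (omegaMap f)
        (hatSpinIso y z) :=
  f.base.base.comm z

theorem hatLineIso_map (f : x ⟶ y) (z : hatLine y) :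
    hatLineIso x (lineMap f z) =
      (map₂ f).dual.tensor ((spinMap f).dual.npow D.dHat) (hatLineIso y z) := by
  have h : hatRootIso x ((lineMap f).npow 1 (pow z 1)) =
      (map₂ f).dual.tensor ((spinMap f).dual.npow D.dHat) (hatRootIso y (pow z 1)) :=
    f.comm (pow z 1)
  rwa [Map.npow_pow] at h

theorem hatLinfIso_map (f : x ⟶ y) (z : ((hatL₁ y).dual.npow D.d).tensor ((hatL₂ y).npow D.ℓ)) :
    hatLinfIso x (((map₁ f).dual.npow D.d).tensor ((map₂ f).npow D.ℓ) z) =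
      (D.Linf.map (hatHom f)).dual (hatLinfIso y z) :=
  hatIso_map f.base.base.base.base.base z

/-- A morphism of the target of the modified input is given by pullback maps of all line bundles
which are compatible with the universal isomorphisms. -/
theorem exists_hatRoot_hom (f : (D.hatToX a b).obj (hatPoint x) ⟶ (D.hatToX a b).obj (hatPoint y))
    (τ₁ : Map (D.X.pull f) (hatL₁ y) (hatL₁ x)) (τ₂ : Map (D.X.pull f) (hatL₂ y) (hatL₂ x))
    (τ : Map (D.X.pull f) (hatSpin y) (hatSpin x)) (ω : Map (D.X.pull f) (hatOmega y) (hatOmega x))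
    (ε : Map (D.X.pull f) (hatLine y) (hatLine x))
    (h₁ : ∀ z, hatLinfIso x ((τ₁.dual.npow D.d).tensor (τ₂.npow D.ℓ) z) =
      (D.Linf.map f).dual (hatLinfIso y z))
    (h₂ : ∀ m, hatTriv (hatPoint x) ((τ₁.zpow a).tensor (τ₂.zpow b) m) =
      Map.unit (D.X.pull f) (hatTriv (hatPoint y) m))
    (h₃ : ∀ z, hatSpinIso x (τ.npow D.rHat z) =
      ((D.LR.map f).tensor (τ₁.dual.npow D.r)).tensor ω (hatSpinIso y z))
    (h₄ : ∀ z, hatLineIso x (ε z) = τ₂.dual.tensor (τ.dual.npow D.dHat) (hatLineIso y z)) :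
    ∃ g : x ⟶ y, hatHom g = f ∧ (∀ m, map₁ g m = τ₁ m) ∧ (∀ m, map₂ g m = τ₂ m) ∧
      (∀ m, spinMap g m = τ m) ∧ (∀ m, omegaMap g m = ω m) ∧ ∀ m, lineMap g m = ε m := by
  let g₀ : hatPoint x ⟶ hatPoint y := ⟨⟨⟨⟨f, τ₁⟩, τ₂⟩, h₁⟩, h₂⟩
  let g₁ : x.base.base ⟶ y.base.base := ⟨⟨⟨g₀, ω⟩, τ⟩, h₃⟩
  have h₅ : ∀ z, hatRootIso x (ε.npow 1 z) =
      τ₂.dual.tensor (τ.dual.npow D.dHat) (hatRootIso y z) := fun z => by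
    obtain ⟨u, rfl⟩ := (oneEquiv (hatLine y)).symm.surjective z
    exact (congrArg (hatRootIso x) (ε.npow_pow u 1)).trans (h₄ u)
  refine ⟨⟨⟨g₁, ε⟩, h₅⟩, rfl, fun _ => rfl, fun _ => rfl, fun _ => rfl, fun _ => rfl,
    fun _ => rfl⟩

end Components

variable (hd : D.d * D.ratio = D.dHat * D.ℓ)

/-- The image in the stack of `r`-th roots. -/
def canonicalInfty (x : D.HatRoot a b) : D.infty.obj :=
  ⟨⟨⟨(D.hatToX a b).obj (hatPoint x), hatOmega x⟩, (hatL₁ x).tensor ((hatSpin x).npow D.ratio)⟩,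
    spinEquiv rHat_eq (hatSpinIso x)⟩

/-- The canonical morphism on objects. -/
def canonicalObj (x : D.HatRoot a b) : D.root.obj :=
  ⟨⟨canonicalInfty x, hatLine x⟩, lineEquiv hd (hatLineIso x) (hatLinfIso x)⟩

variable {x y : D.HatRoot a b}

/-- The canonical morphism on morphisms, with values in the stack of `r`-th roots. -/
def canonicalInftyMap (f : x ⟶ y) : canonicalInfty x ⟶ canonicalInfty y :=
  ⟨⟨⟨hatHom f, omegaMap f⟩, (map₁ f).tensor ((spinMap f).npow D.ratio)⟩,
    spinEquiv_map (hatSpinIso_map f)⟩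

/-- The canonical morphism on morphisms. -/
def canonicalMap (f : x ⟶ y) : canonicalObj hd x ⟶ canonicalObj hd y :=
  ⟨⟨canonicalInftyMap f, lineMap f⟩, lineEquiv_map (hd := hd) (hatLineIso_map f) (hatLinfIso_map f)⟩

/-- The canonical morphism `∞̂ → ∞^{1/ℓ}`. It sends the universal root `Ŝ` to `L₁ ⊗ Ŝ^{r̂ / r}`, and
does not change the line bundle `O(∞̂)`, which becomes an `ℓ`-th root of `O(∞)`. -/
def canonical (a b : ℤ) (hd : D.d * D.ratio = D.dHat * D.ℓ) : D.HatRoot a b ⥤ D.root.obj where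
  obj := canonicalObj hd
  map := canonicalMap hd
  map_id x := WithIso.Hom.ext (WithLine.Hom.ext (WithIso.Hom.ext (WithLine.Hom.ext
    (WithLine.Hom.ext ((D.hatToX a b).map_id _) fun _ => rfl)
    ((D.spinHat a b).map_id x))) fun _ => rfl)
  map_comp f g := WithIso.Hom.ext (WithLine.Hom.ext (WithIso.Hom.ext (WithLine.Hom.ext
    (WithLine.Hom.ext ((D.hatToX a b).map_comp _ _) fun _ => rfl)
    ((D.spinHat a b).map_comp f g))) fun _ => rfl)

end InputData

end

/-! ### The canonical morphism is an equivalence -/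

section

namespace InvMod

variable {A B : Type u} [CommRing A] [CommRing B] {φ : A →+* B}

theorem Map.tensor_npow_gen {L L' : InvMod A} {M M' : InvMod B} {f : Map φ L M} {g : Map φ L' M'}
    {x : L} {y : L'} {x₀ : M} {y₀ : M'} {t s : Bˣ} (hx : f x = t • x₀) (hy : g y = s • y₀) (n : ℕ) :
    f.tensor (g.npow n) (tmul x (pow y n)) = (t * s ^ n) • tmul x₀ (pow y₀ n) := by
  rw [Map.tensor_apply, Map.npow_pow, hx, hy, units_pow_smul]
  rw [Units.smul_def, Units.smul_def, Units.smul_def, smul_tmul, tmul_smul, smul_smul,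
    Units.val_mul]

end InvMod

section Unimodular

variable {M : Type*} [CommGroup M] {a b : ℤ} {c d : ℕ}

theorem unimodular_three_add {M : Type*} [AddCommGroup M] (h : a * c + b * d = 1) (t₁ t₂ s : M) :
    s = a • (t₁ + c • s) + (-b) • (-t₂ + d • (-s)) + -(a • t₁ + b • t₂) := by
  simp only [← natCast_zsmul]
  linear_combination (norm := module) (-h) • s

/-- The monomials `t₁ s^c`, `t₂^{-1} s^{-d}` and `t₁^a t₂^b` determine `s`. -/
theorem unimodular_three (h : a * c + b * d = 1) (t₁ t₂ s : M) :
    s = (t₁ * s ^ c) ^ a * (t₂⁻¹ * s⁻¹ ^ d) ^ (-b) * (t₁ ^ a * t₂ ^ b)⁻¹ :=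
  unimodular_three_add (M := Additive M) h t₁ t₂ s

theorem unimodular_three_add' {M : Type*} [AddCommGroup M] (h : a * c + b * d = 1) (σ ε v : M) :
    a • (σ + -(c • (a • σ + (-b) • ε + -v))) + b • (-ε + -(d • (a • σ + (-b) • ε + -v))) = v := by
  simp only [← natCast_zsmul]
  linear_combination (norm := module) (-h) • (a • σ + (-b) • ε + -v)

/-- The monomials `t₁ s^c`, `t₂⁻¹ s^{-d}`, `t₁^a t₂^b` can be prescribed: the matrix of exponents is
unimodular if `a c + b d = 1`, and `s = (t₁ s^c)^a (t₂⁻¹ s^{-d})^{-b} (t₁^a t₂^b)⁻¹`. -/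
theorem exists_unimodular_three (h : a * c + b * d = 1) (σ ε v : M) :
    ∃ t₁ t₂ s : M, t₁ * s ^ c = σ ∧ t₂⁻¹ * s⁻¹ ^ d = ε ∧ t₁ ^ a * t₂ ^ b = v := by
  refine ⟨σ * ((σ ^ a * ε ^ (-b) * v⁻¹) ^ c)⁻¹, ε⁻¹ * ((σ ^ a * ε ^ (-b) * v⁻¹) ^ d)⁻¹,
    σ ^ a * ε ^ (-b) * v⁻¹, inv_mul_cancel_right _ _, ?_,
    unimodular_three_add' (M := Additive M) h σ ε v⟩
  rw [mul_inv, inv_inv, inv_inv, inv_pow, mul_inv_cancel_right]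

end Unimodular

variable {k : Type u} [Field k]

open InvMod

namespace InputData

variable {D : InputData k} {a b : ℤ} {x y : D.HatRoot a b}

/-- The line bundles `L₁`, `L₂` and the universal root are trivial at `x`. -/
structure IsTrivialAt (x : D.HatRoot a b) : Prop where
  gen₁ : ∃ e : hatL₁ x, IsGen e
  gen₂ : ∃ e : hatL₂ x, IsGen e
  gen : ∃ s : hatSpin x, IsGen s

theorem exists_isTrivialAt (hX : D.X.IsStack) (y : D.HatRoot a b) :
    ∃ (y' : D.HatRoot a b) (g : y' ⟶ y), IsTrivialAt y' ∧ (D.hat a b).root.EtCover g := by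
  have hp := (isStack_root (D := D.hat a b) (isStack_XHat a b hX)).gpd
  let L₂' : LineBundle (D.hat a b).root :=
    ((D.L₂ a b).comap (WithLine.forget (D.hat a b).X)).comap (D.hat a b).rootToBase
  obtain ⟨y₁, g₁, h₁, e₁, he₁⟩ := (D.L₁Target a b).exists_isGen hp y
  obtain ⟨y₂, g₂, h₂, e₂, he₂⟩ := L₂'.exists_isGen hp y₁
  obtain ⟨y₃, g₃, h₃, e₃, he₃⟩ := (D.hat a b).spinRoot.exists_isGen hp y₂
  exact ⟨y₃, g₃ ≫ g₂ ≫ g₁, ⟨⟨_, he₁.map ((D.L₁Target a b).map (g₃ ≫ g₂))⟩,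
    ⟨_, he₂.map (L₂'.map g₃)⟩, _, he₃⟩, .comp h₃ (.comp h₂ h₁)⟩

theorem hatRoot_hom_ext {f g : x ⟶ y} (h : hatHom f = hatHom g)
    (h₁ : ∀ m, map₁ f m = map₁ g m) (h₂ : ∀ m, map₂ f m = map₂ g m)
    (hs : ∀ m, spinMap f m = spinMap g m) (hω : ∀ m, omegaMap f m = omegaMap g m)
    (hl : ∀ m, lineMap f m = lineMap g m) : f = g :=
  WithIso.Hom.ext (WithLine.Hom.ext (WithIso.Hom.ext (WithLine.Hom.ext (WithLine.Hom.ext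
    (hatObj_hom_ext h h₁ h₂) hω) hs)) hl)

/-- On trivial line bundles a morphism of `∞̂` is given by units for `L₁`, `L₂`, `Ŝ`, and by
`unimodular_three` these are determined by the units for `L₁ ⊗ Ŝ^c`, for
`O(∞̂) ≅ L₂^{-1} ⊗ Ŝ^{-d̂}` and for `L₁^a ⊗ L₂^b ≅ O`. -/
theorem canonical_injective (hd : D.d * D.ratio = D.dHat * D.ℓ)
    (hab : a * D.ratio + b * D.dHat = 1) (hx : IsTrivialAt x) (hy : IsTrivialAt y) (f g : x ⟶ y)
    (h : (canonical a b hd).map f = (canonical a b hd).map g) : f = g := by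
  obtain ⟨⟨e₁, δ₁, h₁⟩, ⟨e₂, δ₂, h₂⟩, s₀, ς₀, h₃⟩ := hx
  obtain ⟨⟨e₁', δ₁', h₁'⟩, ⟨e₂', δ₂', h₂'⟩, s₀', ς₀', h₃'⟩ := hy
  have hb : hatHom f = hatHom g := congrArg (fun h => h.base.base.base.base.base) h
  have hω : ∀ m, omegaMap f m = omegaMap g m :=
    WithLine.line_congr (f := ((canonical a b hd).map f).base.base.base.base)
      (g := ((canonical a b hd).map g).base.base.base.base)
      (congrArg (fun h => h.base.base.base.base) h)
  have hl : ∀ m, lineMap f m = lineMap g m :=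
    WithLine.line_congr (f := ((canonical a b hd).map f).base)
      (g := ((canonical a b hd).map g).base) (congrArg (fun h => h.base) h)
  have hσ : ∀ m, (map₁ f).tensor ((spinMap f).npow D.ratio) m =
      (map₁ g).tensor ((spinMap g).npow D.ratio) m :=
    WithLine.line_congr (congrArg (fun h => h.base.base.base) h)
  obtain ⟨t₁, ht₁⟩ := (map₁ f).exists_units ⟨δ₁', h₁'⟩ ⟨δ₁, h₁⟩
  obtain ⟨t₂, ht₂⟩ := (map₂ f).exists_units ⟨δ₂', h₂'⟩ ⟨δ₂, h₂⟩
  obtain ⟨t, ht⟩ := (spinMap f).exists_units ⟨ς₀', h₃'⟩ ⟨ς₀, h₃⟩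
  obtain ⟨s₁, hs₁⟩ := (map₁ g).exists_units ⟨δ₁', h₁'⟩ ⟨δ₁, h₁⟩
  obtain ⟨s₂, hs₂⟩ := (map₂ g).exists_units ⟨δ₂', h₂'⟩ ⟨δ₂, h₂⟩
  obtain ⟨s, hs⟩ := (spinMap g).exists_units ⟨ς₀', h₃'⟩ ⟨ς₀, h₃⟩
  have key₁ : t₁ * t ^ D.ratio = s₁ * s ^ D.ratio := by
    refine Units.ext ((IsGen.tmul ⟨δ₁, h₁⟩ (IsGen.pow ⟨ς₀, h₃⟩ D.ratio)).smul_inj ?_)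
    exact (Map.tensor_npow_gen ht₁ ht _).symm.trans ((hσ _).trans (Map.tensor_npow_gen hs₁ hs _))
  have key₂ : t₂⁻¹ * t⁻¹ ^ D.dHat = s₂⁻¹ * s⁻¹ ^ D.dHat := by
    refine Units.ext (((isGen_dual h₂).tmul ((isGen_dual h₃).pow D.dHat)).smul_inj ?_)
    obtain ⟨z, hz⟩ := (hatLineIso y).surjective (InvMod.tmul δ₂' (pow ς₀' D.dHat))
    have e₁ := hatLineIso_map f z
    have e₂ := hatLineIso_map g z
    rw [hz] at e₁ e₂
    exact (Map.tensor_npow_gen (Map.dual_gen _ h₂' h₂ ht₂) (Map.dual_gen _ h₃' h₃ ht) _).symm.trans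
      (e₁.symm.trans ((congrArg _ (hl z)).trans (e₂.trans
        (Map.tensor_npow_gen (Map.dual_gen _ h₂' h₂ hs₂) (Map.dual_gen _ h₃' h₃ hs) _))))
  have key₃ : t₁ ^ a * t₂ ^ b = s₁ ^ a * s₂ ^ b := by
    refine Units.ext (((isGen_zgen h₁ a).tmul (isGen_zgen h₂ b)).smul_inj ?_)
    exact (Map.tensor_zpow h₁' h₁ ht₁ h₂' h₂ ht₂ a b).symm.trans
      ((hat_zpow_eq hb _).trans (Map.tensor_zpow h₁' h₁ hs₁ h₂' h₂ hs₂ a b))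
  obtain rfl : t = s := by
    rw [unimodular_three hab t₁ t₂ t, key₁, key₂, key₃, ← unimodular_three hab s₁ s₂ s]
  obtain rfl : t₁ = s₁ := mul_right_cancel key₁
  obtain rfl : t₂ = s₂ := inv_injective (mul_right_cancel key₂)
  have hp : ∀ z, D.X.pull (hatHom f) z = D.X.pull (hatHom g) z := fun z => by rw [hb]
  refine hatRoot_hom_ext hb ?_ ?_ ?_ hω hl
  · exact semilinear_ext_gen (map₁ f).map_smul
      (fun z m => (Map.map_smul _ _ _).trans (by rw [hp])) ⟨δ₁', h₁'⟩ (ht₁.trans hs₁.symm)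
  · exact semilinear_ext_gen (map₂ f).map_smul
      (fun z m => (Map.map_smul _ _ _).trans (by rw [hp])) ⟨δ₂', h₂'⟩ (ht₂.trans hs₂.symm)
  · exact semilinear_ext_gen (spinMap f).map_smul
      (fun z m => (Map.map_smul _ _ _).trans (by rw [hp])) ⟨ς₀', h₃'⟩ (ht.trans hs.symm)

/-- On trivial line bundles, morphisms `σ` of `L₁ ⊗ Ŝ^c` and `ε` of `O(∞̂)` lift to morphisms of
`L₁`, `L₂` and `Ŝ`, by `exists_unimodular_three`; the third condition there is compatibility with
`L₁^a ⊗ L₂^b ≅ O`. -/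
theorem exists_hatRoot_hom_of_canonical (hd : D.d * D.ratio = D.dHat * D.ℓ)
    (hab : a * D.ratio + b * D.dHat = 1) (hx : IsTrivialAt x) (hy : IsTrivialAt y)
    (f : (D.hatToX a b).obj (hatPoint x) ⟶ (D.hatToX a b).obj (hatPoint y))
    (σ : Map (D.X.pull f) ((hatL₁ y).tensor ((hatSpin y).npow D.ratio))
      ((hatL₁ x).tensor ((hatSpin x).npow D.ratio)))
    (ω : Map (D.X.pull f) (hatOmega y) (hatOmega x))
    (ε : Map (D.X.pull f) (hatLine y) (hatLine x))
    (hσ : ∀ z, spinEquiv rHat_eq (hatSpinIso x) (σ.npow D.r z) =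
      (D.LR.map f).tensor ω (spinEquiv rHat_eq (hatSpinIso y) z))
    (hε : ∀ z, lineEquiv hd (hatLineIso x) (hatLinfIso x) (ε.npow D.ℓ z) =
      (D.Linf.map f).tensor (σ.dual.npow D.d) (lineEquiv hd (hatLineIso y) (hatLinfIso y) z)) :
    ∃ g : x ⟶ y, hatHom g = f ∧
      (∀ m, (map₁ g).tensor ((spinMap g).npow D.ratio) m = σ m) ∧
      (∀ m, omegaMap g m = ω m) ∧ ∀ m, lineMap g m = ε m := by
  obtain ⟨⟨e₁, δ₁, h₁⟩, ⟨e₂, δ₂, h₂⟩, s₀, ς₀, h₃⟩ := hx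
  obtain ⟨⟨e₁', δ₁', h₁'⟩, ⟨e₂', δ₂', h₂'⟩, s₀', ς₀', h₃'⟩ := hy
  obtain ⟨p, hp⟩ : ∃ p : (hatRing x)ˣ, σ (InvMod.tmul e₁' (pow s₀' D.ratio)) =
      p • InvMod.tmul e₁ (pow s₀ D.ratio) := σ.exists_units
    (IsGen.tmul ⟨δ₁', h₁'⟩ (IsGen.pow ⟨ς₀', h₃'⟩ D.ratio))
    (IsGen.tmul ⟨δ₁, h₁⟩ (IsGen.pow ⟨ς₀, h₃⟩ D.ratio))
  obtain ⟨u, hu⟩ := (hatLineIso y).surjective (InvMod.tmul δ₂' (pow ς₀' D.dHat))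
  have hug : IsGen u := by
    have := ((isGen_dual h₂').tmul ((isGen_dual h₃').pow D.dHat)).equiv (hatLineIso y).symm
    rwa [← hu, LinearEquiv.symm_apply_apply] at this
  obtain ⟨q, hq⟩ := exists_unit_smul ((isGen_dual h₂).tmul ((isGen_dual h₃).pow D.dHat))
    ((hug.map ε).equiv (hatLineIso x))
  obtain ⟨v, hv⟩ := exists_unit_smul
    (((isGen_zgen h₁ a).tmul (isGen_zgen h₂ b)).equiv (hatTriv (hatPoint x)))
    ((((isGen_zgen h₁' a).tmul (isGen_zgen h₂' b)).equiv
      (hatTriv (hatPoint y))).map (Map.unit (D.X.pull f)))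
  obtain ⟨t₁, t₂, t, hpt, hqt, hvt⟩ := exists_unimodular_three hab p q v
  obtain ⟨τ₁, hτ₁⟩ := Map.exists_of_isGen (D.X.pull f) (⟨δ₁', h₁'⟩ : IsGen e₁')
    (IsGen.units_smul ⟨δ₁, h₁⟩ t₁)
  obtain ⟨τ₂, hτ₂⟩ := Map.exists_of_isGen (D.X.pull f) (⟨δ₂', h₂'⟩ : IsGen e₂')
    (IsGen.units_smul ⟨δ₂, h₂⟩ t₂)
  obtain ⟨τ, hτ⟩ := Map.exists_of_isGen (D.X.pull f) (⟨ς₀', h₃'⟩ : IsGen s₀')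
    (IsGen.units_smul ⟨ς₀, h₃⟩ t)
  obtain rfl : τ₁.tensor (τ.npow D.ratio) = σ :=
    Map.ext_gen (IsGen.tmul ⟨δ₁', h₁'⟩ (IsGen.pow ⟨ς₀', h₃'⟩ D.ratio))
      ((Map.tensor_npow_gen hτ₁ hτ _).trans
        ((congrArg (· • InvMod.tmul e₁ (pow s₀ D.ratio)) hpt).trans hp.symm))
  have hline : ∀ z, hatLineIso x (ε z) =
      τ₂.dual.tensor (τ.dual.npow D.dHat) (hatLineIso y z) := by
    refine Map.comm_of_isGen ε _ (hatLineIso y) (hatLineIso x) hug ?_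
    rw [hu]
    exact hq.trans ((congrArg (· • InvMod.tmul δ₂ (pow ς₀ D.dHat)) hqt.symm).trans
      (Map.tensor_npow_gen (Map.dual_gen _ h₂' h₂ hτ₂) (Map.dual_gen _ h₃' h₃ hτ) _).symm)
  obtain ⟨g, rfl, hg₁, hg₂, hg, hgω, hgl⟩ := exists_hatRoot_hom f τ₁ τ₂ τ ω ε
    (map_of_lineEquiv_map (isGen_dual h₁') h₂' (isGen_dual h₃') hline hε)
    (Map.comm_of_isGen _ _ _ _ ((isGen_zgen h₁' a).tmul (isGen_zgen h₂' b))
      ((congrArg (hatTriv (hatPoint x)) ((Map.tensor_zpow h₁' h₁ hτ₁ h₂' h₂ hτ₂ a b).trans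
        (congrArg (· • InvMod.tmul (zgen e₁ δ₁ a) (zgen e₂ δ₂ b)) hvt))).trans
          (((hatTriv (hatPoint x)).map_smul _ _).trans hv.symm)))
    (map_of_spinEquiv_map (⟨δ₁', h₁'⟩ : IsGen e₁') hσ) hline
  refine ⟨g, rfl, fun m => ?_, hgω, hgl⟩
  obtain rfl : map₁ g = τ₁ := Map.ext hg₁
  obtain rfl : spinMap g = τ := Map.ext hg
  rfl

theorem canonical_surjective (hd : D.d * D.ratio = D.dHat * D.ℓ)
    (hab : a * D.ratio + b * D.dHat = 1) (hx : IsTrivialAt x) (hy : IsTrivialAt y)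
    (h : (canonical a b hd).obj x ⟶ (canonical a b hd).obj y) :
    ∃ f : x ⟶ y, (canonical a b hd).map f = h := by
  obtain ⟨g, hg, hσ, hω, hε⟩ := exists_hatRoot_hom_of_canonical hd hab hx hy
    h.base.base.base.base.base h.base.base.base.line h.base.base.base.base.line h.base.line
    h.base.base.comm h.comm
  exact ⟨g, WithIso.Hom.ext (WithLine.Hom.ext (WithIso.Hom.ext (WithLine.Hom.ext
    (WithLine.Hom.ext hg hω) hσ)) hε)⟩

/-- Morphisms can be glued on both stacks, and locally all line bundles are trivial. -/
theorem canonical_full_faithful (hX : D.X.IsStack) (hd : D.d * D.ratio = D.dHat * D.ℓ)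
    (hab : a * D.ratio + b * D.dHat = 1) :
    (canonical a b hd).Full ∧ (canonical a b hd).Faithful :=
  full_faithful_of_local (Z := D.root) (canonical a b hd) (isStack_root hX)
    (isStack_root (D := D.hat a b) (isStack_XHat a b hX)) IsTrivialAt (exists_isTrivialAt hX)
    (canonical_injective hd hab) (canonical_surjective hd hab)

end InputData

end

section

variable {k : Type u} [Field k]

open InvMod

namespace InputData

variable {D : InputData k}

/-- If its roots are trivial, an object of `∞^{1/ℓ}` is isomorphic to the image of an object of `∞̂`
with trivial `L₁`, `L₂` and `Ŝ`. -/
theorem exists_canonical_hom' (a b : ℤ) (hd : D.d * D.ratio = D.dHat * D.ℓ) (p : D.X.obj)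
    (W T E : InvMod (D.X.O p)) (Θ₀ : T.npow D.r ≃ₗ[D.X.O p] (D.LR.obj p).tensor W)
    (Λ : E.npow D.ℓ ≃ₗ[D.X.O p] (D.Linf.obj p).tensor (T.dual.npow D.d)) {s : T} (hs : IsGen s)
    {u : E} (hu : IsGen u) :
    ∃ (x : D.HatRoot a b) (g : (canonical a b hd).obj x ⟶ ⟨⟨⟨⟨⟨p, W⟩, T⟩, Θ₀⟩, E⟩, Λ⟩),
      IsIso (D.root.p.map g) := by
  let O : InvMod (D.X.O p) := InvMod.unit (D.X.O p)
  let o : O := (1 : D.X.O p)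
  let ο : O.dual := udual (D.X.O p)
  have ho : pair ο o = 1 := rfl
  have ho' : IsGen o := ⟨ο, ho⟩
  obtain ⟨σ, hσ⟩ := Map.exists_of_isGen (D.X.pull (𝟙 p)) hs (ho'.tmul (ho'.pow D.ratio))
  let ι (L : InvMod (D.X.O p)) : Map (D.X.pull (𝟙 p)) L L := Map.id (D.X.pull_id p) L
  obtain ⟨Θ, hΘ⟩ := exists_spinEquiv_eq (rHat_eq (D := D)) ho' ho'
    (((hs.pow D.r).equiv Θ₀).map ((D.LR.map (𝟙 p)).tensor (ι W)))
  obtain ⟨ε, hε⟩ := exists_equiv_of_isGen hu ((isGen_dual ho).tmul ((isGen_dual ho).pow D.dHat))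
  have hδς : IsGen (tdual ο (powDual ο D.ratio)) := by
    refine isGen_dual (x := InvMod.tmul o (pow o D.ratio)) ?_
    rw [pair_tdual, pair_powDual, ho, one_pow, one_mul]
  obtain ⟨η, hη⟩ := exists_lineEquiv_eq (ε := ε) (c := D.ratio) hd (isGen_dual ho) ho hε
    (((hu.pow D.ℓ).equiv Λ).map ((D.Linf.map (𝟙 p)).tensor (σ.dual.npow D.d))) hδς
  obtain ⟨e, -⟩ := exists_equiv_of_isGen ((isGen_zgen ho a).tmul (isGen_zgen ho b)) ho'
  have h₁ : ∀ m, spinEquiv rHat_eq Θ (σ.npow D.r m) =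
      (D.LR.map (𝟙 p)).tensor (ι W) (Θ₀ m) := by
    refine Map.comm_of_isGen _ _ Θ₀ (spinEquiv rHat_eq Θ) (hs.pow D.r) ?_
    rw [Map.npow_pow, hσ]
    exact hΘ
  have h₂ : ∀ m, lineEquiv hd ε η ((ι E).npow D.ℓ m) =
      (D.Linf.map (𝟙 p)).tensor (σ.dual.npow D.d) (Λ m) := by
    refine Map.comm_of_isGen _ _ Λ (lineEquiv hd ε η) (hu.pow D.ℓ) ?_
    rw [Map.npow_pow]
    exact hη
  let ε₁ : E.npow 1 ≃ₗ[D.X.O p] O.dual.tensor (O.dual.npow D.dHat) := (oneEquiv E).trans ε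
  have h₃ : (oneEquiv E).symm.trans ε₁ = ε :=
    LinearEquiv.ext fun m => congrArg ε ((oneEquiv E).apply_symm_apply m)
  rw [← h₃] at h₂
  let y : D.HatObj a b := ⟨⟨⟨⟨p, O⟩, O⟩, η⟩, e⟩
  let x : D.HatRoot a b := ⟨⟨⟨⟨⟨y, W⟩, O⟩, Θ⟩, E⟩, ε₁⟩
  let g : (canonical a b hd).obj x ⟶ ⟨⟨⟨⟨⟨p, W⟩, T⟩, Θ₀⟩, E⟩, Λ⟩ :=
    ⟨⟨⟨⟨⟨𝟙 p, ι W⟩, σ⟩, h₁⟩, ι E⟩, h₂⟩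
  exact ⟨x, g, (inferInstance : IsIso (D.X.p.map (𝟙 p)))⟩

theorem exists_canonical_hom (a b : ℤ) (hd : D.d * D.ratio = D.dHat * D.ℓ) (z : D.root.obj)
    (hs : ∃ s : D.spinRoot.obj z, IsGen s) (hu : ∃ u : D.lineRoot.obj z, IsGen u) :
    ∃ (x : D.HatRoot a b) (g : (canonical a b hd).obj x ⟶ z), IsIso (D.root.p.map g) := by
  obtain ⟨s, hs⟩ := hs
  obtain ⟨u, hu⟩ := hu
  exact exists_canonical_hom' a b hd z.base.base.base.base.base z.base.base.base.base.line
    z.base.base.base.line z.base.line z.base.base.iso z.iso hs hu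

/-- For essential surjectivity, trivialize the roots étale locally and glue the preimages. -/
theorem canonical_isEquivalence (hX : D.X.IsStack) {a b : ℤ}
    (hd : D.d * D.ratio = D.dHat * D.ℓ) (hab : a * D.ratio + b * D.dHat = 1) :
    (canonical a b hd).IsEquivalence := by
  obtain ⟨hf, hf'⟩ := canonical_full_faithful hX hd hab
  have h : (canonical a b hd).EssSurj := by
    refine essSurj_of_local (Z := D.root) (canonical a b hd) (isStack_root hX)
      (isStack_root (D := D.hat a b) (isStack_XHat a b hX)) fun z => ?_
    obtain ⟨z₁, g₁, h₁, s, hs⟩ := D.spinRoot.exists_isGen (isStack_root hX).gpd z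
    obtain ⟨z₂, g₂, h₂, u, hu⟩ := D.lineRoot.exists_isGen (isStack_root hX).gpd z₁
    obtain ⟨x, g, hg⟩ := exists_canonical_hom a b hd z₂
      ⟨_, hs.map (D.spinRoot.map g₂)⟩ ⟨u, hu⟩
    exact ⟨x, g ≫ g₂ ≫ g₁, .comp (.of_isIso g) (.comp h₂ h₁)⟩
  exact { }

end InputData

end

/-! ### The canonical isomorphism of log stacks -/

section

namespace InvMod

variable {A : Type u} [CommRing A] {L K S E P : InvMod A} {c d d' l : ℕ}

theorem pair_tdual_powDual {χ : L.dual} {x : L} {ξ : S.dual} {s : S} (h : pair χ x = 1)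
    (h' : pair ξ s = 1) : pair (tdual χ (powDual ξ c)) (tmul x (pow s c)) = 1 := by
  rw [pair_tdual, pair_powDual, h, h', one_pow, one_mul]

/-- The value of `lineEquiv` if the sections of `K` and `P` are normalized. -/
theorem lineEquiv_eq {hd : d * c = d' * l} {ε : E ≃ₗ[A] K.dual.tensor (S.dual.npow d')}
    {η : (L.dual.npow d).tensor (K.npow l) ≃ₗ[A] P.dual} {u : E} {ξ : K.dual} {ς : S.dual}
    (hu : ε u = tmul ξ (pow ς d')) {κ : K} (hκ : pair ξ κ = 1) {m : P} {δ : L.dual}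
    (hm : pair (η (tmul (pow δ d) (pow κ l))) m = 1) :
    lineEquiv hd ε η (pow u l) = tmul m (pow (tdual δ (powDual ς c)) d) := by
  have h := lineEquiv_pow (hd := hd) (η := η) hu m δ κ
  rwa [hm, hκ, one_pow, one_smul, one_smul] at h

end InvMod

variable {k : Type u} [Field k]

open InvMod

namespace InputData

variable {D : InputData k} {a b : ℤ}

/-- The canonical morphism is compatible with the projections to `∞_𝒳 × BC^*_ω`. -/
def canonicalTriangle (a b : ℤ) (hd : D.d * D.ratio = D.dHat * D.ℓ) :
    canonical a b hd ⋙ D.target.proj ≅ (D.hatTarget a b).proj :=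
  Iso.refl (C := D.HatRoot a b ⥤ D.base.obj) (D.hatTarget a b).proj

/-- The canonical isomorphism of log stacks: as the canonical morphism does not change `E`, it is
the identity on log structures. -/
def canonicalLogIso (a b : ℤ) (hd : D.d * D.ratio = D.dHat * D.ℓ)
    (h : (canonical a b hd).IsEquivalence) : (D.hatTarget a b).Iso D.target where
  functor := canonical a b hd
  isEquivalence := h
  triangle := canonicalTriangle a b hd
  logEquiv x := MulEquiv.refl ((D.hatTarget a b).log.M x)
  logEquiv_res _ _ := rfl
  logEquiv_α x _ := D.base.pull_id ((D.hatTarget a b).proj.obj x) _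

/-- The canonical isomorphism with its effect on the universal line bundles. -/
def canonicalIso (a b : ℤ) (hd : D.d * D.ratio = D.dHat * D.ℓ)
    (h : (canonical a b hd).IsEquivalence) : D.CanonicalIso a b where
  toIso := canonicalLogIso a b hd h
  spinIso :=
    { equiv := fun x => AddEquiv.refl ((D.spinHat a b).obj x)
      equiv_smul := fun x c e =>
        congrArg (fun c : hatRing x => c • (show (hatL₁ x).tensor ((hatSpin x).npow D.ratio) from e))
          (D.base.pull_id ((D.hatTarget a b).proj.obj x) c)
      equiv_map := fun _ _ => rfl }
  lineIso :=
    { equiv := fun x => AddEquiv.refl ((D.hat a b).lineRoot.obj x)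
      equiv_smul := fun x c e =>
        congrArg (fun c : hatRing x => c • (show hatLine x from e))
          (D.base.pull_id ((D.hatTarget a b).proj.obj x) c)
      equiv_map := fun _ _ => rfl }
  log_compat x m χ χ' h hm := by
    have : χ' = χ := dual_ext fun e =>
      (D.base.pull_id ((D.hatTarget a b).proj.obj x) _).symm.trans (h e)
    subst this
    exact hm
  spin_compat x e₁ δ₁ s m w σ h₁ hs hσ := by
    obtain rfl : σ = InvMod.tmul e₁ (pow s (D.rHat / D.r)) := hσ
    refine Eq.trans ?_ (D.LRω.map_id ((D.hatTarget a b).proj.obj x) (InvMod.tmul m w)).symm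
    exact spinEquiv_eq (hr := rHat_eq) (Θ := hatSpinIso x) h₁ hs
  line_compat x e₁ δ₁ e₂ δ₂ s ς u m σ σ' t h₁ h₂ h₃ h₄ hu hm hσ ht := by
    obtain rfl : σ = InvMod.tmul e₁ (pow s (D.rHat / D.r)) := hσ
    obtain rfl : t = u := ht
    obtain rfl : σ' = tdual δ₁ (powDual ς (D.rHat / D.r)) :=
      dual_eq_of_pair_eq_one h₄ (pair_tdual_powDual (L := hatL₁ x) (S := hatSpin x) h₁ h₃)
    have h₅ : D.Linf.map ((WithLine.forget D.X).map ((canonicalTriangle a b hd).hom.app x)) m = m :=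
      D.Linf.map_id _ m
    exact (lineEquiv_eq (hd := hd) (ε := hatLineIso x) (η := hatLinfIso x) hu h₂ hm).trans
      (congrArg (InvMod.tmul · (pow (tdual δ₁ (powDual ς D.ratio)) D.d)) h₅.symm)

end InputData

end

end

end LogTarget

theorem mainTheorem8 {k : Type u} [Field k] [IsAlgClosed k] [CharZero k] (D : InputData k)
    (hD : D.IsValid) :
    (∃ a b : ℤ, D.IsBezout a b) ∧
    ∀ a b : ℤ, D.IsBezout a b →
      (D.hat a b).IsValid ∧ (D.hat a b).ℓ = 1 ∧
      D.X.IsEtaleMap (D.hatToX a b) ∧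
      (D.X.IsSmooth → (D.hat a b).X.IsSmooth) ∧
      D.target.log.IsLog ∧ (D.hatTarget a b).log.IsLog ∧
      Nonempty (D.CanonicalIso a b) := by
  refine ⟨hD.exists_isBezout, fun a b hab => ⟨hD.hat hab, rfl, hD.isEtaleMap hab, hD.isSmooth hab,
    InputData.isLog_target hD.properDM.toIsStack, InputData.isLog_hatTarget a b hD.properDM.toIsStack,
    ?_⟩⟩
  have hd : D.d * D.ratio = D.dHat * D.ℓ := by rw [hD.d_eq, hD.ℓ_eq]; ring
  exact ⟨InputData.canonicalIso a b hd (InputData.canonical_isEquivalence hD.properDM.toIsStack hd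
    (hD.isBezout_iff.mp hab))⟩
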